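/- **Setting.** Let $\mathbf k$ be a commutative ring and $Q$ a quiver with vertex set $I$. Let $\overline Q=Q\sqcup Q^*$ be its double, with a reverse arrow $e^*:j\to i$ for each $e:i\to j$ in $Q$, and put $(e^*)^*=e$. For $e\in Q$ put $\omega(e,e^*)=1=-\omega(e^*,e)$; put $\omega(a,b)=0$ for $a,b\in\overline Q$ with $b\ne a^*$. The source and target of $a$ are $a_s,a_t$. Let $P$ be the free $\mathbf k$-module on the paths $a_1\cdots a_n$ in $\overline Q$ (including the paths of length $0$), and $L$ the free $\mathbf k$-module on the necklaces $[a_1\cdots a_n]$, that is, closed paths up to cyclic rotation. Write $x\wedge y=x\otimes y-y\otimes x$. A *cut* $H$ of $X=a_1\cdots a_n$ is a set of pairs (chords) $(i,j)$, $i<j$, with all positions pairwise distinct, with $\{a_i,a_j\}=\{e,e^*\}$ for some $e\in Q$ for each chord, and with no two crossing chords ($i<i'<j<j'$). It is *simple* if no chord is nested inside another one. Put $\varepsilon_H=\prod_{(i,j)\in H}-\omega(a_i,a_j)$. A *path chord diagram* $(X,H)$ is a path with a cut. A *necklace chord diagram* $([X],H)$ is a closed path with a cut, up to simultaneous cyclic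 rotation of the path and the cut. $Ch_{rt}$ and $Ch_{or}$ are the free $\mathbf k$-modules on path and necklace chord diagrams. For a chord $c=(i,j)$ of $D=(X,H)$ let $D_{c,1}$ be the path $(a_i)_t\,a_{i+1}\cdots a_{j-1}$ with the chords of $H$ nested inside $c$, and $D_{c,2}$ the path $a_1\cdots a_{i-1}a_{j+1}\cdots a_n$ with all other chords of $H\setminus\{c\}$. More generally, for a simple $H'\subseteq H$, cutting out the chords in $H'$ in this way gives one chord diagram $D_{H',c}$ inside each $c\in H'$, and one, $D_{H',0}$, which contains the end points of $X$. Put $$\delta_{p,rt}(D)=\sum_{c=(i,j)\in H}-\omega(a_i,a_j)\,D_{c,1}\otimes D_{c,2},$$ $$\delta_{or}([X],H)=\sum_{c=(i,j)\in H}-\omega(a_i,a_j)\,\bigl([D_{c,1}]\otimes[D_{c,2}]-[D_{c,2}]\otimes[D_{c,1}]\bigr),$$ $$\Delta(D)=D\otimes1+\sum_{H'\subseteq H\text{ simple}}\varepsilon_{H'}\Bigl(\prod_{c\in H'}D_{H',c}\Bigr)\otimes D_{H',0},$$ where $\Delta$ is extended multiplicatively to $\operatorname{Sym}Ch_{rt}$.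 On $P$, $L$ and $\operatorname{Sym}P$ one has the corresponding operations $$\delta_{p,rt}(a_1\cdots a_n)=\sum_{i<j}-\omega(a_i,a_j)\,(a_i)_t\,a_{i+1}\cdots a_{j-1}\otimes a_1\cdots a_{i-1}a_{j+1}\cdots a_n,$$ $$\delta_{or}([a_1\cdots a_n])=\sum_{i<j}\omega(a_i,a_j)\,[a_{j+1}\cdots a_na_1\cdots a_{i-1}]\wedge[(a_i)_t\,a_{i+1}\cdots a_{j-1}],$$ $$\Delta(X)=X\otimes 1+\sum_{H\text{ simple cut of }X}\varepsilon_H\Bigl(\prod_{c\in H}X_{H,c}\Bigr)\otimes X_{H,0}.$$ On each symmetric algebra the counit $\epsilon$ vanishes on basis elements, and $S$ is the multiplicative map given on a basis element $x$ by $$S(x)=-x+\sum_{n\ge1}(-1)^{n+1}\mu^n(\Delta')^n(x),$$ where $\eta$ is the unit map, $\Delta'=(1-\eta\epsilon)^{\otimes2}\Delta$, $(\Delta')^n$ is the iterated application of $\Delta'$ with values in the $(n+1)$-st tensor power, and $\mu^n$ is the multiplication. **Trees.** $\mathcal T_{rt}$ is the free $\mathbf k$-module on isomorphism classes of finite rooted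 trees with an orientation of the edges, a ribbon structure (a cyclic order of the edges at each vertex), a corner at the root (a linear order of the edges there which induces the cyclic order), and a path in $\overline Q$ as a label of each vertex. $\mathcal T_{or}$ is the free $\mathbf k$-module on isomorphism classes of finite (unrooted) oriented trees with a ribbon structure and a necklace as a label of each vertex. When edges are deleted, the components inherit these structures; a component which does not contain the old root is rooted at its vertex on the deleted edge leading towards the old root, and the corner there starts at that edge. On $\mathcal T_{rt}$ put $\rho(T)=\sum_eT^1_e\otimes T^2_e$, where $T^2_e$ is the component of $T\setminus e$ which contains the root and $T^1_e$ is the other one. On $\mathcal T_{or}$ put $\rho^{ss}_O(T)=\sum_e(T^1_e\otimes T^2_e-T^2_e\otimes T^1_e)$, where $e$ points from $T^1_e$ to $T^2_e$. On $\operatorname{Sym}\mathcal T_{rt}$ put $\Delta(T)=T\otimes1+\sum_H\bigl(\prod_{e\in H}T_{H,e}\bigr)\otimes T_{H,0}$, the sum over all sets $H$ of edges such that every path starting at the root contains at most one edge of $H$; here $T_{H,0}$ is the component of $T\setminus H$ which contains the root, and $T_{H,e}$ the one below $e$. The *dual tree* $T_H$ of $(X,H)$ is obtained by drawing the chords as arcs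 above a segment. It has one vertex for each face (the root is the unbounded face) and one edge across each chord. Its cyclic orders come from the plane, and the edges at the root are ordered from left to right. The edge across $(i,j)$ points away from the root if $a_i\in Q$ and towards the root otherwise. Each vertex is labelled by the path which remains in its face after all chords have been cut. For a closed path, $T_{H,or}$ is $T_H$ without root and corner, with the labels read as necklaces. Put $$\eta_{rt}(X)=\sum_H\varepsilon_HT_H,\quad \eta_{or}([X])=\sum_HT_{H,or},\quad S_{rt}(X)=\sum_H(X,H),\quad S_{or}([X])=\sum_H([X],H),$$ where all sums run over all cuts $H$ of the path $X$ (chosen as a representative in the necklace case), and $$D_{rt}(X,H)=\varepsilon_HT_H,\qquad D_{or}([X],H)=T_{H,or}.$$ **Theorem 3.2.** All these operations and maps are well defined (independent of the chosen representatives). $(Ch_{rt},\delta_{p,rt})$ is a (left) pre-Lie coalgebra, $(Ch_{or},\delta_{or})$ is a Lie coalgebra, and $\operatorname{Sym}Ch_{rt}$ is a commutative Hopf algebra with coproduct $\Delta$, counit $\epsilon$ and antipode $S$ (for each chord diagram, the sum defining $S$ is finite). One has $\eta_{rt}=D_{rt}\circ S_{rt}$ and $\eta_{or}=D_{or}\circ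 S_{or}$, and likewise for the multiplicative extensions of $\eta_{rt}$, $D_{rt}$, $S_{rt}$ to the symmetric algebras. In $$P\xrightarrow{S_{rt}}Ch_{rt}\xrightarrow{D_{rt}}\mathcal T_{rt},\qquad L\xrightarrow{S_{or}}Ch_{or}\xrightarrow{D_{or}}\mathcal T_{or},\qquad \operatorname{Sym}P\xrightarrow{S_{rt}}\operatorname{Sym}Ch_{rt}\xrightarrow{D_{rt}}\operatorname{Sym}\mathcal T_{rt}$$ the maps are homomorphisms of pre-Lie coalgebras, of Lie coalgebras and of Hopf algebras respectively, that is, they commute with the comultiplications (and in the last case also with products, units, counits and the maps $S$). The maps $S_{rt}$, $S_{or}$ and $\operatorname{Sym}P\to\operatorname{Sym}Ch_{rt}$ are injective. -/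

import Mathlib

open scoped TensorProduct

namespace ChordAlg

universe u v

/-! ## The double quiver, paths and cuts -/

/-- The arrows of the double quiver of `Q`: an arrow `e` of `Q` or its reverse `e^*`. -/
inductive DArrow (I : Type u) [Quiver.{v} I] : Type (max u v)
  | arr (e : Quiver.Total I) : DArrow I
  | star (e : Quiver.Total I) : DArrow I

section Paths

variable {I : Type u} [Quiver.{v} I]

/-- The source of an arrow of the double quiver. -/
def DArrow.src : DArrow I → I
  | .arr e => e.left
  | .star e => e.right

/-- The target of an arrow of the double quiver. -/
def DArrow.tgt : DArrow I → I
  | .arr e => e.right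
  | .star e => e.left

/-- The reversal `a ↦ a^*`, with `(e^*)^* = e`. -/
def DArrow.rev : DArrow I → DArrow I
  | .arr e => .star e
  | .star e => .arr e

open Classical in
/-- `ω(e, e^*) = 1 = -ω(e^*, e)` for `e` in `Q`, all other values vanish. -/
noncomputable def omega : DArrow I → DArrow I → ℤ
  | .arr e, .star f => if e = f then 1 else 0
  | .star e, .arr f => if e = f then -1 else 0
  | _, _ => 0

/-- `IsPath x a y`: the word `a` is a path from `x` to `y` in the double quiver. -/
def IsPath : I → List (DArrow I) → I → Prop
  | x, [], y => x = y
  | x, a :: l, y => a.src = x ∧ IsPath a.tgt l y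

/-- A path in the double quiver: a basis element of the path algebra `P`. The paths with no arrows
are the vertices. -/
@[ext]
structure QPath (I : Type u) [Quiver.{v} I] : Type (max u v) where
  /-- the starting vertex -/
  src : I
  /-- the final vertex -/
  tgt : I
  /-- the arrows `a_1, …, a_n`, in the order in which they are travelled -/
  arrows : List (DArrow I)
  isPath : IsPath src arrows tgt

/-- The vertex reached from `x` after the first `k` arrows of a word. -/
def vertexAt : I → List (DArrow I) → ℕ → I
  | x, _, 0 => x
  | x, [], _ + 1 => x
  | _, a :: l, k + 1 => vertexAt a.tgt l k

/-- `i < j` are positions in the word `a` (counted from `0`) with `{a_i, a_j} = {e, e^*}` for some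
arrow `e` of the quiver. -/
def IsPair (a : List (DArrow I)) (c : ℕ × ℕ) : Prop :=
  c.1 < c.2 ∧ ∃ x : DArrow I, a[c.1]? = some x ∧ a[c.2]? = some x.rev

/-- A cut of the word `a`: a set of pairs `(i, j)`, `i < j`, of pairwise distinct positions, which
do not cross, and such that `{a_i, a_j} = {e, e^*}` for each of them. -/
structure IsCut (a : List (DArrow I)) (H : Finset (ℕ × ℕ)) : Prop where
  pair : ∀ c ∈ H, IsPair a c
  distinct : ∀ c ∈ H, ∀ d ∈ H, c ≠ d → c.1 ≠ d.1 ∧ c.1 ≠ d.2 ∧ c.2 ≠ d.1 ∧ c.2 ≠ d.2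
  noncrossing : ∀ c ∈ H, ∀ d ∈ H, ¬ (c.1 < d.1 ∧ d.1 < c.2 ∧ c.2 < d.2)

theorem IsPair.lt_length {a : List (DArrow I)} {c : ℕ × ℕ} (h : IsPair a c) :
    c.2 < a.length := by
  obtain ⟨-, x, -, h2⟩ := h
  exact (List.getElem?_eq_some_iff.1 h2).1

/-- The finite set of the positions `(i, j)` in `a` with `{a_i, a_j} = {e, e^*}`. -/
noncomputable def pairs (a : List (DArrow I)) : Finset (ℕ × ℕ) := by
  classical
  exact (Finset.range a.length ×ˢ Finset.range a.length).filter (IsPair a)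

theorem mem_pairs {a : List (DArrow I)} {c : ℕ × ℕ} : c ∈ pairs a ↔ IsPair a c := by
  simp only [pairs, Finset.mem_filter, Finset.mem_product, Finset.mem_range, and_iff_right_iff_imp]
  intro h
  have := h.lt_length
  have := h.1
  omega

/-- The finite set of all cuts of the word `a`. -/
noncomputable def cuts (a : List (DArrow I)) : Finset (Finset (ℕ × ℕ)) := by
  classical
  exact (pairs a).powerset.filter (IsCut a)

theorem mem_cuts {a : List (DArrow I)} {H : Finset (ℕ × ℕ)} : H ∈ cuts a ↔ IsCut a H := by
  simp only [cuts, Finset.mem_filter, Finset.mem_powerset, and_iff_right_iff_imp]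
  exact fun h c hc => mem_pairs.2 (h.pair c hc)

/-! ### Faces of a cut

A cut `H` of a word of length `n` has one face `none` (the unbounded one) and one face `some c`
below each chord `c ∈ H`. -/

/-- The first position below the face `f`. -/
def lo : Option (ℕ × ℕ) → ℕ
  | none => 0
  | some c => c.1 + 1

/-- The first position behind the face `f`. -/
def hi (n : ℕ) : Option (ℕ × ℕ) → ℕ
  | none => n
  | some c => c.2

/-- The chord `d` lies below `f`: it is nested inside the chord `c` if `f = some c`. -/
def Below (n : ℕ) (f : Option (ℕ × ℕ)) (d : ℕ × ℕ) : Prop :=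
  lo f ≤ d.1 ∧ d.2 < hi n f

instance (n : ℕ) (f : Option (ℕ × ℕ)) (d : ℕ × ℕ) : Decidable (Below n f d) := by
  unfold Below; infer_instance

/-- The position `x` is not cut off from the face `f` by a chord of `H` below `f`. -/
def Visible (n : ℕ) (H : Finset (ℕ × ℕ)) (f : Option (ℕ × ℕ)) (x : ℕ) : Prop :=
  ∀ d ∈ H, Below n f d → ¬ (d.1 ≤ x ∧ x ≤ d.2)

instance (n : ℕ) (H : Finset (ℕ × ℕ)) (f : Option (ℕ × ℕ)) :
    DecidablePred (Visible n H f) := fun x => by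
  unfold Visible; infer_instance

/-- The position `x` lies on the face `f` of `H`. -/
def OnFace (n : ℕ) (H : Finset (ℕ × ℕ)) (f : Option (ℕ × ℕ)) (x : ℕ) : Prop :=
  lo f ≤ x ∧ x < hi n f ∧ Visible n H f x

instance (n : ℕ) (H : Finset (ℕ × ℕ)) (f : Option (ℕ × ℕ)) :
    DecidablePred (OnFace n H f) := fun x => by
  unfold OnFace; infer_instance

/-- The positions `x` with `lo f ≤ x < m` which are visible from `f`, in increasing order. -/
def visibleBefore (n : ℕ) (H : Finset (ℕ × ℕ)) (f : Option (ℕ × ℕ)) (m : ℕ) : List ℕ :=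
  (List.range' (lo f) (m - lo f)).filter (fun x => Visible n H f x)

/-- The word which remains in the face `f` after all chords of `H` have been cut. -/
def faceWord (a : List (DArrow I)) (H : Finset (ℕ × ℕ)) (f : Option (ℕ × ℕ)) :
    List (DArrow I) :=
  (visibleBefore a.length H f (hi a.length f)).filterMap (fun x => a[x]?)

/-- The new position, in the face `f`, of a position `x` on this face: the number of the positions
on the face before `x`. -/
def faceRank (n : ℕ) (H : Finset (ℕ × ℕ)) (f : Option (ℕ × ℕ)) (x : ℕ) : ℕ :=
  (visibleBefore n H f x).length

/-- The chords of the cut `G` both of whose ends lie on the face `f` of `H`, renumbered as chords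
on the word `faceWord a H f`. -/
def faceCut (n : ℕ) (G H : Finset (ℕ × ℕ)) (f : Option (ℕ × ℕ)) : Finset (ℕ × ℕ) :=
  (G.filter (fun d => OnFace n H f d.1 ∧ OnFace n H f d.2)).image
    (fun d => (faceRank n H f d.1, faceRank n H f d.2))

theorem vertexAt_arrow {x y : I} {a : List (DArrow I)} (h : IsPath x a y) {k : ℕ} {b : DArrow I}
    (hb : a[k]? = some b) : vertexAt x a k = b.src ∧ vertexAt x a (k + 1) = b.tgt := by
  induction k generalizing x a with
  | zero =>
    cases a with
    | nil => simp at hb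
    | cons c l =>
      simp at hb
      subst hb
      exact ⟨h.1.symm, by simp [vertexAt]⟩
  | succ k ih =>
    cases a with
    | nil => simp at hb
    | cons c l =>
      simp at hb
      exact ih h.2 hb

theorem vertexAt_length {x y : I} {a : List (DArrow I)} (h : IsPath x a y) :
    vertexAt x a a.length = y := by
  induction a generalizing x with
  | nil => exact h
  | cons c l ih => exact ih h.2

theorem DArrow.src_rev (b : DArrow I) : b.rev.src = b.tgt := by cases b <;> rfl

theorem DArrow.tgt_rev (b : DArrow I) : b.rev.tgt = b.src := by cases b <;> rfl

theorem vertexAt_pair {x y : I} {a : List (DArrow I)} (h : IsPath x a y) {c : ℕ × ℕ}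
    (hc : IsPair a c) : vertexAt x a c.1 = vertexAt x a (c.2 + 1) ∧
      vertexAt x a (c.1 + 1) = vertexAt x a c.2 := by
  obtain ⟨-, b, h1, h2⟩ := hc
  obtain ⟨e1, e2⟩ := vertexAt_arrow h h1
  obtain ⟨e3, e4⟩ := vertexAt_arrow h h2
  rw [e1, e2, e3, e4, DArrow.src_rev, DArrow.tgt_rev]
  exact ⟨rfl, rfl⟩

/-- `f` is the unbounded face or a chord of `G`. -/
def IsFaceOf (G : Finset (ℕ × ℕ)) (f : Option (ℕ × ℕ)) : Prop := ∀ c, f = some c → c ∈ G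

theorem hi_le {a : List (DArrow I)} {G : Finset (ℕ × ℕ)} (hG : IsCut a G)
    {f : Option (ℕ × ℕ)} (hf : IsFaceOf G f) : lo f ≤ hi a.length f ∧ hi a.length f ≤ a.length := by
  cases f with
  | none => simp [lo, hi]
  | some c =>
    have h := hG.pair c (hf c rfl)
    have := h.lt_length
    have := h.1
    simp only [lo, hi]
    omega

theorem isPath_visible {x y : I} {a : List (DArrow I)} (h : IsPath x a y)
    {G H : Finset (ℕ × ℕ)} (hG : IsCut a G) (hH : H ⊆ G) {f : Option (ℕ × ℕ)}
    (hf : IsFaceOf G f) :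
    ∀ m p, p + m = hi a.length f → lo f ≤ p →
      (∀ d ∈ H, Below a.length f d → ¬ (d.1 < p ∧ p ≤ d.2)) →
      IsPath (vertexAt x a p) (((List.range' p m).filter
        (fun z => Visible a.length H f z)).filterMap (fun z => a[z]?))
        (vertexAt x a (hi a.length f)) := by
  intro m
  induction m using Nat.strong_induction_on with
  | _ m ih =>
    intro p hp hlo hvis
    obtain ⟨-, hle⟩ := hi_le hG hf
    rcases m with _ | m
    · simp only [List.range'_zero, List.filter_nil, List.filterMap_nil]
      simp only [Nat.add_zero] at hp
      rw [hp]
      rfl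
    · by_cases hv : Visible a.length H f p
      · have hlt : p < a.length := by omega
        have hb : a[p]? = some a[p] := List.getElem?_eq_getElem hlt
        obtain ⟨e1, e2⟩ := vertexAt_arrow h hb
        rw [List.range'_succ, List.filter_cons_of_pos (by simpa using hv),
          List.filterMap_cons_some hb]
        refine ⟨e1.symm, ?_⟩
        rw [← e2]
        refine ih m (by omega) (p + 1) (by omega) (by omega) ?_
        intro d hd hbel hcon
        exact hv d hd hbel ⟨by omega, by omega⟩
      · unfold Visible at hv
        push Not at hv
        obtain ⟨d, hd, hbel, h1, h2⟩ := hv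
        have hd1 : d.1 = p := by
          by_contra hne
          exact hvis d hd hbel ⟨by omega, h2⟩
        have hlt := (hG.pair d (hH hd)).1
        have hb2 := hbel.2
        obtain ⟨q, hq⟩ : ∃ q, m = (d.2 - p) + q := ⟨m - (d.2 - p), by omega⟩
        have hsplit : List.range' p (m + 1) = List.range' p (d.2 + 1 - p) ++
            List.range' (d.2 + 1) q := by
          rw [show m + 1 = (d.2 + 1 - p) + q by omega]
          have := List.range'_append (s := p) (m := d.2 + 1 - p) (n := q) (step := 1)
          rw [← this]
          congr 2
          omega
        have hnil : (List.range' p (d.2 + 1 - p)).filter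
            (fun z => Visible a.length H f z) = [] := by
          rw [List.filter_eq_nil_iff]
          intro z hz
          rw [List.mem_range'_1] at hz
          simp only [decide_eq_true_eq]
          intro hvz
          exact hvz d hd hbel ⟨by omega, by omega⟩
        rw [hsplit, List.filter_append, hnil, List.nil_append]
        have hv1 : vertexAt x a p = vertexAt x a (d.2 + 1) := by
          rw [← hd1]
          exact (vertexAt_pair h (hG.pair d (hH hd))).1
        rw [hv1]
        refine ih q (by omega) (d.2 + 1) (by omega) (by omega) ?_
        intro d' hd' hbel' hcon
        have hne : d' ≠ d := by
          rintro rfl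
          omega
        obtain ⟨n1, n2, n3, n4⟩ := hG.distinct d' (hH hd') d (hH hd) hne
        have hnc := hG.noncrossing d (hH hd) d' (hH hd')
        have := hvis d' hd' hbel'
        omega

theorem isPath_faceWord {x y : I} {a : List (DArrow I)} (h : IsPath x a y)
    {G H : Finset (ℕ × ℕ)} (hG : IsCut a G) (hH : H ⊆ G) {f : Option (ℕ × ℕ)}
    (hf : IsFaceOf G f) :
    IsPath (vertexAt x a (lo f)) (faceWord a H f) (vertexAt x a (hi a.length f)) := by
  have hle := hi_le hG hf
  refine isPath_visible h hG hH hf _ _ (by omega) le_rfl ?_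
  rintro d - hbel ⟨h1, -⟩
  have := hbel.1
  omega

theorem faceRank_lt {n : ℕ} {H : Finset (ℕ × ℕ)} {f : Option (ℕ × ℕ)} {x y : ℕ}
    (hx : OnFace n H f x) (hxy : x < y) : faceRank n H f x < faceRank n H f y := by
  obtain ⟨h1, -, h3⟩ := hx
  obtain ⟨q, rfl⟩ : ∃ q, y = x + 1 + q := ⟨y - (x + 1), by omega⟩
  have : List.range' (lo f) (x + 1 + q - lo f) =
      List.range' (lo f) (x - lo f) ++ x :: List.range' (x + 1) q := by
    rw [show x + 1 + q - lo f = (x - lo f) + (q + 1) by omega]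
    have := List.range'_append (s := lo f) (m := x - lo f) (n := q + 1) (step := 1)
    rw [← this, show lo f + 1 * (x - lo f) = x by omega, List.range'_succ]
  unfold faceRank visibleBefore
  rw [this, List.filter_append, List.length_append,
    List.filter_cons_of_pos (by simpa using h3)]
  simp

theorem getElem?_faceWord {a : List (DArrow I)} {G H : Finset (ℕ × ℕ)} (hG : IsCut a G)
    {f : Option (ℕ × ℕ)} (hf : IsFaceOf G f) {x : ℕ} (hx : OnFace a.length H f x) :
    (faceWord a H f)[faceRank a.length H f x]? = a[x]? := by
  obtain ⟨h1, h2, h3⟩ := hx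
  obtain ⟨-, hle⟩ := hi_le hG hf
  obtain ⟨q, hq⟩ : ∃ q, hi a.length f = x + 1 + q := ⟨hi a.length f - (x + 1), by omega⟩
  have : List.range' (lo f) (x + 1 + q - lo f) =
      List.range' (lo f) (x - lo f) ++ x :: List.range' (x + 1) q := by
    rw [show x + 1 + q - lo f = (x - lo f) + (q + 1) by omega]
    have := List.range'_append (s := lo f) (m := x - lo f) (n := q + 1) (step := 1)
    rw [← this, show lo f + 1 * (x - lo f) = x by omega, List.range'_succ]
  have hlen : ((visibleBefore a.length H f x).filterMap (fun z => a[z]?)).length =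
      (visibleBefore a.length H f x).length := by
    have : ∀ l : List ℕ, (∀ z ∈ l, z < a.length) →
        (l.filterMap (fun z => a[z]?)).length = l.length := by
      intro l
      induction l with
      | nil => simp
      | cons b l ih =>
        intro hl
        rw [List.filterMap_cons_some
          (List.getElem?_eq_getElem (hl b List.mem_cons_self))]
        simp only [List.length_cons]
        rw [ih (fun z hz => hl z (List.mem_cons_of_mem _ hz))]
    apply this
    intro z hz
    unfold visibleBefore at hz
    have := List.mem_range'_1.1 (List.mem_of_mem_filter hz)
    omega
  have hb : a[x]? = some a[x] := List.getElem?_eq_getElem (by omega)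
  unfold faceWord faceRank
  conv_lhs =>
    rw [visibleBefore, hq, this, List.filter_append, List.filterMap_append,
      List.filter_cons_of_pos (by simpa using h3), List.filterMap_cons_some hb]
  change (List.filterMap (fun z => a[z]?) (visibleBefore a.length H f x) ++ _)[_]? = _
  rw [List.getElem?_append_right (by omega), hlen]
  simp [hb]

theorem isCut_face {a : List (DArrow I)} {G H : Finset (ℕ × ℕ)} (hG : IsCut a G)
    {f : Option (ℕ × ℕ)} (hf : IsFaceOf G f) :
    IsCut (faceWord a H f) (faceCut a.length G H f) := by
  have hlt : ∀ {x y}, OnFace a.length H f x → OnFace a.length H f y →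
      (faceRank a.length H f x < faceRank a.length H f y ↔ x < y) := by
    intro x y hx hy
    refine ⟨fun h => ?_, faceRank_lt hx⟩
    by_contra hcon
    rcases Nat.lt_or_ge y x with h' | h'
    · have := faceRank_lt hy h'
      omega
    · have : x = y := by omega
      subst this
      omega
  have hne : ∀ {x y}, OnFace a.length H f x → OnFace a.length H f y → x ≠ y →
      faceRank a.length H f x ≠ faceRank a.length H f y := by
    intro x y hx hy hxy
    have := hlt hx hy
    have := hlt hy hx
    omega
  refine ⟨?_, ?_, ?_⟩
  · intro c hc
    simp only [faceCut, Finset.mem_image, Finset.mem_filter] at hc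
    obtain ⟨d, ⟨hd, h1, h2⟩, rfl⟩ := hc
    obtain ⟨hlt', b, hb1, hb2⟩ := hG.pair d hd
    refine ⟨faceRank_lt h1 hlt', b, ?_, ?_⟩
    · exact (getElem?_faceWord hG hf h1).trans hb1
    · exact (getElem?_faceWord hG hf h2).trans hb2
  · intro c hc c' hc' hcc
    simp only [faceCut, Finset.mem_image, Finset.mem_filter] at hc hc'
    obtain ⟨d, ⟨hd, h1, h2⟩, rfl⟩ := hc
    obtain ⟨d', ⟨hd', h1', h2'⟩, rfl⟩ := hc'
    have hdd : d ≠ d' := by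
      rintro rfl
      exact hcc rfl
    obtain ⟨n1, n2, n3, n4⟩ := hG.distinct d hd d' hd' hdd
    exact ⟨hne h1 h1' n1, hne h1 h2' n2, hne h2 h1' n3, hne h2 h2' n4⟩
  · intro c hc c' hc'
    simp only [faceCut, Finset.mem_image, Finset.mem_filter] at hc hc'
    obtain ⟨d, ⟨hd, h1, h2⟩, rfl⟩ := hc
    obtain ⟨d', ⟨hd', h1', h2'⟩, rfl⟩ := hc'
    rintro ⟨k1, k2, k3⟩
    exact hG.noncrossing d hd d' hd'
      ⟨(hlt h1 h1').1 k1, (hlt h1' h2).1 k2, (hlt h2 h2').1 k3⟩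

end Paths

end ChordAlg

namespace ChordAlg

universe u v w

/-! ## Chord diagrams on paths and on necklaces -/

section Diagrams

variable {I : Type u} [Quiver.{v} I]

/-- A path chord diagram: a path together with a cut of it. -/
@[ext]
structure PathChord (I : Type u) [Quiver.{v} I] : Type (max u v) where
  path : QPath I
  cut : Finset (ℕ × ℕ)
  isCut : IsCut path.arrows cut

/-- The chords of a chord diagram. -/
abbrev PathChord.Chord (D : PathChord I) : Type := {c : ℕ × ℕ // c ∈ D.cut}

/-- A set of chords of `D`, as a set of pairs of positions. -/
def PathChord.rawCut (D : PathChord I) (H : Finset D.Chord) : Finset (ℕ × ℕ) :=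
  H.map (Function.Embedding.subtype _)

/-- A face of `D` (`none` is the unbounded one), as a pair of positions. -/
def PathChord.rawFace (D : PathChord I) (f : Option D.Chord) : Option (ℕ × ℕ) :=
  f.map Subtype.val

theorem PathChord.rawCut_subset (D : PathChord I) (H : Finset D.Chord) : D.rawCut H ⊆ D.cut := by
  intro c hc
  simp only [PathChord.rawCut, Finset.mem_map] at hc
  obtain ⟨d, -, rfl⟩ := hc
  exact d.2

theorem PathChord.rawFace_isFaceOf (D : PathChord I) (f : Option D.Chord) :
    IsFaceOf D.cut (D.rawFace f) := by
  intro c hc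
  cases f with
  | none => simp [PathChord.rawFace] at hc
  | some d =>
    simp only [PathChord.rawFace, Option.map_some, Option.some.injEq] at hc
    exact hc ▸ d.2

/-- Cut out the chords of `H` and glue, and take the piece which belongs to the face `f`, with the
remaining chords on it: for `f = none` the piece `X_{H,0}` which contains the base point, for
`f = some c` the piece `X_{H,c}` from the target of `a_i` to the source of `a_j`, `c = (i, j)`. -/
def PathChord.face (D : PathChord I) (H : Finset D.Chord) (f : Option D.Chord) : PathChord I where
  path :=
    { src := vertexAt D.path.src D.path.arrows (lo (D.rawFace f))
      tgt := vertexAt D.path.src D.path.arrows (hi D.path.arrows.length (D.rawFace f))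
      arrows := faceWord D.path.arrows (D.rawCut H) (D.rawFace f)
      isPath := isPath_faceWord D.path.isPath D.isCut (D.rawCut_subset H) (D.rawFace_isFaceOf f) }
  cut := faceCut D.path.arrows.length D.cut (D.rawCut H) (D.rawFace f)
  isCut := isCut_face D.isCut (D.rawFace_isFaceOf f)

theorem PathChord.face_closed (D : PathChord I) (h : D.path.src = D.path.tgt)
    (H : Finset D.Chord) (f : Option D.Chord) :
    (D.face H f).path.src = (D.face H f).path.tgt := by
  cases f with
  | none =>
    change vertexAt _ _ 0 = vertexAt _ _ D.path.arrows.length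
    rw [vertexAt_length D.path.isPath, ← h]
    simp [vertexAt]
  | some c => exact (vertexAt_pair D.path.isPath (D.isCut.pair _ c.2)).2

/-- The part of `D` below the chord `c`. -/
def PathChord.inner (D : PathChord I) (c : D.Chord) : PathChord I := D.face {c} (some c)

/-- The part of `D` outside of the chord `c`. -/
def PathChord.outer (D : PathChord I) (c : D.Chord) : PathChord I := D.face {c} none

/-- `ω(a_i, a_j)` for two positions `c = (i, j)` in a word. -/
noncomputable def omegaAt (a : List (DArrow I)) (c : ℕ × ℕ) : ℤ :=
  match a[c.1]?, a[c.2]? with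
  | some x, some y => omega x y
  | _, _ => 0

/-- The sign `ε_H = ∏ -ω(a_i, a_j)` over the chords `(i, j)` in `H`. -/
noncomputable def PathChord.eps (D : PathChord I) (H : Finset D.Chord) : ℤ :=
  ∏ c ∈ H, -omegaAt D.path.arrows c.1

/-- A set of chords is simple if none of its chords is nested inside another one. -/
def PathChord.IsSimple (D : PathChord I) (H : Finset D.Chord) : Prop :=
  ∀ c ∈ H, ∀ d ∈ H, ¬ (c.1.1 < d.1.1 ∧ d.1.2 < c.1.2)

open Classical in
/-- The simple subcuts of a chord diagram. -/
noncomputable def PathChord.simpleCuts (D : PathChord I) : Finset (Finset D.Chord) :=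
  Finset.univ.filter D.IsSimple

/-- The cuts of a path. -/
abbrev QPath.Cut (X : QPath I) : Type := {H : Finset (ℕ × ℕ) // H ∈ cuts X.arrows}

/-- A path with one of its cuts, as a chord diagram. -/
def QPath.withCut (X : QPath I) (H : X.Cut) : PathChord I := ⟨X, H.1, mem_cuts.1 H.2⟩

open Classical in
/-- The simple cuts of a path. -/
noncomputable def QPath.simpleCuts (X : QPath I) : Finset X.Cut :=
  Finset.univ.filter (fun H => (X.withCut H).IsSimple Finset.univ)

/-- The pairs of positions `i < j` of a path with `ω(a_i, a_j) ≠ 0`. -/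
abbrev QPath.Pair (X : QPath I) : Type := {c : ℕ × ℕ // c ∈ pairs X.arrows}

/-- A path with a single chord. -/
def QPath.withPair (X : QPath I) (c : X.Pair) : PathChord I where
  path := X
  cut := {c.1}
  isCut := by
    refine ⟨?_, ?_, ?_⟩
    · intro d hd
      rw [Finset.mem_singleton] at hd
      exact hd ▸ mem_pairs.1 c.2
    · intro d hd e he hne
      rw [Finset.mem_singleton] at hd he
      exact absurd (hd.trans he.symm) hne
    · intro d hd e he h
      rw [Finset.mem_singleton] at hd he
      subst hd
      subst he
      exact lt_irrefl _ h.1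

/-- The path `(a_i)_t a_{i+1} ⋯ a_{j-1}`. -/
def QPath.inner (X : QPath I) (c : X.Pair) : QPath I :=
  ((X.withPair c).inner ⟨c.1, Finset.mem_singleton_self _⟩).path

/-- The path `(a_1)_s a_1 ⋯ a_{i-1} a_{j+1} ⋯ a_n`. -/
def QPath.outer (X : QPath I) (c : X.Pair) : QPath I :=
  ((X.withPair c).outer ⟨c.1, Finset.mem_singleton_self _⟩).path

/-- Closed paths. -/
abbrev ClosedPath (I : Type u) [Quiver.{v} I] : Type (max u v) := {X : QPath I // X.src = X.tgt}

/-- Chord diagrams on closed paths. -/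
abbrev ClosedChord (I : Type u) [Quiver.{v} I] : Type (max u v) :=
  {D : PathChord I // D.path.src = D.path.tgt}

/-- `Y` arises from the closed path `X` by moving the first arrow to the end. -/
def RotPath (X Y : ClosedPath I) : Prop :=
  ∃ (a : DArrow I) (l : List (DArrow I)), X.1.arrows = a :: l ∧ Y.1.arrows = l ++ [a]

/-- Necklaces: closed paths up to cyclic rotation. -/
def Necklace (I : Type u) [Quiver.{v} I] : Type (max u v) := Quot (RotPath (I := I))

/-- The necklace `[X]`. -/
def Necklace.mk (X : ClosedPath I) : Necklace I := Quot.mk _ X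

/-- How the chord `(i, j)`, `i < j`, is renumbered when the first of the positions `0, …, m` is
moved to the end. -/
def rotChord (m : ℕ) (c : ℕ × ℕ) : ℕ × ℕ :=
  if c.1 = 0 then (c.2 - 1, m) else (c.1 - 1, c.2 - 1)

/-- `D'` arises from the chord diagram `D` on a closed path by moving the first arrow, with the end
of the chord that may be attached to it, to the end. -/
def RotChord (D D' : ClosedChord I) : Prop :=
  ∃ (a : DArrow I) (l : List (DArrow I)), D.1.path.arrows = a :: l ∧
    D'.1.path.arrows = l ++ [a] ∧ D'.1.cut = D.1.cut.image (rotChord l.length)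

/-- Necklace chord diagrams: necklaces with a cut, that is, chord diagrams on closed paths up to
simultaneous cyclic rotation of the path and the cut. -/
def NecklaceChord (I : Type u) [Quiver.{v} I] : Type (max u v) := Quot (RotChord (I := I))

/-- The necklace chord diagram `([X], H)`. -/
def NecklaceChord.mk (D : ClosedChord I) : NecklaceChord I := Quot.mk _ D

/-- Inner part of a chord diagram on a closed path. -/
def ClosedChord.inner (D : ClosedChord I) (c : D.1.Chord) : ClosedChord I :=
  ⟨D.1.inner c, D.1.face_closed D.2 _ _⟩

/-- Outer part of a chord diagram on a closed path. -/
def ClosedChord.outer (D : ClosedChord I) (c : D.1.Chord) : ClosedChord I :=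
  ⟨D.1.outer c, D.1.face_closed D.2 _ _⟩

/-- Inner part of a closed path. -/
def ClosedPath.inner (X : ClosedPath I) (c : X.1.Pair) : ClosedPath I :=
  ⟨X.1.inner c, (X.1.withPair c).face_closed X.2 _ _⟩

/-- Outer part of a closed path. -/
def ClosedPath.outer (X : ClosedPath I) (c : X.1.Pair) : ClosedPath I :=
  ⟨X.1.outer c, (X.1.withPair c).face_closed X.2 _ _⟩

/-- A closed path with one of its cuts. -/
def ClosedPath.withCut (X : ClosedPath I) (H : X.1.Cut) : ClosedChord I := ⟨X.1.withCut H, X.2⟩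

end Diagrams

/-! ## Decorated trees -/

/-- `r` is a (strict, total) cyclic order on the set `N`. -/
structure IsCyclicOrder {V : Type} (N : V → Prop) (r : V → V → V → Prop) : Prop where
  mem : ∀ a b c, r a b c → N a
  rot : ∀ a b c, r a b c → r b c a
  asymm : ∀ a b c, r a b c → ¬ r c b a
  trans : ∀ a b c d, r a b c → r a c d → r a b d
  total : ∀ a b c, N a → N b → N c → a ≠ b → b ≠ c → a ≠ c → r a b c ∨ r c b a

/-- `lt` is a strict linear order on the set `N` which induces the cyclic order `r`. -/
structure IsCorner {V : Type} (N : V → Prop) (r : V → V → V → Prop) (lt : V → V → Prop) :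
    Prop where
  mem : ∀ a b, lt a b → N a ∧ N b
  irrefl : ∀ a, ¬ lt a a
  trans : ∀ a b c, lt a b → lt b c → lt a c
  total : ∀ a b, N a → N b → a ≠ b → lt a b ∨ lt b a
  cyc : ∀ a b c, r a b c ↔ (lt a b ∧ lt b c) ∨ (lt b c ∧ lt c a) ∨ (lt c a ∧ lt a b)

/-- A finite oriented tree with a ribbon graph structure and labels in `Λ`: `arrow u v` says that
there is an edge pointing from `u` to `v`, and `cyc v` is the cyclic order of the edges at `v`
(edges are given by their other end). -/
structure RibbonTree (Λ : Type w) : Type (max 1 w) where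
  V : Type
  fin : Fintype V
  arrow : V → V → Prop
  arrow_asymm : ∀ a b, arrow a b → ¬ arrow b a
  isTree : (SimpleGraph.fromRel arrow).IsTree
  cyc : V → V → V → V → Prop
  isCyc : ∀ x, IsCyclicOrder ((SimpleGraph.fromRel arrow).Adj x) (cyc x)
  label : V → Λ

/-- The underlying graph. -/
def RibbonTree.graph {Λ : Type w} (T : RibbonTree Λ) : SimpleGraph T.V := SimpleGraph.fromRel T.arrow

/-- A rooted tree with the structure `Φ_rt`: orientations of all edges, a ribbon graph structure,
a corner at the root (the linear order `lt` of the edges at the root) and labels in `Λ`. -/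
structure RootedTree (Λ : Type w) : Type (max 1 w) extends RibbonTree Λ where
  root : V
  lt : V → V → Prop
  isCorner : IsCorner ((SimpleGraph.fromRel arrow).Adj root) (cyc root) lt

section Trees

variable {Λ : Type w}

/-- `φ` is an isomorphism of oriented trees which respects the ribbon structures and the labels. -/
structure RibbonTree.IsIso (T T' : RibbonTree Λ) (φ : T.V ≃ T'.V) : Prop where
  arrow : ∀ a b, T'.arrow (φ a) (φ b) ↔ T.arrow a b
  cyc : ∀ x a b c, T'.cyc (φ x) (φ a) (φ b) (φ c) ↔ T.cyc x a b c
  label : ∀ x, T'.label (φ x) = T.label x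

/-- Isomorphism of decorated oriented trees. -/
def RibbonTree.Iso (T T' : RibbonTree Λ) : Prop := ∃ φ : T.V ≃ T'.V, T.IsIso T' φ

/-- Isomorphism of decorated rooted trees. -/
def RootedTree.Iso (T T' : RootedTree Λ) : Prop :=
  ∃ φ : T.V ≃ T'.V, T.toRibbonTree.IsIso T'.toRibbonTree φ ∧ φ T.root = T'.root ∧
    ∀ a b, T'.lt (φ a) (φ b) ↔ T.lt a b

/-- Isomorphism classes of decorated oriented trees. -/
def OTreeClass (Λ : Type w) : Type (max 1 w) := Quot (RibbonTree.Iso (Λ := Λ))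

/-- Isomorphism classes of decorated rooted trees. -/
def RTreeClass (Λ : Type w) : Type (max 1 w) := Quot (RootedTree.Iso (Λ := Λ))

/-- The isomorphism class of `T`. -/
def OTreeClass.mk (T : RibbonTree Λ) : OTreeClass Λ := Quot.mk _ T

/-- The isomorphism class of `T`. -/
def RTreeClass.mk (T : RootedTree Λ) : RTreeClass Λ := Quot.mk _ T

/-- The connected component of `x` in `T` without the edges in `E`, with the restricted
structure. -/
noncomputable def RibbonTree.comp (T : RibbonTree Λ) (E : Set (Sym2 T.V)) (x : T.V) :
    RibbonTree Λ where
  V := {y : T.V // (T.graph.deleteEdges E).Reachable x y}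
  fin := by
    classical
    have := T.fin
    exact Fintype.ofFinite _
  arrow a b := T.arrow a.1 b.1
  arrow_asymm a b := T.arrow_asymm a.1 b.1
  isTree := by
    have h1 : SimpleGraph.fromRel
        (fun a b : {y : T.V // (T.graph.deleteEdges E).Reachable x y} => T.arrow a.1 b.1) =
        T.graph.induce {y | (T.graph.deleteEdges E).Reachable x y} := by
      ext a b
      rw [SimpleGraph.fromRel_adj]
      change _ ↔ (SimpleGraph.fromRel T.arrow).Adj a.1 b.1
      simp [SimpleGraph.fromRel_adj, Subtype.ext_iff]
    rw [h1]
    refine ⟨?_, T.isTree.isAcyclic.induce _⟩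
    have h2 : ((T.graph.deleteEdges E).induce
        {y | (T.graph.deleteEdges E).Reachable x y}).Connected := by
      have h3 := ((T.graph.deleteEdges E).connectedComponentMk x).connected_toSimpleGraph
      have h4 : ((T.graph.deleteEdges E).connectedComponentMk x).supp =
          {y | (T.graph.deleteEdges E).Reachable x y} := by
        ext y
        simp [SimpleGraph.ConnectedComponent.mem_supp_iff, SimpleGraph.reachable_comm]
      unfold SimpleGraph.ConnectedComponent.toSimpleGraph at h3
      rw [← h4]
      exact h3
    refine h2.mono ?_
    intro a b hab
    exact (SimpleGraph.deleteEdges_le E) hab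
  cyc x a b c := T.cyc x.1 a.1 b.1 c.1
  isCyc z := by
    have hadj : ∀ a b : {y : T.V // (T.graph.deleteEdges E).Reachable x y},
        (SimpleGraph.fromRel (fun a b : {y : T.V // (T.graph.deleteEdges E).Reachable x y} =>
          T.arrow a.1 b.1)).Adj a b ↔ (SimpleGraph.fromRel T.arrow).Adj a.1 b.1 := by
      intro a b
      simp [SimpleGraph.fromRel_adj, Subtype.ext_iff]
    have h := T.isCyc z.1
    refine ⟨?_, ?_, ?_, ?_, ?_⟩
    · intro a b c hr
      exact (hadj _ _).2 (h.mem _ _ _ hr)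
    · intro a b c hr
      exact h.rot _ _ _ hr
    · intro a b c hr
      exact h.asymm _ _ _ hr
    · intro a b c d hr hr'
      exact h.trans _ _ _ _ hr hr'
    · intro a b c ha hb hc hab hbc hac
      exact h.total _ _ _ ((hadj _ _).1 ha) ((hadj _ _).1 hb) ((hadj _ _).1 hc)
        (fun e => hab (Subtype.ext e)) (fun e => hbc (Subtype.ext e))
        (fun e => hac (Subtype.ext e))
  label y := T.label y.1

theorem IsCyclicOrder.isCorner {V : Type} {N : V → Prop} {r : V → V → V → Prop}
    (h : IsCyclicOrder N r) {p : V} (hp : N p) (S : Set V) (hS : p ∉ S) :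
    IsCorner (fun a : S => N a) (fun a b c => r a b c) (fun a b => r p a b) := by
  have key : ∀ a b c, r p a b → r p b c → r a b c := by
    intro a b c h1 h2
    have h3 := h.rot _ _ _ (h.rot _ _ _ h1)
    have h4 := h.rot _ _ _ h2
    exact h.rot _ _ _ (h.rot _ _ _ (h.trans _ _ _ _ h4 h3))
  have hirr : ∀ a, ¬ r p a a := by
    intro a ha
    have h1 := h.rot _ _ _ ha
    exact h.asymm _ _ _ ha h1
  have htot : ∀ a b : V, N a → N b → a ∈ S → b ∈ S → a ≠ b → r p a b ∨ r p b a := by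
    intro a b ha hb haS hbS hab
    rcases h.total p a b hp ha hb (fun e => hS (e ▸ haS)) hab (fun e => hS (e ▸ hbS)) with h1 | h1
    · exact Or.inl h1
    · exact Or.inr (h.rot _ _ _ (h.rot _ _ _ h1))
  have hmem : ∀ a b c, r a b c → N a ∧ N b ∧ N c := fun a b c hr =>
    ⟨h.mem _ _ _ hr, h.mem _ _ _ (h.rot _ _ _ hr), h.mem _ _ _ (h.rot _ _ _ (h.rot _ _ _ hr))⟩
  have hne : ∀ a b c, r a b c → a ≠ b := by
    rintro a b c hr rfl
    have h1 := h.rot _ _ _ (h.rot _ _ _ hr)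
    exact h.asymm _ _ _ h1 (h.rot _ _ _ h1)
  refine ⟨?_, ?_, ?_, ?_, ?_⟩
  · intro a b hr
    exact (hmem _ _ _ hr).2
  · intro a
    exact hirr a
  · intro a b c h1 h2
    exact h.trans _ _ _ _ h1 h2
  · intro a b ha hb hab
    exact htot a b ha hb a.2 b.2 (fun e => hab (Subtype.ext e))
  · rintro ⟨a, ha⟩ ⟨b, hb⟩ ⟨c, hc⟩
    constructor
    · intro hr
      change r a b c at hr
      change (r p a b ∧ r p b c) ∨ (r p b c ∧ r p c a) ∨ (r p c a ∧ r p a b)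
      obtain ⟨na, nb, nc⟩ := hmem _ _ _ hr
      have hr2 := h.rot _ _ _ hr
      have hr3 := h.rot _ _ _ hr2
      have hasym := h.asymm _ _ _ hr
      have hasym2 := h.asymm _ _ _ hr2
      have hasym3 := h.asymm _ _ _ hr3
      rcases htot a b na nb ha hb (hne _ _ _ hr) with h1 | h1 <;>
      rcases htot b c nb nc hb hc (hne _ _ _ hr2) with h2 | h2 <;>
      rcases htot c a nc na hc ha (hne _ _ _ hr3) with h3 | h3
      · exact Or.inl ⟨h1, h2⟩
      · exact Or.inl ⟨h1, h2⟩
      · exact Or.inr (Or.inr ⟨h3, h1⟩)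
      · exact absurd (key _ _ _ h3 h2) hasym2
      · exact Or.inr (Or.inl ⟨h2, h3⟩)
      · exact absurd (key _ _ _ h1 h3) hasym3
      · exact absurd (key _ _ _ h2 h1) hasym
      · exact absurd (key _ _ _ h2 h1) hasym
    · rintro (⟨h1, h2⟩ | ⟨h1, h2⟩ | ⟨h1, h2⟩)
      · exact key _ _ _ h1 h2
      · exact h.rot _ _ _ (h.rot _ _ _ (key _ _ _ h1 h2))
      · exact h.rot _ _ _ (key _ _ _ h1 h2)

/-- The edges of a rooted tree, given as pairs (upper end, lower end), where the upper end is the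
one closer to the root. -/
abbrev RootedTree.Edge (T : RootedTree Λ) : Type :=
  {e : T.V × T.V // T.graph.Adj e.1 e.2 ∧ T.graph.dist T.root e.2 = T.graph.dist T.root e.1 + 1}

/-- A set of edges of a rooted tree, as a set of unordered pairs. -/
def RootedTree.edgeSym (T : RootedTree Λ) (H : Set T.Edge) : Set (Sym2 T.V) :=
  (fun e : T.Edge => s(e.1.1, e.1.2)) '' H

/-- The component which contains the root after the edges in `H` have been deleted. -/
noncomputable def RootedTree.trunk (T : RootedTree Λ) (H : Set T.Edge) : RootedTree Λ where
  toRibbonTree := T.toRibbonTree.comp (T.edgeSym H) T.root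
  root := ⟨T.root, SimpleGraph.Reachable.refl _⟩
  lt a b := T.lt a.1 b.1
  isCorner := by
    have hadj : ∀ a b : {y : T.V // (T.graph.deleteEdges (T.edgeSym H)).Reachable T.root y},
        (SimpleGraph.fromRel
          (fun a b : {y : T.V // (T.graph.deleteEdges (T.edgeSym H)).Reachable T.root y} =>
          T.arrow a.1 b.1)).Adj a b ↔ (SimpleGraph.fromRel T.arrow).Adj a.1 b.1 := by
      intro a b
      simp [SimpleGraph.fromRel_adj, Subtype.ext_iff]
    have h := T.isCorner
    refine ⟨?_, ?_, ?_, ?_, ?_⟩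
    · intro a b hab
      exact ⟨(hadj _ _).2 (h.mem _ _ hab).1, (hadj _ _).2 (h.mem _ _ hab).2⟩
    · intro a
      exact h.irrefl a.1
    · intro a b c
      exact h.trans a.1 b.1 c.1
    · intro a b ha hb hab
      exact h.total _ _ ((hadj _ _).1 ha) ((hadj _ _).1 hb) (fun e => hab (Subtype.ext e))
    · intro a b c
      exact h.cyc a.1 b.1 c.1

theorem RootedTree.not_reachable (T : RootedTree Λ) (H : Set T.Edge) (e : T.Edge) (he : e ∈ H) :
    ¬ (T.graph.deleteEdges (T.edgeSym H)).Reachable e.1.2 e.1.1 := by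
  have hb := SimpleGraph.isAcyclic_iff_forall_adj_isBridge.1 T.isTree.isAcyclic e.2.1.symm
  rw [SimpleGraph.isBridge_iff] at hb
  intro hr
  refine hb (hr.mono ?_)
  refine SimpleGraph.deleteEdges_anti ?_
  rintro _ rfl
  exact ⟨e, he, Sym2.eq_swap⟩

/-- The component below the edge `e ∈ H` after the edges in `H` have been deleted. Its root is the
lower end of `e`; the edges there are ordered by starting the cyclic order at `e`. -/
noncomputable def RootedTree.branch (T : RootedTree Λ) (H : Set T.Edge) (e : T.Edge) (he : e ∈ H) :
    RootedTree Λ where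
  toRibbonTree := T.toRibbonTree.comp (T.edgeSym H) e.1.2
  root := ⟨e.1.2, SimpleGraph.Reachable.refl _⟩
  lt a b := T.cyc e.1.2 e.1.1 a.1 b.1
  isCorner := by
    have hadj : ∀ a b : {y : T.V // (T.graph.deleteEdges (T.edgeSym H)).Reachable e.1.2 y},
        (SimpleGraph.fromRel
          (fun a b : {y : T.V // (T.graph.deleteEdges (T.edgeSym H)).Reachable e.1.2 y} =>
          T.arrow a.1 b.1)).Adj a b ↔ (SimpleGraph.fromRel T.arrow).Adj a.1 b.1 := by
      intro a b
      simp [SimpleGraph.fromRel_adj, Subtype.ext_iff]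
    have h := (T.isCyc e.1.2).isCorner e.2.1.symm
      {y | (T.graph.deleteEdges (T.edgeSym H)).Reachable e.1.2 y} (T.not_reachable H e he)
    refine ⟨?_, h.irrefl, h.trans, ?_, h.cyc⟩
    · intro a b hab
      exact ⟨(hadj _ _).2 (h.mem _ _ hab).1, (hadj _ _).2 (h.mem _ _ hab).2⟩
    · intro a b ha hb hab
      exact h.total _ _ ((hadj _ _).1 ha) ((hadj _ _).1 hb) hab

/-- A set of edges is a simple cut if each path which starts at the root contains at most one of
them. -/
def RootedTree.IsSimple (T : RootedTree Λ) (H : Finset T.Edge) : Prop :=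
  ∀ (x : T.V) (p : T.graph.Walk T.root x), p.IsPath → ∀ e ∈ H, ∀ e' ∈ H,
    s(e.1.1, e.1.2) ∈ p.edges → s(e'.1.1, e'.1.2) ∈ p.edges → e = e'

noncomputable instance (T : RootedTree Λ) : Fintype T.Edge := by
  classical
  have := T.fin
  exact Fintype.ofFinite _

open Classical in
/-- The simple cuts of a rooted tree. -/
noncomputable def RootedTree.simpleCuts (T : RootedTree Λ) : Finset (Finset T.Edge) :=
  Finset.univ.filter T.IsSimple

/-- The edges of an oriented tree, as pairs (source, target). -/
abbrev RibbonTree.Edge (T : RibbonTree Λ) : Type := {e : T.V × T.V // T.arrow e.1 e.2}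

noncomputable instance (T : RibbonTree Λ) : Fintype T.Edge := by
  classical
  have := T.fin
  exact Fintype.ofFinite _

/-- The subtree which the edge `e` points away from. -/
noncomputable def RibbonTree.tail (T : RibbonTree Λ) (e : T.Edge) : RibbonTree Λ :=
  T.comp {s(e.1.1, e.1.2)} e.1.1

/-- The subtree which the edge `e` points to. -/
noncomputable def RibbonTree.head (T : RibbonTree Λ) (e : T.Edge) : RibbonTree Λ :=
  T.comp {s(e.1.1, e.1.2)} e.1.2

end Trees

end ChordAlg

namespace ChordAlg

universe u v w

/-! ## The dual tree of a chord diagram -/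

theorem isTree_of_parent {V : Type} [Finite V] (G : SimpleGraph V) (r : V) (par : V → V → Prop)
    (h : V → ℕ) (hadj : ∀ x y, G.Adj x y ↔ par x y ∨ par y x) (hlt : ∀ x y, par x y → h x < h y)
    (hex : ∀ y, y ≠ r → ∃ x, par x y) (huniq : ∀ x x' y, par x y → par x' y → x = x')
    (hroot : ∀ x, ¬ par x r) : G.IsTree := by
  classical
  have := Fintype.ofFinite V
  have hreach : ∀ n y, h y = n → G.Reachable r y := by
    intro n
    induction n using Nat.strong_induction_on with
    | _ n ih =>
      intro y hy
      by_cases hyr : y = r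
      · rw [hyr]
      · obtain ⟨x, hx⟩ := hex y hyr
        have h1 := ih (h x) (hy ▸ hlt x y hx) x rfl
        exact h1.trans (SimpleGraph.Adj.reachable ((hadj x y).2 (Or.inl hx)))
  have hconn : G.Connected :=
    { preconnected := fun x y => (hreach _ x rfl).symm.trans (hreach _ y rfl)
      nonempty := ⟨r⟩ }
  rw [SimpleGraph.isTree_iff_connected_and_card]
  refine ⟨hconn, le_antisymm ?_ hconn.card_vert_le_card_edgeSet_add_one⟩
  choose p hp using fun y : {y : V // y ≠ r} => hex y.1 y.2
  let φ : {y : V // y ≠ r} → G.edgeSet := fun y =>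
    ⟨s(p y, y.1), (SimpleGraph.mem_edgeSet G).2 ((hadj _ _).2 (Or.inl (hp y)))⟩
  have hφ : Function.Surjective φ := by
    rintro ⟨e, he⟩
    induction e using Sym2.ind with
    | _ x y =>
      rw [SimpleGraph.mem_edgeSet, hadj] at he
      rcases he with he | he
      · have hy : y ≠ r := by
          rintro rfl
          exact hroot _ he
        refine ⟨⟨y, hy⟩, Subtype.ext ?_⟩
        change s(p ⟨y, hy⟩, y) = s(x, y)
        rw [huniq _ _ _ (hp ⟨y, hy⟩) he]
      · have hx : x ≠ r := by
          rintro rfl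
          exact hroot _ he
        refine ⟨⟨x, hx⟩, Subtype.ext ?_⟩
        change s(p ⟨x, hx⟩, x) = s(x, y)
        rw [huniq _ _ _ (hp ⟨x, hx⟩) he, Sym2.eq_swap]
  have h1 := Nat.card_le_card_of_surjective φ hφ
  have h2 : Nat.card {y : V // y ≠ r} = Nat.card V - 1 := by
    rw [Nat.card_eq_fintype_card, Nat.card_eq_fintype_card, Fintype.card_subtype_compl]
    simp
  have h3 : 0 < Nat.card V := Nat.card_pos_iff.2 ⟨⟨r⟩, inferInstance⟩
  omega

theorem isCyclicOrder_of_key {V : Type} (N : V → Prop) (k : V → ℕ)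
    (hk : ∀ a b, N a → N b → k a = k b → a = b) :
    IsCyclicOrder N (fun a b c => (N a ∧ N b ∧ N c) ∧
      ((k a < k b ∧ k b < k c) ∨ (k b < k c ∧ k c < k a) ∨ (k c < k a ∧ k a < k b))) := by
  refine ⟨?_, ?_, ?_, ?_, ?_⟩
  · rintro a b c ⟨⟨ha, -, -⟩, -⟩
    exact ha
  · rintro a b c ⟨⟨ha, hb, hc⟩, h⟩
    exact ⟨⟨hb, hc, ha⟩, by omega⟩
  · rintro a b c ⟨-, h⟩ ⟨-, h'⟩
    omega
  · rintro a b c d ⟨⟨ha, hb, hc⟩, h⟩ ⟨⟨-, -, hd⟩, h'⟩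
    exact ⟨⟨ha, hb, hd⟩, by omega⟩
  · intro a b c ha hb hc hab hbc hac
    have h1 : k a ≠ k b := fun e => hab (hk a b ha hb e)
    have h2 : k b ≠ k c := fun e => hbc (hk b c hb hc e)
    have h3 : k a ≠ k c := fun e => hac (hk a c ha hc e)
    by_cases h : (k a < k b ∧ k b < k c) ∨ (k b < k c ∧ k c < k a) ∨ (k c < k a ∧ k a < k b)
    · exact Or.inl ⟨⟨ha, hb, hc⟩, h⟩
    · exact Or.inr ⟨⟨hc, hb, ha⟩, by omega⟩

section Dual

variable {I : Type u} [Quiver.{v} I]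

/-- The face `f` of `D` lies directly above the chord `d`: `d` is nested inside `f`, and no chord
lies between them. -/
def PathChord.Parent (D : PathChord I) (f : Option D.Chord) (d : D.Chord) : Prop :=
  Below D.path.arrows.length (D.rawFace f) d.1 ∧
    ∀ e : D.Chord, Below D.path.arrows.length (some e.1) d.1 →
      ¬ Below D.path.arrows.length (D.rawFace f) e.1

/-- The faces `f` and `g` are separated by one chord, with `f` above `g`. -/
def PathChord.Above (D : PathChord I) (f g : Option D.Chord) : Prop :=
  ∃ d : D.Chord, g = some d ∧ D.Parent f d

/-- The chord `d = (i, j)` has `a_i` in the quiver `Q`; it is then oriented from `i` to `j`, and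
from `j` to `i` otherwise. -/
def PathChord.Forward (D : PathChord I) (d : D.Chord) : Prop :=
  ∃ e : Quiver.Total I, D.path.arrows[d.1.1]? = some (DArrow.arr e)

/-- The orientation of the edges of the dual tree. The chords are drawn as arcs above the segment;
the dual edge of a chord `d` followed by `d` is a positive frame. So the dual edge points downwards
through a chord which is oriented from left to right, and upwards otherwise. -/
def PathChord.dualArrow (D : PathChord I) (f g : Option D.Chord) : Prop :=
  (∃ d : D.Chord, g = some d ∧ D.Parent f d ∧ D.Forward d) ∨
    (∃ d : D.Chord, f = some d ∧ D.Parent g d ∧ ¬ D.Forward d)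

open Classical in
/-- The position of the neighbour `g` around the face `f`: first the face above `f`, then those
below `f` from left to right. This is the counterclockwise order. -/
noncomputable def PathChord.dualKey (D : PathChord I) (f : Option D.Chord) : Option D.Chord → ℕ
  | none => 0
  | some d => if D.Parent f d then d.1.1 + 1 else 0

theorem PathChord.fromRel_adj (D : PathChord I) (f g : Option D.Chord) :
    (SimpleGraph.fromRel D.dualArrow).Adj f g ↔ D.Above f g ∨ D.Above g f := by
  have hself : ∀ x y, D.Above x y → x ≠ y := by
    rintro x _ ⟨d, rfl, h1, -⟩ rfl
    have := h1.1
    simp only [PathChord.rawFace, Option.map_some, lo] at this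
    omega
  rw [SimpleGraph.fromRel_adj]
  constructor
  · rintro ⟨-, (⟨d, h1, h2, -⟩ | ⟨d, h1, h2, -⟩) | (⟨d, h1, h2, -⟩ | ⟨d, h1, h2, -⟩)⟩
    · exact Or.inl ⟨d, h1, h2⟩
    · exact Or.inr ⟨d, h1, h2⟩
    · exact Or.inr ⟨d, h1, h2⟩
    · exact Or.inl ⟨d, h1, h2⟩
  · rintro (h | h)
    · refine ⟨hself _ _ h, ?_⟩
      obtain ⟨d, h1, h2⟩ := h
      by_cases hd : D.Forward d
      · exact Or.inl (Or.inl ⟨d, h1, h2, hd⟩)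
      · exact Or.inr (Or.inr ⟨d, h1, h2, hd⟩)
    · refine ⟨(hself _ _ h).symm, ?_⟩
      obtain ⟨d, h1, h2⟩ := h
      by_cases hd : D.Forward d
      · exact Or.inr (Or.inl ⟨d, h1, h2, hd⟩)
      · exact Or.inl (Or.inr ⟨d, h1, h2, hd⟩)

theorem PathChord.above_unique (D : PathChord I) {f f' g : Option D.Chord} (h : D.Above f g)
    (h' : D.Above f' g) : f = f' := by
  obtain ⟨d, rfl, h1, h2⟩ := h
  obtain ⟨d', hd, h1', h2'⟩ := h'
  obtain rfl : d = d' := Option.some.inj hd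
  have hw : ∀ c : D.Chord, c.1.1 < c.1.2 ∧ c.1.2 < D.path.arrows.length := fun c =>
    ⟨(D.isCut.pair _ c.2).1, (D.isCut.pair _ c.2).lt_length⟩
  have hwd := hw d
  unfold Below at *
  cases f with
  | none =>
    cases f' with
    | none => rfl
    | some c' =>
      have := h2 c' h1'
      have := hw c'
      simp only [PathChord.rawFace, Option.map_none, Option.map_some, lo, hi] at *
      omega
  | some c =>
    cases f' with
    | none =>
      have := h2' c h1
      have := hw c
      simp only [PathChord.rawFace, Option.map_none, Option.map_some, lo, hi] at *
      omega
    | some c' =>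
      by_contra hne
      have hne' : c.1 ≠ c'.1 := fun e => hne (congrArg some (Subtype.ext e))
      have k1 := h2 c' h1'
      have k2 := h2' c h1
      have k3 := D.isCut.distinct c.1 c.2 c'.1 c'.2 hne'
      have k4 := D.isCut.noncrossing c.1 c.2 c'.1 c'.2
      have k5 := D.isCut.noncrossing c'.1 c'.2 c.1 c.2
      simp only [PathChord.rawFace, Option.map_some, lo, hi] at *
      omega

theorem PathChord.exists_parent (D : PathChord I) (d : D.Chord) : ∃ f, D.Parent f d := by
  classical
  have hw : ∀ c : D.Chord, c.1.1 < c.1.2 ∧ c.1.2 < D.path.arrows.length := fun c =>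
    ⟨(D.isCut.pair _ c.2).1, (D.isCut.pair _ c.2).lt_length⟩
  have hwd := hw d
  let A : Finset D.Chord :=
    Finset.univ.filter (fun e => Below D.path.arrows.length (some e.1) d.1)
  have hA : ∀ e, e ∈ A ↔ Below D.path.arrows.length (some e.1) d.1 := by simp [A]
  rcases A.eq_empty_or_nonempty with hA0 | hA0
  · refine ⟨none, ⟨?_, ?_⟩⟩
    · unfold Below
      simp only [PathChord.rawFace, Option.map_none, lo, hi]
      omega
    · intro e he
      rw [← hA, hA0] at he
      simp at he
  · obtain ⟨c, hc, hmax⟩ := A.exists_max_image (fun e => e.1.1) hA0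
    refine ⟨some c, ⟨(hA c).1 hc, ?_⟩⟩
    intro e he hce
    have := hmax e ((hA e).2 he)
    have := hce.1
    simp only [PathChord.rawFace, Option.map_some, lo] at *
    omega

theorem PathChord.dual_isTree (D : PathChord I) :
    (SimpleGraph.fromRel D.dualArrow).IsTree := by
  have hw : ∀ c : D.Chord, c.1.1 < c.1.2 ∧ c.1.2 < D.path.arrows.length := fun c =>
    ⟨(D.isCut.pair _ c.2).1, (D.isCut.pair _ c.2).lt_length⟩
  refine isTree_of_parent _ none D.Above
    (fun f => match f with | none => 0 | some d => d.1.1 + 1) D.fromRel_adj ?_ ?_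
    (fun _ _ _ => D.above_unique) ?_
  · rintro f _ ⟨d, rfl, h1, -⟩
    have := h1.1
    cases f with
    | none => simp
    | some c =>
      simp only [PathChord.rawFace, Option.map_some, lo] at *
      omega
  · intro g hg
    obtain ⟨d, rfl⟩ := Option.ne_none_iff_exists'.1 hg
    obtain ⟨f, hf⟩ := D.exists_parent d
    exact ⟨f, d, rfl, hf⟩
  · rintro f ⟨d, hd, -⟩
    simp at hd

theorem PathChord.dualKey_inj (D : PathChord I) (f a b : Option D.Chord)
    (ha : (SimpleGraph.fromRel D.dualArrow).Adj f a)
    (hb : (SimpleGraph.fromRel D.dualArrow).Adj f b)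
    (hab : D.dualKey f a = D.dualKey f b) : a = b := by
  have hnot : ∀ {x y}, D.Above x y → ¬ D.Above y x := by
    rintro _ _ ⟨d, rfl, h1, -⟩ ⟨e, rfl, h2, -⟩
    have h1 := h1.1
    have h2 := h2.1
    simp only [PathChord.rawFace, Option.map_some, lo] at *
    omega
  have hup : ∀ x, D.Above x f → D.dualKey f x = 0 := by
    intro x hx
    cases x with
    | none => rfl
    | some d =>
      have : ¬ D.Parent f d := fun h => hnot hx ⟨d, rfl, h⟩
      simp [PathChord.dualKey, this]
  have hdown : ∀ x, D.Above f x → ∃ d : D.Chord, x = some d ∧ D.dualKey f x = d.1.1 + 1 := by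
    rintro _ ⟨d, rfl, h⟩
    exact ⟨d, rfl, by simp [PathChord.dualKey, h]⟩
  rw [D.fromRel_adj] at ha hb
  rcases ha with ha | ha <;> rcases hb with hb | hb
  · obtain ⟨d, rfl, h1⟩ := hdown _ ha
    obtain ⟨e, rfl, h2⟩ := hdown _ hb
    by_contra hne
    have := (D.isCut.distinct d.1 d.2 e.1 e.2
      (fun h => hne (congrArg some (Subtype.ext h)))).1
    omega
  · obtain ⟨d, rfl, h1⟩ := hdown _ ha
    have := hup _ hb
    omega
  · obtain ⟨d, rfl, h1⟩ := hdown _ hb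
    have := hup _ ha
    omega
  · exact D.above_unique ha hb

/-- The dual tree of a chord diagram, as an oriented tree with a ribbon graph structure, with one
vertex for each face and one edge across each chord, and with given labels of the faces. -/
noncomputable def PathChord.dualRibbon {Λ : Type w} (D : PathChord I)
    (label : Option D.Chord → Λ) : RibbonTree Λ where
  V := Option D.Chord
  fin := inferInstance
  arrow := D.dualArrow
  arrow_asymm := by
    rintro f g (⟨d, rfl, h, h0⟩ | ⟨d, rfl, h, h0⟩) (⟨e, he, h', h0'⟩ | ⟨e, he, h', h0'⟩)
    · subst he
      have h1 := h.1
      have h2 := h'.1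
      simp only [PathChord.rawFace, Option.map_some, lo, Below] at *
      omega
    · obtain rfl : d = e := Option.some.inj he
      exact h0' h0
    · obtain rfl : d = e := Option.some.inj he
      exact h0 h0'
    · subst he
      have h1 := h.1
      have h2 := h'.1
      simp only [PathChord.rawFace, Option.map_some, lo, Below] at *
      omega
  isTree := D.dual_isTree
  cyc f a b c :=
    ((SimpleGraph.fromRel D.dualArrow).Adj f a ∧ (SimpleGraph.fromRel D.dualArrow).Adj f b ∧
      (SimpleGraph.fromRel D.dualArrow).Adj f c) ∧
    ((D.dualKey f a < D.dualKey f b ∧ D.dualKey f b < D.dualKey f c) ∨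
      (D.dualKey f b < D.dualKey f c ∧ D.dualKey f c < D.dualKey f a) ∨
      (D.dualKey f c < D.dualKey f a ∧ D.dualKey f a < D.dualKey f b))
  isCyc f := isCyclicOrder_of_key _ _ (D.dualKey_inj f)
  label := label

/-- The dual rooted tree `(T_H, s_H)`: the root is the unbounded face, the edges at the root are
ordered from left to right, and each face is labelled by the path which remains there. -/
noncomputable def PathChord.dualRooted (D : PathChord I) : RootedTree (QPath I) where
  toRibbonTree := D.dualRibbon (fun f => (D.face Finset.univ f).path)
  root := (none : Option D.Chord)
  lt a b := (SimpleGraph.fromRel D.dualArrow).Adj none a ∧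
    (SimpleGraph.fromRel D.dualArrow).Adj none b ∧ D.dualKey none a < D.dualKey none b
  isCorner := by
    refine ⟨?_, ?_, ?_, ?_, ?_⟩
    · rintro a b ⟨h1, h2, -⟩
      exact ⟨h1, h2⟩
    · rintro a ⟨-, -, h⟩
      exact lt_irrefl _ h
    · rintro a b c ⟨h1, h2, h3⟩ ⟨-, h4, h5⟩
      exact ⟨h1, h4, h3.trans h5⟩
    · intro a b ha hb hab
      have := fun e => hab (D.dualKey_inj none a b ha hb e)
      rcases Nat.lt_or_gt_of_ne this with h | h
      · exact Or.inl ⟨ha, hb, h⟩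
      · exact Or.inr ⟨hb, ha, h⟩
    · intro a b c
      simp only [PathChord.dualRibbon]
      tauto

/-- The dual oriented tree `(T_{H,or}, s_{H,or})` of a chord diagram on a closed path: the root and
the corner are forgotten, and the labels are turned into necklaces. -/
noncomputable def ClosedChord.dualOriented (D : ClosedChord I) : RibbonTree (Necklace I) :=
  D.1.dualRibbon (fun f => Necklace.mk ⟨(D.1.face Finset.univ f).path, D.1.face_closed D.2 _ _⟩)

end Dual

end ChordAlg

namespace ChordAlg

universe u v w w'

/-! ## Pre-Lie coalgebras, Lie coalgebras and Hopf algebras -/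

section Structures

variable {k : Type w} [CommRing k]

section

variable {M : Type w'} [AddCommGroup M] [Module k M]

/-- `δ` is a (left) pre-Lie comultiplication:
`(Id - τ_(12)) (δ ⊗ 1 - 1 ⊗ δ) δ = 0`, as a map to `M ⊗ M ⊗ M`. -/
def IsPreLieComul (δ : M →ₗ[k] M ⊗[k] M) : Prop :=
  (LinearMap.id - (TensorProduct.comm k M M).toLinearMap.rTensor M) ∘ₗ
    (δ.rTensor M ∘ₗ δ -
      (TensorProduct.assoc k M M M).symm.toLinearMap ∘ₗ δ.lTensor M ∘ₗ δ) = 0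

/-- The cyclic permutation `x ⊗ y ⊗ z ↦ z ⊗ x ⊗ y`. -/
noncomputable def cyclicPerm : (M ⊗[k] M) ⊗[k] M →ₗ[k] (M ⊗[k] M) ⊗[k] M :=
  (TensorProduct.assoc k M M M).symm.toLinearMap ∘ₗ
    (TensorProduct.comm k (M ⊗[k] M) M).toLinearMap

/-- `δ` is a Lie cobracket: its values are sums of elements `x ⊗ y - y ⊗ x`, and it satisfies the
co-Jacobi identity. -/
structure IsLieCobracket (δ : M →ₗ[k] M ⊗[k] M) : Prop where
  skew : ∀ x, δ x ∈ LinearMap.range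
    (LinearMap.id - (TensorProduct.comm k M M).toLinearMap : M ⊗[k] M →ₗ[k] M ⊗[k] M)
  coJacobi : (LinearMap.id + cyclicPerm + cyclicPerm ∘ₗ cyclicPerm) ∘ₗ δ.rTensor M ∘ₗ δ = 0

/-- `x ∧ y = x ⊗ y - y ⊗ x`. -/
def wedge (x y : M) : M ⊗[k] M := x ⊗ₜ[k] y - y ⊗ₜ[k] x

end

/-- `f` is a homomorphism between modules with comultiplications `δ` and `δ'`. For pre-Lie
(respectively Lie) coalgebras these are the homomorphisms of pre-Lie (respectively Lie)
coalgebras. -/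
def IsComulHom {M : Type*} {N : Type*} [AddCommGroup M] [Module k M] [AddCommGroup N] [Module k N]
    (δ : M →ₗ[k] M ⊗[k] M) (δ' : N →ₗ[k] N ⊗[k] N) (f : M →ₗ[k] N) : Prop :=
  TensorProduct.map f f ∘ₗ δ = δ' ∘ₗ f

/-- The commutative algebra `A` is a (commutative) Hopf algebra with coproduct `Δ`, counit `ε` and
antipode `S`. -/
structure IsHopf {A : Type*} [CommRing A] [Algebra k A] (Δ : A →ₐ[k] A ⊗[k] A) (ε : A →ₐ[k] k)
    (S : A →ₗ[k] A) : Prop where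
  coassoc : (TensorProduct.assoc k A A A).toLinearMap ∘ₗ Δ.toLinearMap.rTensor A ∘ₗ
    Δ.toLinearMap = Δ.toLinearMap.lTensor A ∘ₗ Δ.toLinearMap
  counit_left : ε.toLinearMap.rTensor A ∘ₗ Δ.toLinearMap = TensorProduct.mk k k A 1
  counit_right : ε.toLinearMap.lTensor A ∘ₗ Δ.toLinearMap = (TensorProduct.mk k A k).flip 1
  antipode_left : LinearMap.mul' k A ∘ₗ S.rTensor A ∘ₗ Δ.toLinearMap =
    Algebra.linearMap k A ∘ₗ ε.toLinearMap
  antipode_right : LinearMap.mul' k A ∘ₗ S.lTensor A ∘ₗ Δ.toLinearMap =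
    Algebra.linearMap k A ∘ₗ ε.toLinearMap

/-- The resulting Hopf algebra in the sense of Mathlib. -/
@[reducible] noncomputable def IsHopf.hopfAlgebra {A : Type*} [CommRing A] [Algebra k A]
    {Δ : A →ₐ[k] A ⊗[k] A} {ε : A →ₐ[k] k} {S : A →ₗ[k] A} (h : IsHopf Δ ε S) :
    HopfAlgebra k A :=
  letI b : Bialgebra k A := Bialgebra.ofAlgHom Δ ε
    (AlgHom.toLinearMap_injective h.coassoc)
    (AlgHom.toLinearMap_injective h.counit_left)
    (AlgHom.toLinearMap_injective h.counit_right)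
  { b with
    antipode := S
    mul_antipode_rTensor_comul := h.antipode_left
    mul_antipode_lTensor_comul := h.antipode_right }

/-- The algebra homomorphism `F` is a homomorphism of Hopf algebras: it respects coproduct, counit
and antipode. -/
structure IsHopfHom {A : Type*} {B : Type*} [CommRing A] [Algebra k A] [CommRing B] [Algebra k B]
    (Δ : A →ₐ[k] A ⊗[k] A) (ε : A →ₐ[k] k) (S : A →ₗ[k] A)
    (Δ' : B →ₐ[k] B ⊗[k] B) (ε' : B →ₐ[k] k) (S' : B →ₗ[k] B) (F : A →ₐ[k] B) : Prop where
  comul : (Algebra.TensorProduct.map F F).comp Δ = Δ'.comp F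
  counit : ε'.comp F = ε
  antipode : F.toLinearMap ∘ₗ S = S' ∘ₗ F.toLinearMap

/-! ### The symmetric algebra on a free module -/

variable (k)

/-- The symmetric algebra of the free module with basis `B`. -/
abbrev Sym (B : Type w') : Type (max w w') := SymmetricAlgebra k (B →₀ k)

variable {k} {B : Type w'}

/-- The generator which belongs to a basis element. -/
noncomputable def gen (b : B) : Sym k B := SymmetricAlgebra.ι k (B →₀ k) (Finsupp.single b 1)

/-- The algebra homomorphism on the symmetric algebra with given values on the basis. -/
noncomputable def symLift {A : Type*} [CommRing A] [Algebra k A] (f : B → A) : Sym k B →ₐ[k] A :=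
  SymmetricAlgebra.lift (Finsupp.linearCombination k f)

/-- The counit of the symmetric algebra, with `ε(b) = 0` for all `b`. -/
noncomputable def symCounit : Sym k B →ₐ[k] k := symLift (fun _ => 0)

/-- The multiplicative extension of a linear map. -/
noncomputable def symMap {C : Type*} (f : (B →₀ k) →ₗ[k] (C →₀ k)) : Sym k B →ₐ[k] Sym k C :=
  SymmetricAlgebra.lift (SymmetricAlgebra.ι k (C →₀ k) ∘ₗ f)

/-- The projection `1 - η ε` of the symmetric algebra onto the augmentation ideal. -/
noncomputable def augProj : Sym k B →ₗ[k] Sym k B :=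
  LinearMap.id - Algebra.linearMap k (Sym k B) ∘ₗ symCounit.toLinearMap

/-- The reduced coproduct `Δ' = (1 - η ε)^{⊗ 2} Δ`. -/
noncomputable def reducedComul (Δ : Sym k B →ₐ[k] Sym k B ⊗[k] Sym k B) :
    Sym k B →ₗ[k] Sym k B ⊗[k] Sym k B :=
  TensorProduct.map augProj augProj ∘ₗ Δ.toLinearMap

/-- `μ^n ∘ (Δ')^n`, where `(Δ')^{n+1} = ((Δ')^n ⊗ 1) ∘ Δ'` is the iterated reduced coproduct and
`μ^n` is the multiplication of `n + 1` factors. -/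
noncomputable def mulReducedPow (Δ : Sym k B →ₐ[k] Sym k B ⊗[k] Sym k B) :
    ℕ → (Sym k B →ₗ[k] Sym k B)
  | 0 => LinearMap.id
  | n + 1 => LinearMap.mul' k (Sym k B) ∘ₗ (mulReducedPow Δ n).rTensor (Sym k B) ∘ₗ
      reducedComul Δ

/-- The multiplicative map `S` with `S(b) = -b + ∑_{n ≥ 1} (-1)^{n+1} μ^n (Δ')^n (b)` on the basis
elements `b`. -/
noncomputable def symAntipode (Δ : Sym k B →ₐ[k] Sym k B ⊗[k] Sym k B) :
    Sym k B →ₐ[k] Sym k B :=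
  symLift (fun b => -gen b + ∑ᶠ (n : ℕ) (_ : 1 ≤ n), (-1 : k) ^ (n + 1) • mulReducedPow Δ n (gen b))

end Structures

/-! ## The coalgebras of paths, necklaces, chord diagrams and trees -/

section Coalgebras

variable (k : Type w) [CommRing k] {I : Type u} [Quiver.{v} I] {Λ : Type w'}

/-- A basis element of a free module. -/
noncomputable abbrev bas {B : Type*} (b : B) : B →₀ k := Finsupp.single b 1

/-- `δ_{p,rt}` of a path. -/
noncomputable def pathComulOn (X : QPath I) : (QPath I →₀ k) ⊗[k] (QPath I →₀ k) :=
  ∑ c : X.Pair, (-omegaAt X.arrows c.1) • (bas k (X.inner c) ⊗ₜ[k] bas k (X.outer c))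

/-- The pre-Lie comultiplication `δ_{p,rt}` on the path algebra `P`. -/
noncomputable def pathComul : (QPath I →₀ k) →ₗ[k] (QPath I →₀ k) ⊗[k] (QPath I →₀ k) :=
  Finsupp.linearCombination k (pathComulOn k)

/-- `δ_or` of the necklace `[X]`. -/
noncomputable def necklaceCobracketOn (X : ClosedPath I) :
    (Necklace I →₀ k) ⊗[k] (Necklace I →₀ k) :=
  ∑ c : X.1.Pair, omegaAt X.1.arrows c.1 •
    wedge (k := k) (bas k (Necklace.mk (X.outer c))) (bas k (Necklace.mk (X.inner c)))

/-- The Lie cobracket `δ_or` on the module `L` of necklaces, computed on a representative of each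
necklace. -/
noncomputable def necklaceCobracket :
    (Necklace I →₀ k) →ₗ[k] (Necklace I →₀ k) ⊗[k] (Necklace I →₀ k) :=
  Finsupp.linearCombination k (fun N => necklaceCobracketOn k (Quot.out N))

/-- `δ_{p,rt}` of a path chord diagram. -/
noncomputable def chordComulOn (D : PathChord I) : (PathChord I →₀ k) ⊗[k] (PathChord I →₀ k) :=
  ∑ c : D.Chord, (-omegaAt D.path.arrows c.1) • (bas k (D.inner c) ⊗ₜ[k] bas k (D.outer c))

/-- The comultiplication `δ_{p,rt}` on `Ch_rt`. -/
noncomputable def chordComul : (PathChord I →₀ k) →ₗ[k] (PathChord I →₀ k) ⊗[k] (PathChord I →₀ k) :=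
  Finsupp.linearCombination k (chordComulOn k)

/-- `δ_or` of the necklace chord diagram which is represented by `D`. -/
noncomputable def chordCobracketOn (D : ClosedChord I) :
    (NecklaceChord I →₀ k) ⊗[k] (NecklaceChord I →₀ k) :=
  ∑ c : D.1.Chord, (-omegaAt D.1.path.arrows c.1) •
    (bas k (NecklaceChord.mk (D.inner c)) ⊗ₜ[k] bas k (NecklaceChord.mk (D.outer c)) -
      bas k (NecklaceChord.mk (D.outer c)) ⊗ₜ[k] bas k (NecklaceChord.mk (D.inner c)))

/-- The cobracket `δ_or` on `Ch_or`, computed on a representative of each necklace chord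
diagram. -/
noncomputable def chordCobracket :
    (NecklaceChord I →₀ k) →ₗ[k] (NecklaceChord I →₀ k) ⊗[k] (NecklaceChord I →₀ k) :=
  Finsupp.linearCombination k (fun N => chordCobracketOn k (Quot.out N))

/-- `ρ` of the class of a rooted tree: the sum over all edges. -/
noncomputable def rtreeComulOn (T : RootedTree Λ) : (RTreeClass Λ →₀ k) ⊗[k] (RTreeClass Λ →₀ k) :=
  ∑ e : T.Edge, bas k (RTreeClass.mk (T.branch {e} e rfl)) ⊗ₜ[k] bas k (RTreeClass.mk (T.trunk {e}))

/-- The pre-Lie comultiplication `ρ` on decorated rooted trees, computed on a representative of each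
isomorphism class. -/
noncomputable def rtreeComul :
    (RTreeClass Λ →₀ k) →ₗ[k] (RTreeClass Λ →₀ k) ⊗[k] (RTreeClass Λ →₀ k) :=
  Finsupp.linearCombination k (fun t => rtreeComulOn k (Quot.out t))

/-- The cobracket of the class of an oriented tree. -/
noncomputable def otreeCobracketOn (T : RibbonTree Λ) :
    (OTreeClass Λ →₀ k) ⊗[k] (OTreeClass Λ →₀ k) :=
  ∑ e : T.Edge, (bas k (OTreeClass.mk (T.tail e)) ⊗ₜ[k] bas k (OTreeClass.mk (T.head e)) -
    bas k (OTreeClass.mk (T.head e)) ⊗ₜ[k] bas k (OTreeClass.mk (T.tail e)))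

/-- The Lie cobracket on decorated oriented trees, computed on a representative of each isomorphism
class. -/
noncomputable def otreeCobracket :
    (OTreeClass Λ →₀ k) →ₗ[k] (OTreeClass Λ →₀ k) ⊗[k] (OTreeClass Λ →₀ k) :=
  Finsupp.linearCombination k (fun t => otreeCobracketOn k (Quot.out t))

/-- `Δ` of a path, as an element of `Sym P ⊗ Sym P`. -/
noncomputable def pathCoprodOn (X : QPath I) : Sym k (QPath I) ⊗[k] Sym k (QPath I) :=
  gen X ⊗ₜ[k] 1 + ∑ H ∈ X.simpleCuts,
    (X.withCut H).eps Finset.univ •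
      ((∏ c : (X.withCut H).Chord, gen ((X.withCut H).face Finset.univ (some c)).path) ⊗ₜ[k]
        gen ((X.withCut H).face Finset.univ none).path)

/-- The coproduct of `Sym P`. -/
noncomputable def pathCoprod : Sym k (QPath I) →ₐ[k] Sym k (QPath I) ⊗[k] Sym k (QPath I) :=
  symLift (pathCoprodOn k)

/-- `Δ` of a path chord diagram: the sum over its simple subcuts. -/
noncomputable def chordCoprodOn (D : PathChord I) : Sym k (PathChord I) ⊗[k] Sym k (PathChord I) :=
  gen D ⊗ₜ[k] 1 + ∑ H ∈ D.simpleCuts,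
    D.eps H • ((∏ c ∈ H, gen (D.face H (some c))) ⊗ₜ[k] gen (D.face H none))

/-- The coproduct of `Sym Ch_rt`. -/
noncomputable def chordCoprod :
    Sym k (PathChord I) →ₐ[k] Sym k (PathChord I) ⊗[k] Sym k (PathChord I) :=
  symLift (chordCoprodOn k)

/-- `Δ` of the class of a rooted tree: the sum over its simple cuts. -/
noncomputable def rtreeCoprodOn (T : RootedTree Λ) :
    Sym k (RTreeClass Λ) ⊗[k] Sym k (RTreeClass Λ) :=
  gen (RTreeClass.mk T) ⊗ₜ[k] 1 + ∑ H ∈ T.simpleCuts,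
    ((∏ e : {e // e ∈ H}, gen (RTreeClass.mk (T.branch (H : Set T.Edge) e.1 e.2))) ⊗ₜ[k]
      gen (RTreeClass.mk (T.trunk (H : Set T.Edge))))

/-- The Connes-Kreimer coproduct on decorated rooted trees, computed on a representative of each
isomorphism class. -/
noncomputable def rtreeCoprod :
    Sym k (RTreeClass Λ) →ₐ[k] Sym k (RTreeClass Λ) ⊗[k] Sym k (RTreeClass Λ) :=
  symLift (fun t => rtreeCoprodOn k (Quot.out t))

/-! ## The maps `S_*`, `D_*` and `η_*` -/

/-- `S_rt` of a path: the sum of all chord diagrams on this path. -/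
noncomputable def sRtOn (X : QPath I) : PathChord I →₀ k := ∑ H : X.Cut, bas k (X.withCut H)

/-- The map `S_rt : P → Ch_rt`. -/
noncomputable def sRt : (QPath I →₀ k) →ₗ[k] (PathChord I →₀ k) :=
  Finsupp.linearCombination k (sRtOn k)

/-- `S_or` of `[X]`: the sum of all chord diagrams `([X], H)`, one for each cut `H` of `X`. -/
noncomputable def sOrOn (X : ClosedPath I) : NecklaceChord I →₀ k :=
  ∑ H : X.1.Cut, bas k (NecklaceChord.mk (X.withCut H))

/-- The map `S_or : L → Ch_or`, computed on a representative of each necklace. -/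
noncomputable def sOr : (Necklace I →₀ k) →ₗ[k] (NecklaceChord I →₀ k) :=
  Finsupp.linearCombination k (fun N => sOrOn k (Quot.out N))

/-- `D_rt` of a path chord diagram with cut `H`: the dual tree times `ε_H`. -/
noncomputable def dRtOn (D : PathChord I) : RTreeClass (QPath I) →₀ k :=
  D.eps Finset.univ • bas k (RTreeClass.mk D.dualRooted)

/-- The map `D_rt : Ch_rt → T_rt(Φ_rt)`. -/
noncomputable def dRt : (PathChord I →₀ k) →ₗ[k] (RTreeClass (QPath I) →₀ k) :=
  Finsupp.linearCombination k (dRtOn k)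

/-- `D_or` of a necklace chord diagram: the dual oriented tree. -/
noncomputable def dOrOn (D : ClosedChord I) : OTreeClass (Necklace I) →₀ k :=
  bas k (OTreeClass.mk D.dualOriented)

/-- The map `D_or : Ch_or → T_or(Φ_or)`, computed on a representative of each necklace chord
diagram. -/
noncomputable def dOr : (NecklaceChord I →₀ k) →ₗ[k] (OTreeClass (Necklace I) →₀ k) :=
  Finsupp.linearCombination k (fun N => dOrOn k (Quot.out N))

/-- `η_rt` of a path: the sum of `ε_H (T_H, s_H)` over all cuts. -/
noncomputable def etaRt : (QPath I →₀ k) →ₗ[k] (RTreeClass (QPath I) →₀ k) :=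
  Finsupp.linearCombination k (fun X => ∑ H : X.Cut,
    (X.withCut H).eps Finset.univ • bas k (RTreeClass.mk (X.withCut H).dualRooted))

/-- `η_or` of `[X]`: the sum of `(T_{H,or}, s_{H,or})` over all cuts. -/
noncomputable def etaOrOn (X : ClosedPath I) : OTreeClass (Necklace I) →₀ k :=
  ∑ H : X.1.Cut, bas k (OTreeClass.mk (X.withCut H).dualOriented)

/-- The map `η_or`, computed on a representative of each necklace. -/
noncomputable def etaOr : (Necklace I →₀ k) →ₗ[k] (OTreeClass (Necklace I) →₀ k) :=
  Finsupp.linearCombination k (fun N => etaOrOn k (Quot.out N))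

end Coalgebras

end ChordAlg

namespace ChordAlg

universe u v w w'

/-! ## Counting positions and subwords -/

section Counting

open Classical in
/-- The number of `x < n` with `p x`. -/
noncomputable def cnt (p : ℕ → Prop) (n : ℕ) : ℕ := Nat.count p n

variable {p q : ℕ → Prop} {x y n r : ℕ}

theorem cnt_zero : cnt p 0 = 0 := by simp [cnt]

theorem cnt_succ_of (h : p x) : cnt p (x + 1) = cnt p x + 1 := by
  classical
  simp [cnt, Nat.count_succ, h]

theorem cnt_succ_of_not (h : ¬ p x) : cnt p (x + 1) = cnt p x := by
  classical
  simp [cnt, Nat.count_succ, h]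

theorem cnt_mono (h : x ≤ y) : cnt p x ≤ cnt p y := by
  classical
  exact Nat.count_monotone p h

theorem cnt_lt_cnt (hx : p x) (h : x < y) : cnt p x < cnt p y := by
  classical
  exact Nat.count_strict_mono hx h

theorem cnt_lt_iff (hx : p x) : cnt p x < cnt p y ↔ x < y := by
  refine ⟨fun h => ?_, cnt_lt_cnt hx⟩
  by_contra hc
  have := cnt_mono (p := p) (not_lt.1 hc)
  omega

theorem cnt_le_iff (hy : p y) : cnt p x ≤ cnt p y ↔ x ≤ y := by
  have := cnt_lt_iff (p := p) (x := y) (y := x) hy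
  omega

theorem cnt_inj (hx : p x) (hy : p y) (h : cnt p x = cnt p y) : x = y := by
  have h1 := cnt_lt_iff (y := y) hx
  have h2 := cnt_lt_iff (y := x) hy
  omega

theorem exists_of_lt_cnt (h : r < cnt p n) : ∃ x < n, p x ∧ cnt p x = r := by
  induction n with
  | zero => simp [cnt_zero] at h
  | succ n ih =>
    by_cases hp : p n
    · rw [cnt_succ_of hp] at h
      rcases Nat.lt_succ_iff_lt_or_eq.1 h with h | h
      · obtain ⟨x, hx, h⟩ := ih h
        exact ⟨x, by omega, h⟩
      · exact ⟨n, by omega, hp, h.symm⟩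
    · rw [cnt_succ_of_not hp] at h
      obtain ⟨x, hx, h⟩ := ih h
      exact ⟨x, by omega, h⟩

theorem cnt_cnt : cnt q (cnt p x) = cnt (fun x => p x ∧ q (cnt p x)) x := by
  induction x with
  | zero => simp [cnt_zero]
  | succ x ih =>
    by_cases hp : p x
    · by_cases hq : q (cnt p x)
      · have h : (fun x => p x ∧ q (cnt p x)) x := ⟨hp, hq⟩
        rw [cnt_succ_of hp, cnt_succ_of hq, cnt_succ_of h, ih]
      · have h : ¬ (fun x => p x ∧ q (cnt p x)) x := fun h => hq h.2
        rw [cnt_succ_of hp, cnt_succ_of_not hq, cnt_succ_of_not h, ih]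
    · have h : ¬ (fun x => p x ∧ q (cnt p x)) x := fun h => hp h.1
      rw [cnt_succ_of_not hp, cnt_succ_of_not h, ih]

theorem cnt_eq_of_not_mem (hxy : x ≤ y) (h : ∀ z, x ≤ z → z < y → ¬ p z) :
    cnt p x = cnt p y := by
  induction y, hxy using Nat.le_induction with
  | base => rfl
  | succ y hy ih =>
    rw [cnt_succ_of_not (h y hy (by omega)), ih (fun z hz hzy => h z hz (by omega))]

theorem cnt_shift (h0 : ¬ p 0) (h : ∀ z < x, p (z + 1) ↔ q z) : cnt p (x + 1) = cnt q x := by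
  induction x with
  | zero => rw [cnt_succ_of_not h0, cnt_zero, cnt_zero]
  | succ x ih =>
    have ih := ih (fun z hz => h z (by omega))
    by_cases hp : p (x + 1)
    · rw [cnt_succ_of hp, cnt_succ_of ((h x (by omega)).1 hp), ih]
    · rw [cnt_succ_of_not hp, cnt_succ_of_not (fun hq => hp ((h x (by omega)).2 hq)), ih]

theorem cnt_shift_of (h0 : p 0) (h : ∀ z < x, p (z + 1) ↔ q z) :
    cnt p (x + 1) = cnt q x + 1 := by
  induction x with
  | zero => rw [cnt_succ_of h0, cnt_zero, cnt_zero]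
  | succ x ih =>
    have ih := ih (fun z hz => h z (by omega))
    by_cases hp : p (x + 1)
    · rw [cnt_succ_of hp, cnt_succ_of ((h x (by omega)).1 hp), ih]
    · rw [cnt_succ_of_not hp, cnt_succ_of_not (fun hq => hp ((h x (by omega)).2 hq)), ih]

end Counting

/-- `w` is the subword of `a` at the positions with `p`. -/
structure IsSubword {A : Type*} (a : List A) (p : ℕ → Prop) (w : List A) : Prop where
  length : w.length = cnt p a.length
  get : ∀ x < a.length, p x → w[cnt p x]? = a[x]?

theorem IsSubword.unique {A : Type*} {a : List A} {p : ℕ → Prop} {w w' : List A}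
    (h : IsSubword a p w) (h' : IsSubword a p w') : w = w' := by
  apply List.ext_getElem?
  intro r
  by_cases hr : r < cnt p a.length
  · obtain ⟨x, hx, hp, rfl⟩ := exists_of_lt_cnt hr
    rw [h.get x hx hp, h'.get x hx hp]
  · rw [List.getElem?_eq_none (by rw [h.length]; omega),
      List.getElem?_eq_none (by rw [h'.length]; omega)]

theorem IsSubword.trans {A : Type*} {a : List A} {p q : ℕ → Prop} {w v : List A}
    (h : IsSubword a p w) (h' : IsSubword w q v) :
    IsSubword a (fun x => p x ∧ q (cnt p x)) v where
  length := by rw [h'.length, h.length, cnt_cnt]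
  get x hx hpq := by
    rw [← cnt_cnt, h'.get _ (by rw [h.length]; exact cnt_lt_cnt hpq.1 hx) hpq.2,
      h.get x hx hpq.1]

/-! ## Faces as subwords -/

section Faces

theorem IsCut.tri {I : Type u} [Quiver.{v} I] {a : List (DArrow I)} {G : Finset (ℕ × ℕ)}
    (hG : IsCut a G) {c d : ℕ × ℕ} (hc : c ∈ G) (hd : d ∈ G) (hne : c ≠ d) :
    c.2 < d.1 ∨ d.2 < c.1 ∨ (c.1 < d.1 ∧ d.2 < c.2) ∨ (d.1 < c.1 ∧ c.2 < d.2) := by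
  have h1 := (hG.pair c hc).1
  have h2 := (hG.pair d hd).1
  have h3 := hG.distinct c hc d hd hne
  have h4 := hG.noncrossing c hc d hd
  have h5 := hG.noncrossing d hd c hc
  omega

theorem IsCut.lt {I : Type u} [Quiver.{v} I] {a : List (DArrow I)} {G : Finset (ℕ × ℕ)}
    (hG : IsCut a G) {c : ℕ × ℕ} (hc : c ∈ G) : c.1 < c.2 ∧ c.2 < a.length :=
  ⟨(hG.pair c hc).1, (hG.pair c hc).lt_length⟩

theorem IsCut.mono {I : Type u} [Quiver.{v} I] {a : List (DArrow I)} {G H : Finset (ℕ × ℕ)}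
    (hG : IsCut a G) (h : H ⊆ G) : IsCut a H :=
  ⟨fun c hc => hG.pair c (h hc), fun c hc d hd => hG.distinct c (h hc) d (h hd),
    fun c hc d hd => hG.noncrossing c (h hc) d (h hd)⟩

theorem IsCut.eq_of_fst {I : Type u} [Quiver.{v} I] {a : List (DArrow I)} {G : Finset (ℕ × ℕ)}
    (hG : IsCut a G) {c d : ℕ × ℕ} (hc : c ∈ G) (hd : d ∈ G) (h : c.1 = d.1) : c = d := by
  by_contra hne
  have := hG.tri hc hd hne
  have := hG.lt hc
  have := hG.lt hd
  omega

theorem faceRank_eq_cnt {n : ℕ} {H : Finset (ℕ × ℕ)} {f : Option (ℕ × ℕ)} {x : ℕ}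
    (hx : x ≤ hi n f) : faceRank n H f x = cnt (OnFace n H f) x := by
  induction x with
  | zero => simp [faceRank, visibleBefore, cnt_zero]
  | succ x ih =>
    have ih := ih (by omega)
    by_cases hlo : lo f ≤ x
    · have h1 : visibleBefore n H f (x + 1) = visibleBefore n H f x ++
          [x].filter (fun z => Visible n H f z) := by
        unfold visibleBefore
        rw [show x + 1 - lo f = (x - lo f) + 1 by omega, List.range'_concat, List.filter_append,
          show lo f + 1 * (x - lo f) = x by omega]
      unfold faceRank at ih ⊢
      rw [h1, List.length_append, ih]
      by_cases hv : Visible n H f x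
      · rw [cnt_succ_of (show OnFace n H f x from ⟨hlo, by omega, hv⟩)]
        simp [hv]
      · rw [cnt_succ_of_not (fun h : OnFace n H f x => hv h.2.2)]
        simp [hv]
    · rw [cnt_succ_of_not (fun h : OnFace n H f x => hlo h.1), ← ih]
      unfold faceRank visibleBefore
      rw [show x + 1 - lo f = 0 by omega, show x - lo f = 0 by omega]

theorem OnFace.rank_eq {n : ℕ} {H : Finset (ℕ × ℕ)} {f : Option (ℕ × ℕ)} {x : ℕ}
    (h : OnFace n H f x) : faceRank n H f x = cnt (OnFace n H f) x :=
  faceRank_eq_cnt h.2.1.le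

theorem isSubword_faceWord {I : Type u} [Quiver.{v} I] {a : List (DArrow I)}
    {G H : Finset (ℕ × ℕ)} (hG : IsCut a G) {f : Option (ℕ × ℕ)} (hf : IsFaceOf G f) :
    IsSubword a (OnFace a.length H f) (faceWord a H f) where
  length := by
    obtain ⟨-, hle⟩ := hi_le hG hf
    have h1 : ∀ l : List ℕ, (∀ z ∈ l, z < a.length) →
        (l.filterMap (fun z => a[z]?)).length = l.length := by
      intro l
      induction l with
      | nil => simp
      | cons b l ih =>
        intro hl
        rw [List.filterMap_cons_some (List.getElem?_eq_getElem (hl b List.mem_cons_self)),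
          List.length_cons, List.length_cons, ih (fun z hz => hl z (List.mem_cons_of_mem _ hz))]
    have h2 : (faceWord a H f).length = faceRank a.length H f (hi a.length f) := by
      apply h1
      intro z hz
      have := List.mem_range'_1.1 (List.mem_of_mem_filter hz)
      omega
    rw [h2, faceRank_eq_cnt le_rfl]
    exact cnt_eq_of_not_mem hle (fun z hz _ hon => by have := hon.2.1; omega)
  get x _ hx := by
    rw [← hx.rank_eq]
    exact getElem?_faceWord hG hf hx

/-- The renumbering of a chord on a face. -/
noncomputable def rk (n : ℕ) (H : Finset (ℕ × ℕ)) (f : Option (ℕ × ℕ)) (d : ℕ × ℕ) : ℕ × ℕ :=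
  (cnt (OnFace n H f) d.1, cnt (OnFace n H f) d.2)

/-- The chords of `G` with both ends on the face `f` of `H`. -/
def onCut (n : ℕ) (G H : Finset (ℕ × ℕ)) (f : Option (ℕ × ℕ)) : Finset (ℕ × ℕ) :=
  G.filter (fun d => OnFace n H f d.1 ∧ OnFace n H f d.2)

theorem mem_onCut {n : ℕ} {G H : Finset (ℕ × ℕ)} {f : Option (ℕ × ℕ)} {d : ℕ × ℕ} :
    d ∈ onCut n G H f ↔ d ∈ G ∧ OnFace n H f d.1 ∧ OnFace n H f d.2 := Finset.mem_filter

theorem faceCut_eq_image (n : ℕ) (G H : Finset (ℕ × ℕ)) (f : Option (ℕ × ℕ)) :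
    faceCut n G H f = (onCut n G H f).image (rk n H f) := by
  unfold faceCut onCut
  apply Finset.image_congr
  intro d hd
  simp only [Finset.coe_filter, Set.mem_ofPred_eq] at hd
  simp only [rk, hd.2.1.rank_eq, hd.2.2.rank_eq]

theorem rk_inj {n : ℕ} {G H : Finset (ℕ × ℕ)} {f : Option (ℕ × ℕ)} {c d : ℕ × ℕ}
    (hc : c ∈ onCut n G H f) (hd : d ∈ onCut n G H f) (h : rk n H f c = rk n H f d) : c = d := by
  rw [mem_onCut] at hc hd
  exact Prod.ext (cnt_inj hc.2.1 hd.2.1 (congrArg Prod.fst h))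
    (cnt_inj hc.2.2 hd.2.2 (congrArg Prod.snd h))

theorem onFace_image_rk {I : Type u} [Quiver.{v} I] {a : List (DArrow I)}
    {G H K : Finset (ℕ × ℕ)} (hG : IsCut a G) {f g : Option (ℕ × ℕ)}
    (hf : IsFaceOf G f) (hK : K ⊆ onCut a.length G H f)
    (hg : IsFaceOf (onCut a.length G H f) g) (x : ℕ) :
    (OnFace a.length H f x ∧
      OnFace (faceWord a H f).length (K.image (rk a.length H f)) (g.map (rk a.length H f))
        (cnt (OnFace a.length H f) x)) ↔ OnFace a.length (H ∪ K) (g.or f) x := by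
  have hw := isSubword_faceWord (H := H) hG hf
  set n := a.length with hn
  set P := OnFace n H f with hP
  have hle := (hi_le hG hf).2
  -- inside of a chord on the face
  have hin : ∀ {c y}, c ∈ onCut n G H f → P y →
      ((cnt P c.1 < cnt P y ↔ c.1 < y) ∧ (cnt P y < cnt P c.2 ↔ y < c.2) ∧
        (cnt P c.1 ≤ cnt P y ↔ c.1 ≤ y) ∧ (cnt P y ≤ cnt P c.2 ↔ y ≤ c.2)) := by
    intro c y hc hy
    rw [mem_onCut] at hc
    exact ⟨cnt_lt_iff hc.2.1, cnt_lt_iff hy, cnt_le_iff hy, cnt_le_iff hc.2.2⟩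
  have hbel : ∀ {c}, c ∈ onCut n G H f → lo f ≤ c.1 ∧ c.2 < hi n f := by
    intro c hc
    rw [mem_onCut] at hc
    exact ⟨hc.2.1.1, hc.2.2.2.1⟩
  cases g with
  | none =>
    simp only [Option.map_none, Option.none_or]
    constructor
    · rintro ⟨h1, -, -, h3⟩
      refine ⟨h1.1, h1.2.1, ?_⟩
      intro d hd hb hcon
      rcases Finset.mem_union.1 hd with hd | hd
      · exact h1.2.2 d hd hb hcon
      · obtain ⟨-, -, k1, k2⟩ := hin (hK hd) h1
        refine h3 _ (Finset.mem_image_of_mem _ hd) ⟨by simp [lo], ?_⟩ ⟨k1.2 hcon.1, k2.2 hcon.2⟩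
        simp only [hi, hw.length]
        have := mem_onCut.1 (hK hd)
        exact cnt_lt_cnt this.2.2 (hG.lt this.1).2
    · rintro ⟨h1, h2, h3⟩
      have hx : P x := ⟨h1, h2, fun d hd => h3 d (Finset.mem_union_left _ hd)⟩
      refine ⟨hx, by simp [lo], ?_, ?_⟩
      · simp only [hi, hw.length]
        exact cnt_lt_cnt hx (lt_of_lt_of_le h2 hle)
      · intro d hd hb hcon
        obtain ⟨c, hc, rfl⟩ := Finset.mem_image.1 hd
        obtain ⟨-, -, k1, k2⟩ := hin (hK hc) hx
        exact h3 c (Finset.mem_union_right _ hc) (hbel (hK hc)) ⟨k1.1 hcon.1, k2.1 hcon.2⟩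
  | some c =>
    have hc := hg c rfl
    have hc' := mem_onCut.1 hc
    simp only [Option.map_some, Option.some_or]
    constructor
    · rintro ⟨h1, h2, h2', h3⟩
      obtain ⟨k1, k2, -, -⟩ := hin hc h1
      refine ⟨k1.1 h2, k2.1 h2', ?_⟩
      intro d hd hb hcon
      rcases Finset.mem_union.1 hd with hd | hd
      · refine h1.2.2 d hd ?_ hcon
        have := hbel hc
        unfold Below at hb ⊢
        simp only [lo, hi] at hb
        omega
      · obtain ⟨-, -, k1, k2⟩ := hin (hK hd) h1
        refine h3 _ (Finset.mem_image_of_mem _ hd) ⟨?_, ?_⟩ ⟨k1.2 hcon.1, k2.2 hcon.2⟩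
        · exact ((hin hc (mem_onCut.1 (hK hd)).2.1).1).2 hb.1
        · exact ((hin hc (mem_onCut.1 (hK hd)).2.2).2.1).2 hb.2
    · rintro ⟨h1, h2, h3⟩
      simp only [lo, hi] at h1 h2
      have hx : P x := by
        have hb := hbel hc
        refine ⟨by omega, by omega, ?_⟩
        intro d hd hbd hcon
        refine h3 d (Finset.mem_union_left _ hd) ?_ hcon
        have e1 := hc'.2.1.2.2 d hd hbd
        have e2 := hc'.2.2.2.2 d hd hbd
        simp only [Below, lo, hi]
        omega
      obtain ⟨k1, k2, -, -⟩ := hin hc hx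
      refine ⟨hx, k1.2 h1, k2.2 h2, ?_⟩
      intro d hd hb hcon
      obtain ⟨e, he, rfl⟩ := Finset.mem_image.1 hd
      obtain ⟨-, -, k3, k4⟩ := hin (hK he) hx
      refine h3 e (Finset.mem_union_right _ he) ⟨?_, ?_⟩ ⟨k3.1 hcon.1, k4.1 hcon.2⟩
      · exact ((hin hc (mem_onCut.1 (hK he)).2.1).1).1 hb.1
      · exact ((hin hc (mem_onCut.1 (hK he)).2.2).2.1).1 hb.2

end Faces

/-! ## Pieces of chord diagrams -/

section Pieces

variable {I : Type u} [Quiver.{v} I]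

open Classical in
/-- The piece of `D` which belongs to the face `f` of the subcut `H`; this is `D` itself for
unsuitable `H` and `f`. -/
noncomputable def PathChord.piece (D : PathChord I) (H : Finset (ℕ × ℕ)) (f : Option (ℕ × ℕ)) :
    PathChord I :=
  if h : H ⊆ D.cut ∧ IsFaceOf D.cut f then
    { path :=
        { src := vertexAt D.path.src D.path.arrows (lo f)
          tgt := vertexAt D.path.src D.path.arrows (hi D.path.arrows.length f)
          arrows := faceWord D.path.arrows H f
          isPath := isPath_faceWord D.path.isPath D.isCut h.1 h.2 }
      cut := faceCut D.path.arrows.length D.cut H f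
      isCut := isCut_face D.isCut h.2 }
  else D

theorem PathChord.face_eq_piece (D : PathChord I) (H : Finset D.Chord) (f : Option D.Chord) :
    D.face H f = D.piece (D.rawCut H) (D.rawFace f) := by
  rw [PathChord.piece, dif_pos ⟨D.rawCut_subset H, D.rawFace_isFaceOf f⟩]
  rfl

variable {D : PathChord I} {H : Finset (ℕ × ℕ)} {f : Option (ℕ × ℕ)}

theorem PathChord.piece_path_src (hH : H ⊆ D.cut) (hf : IsFaceOf D.cut f) :
    (D.piece H f).path.src = vertexAt D.path.src D.path.arrows (lo f) := by
  rw [PathChord.piece, dif_pos ⟨hH, hf⟩]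

theorem PathChord.piece_path_tgt (hH : H ⊆ D.cut) (hf : IsFaceOf D.cut f) :
    (D.piece H f).path.tgt =
      vertexAt D.path.src D.path.arrows (hi D.path.arrows.length f) := by
  rw [PathChord.piece, dif_pos ⟨hH, hf⟩]

theorem PathChord.piece_arrows (hH : H ⊆ D.cut) (hf : IsFaceOf D.cut f) :
    (D.piece H f).path.arrows = faceWord D.path.arrows H f := by
  rw [PathChord.piece, dif_pos ⟨hH, hf⟩]

/-- The chords of `D` on the face `f` of `H`. -/
def PathChord.on (D : PathChord I) (H : Finset (ℕ × ℕ)) (f : Option (ℕ × ℕ)) :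
    Finset (ℕ × ℕ) := onCut D.path.arrows.length D.cut H f

/-- The renumbering of these chords. -/
noncomputable def PathChord.rk (D : PathChord I) (H : Finset (ℕ × ℕ)) (f : Option (ℕ × ℕ)) :
    ℕ × ℕ → ℕ × ℕ := ChordAlg.rk D.path.arrows.length H f

theorem PathChord.piece_cut (hH : H ⊆ D.cut) (hf : IsFaceOf D.cut f) :
    (D.piece H f).cut = (D.on H f).image (D.rk H f) := by
  rw [PathChord.piece, dif_pos ⟨hH, hf⟩]
  exact faceCut_eq_image _ _ _ _

theorem PathChord.piece_isSubword (hH : H ⊆ D.cut) (hf : IsFaceOf D.cut f) :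
    IsSubword D.path.arrows (OnFace D.path.arrows.length H f) (D.piece H f).path.arrows := by
  rw [PathChord.piece_arrows hH hf]
  exact isSubword_faceWord D.isCut hf

theorem PathChord.on_subset : D.on H f ⊆ D.cut := Finset.filter_subset _ _

theorem vertexAt_zero (x : I) (a : List (DArrow I)) : vertexAt x a 0 = x := by
  cases a <;> rfl

theorem PathChord.piece_piece (hH : H ⊆ D.cut) (hf : IsFaceOf D.cut f)
    {K : Finset (ℕ × ℕ)} (hK : K ⊆ D.on H f) {g : Option (ℕ × ℕ)}
    (hg : IsFaceOf (D.on H f) g) :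
    (D.piece H f).piece (K.image (D.rk H f)) (g.map (D.rk H f)) = D.piece (H ∪ K) (g.or f) := by
  have hHK : H ∪ K ⊆ D.cut := Finset.union_subset hH (hK.trans PathChord.on_subset)
  have hgf : IsFaceOf D.cut (g.or f) := by
    intro c hc
    cases g with
    | none => exact hf c (by simpa using hc)
    | some d =>
      simp only [Option.some_or, Option.some.injEq] at hc
      exact hc ▸ PathChord.on_subset (hg d rfl)
  have hK' : K.image (D.rk H f) ⊆ (D.piece H f).cut := by
    rw [PathChord.piece_cut hH hf]
    exact Finset.image_subset_image hK
  have hg' : IsFaceOf (D.piece H f).cut (g.map (D.rk H f)) := by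
    intro c hc
    cases g with
    | none => simp at hc
    | some d =>
      simp only [Option.map_some, Option.some.injEq] at hc
      rw [PathChord.piece_cut hH hf, ← hc]
      exact Finset.mem_image_of_mem _ (hg d rfl)
  have hsub := PathChord.piece_isSubword hH hf
  have key := onFace_image_rk D.isCut hf hK hg
  rw [← PathChord.piece_arrows hH hf] at key
  change ∀ x, (OnFace D.path.arrows.length H f x ∧ OnFace (D.piece H f).path.arrows.length
    (K.image (D.rk H f)) (g.map (D.rk H f)) (cnt (OnFace D.path.arrows.length H f) x)) ↔ _ at key
  have keyf := funext fun x => propext (key x)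
  have hsub2 := hsub.trans (PathChord.piece_isSubword hK' hg')
  have hget : ∀ {c : ℕ × ℕ}, c ∈ D.on H f →
      (D.piece H f).path.arrows[(D.rk H f c).1]? = D.path.arrows[c.1]? ∧
      (D.piece H f).path.arrows[(D.rk H f c).2]? = D.path.arrows[c.2]? := by
    intro c hc
    have hc' := mem_onCut.1 hc
    have := D.isCut.lt hc'.1
    exact ⟨hsub.get _ (by omega) hc'.2.1, hsub.get _ (by omega) hc'.2.2⟩
  apply PathChord.ext
  · apply QPath.ext
    · rw [PathChord.piece_path_src hK' hg', PathChord.piece_path_src hHK hgf]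
      cases g with
      | none =>
        simp only [Option.map_none, Option.none_or, lo]
        rw [vertexAt_zero, PathChord.piece_path_src hH hf]
        cases f <;> rfl
      | some c =>
        have hc := hg c rfl
        obtain ⟨-, b, h1, h2⟩ := D.isCut.pair c (PathChord.on_subset hc)
        simp only [Option.map_some, Option.some_or, lo]
        rw [(vertexAt_arrow (D.piece H f).path.isPath ((hget hc).1.trans h1)).2,
          (vertexAt_arrow D.path.isPath h1).2]
    · rw [PathChord.piece_path_tgt hK' hg', PathChord.piece_path_tgt hHK hgf]
      cases g with
      | none =>
        simp only [Option.map_none, Option.none_or, hi]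
        rw [vertexAt_length (D.piece H f).path.isPath, PathChord.piece_path_tgt hH hf]
        cases f <;> rfl
      | some c =>
        have hc := hg c rfl
        obtain ⟨-, b, h1, h2⟩ := D.isCut.pair c (PathChord.on_subset hc)
        simp only [Option.map_some, Option.some_or, hi]
        rw [(vertexAt_arrow (D.piece H f).path.isPath ((hget hc).2.trans h2)).1,
          (vertexAt_arrow D.path.isPath h2).1]
    · rw [keyf] at hsub2
      exact hsub2.unique (PathChord.piece_isSubword hHK hgf)
  · rw [PathChord.piece_cut hK' hg', PathChord.piece_cut hHK hgf]
    have hrk : ∀ c, (D.piece H f).rk (K.image (D.rk H f))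
        (g.map (D.rk H f)) (D.rk H f c) = D.rk (H ∪ K) (g.or f) c := by
      intro c
      simp only [PathChord.rk, ChordAlg.rk] at keyf ⊢
      rw [cnt_cnt, cnt_cnt, keyf]
    ext e
    constructor
    · intro he
      obtain ⟨d, hd, rfl⟩ := Finset.mem_image.1 he
      rw [PathChord.on, mem_onCut, PathChord.piece_cut hH hf] at hd
      obtain ⟨hd0, hd1, hd2⟩ := hd
      obtain ⟨c, hc, rfl⟩ := Finset.mem_image.1 hd0
      have hc' := mem_onCut.1 hc
      rw [hrk]
      refine Finset.mem_image_of_mem _ (mem_onCut.2 ⟨hc'.1, ?_, ?_⟩)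
      · exact (key _).1 ⟨hc'.2.1, hd1⟩
      · exact (key _).1 ⟨hc'.2.2, hd2⟩
    · intro he
      obtain ⟨c, hc, rfl⟩ := Finset.mem_image.1 he
      rw [PathChord.on, mem_onCut, ← key, ← key] at hc
      rw [← hrk]
      refine Finset.mem_image_of_mem _ (mem_onCut.2 ⟨?_, hc.2.1.2, hc.2.2.2⟩)
      rw [PathChord.piece_cut hH hf]
      exact Finset.mem_image_of_mem _ (mem_onCut.2 ⟨hc.1, hc.2.1.1, hc.2.2.1⟩)

end Pieces

section PieceLemmas

variable {I : Type u} [Quiver.{v} I] {D : PathChord I} {H : Finset (ℕ × ℕ)}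
  {f : Option (ℕ × ℕ)}

theorem PathChord.mem_on (hH : H ⊆ D.cut) {d : ℕ × ℕ} :
    d ∈ D.on H f ↔ d ∈ D.cut ∧ Below D.path.arrows.length f d ∧
      ∀ h ∈ H, Below D.path.arrows.length f h → ¬ (h.1 ≤ d.1 ∧ d.2 ≤ h.2) := by
  rw [PathChord.on, mem_onCut]
  constructor
  · rintro ⟨h0, h1, h2⟩
    refine ⟨h0, ⟨h1.1, h2.2.1⟩, ?_⟩
    intro h hh hb hcon
    have := D.isCut.lt h0
    exact h1.2.2 h hh hb (by omega)
  · rintro ⟨h0, h1, h2⟩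
    have hd := D.isCut.lt h0
    have key : ∀ h ∈ H, Below D.path.arrows.length f h →
        ¬ (h.1 ≤ d.1 ∧ d.1 ≤ h.2) ∧ ¬ (h.1 ≤ d.2 ∧ d.2 ≤ h.2) := by
      intro h hh hb
      have h3 := h2 h hh hb
      have hne : h ≠ d := by
        rintro rfl
        exact h3 (by omega)
      have := D.isCut.tri (hH hh) h0 hne
      have := D.isCut.lt (hH hh)
      omega
    have h11 := h1.1
    have h12 := h1.2
    exact ⟨h0, ⟨h11, by omega, fun h hh hb => (key h hh hb).1⟩,
      ⟨by omega, h12, fun h hh hb => (key h hh hb).2⟩⟩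

theorem PathChord.piece_congr {H' : Finset (ℕ × ℕ)} (hH : H ⊆ D.cut) (hH' : H' ⊆ D.cut)
    (h : ∀ x, OnFace D.path.arrows.length H f x ↔ OnFace D.path.arrows.length H' f x) :
    D.piece H f = D.piece H' f := by
  by_cases hf : IsFaceOf D.cut f
  · have he : OnFace D.path.arrows.length H f = OnFace D.path.arrows.length H' f :=
      funext fun x => propext (h x)
    apply PathChord.ext
    · apply QPath.ext
      · rw [PathChord.piece_path_src hH hf, PathChord.piece_path_src hH' hf]
      · rw [PathChord.piece_path_tgt hH hf, PathChord.piece_path_tgt hH' hf]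
      · have h1 := PathChord.piece_isSubword hH hf
        rw [he] at h1
        exact h1.unique (PathChord.piece_isSubword hH' hf)
    · rw [PathChord.piece_cut hH hf, PathChord.piece_cut hH' hf]
      have h1 : D.on H f = D.on H' f := by
        ext d
        simp only [PathChord.on, mem_onCut, he]
      have h2 : D.rk H f = D.rk H' f := by
        funext d
        simp only [PathChord.rk, ChordAlg.rk, he]
      rw [h1, h2]
  · rw [PathChord.piece, PathChord.piece, dif_neg (fun h => hf h.2), dif_neg (fun h => hf h.2)]

theorem PathChord.piece_congr_cover {H' : Finset (ℕ × ℕ)} (hH : H ⊆ D.cut) (hH' : H' ⊆ D.cut)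
    (h : ∀ c ∈ H, Below D.path.arrows.length f c →
      ∃ d ∈ H', Below D.path.arrows.length f d ∧ d.1 ≤ c.1 ∧ c.2 ≤ d.2)
    (h' : ∀ c ∈ H', Below D.path.arrows.length f c →
      ∃ d ∈ H, Below D.path.arrows.length f d ∧ d.1 ≤ c.1 ∧ c.2 ≤ d.2) :
    D.piece H f = D.piece H' f := by
  refine PathChord.piece_congr hH hH' fun x => ?_
  constructor
  · rintro ⟨h1, h2, h3⟩
    refine ⟨h1, h2, ?_⟩
    intro c hc hb hcon
    obtain ⟨d, hd, hb', k1, k2⟩ := h' c hc hb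
    exact h3 d hd hb' (by omega)
  · rintro ⟨h1, h2, h3⟩
    refine ⟨h1, h2, ?_⟩
    intro c hc hb hcon
    obtain ⟨d, hd, hb', k1, k2⟩ := h c hc hb
    exact h3 d hd hb' (by omega)

theorem PathChord.omegaAt_rk (hH : H ⊆ D.cut) (hf : IsFaceOf D.cut f) {c : ℕ × ℕ}
    (hc : c ∈ D.on H f) :
    omegaAt (D.piece H f).path.arrows (D.rk H f c) = omegaAt D.path.arrows c := by
  have hc' := mem_onCut.1 hc
  have hlt := D.isCut.lt hc'.1
  have h1 := (PathChord.piece_isSubword hH hf).get c.1 (by omega) hc'.2.1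
  have h2 := (PathChord.piece_isSubword hH hf).get c.2 (by omega) hc'.2.2
  unfold omegaAt
  simp only [PathChord.rk, ChordAlg.rk]
  rw [h1, h2]

theorem PathChord.sum_piece_cut {M : Type*} [AddCommMonoid M] (hH : H ⊆ D.cut)
    (hf : IsFaceOf D.cut f) (F : ℕ × ℕ → M) :
    ∑ c ∈ (D.piece H f).cut, F c = ∑ c ∈ D.on H f, F (D.rk H f c) := by
  rw [PathChord.piece_cut hH hf]
  refine Finset.sum_image fun c hc d hd h => ?_
  exact rk_inj (G := D.cut) hc hd h

theorem PathChord.piece_piece_singleton (hH : H ⊆ D.cut) (hf : IsFaceOf D.cut f) {c : ℕ × ℕ}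
    (hc : c ∈ D.on H f) :
    (D.piece H f).piece {D.rk H f c} (some (D.rk H f c)) = D.piece (insert c H) (some c) ∧
      (D.piece H f).piece {D.rk H f c} none = D.piece (insert c H) f := by
  have h1 := PathChord.piece_piece hH hf (K := {c}) (by simpa using hc) (g := some c)
    (by rintro d hd; rwa [← Option.some.inj hd])
  have h2 := PathChord.piece_piece hH hf (K := {c}) (by simpa using hc) (g := none)
    (by rintro d hd; simp at hd)
  rw [Finset.union_comm, ← Finset.insert_eq] at h1 h2
  simpa using ⟨h1, h2⟩

theorem PathChord.rawCut_singleton (c : D.Chord) : D.rawCut {c} = {c.1} := by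
  simp [PathChord.rawCut]

theorem PathChord.inner_eq_piece (c : D.Chord) : D.inner c = D.piece {c.1} (some c.1) := by
  rw [PathChord.inner, PathChord.face_eq_piece, PathChord.rawCut_singleton]
  rfl

theorem PathChord.outer_eq_piece (c : D.Chord) : D.outer c = D.piece {c.1} none := by
  rw [PathChord.outer, PathChord.face_eq_piece, PathChord.rawCut_singleton]
  rfl

theorem isFaceOf_none {G : Finset (ℕ × ℕ)} : IsFaceOf G none := by
  intro c hc
  simp at hc

theorem isFaceOf_some {G : Finset (ℕ × ℕ)} {c : ℕ × ℕ} : IsFaceOf G (some c) ↔ c ∈ G := by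
  simp [IsFaceOf]

end PieceLemmas

section PreLie

variable {k : Type w} [CommRing k] {I : Type u} [Quiver.{v} I]

/-- The sign of a chord. -/
noncomputable def PathChord.sgn (D : PathChord I) (c : ℕ × ℕ) : ℤ := -omegaAt D.path.arrows c

theorem chordComulOn_eq (D : PathChord I) :
    chordComulOn k D = ∑ c ∈ D.cut, D.sgn c •
      (bas k (D.piece {c} (some c)) ⊗ₜ[k] bas k (D.piece {c} none)) := by
  refine Eq.trans ?_ (Finset.sum_coe_sort D.cut (fun c => D.sgn c •
      (bas k (D.piece {c} (some c)) ⊗ₜ[k] bas k (D.piece {c} none))))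
  refine Finset.sum_congr rfl fun c _ => ?_
  rw [D.inner_eq_piece, D.outer_eq_piece]
  rfl

theorem chordComul_bas (D : PathChord I) : chordComul k (bas k D) = chordComulOn k D := by
  simp [chordComul]

theorem PathChord.sgn_rk {D : PathChord I} {H : Finset (ℕ × ℕ)} {f : Option (ℕ × ℕ)}
    (hH : H ⊆ D.cut) (hf : IsFaceOf D.cut f) {c : ℕ × ℕ} (hc : c ∈ D.on H f) :
    (D.piece H f).sgn (D.rk H f c) = D.sgn c := by
  rw [PathChord.sgn, PathChord.omegaAt_rk hH hf hc, PathChord.sgn]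

/-- A comultiplication which is given on the images `b D` of the chord diagrams by the formula for
`δ_{p,rt}`. -/
def IsChordComul {M : Type*} [AddCommGroup M] [Module k M] (b : PathChord I → M)
    (δ : M →ₗ[k] M ⊗[k] M) : Prop :=
  ∀ D, δ (b D) = ∑ c ∈ D.cut, (D.sgn c : k) • (b (D.piece {c} (some c)) ⊗ₜ[k] b (D.piece {c} none))

theorem chordComul_isChordComul : IsChordComul (k := k) (I := I) (bas k) (chordComul k) :=
  fun D => by
    rw [chordComul_bas, chordComulOn_eq]
    exact Finset.sum_congr rfl fun c _ => (Int.cast_smul_eq_zsmul k _ _).symm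

variable {M : Type*} [AddCommGroup M] [Module k M] {b : PathChord I → M} {δ : M →ₗ[k] M ⊗[k] M}

theorem IsChordComul.piece (hδ : IsChordComul b δ) {D : PathChord I} {H : Finset (ℕ × ℕ)}
    {f : Option (ℕ × ℕ)} (hH : H ⊆ D.cut) (hf : IsFaceOf D.cut f) :
    δ (b (D.piece H f)) = ∑ c ∈ D.on H f, (D.sgn c : k) •
      (b (D.piece (insert c H) (some c)) ⊗ₜ[k] b (D.piece (insert c H) f)) := by
  rw [hδ, PathChord.sum_piece_cut hH hf]
  refine Finset.sum_congr rfl fun c hc => ?_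
  rw [PathChord.sgn_rk hH hf hc, (PathChord.piece_piece_singleton hH hf hc).1,
    (PathChord.piece_piece_singleton hH hf hc).2]

theorem IsChordComul.preLie (hδ : IsChordComul b δ) (D : PathChord I) :
    ((LinearMap.id - (TensorProduct.comm k M M).toLinearMap.rTensor M) ∘ₗ
    (δ.rTensor M ∘ₗ δ -
      (TensorProduct.assoc k M M M).symm.toLinearMap ∘ₗ δ.lTensor M ∘ₗ δ)) (b D) = 0 := by
  rw [LinearMap.comp_apply]
  let T : ℕ × ℕ → ℕ × ℕ → (M ⊗[k] M) ⊗[k] M :=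
    fun c d => ((D.sgn c : k) * (D.sgn d : k)) • ((b (D.piece {c, d} (some c)) ⊗ₜ[k]
      b (D.piece {c, d} (some d))) ⊗ₜ[k] b (D.piece {c, d} none))
  have hsub1 : ∀ {c}, c ∈ D.cut → {c} ⊆ D.cut := fun hc => by simpa using hc
  have hsub2 : ∀ {c d}, c ∈ D.cut → d ∈ D.cut → {c, d} ⊆ D.cut := by
    intro c d hc hd x hx
    simp only [Finset.mem_insert, Finset.mem_singleton] at hx
    rcases hx with rfl | rfl <;> assumption
  have hA : (δ.rTensor M) (δ (b D)) =
      ∑ c ∈ D.cut, ∑ d ∈ D.cut, if d.1 < c.1 ∧ c.2 < d.2 then T c d else 0 := by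
    rw [Finset.sum_comm, hδ, map_sum]
    refine Finset.sum_congr rfl fun c hc => ?_
    rw [map_smul, LinearMap.rTensor_tmul,
      hδ.piece (hsub1 hc) (isFaceOf_some.2 hc), TensorProduct.sum_tmul, Finset.smul_sum,
      ← Finset.sum_filter]
    refine Finset.sum_congr ?_ ?_
    · ext d
      rw [PathChord.mem_on (hsub1 hc), Finset.mem_filter]
      simp only [Below, lo, hi, Finset.mem_singleton, forall_eq]
      constructor
      · rintro ⟨h0, h1, -⟩
        exact ⟨h0, by omega⟩
      · rintro ⟨h0, h1⟩
        exact ⟨h0, by omega, by omega⟩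
    · intro d hd
      rw [Finset.mem_filter] at hd
      have h1 : D.piece {c} none = D.piece {d, c} none := by
        refine PathChord.piece_congr_cover (hsub1 hc) (hsub2 hd.1 hc) ?_ ?_
        · intro e he hb
          exact ⟨e, Finset.mem_insert_of_mem he, hb, le_rfl, le_rfl⟩
        · intro e he hb
          have hlt := D.isCut.lt hc
          refine ⟨c, Finset.mem_singleton_self _, ⟨by simp [lo], hlt.2⟩, ?_⟩
          simp only [Finset.mem_insert, Finset.mem_singleton] at he
          rcases he with rfl | rfl
          · omega
          · exact ⟨le_rfl, le_rfl⟩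
      simp only [T]
      rw [h1, ← TensorProduct.smul_tmul', smul_smul, mul_comm]
  have hB : (TensorProduct.assoc k _ _ _).symm
      ((δ.lTensor M) (δ (b D))) =
      ∑ c ∈ D.cut, ∑ d ∈ D.cut, if d ≠ c ∧ ¬ (c.1 < d.1 ∧ d.2 < c.2) then T c d else 0 := by
    rw [hδ, map_sum, map_sum]
    refine Finset.sum_congr rfl fun c hc => ?_
    rw [map_smul, map_smul, LinearMap.lTensor_tmul,
      hδ.piece (hsub1 hc) isFaceOf_none, TensorProduct.tmul_sum, map_sum, Finset.smul_sum,
      ← Finset.sum_filter]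
    refine Finset.sum_congr ?_ ?_
    · ext d
      rw [PathChord.mem_on (hsub1 hc), Finset.mem_filter]
      simp only [Below, lo, hi, Finset.mem_singleton, forall_eq]
      have hltc := D.isCut.lt hc
      constructor
      · rintro ⟨h0, h1, h2⟩
        refine ⟨h0, ?_, ?_⟩
        · rintro rfl
          exact h2 (by omega) (by omega)
        · intro h3
          exact h2 (by omega) (by omega)
      · rintro ⟨h0, h1, h2⟩
        have := D.isCut.tri hc h0 (Ne.symm h1)
        have := D.isCut.lt h0
        exact ⟨h0, by omega, fun _ => by omega⟩
    · intro d hd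
      rw [Finset.mem_filter] at hd
      have h1 : D.piece {c} (some c) = D.piece {c, d} (some c) := by
        refine PathChord.piece_congr_cover (hsub1 hc) (hsub2 hc hd.1) ?_ ?_
        · intro e he hb
          exact ⟨e, by simp at he; simp [he], hb, le_rfl, le_rfl⟩
        · intro e he hb
          simp only [Below, lo, hi] at hb
          simp only [Finset.mem_insert, Finset.mem_singleton] at he
          rcases he with rfl | rfl
          · omega
          · exact absurd (by omega) hd.2.2
      simp only [T]
      rw [h1, Finset.pair_comm c d, TensorProduct.tmul_smul, map_smul,
        TensorProduct.assoc_symm_tmul, smul_smul]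
  have hAB : (δ.rTensor M ∘ₗ δ -
      (TensorProduct.assoc k _ _ _).symm.toLinearMap ∘ₗ
        δ.lTensor M ∘ₗ δ) (b D) =
      - ∑ c ∈ D.cut, ∑ d ∈ D.cut, if c.2 < d.1 ∨ d.2 < c.1 then T c d else 0 := by
    simp only [LinearMap.sub_apply, LinearMap.coe_comp, Function.comp_apply,
      LinearEquiv.coe_coe]
    rw [hA, hB, ← Finset.sum_sub_distrib, ← Finset.sum_neg_distrib]
    refine Finset.sum_congr rfl fun c hc => ?_
    rw [← Finset.sum_sub_distrib, ← Finset.sum_neg_distrib]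
    refine Finset.sum_congr rfl fun d hd => ?_
    have hltc := D.isCut.lt hc
    have hltd := D.isCut.lt hd
    by_cases hdc : d = c
    · subst hdc
      rw [if_neg (by omega), if_neg (by simp), if_neg (by omega)]
      simp
    · have := D.isCut.tri hc hd (Ne.symm hdc)
      by_cases h1 : d.1 < c.1 ∧ c.2 < d.2
      · rw [if_pos h1, if_pos ⟨hdc, by omega⟩, if_neg (by omega)]
        simp
      · by_cases h2 : c.2 < d.1 ∨ d.2 < c.1
        · rw [if_neg h1, if_pos ⟨hdc, by omega⟩, if_pos h2]
          simp
        · rw [if_neg h1, if_neg (by simp only [not_and]; omega), if_neg h2]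
          simp
  rw [hAB]
  rw [map_neg, neg_eq_zero, LinearMap.sub_apply, LinearMap.id_apply, sub_eq_zero]
  conv_lhs => rw [Finset.sum_comm]
  simp only [map_sum]
  refine Finset.sum_congr rfl fun c hc => Finset.sum_congr rfl fun d hd => ?_
  by_cases h : c.2 < d.1 ∨ d.2 < c.1
  · rw [if_pos h, if_pos (by omega)]
    simp only [T, map_smul, LinearMap.rTensor_tmul, LinearEquiv.coe_coe, TensorProduct.comm_tmul]
    rw [Finset.pair_comm c d, mul_comm]
  · rw [if_neg h, if_neg (by omega), map_zero]

theorem chordComul_isPreLie : IsPreLieComul (chordComul k (I := I)) := by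
  unfold IsPreLieComul
  apply Finsupp.lhom_ext'
  intro D
  apply LinearMap.ext_ring
  exact chordComul_isChordComul.preLie D

end PreLie

section LieFromPreLie

variable {k : Type w} [CommRing k] {M : Type*} [AddCommGroup M] [Module k M]
  {N : Type*} [AddCommGroup N] [Module k N]

theorem cyclicPerm_tmul (x y z : M) :
    cyclicPerm (k := k) ((x ⊗ₜ[k] y) ⊗ₜ[k] z) = (z ⊗ₜ[k] x) ⊗ₜ[k] y := by
  simp [cyclicPerm]

/-- The antisymmetrization of a pre-Lie comultiplication satisfies the co-Jacobi identity. -/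
theorem IsPreLieComul.coJacobi {δ : M →ₗ[k] M ⊗[k] M} (h : IsPreLieComul δ)
    {δ' : M →ₗ[k] M ⊗[k] M}
    (hδ' : δ' = (LinearMap.id - (TensorProduct.comm k M M).toLinearMap) ∘ₗ δ) :
    (LinearMap.id + cyclicPerm + cyclicPerm ∘ₗ cyclicPerm) ∘ₗ δ'.rTensor M ∘ₗ δ' = 0 := by
  have h1 : (LinearMap.id + cyclicPerm + cyclicPerm ∘ₗ cyclicPerm : (M ⊗[k] M) ⊗[k] M →ₗ[k] _) ∘ₗ
      (LinearMap.id - (TensorProduct.comm k M M).toLinearMap).rTensor M ∘ₗ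
      (TensorProduct.comm k M (M ⊗[k] M)).toLinearMap ∘ₗ
      (TensorProduct.assoc k M M M).toLinearMap =
      (LinearMap.id + cyclicPerm + cyclicPerm ∘ₗ cyclicPerm) ∘ₗ
      (LinearMap.id - (TensorProduct.comm k M M).toLinearMap).rTensor M := by
    apply TensorProduct.ext_threefold
    intro x y z
    simp only [LinearMap.comp_apply, LinearMap.add_apply, LinearMap.id_apply, LinearEquiv.coe_coe,
      TensorProduct.assoc_tmul, TensorProduct.comm_tmul, LinearMap.rTensor_tmul,
      LinearMap.sub_apply, TensorProduct.sub_tmul, map_sub, cyclicPerm_tmul]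
    abel
  have h2 : δ'.rTensor M ∘ₗ δ' = (LinearMap.id - (TensorProduct.comm k M M).toLinearMap).rTensor M ∘ₗ
      (δ.rTensor M ∘ₗ δ - (TensorProduct.comm k M (M ⊗[k] M)).toLinearMap ∘ₗ
        (TensorProduct.assoc k M M M).toLinearMap ∘ₗ
        (TensorProduct.assoc k M M M).symm.toLinearMap ∘ₗ δ.lTensor M ∘ₗ δ) := by
    have h3 : δ.rTensor M ∘ₗ (TensorProduct.comm k M M).toLinearMap =
        (TensorProduct.comm k M (M ⊗[k] M)).toLinearMap ∘ₗ δ.lTensor M := by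
      apply TensorProduct.ext'
      intro x y
      simp
    apply LinearMap.ext
    intro x
    have h4 := LinearMap.congr_fun h3 (δ x)
    simp only [LinearMap.comp_apply, LinearEquiv.coe_coe] at h4
    simp only [LinearMap.comp_apply, LinearMap.sub_apply, LinearEquiv.coe_coe,
      LinearEquiv.apply_symm_apply]
    rw [← h4, ← map_sub, hδ', LinearMap.rTensor_comp_apply, LinearMap.comp_apply,
      LinearMap.sub_apply, LinearMap.id_apply]
    rfl
  rw [h2]
  have h5 : (LinearMap.id + cyclicPerm + cyclicPerm ∘ₗ cyclicPerm : (M ⊗[k] M) ⊗[k] M →ₗ[k] _) ∘ₗ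
      (LinearMap.id - (TensorProduct.comm k M M).toLinearMap).rTensor M ∘ₗ
      (δ.rTensor M ∘ₗ δ - (TensorProduct.comm k M (M ⊗[k] M)).toLinearMap ∘ₗ
        (TensorProduct.assoc k M M M).toLinearMap ∘ₗ
        (TensorProduct.assoc k M M M).symm.toLinearMap ∘ₗ δ.lTensor M ∘ₗ δ) =
      (LinearMap.id + cyclicPerm + cyclicPerm ∘ₗ cyclicPerm) ∘ₗ
      ((LinearMap.id - (TensorProduct.comm k M M).toLinearMap.rTensor M) ∘ₗ
        (δ.rTensor M ∘ₗ δ -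
        (TensorProduct.assoc k M M M).symm.toLinearMap ∘ₗ δ.lTensor M ∘ₗ δ)) := by
    have h6 : (LinearMap.id - (TensorProduct.comm k M M).toLinearMap).rTensor M =
        LinearMap.id - (TensorProduct.comm k M M).toLinearMap.rTensor M := by
      rw [LinearMap.rTensor_sub, LinearMap.rTensor_id]
    rw [← h6, LinearMap.comp_sub, LinearMap.comp_sub, LinearMap.comp_sub, LinearMap.comp_sub]
    congr 1
    apply LinearMap.ext
    intro x
    exact LinearMap.congr_fun h1 _
  rw [h5]
  unfold IsPreLieComul at h
  rw [h, LinearMap.comp_zero]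

/-- A quotient of the antisymmetrization of a pre-Lie comultiplication is a Lie cobracket. -/
theorem IsPreLieComul.isLieCobracket {δ : M →ₗ[k] M ⊗[k] M} (h : IsPreLieComul δ)
    {π : M →ₗ[k] N} (hπ : Function.Surjective π) {δN : N →ₗ[k] N ⊗[k] N}
    (hδ : δN ∘ₗ π = TensorProduct.map π π ∘ₗ
      (LinearMap.id - (TensorProduct.comm k M M).toLinearMap) ∘ₗ δ) : IsLieCobracket δN where
  skew x := by
    obtain ⟨m, rfl⟩ := hπ x
    refine ⟨TensorProduct.map π π (δ m), ?_⟩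
    have h1 : (LinearMap.id - (TensorProduct.comm k N N).toLinearMap) ∘ₗ TensorProduct.map π π =
        TensorProduct.map π π ∘ₗ (LinearMap.id - (TensorProduct.comm k M M).toLinearMap) := by
      apply TensorProduct.ext'
      intro x y
      simp
    exact (LinearMap.congr_fun h1 (δ m)).trans (LinearMap.congr_fun hδ m).symm
  coJacobi := by
    set δ' := (LinearMap.id - (TensorProduct.comm k M M).toLinearMap) ∘ₗ δ with hδ'
    have h1 := h.coJacobi hδ'
    apply LinearMap.ext
    intro x
    obtain ⟨m, rfl⟩ := hπ x
    have h2 : δN.rTensor N ∘ₗ TensorProduct.map π π =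
        TensorProduct.map (TensorProduct.map π π) π ∘ₗ δ'.rTensor M := by
      apply TensorProduct.ext'
      intro x y
      simp only [LinearMap.comp_apply, TensorProduct.map_tmul, LinearMap.rTensor_tmul]
      rw [← LinearMap.comp_apply δN π, hδ, LinearMap.comp_apply]
    have h3 : (cyclicPerm : (N ⊗[k] N) ⊗[k] N →ₗ[k] _) ∘ₗ
        TensorProduct.map (TensorProduct.map π π) π =
        TensorProduct.map (TensorProduct.map π π) π ∘ₗ cyclicPerm := by
      apply TensorProduct.ext_threefold
      intro x y z
      simp [cyclicPerm_tmul]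
    have h3' := fun t => LinearMap.congr_fun h3 t
    simp only [LinearMap.comp_apply] at h3'
    have h4 : δN.rTensor N (δN (π m)) =
        TensorProduct.map (TensorProduct.map π π) π (δ'.rTensor M (δ' m)) := by
      rw [← LinearMap.comp_apply δN π, hδ, LinearMap.comp_apply]
      exact LinearMap.congr_fun h2 _
    have h5 := LinearMap.congr_fun h1 m
    simp only [LinearMap.comp_apply, LinearMap.add_apply, LinearMap.id_apply,
      LinearMap.zero_apply] at h5 ⊢
    rw [h4, h3', h3', ← map_add, ← map_add, h5, map_zero]

end LieFromPreLie

section Filtration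

variable {k : Type w} [CommRing k] {B : Type w'}

theorem symLift_gen {A : Type*} [CommRing A] [Algebra k A] (f : B → A) (b : B) :
    symLift (k := k) f (gen b) = f b := by
  simp [symLift, gen, SymmetricAlgebra.lift_ι_apply]

theorem sym_algHom_ext {A : Type*} [CommRing A] [Algebra k A] {F G : Sym k B →ₐ[k] A}
    (h : ∀ b, F (gen b) = G (gen b)) : F = G := by
  apply SymmetricAlgebra.algHom_ext
  apply Finsupp.lhom_ext'
  intro b
  apply LinearMap.ext_ring
  exact h b

theorem symCounit_gen (b : B) : symCounit (k := k) (gen b) = 0 := symLift_gen _ _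

theorem augProj_one : augProj (1 : Sym k B) = 0 := by
  simp [augProj]

theorem augProj_gen (b : B) : augProj (gen b : Sym k B) = gen b := by
  simp [augProj, symCounit_gen]

variable (k) in
/-- The span of the monomials of weight at most `n`. -/
noncomputable def symFil (wt : B → ℕ) (n : ℕ) : Submodule k (Sym k B) :=
  Submodule.span k {x | ∃ s : Multiset B, (s.map wt).sum ≤ n ∧ x = (s.map gen).prod}

variable (k) in
/-- The induced filtration of the tensor square. -/
noncomputable def symFil₂ (wt : B → ℕ) (n : ℕ) : Submodule k (Sym k B ⊗[k] Sym k B) :=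
  Submodule.span k {t | ∃ i j x y, i + j ≤ n ∧ x ∈ symFil k wt i ∧ y ∈ symFil k wt j ∧
    t = x ⊗ₜ[k] y}

variable {wt : B → ℕ}

theorem symFil_mono {m n : ℕ} (h : m ≤ n) : symFil k wt m ≤ symFil k wt n := by
  apply Submodule.span_mono
  rintro x ⟨s, hs, rfl⟩
  exact ⟨s, hs.trans h, rfl⟩

theorem symFil₂_mono {m n : ℕ} (h : m ≤ n) : symFil₂ k wt m ≤ symFil₂ k wt n := by
  apply Submodule.span_mono
  rintro x ⟨i, j, x, y, hij, hx, hy, rfl⟩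
  exact ⟨i, j, x, y, hij.trans h, hx, hy, rfl⟩

theorem one_mem_symFil (n : ℕ) : (1 : Sym k B) ∈ symFil k wt n :=
  Submodule.subset_span ⟨0, by simp, by simp⟩

theorem gen_mem_symFil (b : B) : (gen b : Sym k B) ∈ symFil k wt (wt b) :=
  Submodule.subset_span ⟨{b}, by simp, by simp⟩

theorem tmul_mem_symFil₂ {i j n : ℕ} {x y : Sym k B} (hx : x ∈ symFil k wt i)
    (hy : y ∈ symFil k wt j) (h : i + j ≤ n) : x ⊗ₜ[k] y ∈ symFil₂ k wt n :=
  Submodule.subset_span ⟨i, j, x, y, h, hx, hy, rfl⟩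

theorem mul_mem_symFil {i j : ℕ} {x y : Sym k B} (hx : x ∈ symFil k wt i)
    (hy : y ∈ symFil k wt j) : x * y ∈ symFil k wt (i + j) := by
  induction hx using Submodule.span_induction with
  | mem x hx =>
    obtain ⟨s, hs, rfl⟩ := hx
    induction hy using Submodule.span_induction with
    | mem y hy =>
      obtain ⟨t, ht, rfl⟩ := hy
      refine Submodule.subset_span ⟨s + t, ?_, ?_⟩
      · rw [Multiset.map_add, Multiset.sum_add]
        omega
      · rw [Multiset.map_add, Multiset.prod_add]
    | zero => rw [mul_zero]; exact zero_mem _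
    | add y z _ _ hy hz => rw [mul_add]; exact add_mem hy hz
    | smul a y _ hy => rw [mul_smul_comm]; exact Submodule.smul_mem _ _ hy
  | zero => rw [zero_mul]; exact zero_mem _
  | add y z _ _ hy hz => rw [add_mul]; exact add_mem hy hz
  | smul a y _ hy => rw [smul_mul_assoc]; exact Submodule.smul_mem _ _ hy

theorem mul_mem_symFil₂ {i j : ℕ} {x y : Sym k B ⊗[k] Sym k B} (hx : x ∈ symFil₂ k wt i)
    (hy : y ∈ symFil₂ k wt j) : x * y ∈ symFil₂ k wt (i + j) := by
  induction hx using Submodule.span_induction with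
  | mem x hx =>
    obtain ⟨a, b, x, x', hs, h1, h2, rfl⟩ := hx
    induction hy using Submodule.span_induction with
    | mem y hy =>
      obtain ⟨c, d, y, y', ht, h3, h4, rfl⟩ := hy
      rw [Algebra.TensorProduct.tmul_mul_tmul]
      exact tmul_mem_symFil₂ (mul_mem_symFil h1 h3) (mul_mem_symFil h2 h4) (by omega)
    | zero => rw [mul_zero]; exact zero_mem _
    | add y z _ _ hy hz => rw [mul_add]; exact add_mem hy hz
    | smul a y _ hy => rw [mul_smul_comm]; exact Submodule.smul_mem _ _ hy
  | zero => rw [zero_mul]; exact zero_mem _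
  | add y z _ _ hy hz => rw [add_mul]; exact add_mem hy hz
  | smul a y _ hy => rw [smul_mul_assoc]; exact Submodule.smul_mem _ _ hy

theorem prod_mem_symFil {ι : Type*} (s : Finset ι) (g : ι → B) :
    (∏ i ∈ s, gen (g i) : Sym k B) ∈ symFil k wt (∑ i ∈ s, wt (g i)) := by
  classical
  induction s using Finset.induction_on with
  | empty => simpa using one_mem_symFil 0
  | insert a s ha ih =>
    rw [Finset.prod_insert ha, Finset.sum_insert ha]
    exact mul_mem_symFil (gen_mem_symFil _) ih

theorem exists_mem_symFil (wt : B → ℕ) (x : Sym k B) : ∃ n, x ∈ symFil k wt n := by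
  induction x using SymmetricAlgebra.induction with
  | algebraMap r =>
    refine ⟨0, ?_⟩
    rw [Algebra.algebraMap_eq_smul_one]
    exact Submodule.smul_mem _ _ (one_mem_symFil 0)
  | ι x =>
    induction x using Finsupp.induction_linear with
    | zero => exact ⟨0, by rw [map_zero]; exact zero_mem _⟩
    | add x y hx hy =>
      obtain ⟨m, hm⟩ := hx
      obtain ⟨n, hn⟩ := hy
      refine ⟨max m n, ?_⟩
      rw [map_add]
      exact add_mem (symFil_mono (le_max_left _ _) hm) (symFil_mono (le_max_right _ _) hn)
    | single b r =>
      refine ⟨wt b, ?_⟩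
      rw [← mul_one r, ← smul_eq_mul, ← Finsupp.smul_single, map_smul]
      exact Submodule.smul_mem _ _ (gen_mem_symFil b)
  | mul x y hx hy =>
    obtain ⟨m, hm⟩ := hx
    obtain ⟨n, hn⟩ := hy
    exact ⟨_, mul_mem_symFil hm hn⟩
  | add x y hx hy =>
    obtain ⟨m, hm⟩ := hx
    obtain ⟨n, hn⟩ := hy
    exact ⟨max m n,
      add_mem (symFil_mono (le_max_left _ _) hm) (symFil_mono (le_max_right _ _) hn)⟩

theorem augProj_eq_zero (hwt : ∀ b, 1 ≤ wt b) {x : Sym k B} (hx : x ∈ symFil k wt 0) :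
    augProj x = 0 := by
  induction hx using Submodule.span_induction with
  | mem x hx =>
    obtain ⟨s, hs, rfl⟩ := hx
    have : s = 0 := by
      rw [Multiset.eq_zero_iff_forall_notMem]
      intro b hb
      have h1 := Multiset.single_le_sum (fun x _ => Nat.zero_le x) _ (Multiset.mem_map_of_mem wt hb)
      have := hwt b
      omega
    subst this
    simp [augProj_one]
  | zero => rw [map_zero]
  | add y z _ _ hy hz => rw [map_add, hy, hz, add_zero]
  | smul a y _ hy => rw [map_smul, hy, smul_zero]

variable {Δ : Sym k B →ₐ[k] Sym k B ⊗[k] Sym k B}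

theorem comul_mem_symFil₂ (hΔ : ∀ b, Δ (gen b) ∈ symFil₂ k wt (wt b)) {n : ℕ} {x : Sym k B}
    (hx : x ∈ symFil k wt n) : Δ x ∈ symFil₂ k wt n := by
  induction hx using Submodule.span_induction with
  | mem x hx =>
    obtain ⟨s, hs, rfl⟩ := hx
    refine symFil₂_mono hs ?_
    clear hs
    induction s using Multiset.induction_on with
    | empty =>
      rw [Multiset.map_zero, Multiset.map_zero, Multiset.prod_zero, map_one]
      exact tmul_mem_symFil₂ (one_mem_symFil 0) (one_mem_symFil 0) (by simp)
    | cons b s ih =>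
      rw [Multiset.map_cons, Multiset.map_cons, Multiset.sum_cons, Multiset.prod_cons, map_mul]
      exact mul_mem_symFil₂ (hΔ b) ih
  | zero => rw [map_zero]; exact zero_mem _
  | add y z _ _ hy hz => rw [map_add]; exact add_mem hy hz
  | smul a y _ hy => rw [map_smul]; exact Submodule.smul_mem _ _ hy

theorem mulReducedPow_succ_apply (n : ℕ) (x : Sym k B) : mulReducedPow Δ (n + 1) x =
    LinearMap.mul' k (Sym k B)
      (TensorProduct.map (mulReducedPow Δ n ∘ₗ augProj) augProj (Δ x)) := by
  have : (mulReducedPow Δ n).rTensor (Sym k B) ∘ₗ TensorProduct.map augProj augProj =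
      TensorProduct.map (mulReducedPow Δ n ∘ₗ augProj) augProj := by
    apply TensorProduct.ext'
    intro x y
    simp
  rw [← this]
  rfl

theorem mulReducedPow_augProj_succ (n : ℕ) (x : Sym k B) :
    mulReducedPow Δ (n + 1) (augProj x) = mulReducedPow Δ (n + 1) x := by
  have h1 : mulReducedPow Δ (n + 1) 1 = 0 := by
    rw [mulReducedPow_succ_apply, map_one, Algebra.TensorProduct.one_def, TensorProduct.map_tmul,
      augProj_one, TensorProduct.tmul_zero, map_zero]
  have h2 : augProj x = x - symCounit x • 1 := by
    simp [augProj, Algebra.algebraMap_eq_smul_one]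
  rw [h2, map_sub, map_smul, h1, smul_zero, sub_zero]

theorem mulReducedPow_augProj_eq_zero (hwt : ∀ b, 1 ≤ wt b)
    (hΔ : ∀ b, Δ (gen b) ∈ symFil₂ k wt (wt b)) {n m : ℕ} (h : n ≤ m) {x : Sym k B}
    (hx : x ∈ symFil k wt n) : mulReducedPow Δ m (augProj x) = 0 := by
  induction m generalizing n x with
  | zero =>
    obtain rfl : n = 0 := by omega
    rw [augProj_eq_zero hwt hx, map_zero]
  | succ m ih =>
    rw [mulReducedPow_augProj_succ, mulReducedPow_succ_apply]
    have hx' := comul_mem_symFil₂ hΔ hx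
    generalize Δ x = t at hx'
    induction hx' using Submodule.span_induction with
    | mem t ht =>
      obtain ⟨i, j, u, v, hij, hu, hv, rfl⟩ := ht
      rw [TensorProduct.map_tmul]
      by_cases hj : j = 0
      · subst hj
        rw [augProj_eq_zero hwt hv, TensorProduct.tmul_zero, map_zero]
      · rw [LinearMap.comp_apply, ih (by omega) hu, TensorProduct.zero_tmul, map_zero]
    | zero => rw [map_zero, map_zero]
    | add y z _ _ hy hz => rw [map_add, map_add, hy, hz, add_zero]
    | smul a y _ hy => rw [map_smul, map_smul, hy, smul_zero]

theorem mulReducedPow_gen_eq_zero (hwt : ∀ b, 1 ≤ wt b)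
    (hΔ : ∀ b, Δ (gen b) ∈ symFil₂ k wt (wt b)) {b : B} {m : ℕ} (h : wt b ≤ m) :
    mulReducedPow Δ m (gen b) = 0 := by
  rw [← augProj_gen]
  exact mulReducedPow_augProj_eq_zero hwt hΔ h (gen_mem_symFil b)

theorem finsum_one_le {M : Type*} [AddCommMonoid M] (f : ℕ → M) {N : ℕ}
    (h : ∀ n, N ≤ n → f n = 0) :
    ∑ᶠ (n : ℕ) (_ : 1 ≤ n), f n = ∑ n ∈ Finset.range N, if 1 ≤ n then f n else 0 := by
  have h1 : ∀ n, ∑ᶠ (_ : 1 ≤ n), f n = if 1 ≤ n then f n else 0 := fun n => finsum_eq_if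
  simp_rw [h1]
  apply finsum_eq_sum_of_support_subset
  intro n hn
  rw [Function.mem_support] at hn
  rw [Finset.coe_range, Set.mem_Iio]
  by_contra hc
  exact hn (by rw [h n (by omega), ite_self])

/-- The antipode on a basis element as a finite sum. -/
theorem symAntipode_gen {b : B} {N : ℕ} (h : ∀ n, N ≤ n → mulReducedPow Δ n (gen b) = 0) :
    symAntipode Δ (gen b) = -gen b + ∑ n ∈ Finset.range N,
      if 1 ≤ n then (-1 : k) ^ (n + 1) • mulReducedPow Δ n (gen b) else 0 := by
  rw [symAntipode, symLift_gen, finsum_one_le]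
  intro n hn
  rw [h n hn, smul_zero]

end Filtration

section Antipode

variable {k : Type w} [CommRing k]

/-- A convolution inverse of the identity of a bialgebra, obtained as a geometric series which is
finite on each step of a filtration. -/
theorem exists_convolution_inverse {A : Type*} [CommRing A] [Bialgebra k A]
    (F : ℕ → Submodule k A) (hF : Monotone F) (hex : ∀ x, ∃ n, x ∈ F n)
    (hcomul : ∀ n x, x ∈ F n → Coalgebra.comul (R := k) x ∈
      Submodule.span k {t : A ⊗[k] A | ∃ u ∈ F n, ∃ v ∈ F n, t = u ⊗ₜ[k] v})
    (j : WithConv (A →ₗ[k] A)) (hj : WithConv.toConv LinearMap.id = 1 + j)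
    (hnil : ∀ n x, x ∈ F n → ∀ m, n < m → (j ^ m).ofConv x = 0) :
    ∃ S : A →ₗ[k] A,
      (∀ n x, x ∈ F n → S x = ∑ i ∈ Finset.range (n + 1), (-1 : k) ^ i • (j ^ i).ofConv x) ∧
      WithConv.toConv S * WithConv.toConv LinearMap.id = 1 ∧
      WithConv.toConv LinearMap.id * WithConv.toConv S = 1 := by
  let s : ℕ → WithConv (A →ₗ[k] A) := fun n => ∑ i ∈ Finset.range (n + 1), (-j) ^ i
  have hs : ∀ n x, (s n).ofConv x = ∑ i ∈ Finset.range (n + 1), (-1 : k) ^ i • (j ^ i).ofConv x := by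
    intro n x
    simp only [s]
    rw [WithConv.ofConv_sum, LinearMap.sum_apply]
    refine Finset.sum_congr rfl fun i _ => ?_
    have : (-j) ^ i = (-1 : k) ^ i • j ^ i := by
      rcases Nat.even_or_odd i with h | h
      · rw [h.neg_pow, h.neg_one_pow, one_smul]
      · rw [h.neg_pow, h.neg_one_pow, neg_smul, one_smul]
    rw [this]
    rfl
  have hstab : ∀ m n x, x ∈ F n → n ≤ m → (s m).ofConv x = (s n).ofConv x := by
    intro m n x hx hnm
    induction m, hnm using Nat.le_induction with
    | base => rfl
    | succ m hm ih =>
      rw [← ih, hs, hs, Finset.sum_range_succ, hnil n x hx (m + 1) (by omega), smul_zero, add_zero]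
  choose N hN using hex
  have hval : ∀ n x, x ∈ F n → (s (N x)).ofConv x = (s n).ofConv x := by
    intro n x hx
    rw [← hstab (max n (N x)) (N x) x (hN x) (le_max_right _ _),
      hstab (max n (N x)) n x hx (le_max_left _ _)]
  let S : A →ₗ[k] A :=
    { toFun := fun x => (s (N x)).ofConv x
      map_add' := by
        intro x y
        have h1 := hF (le_max_left (N x) (N y)) (hN x)
        have h2 := hF (le_max_right (N x) (N y)) (hN y)
        rw [hval _ _ (add_mem h1 h2), hval _ _ h1, hval _ _ h2, map_add]
      map_smul' := by
        intro a x
        rw [hval _ _ (Submodule.smul_mem _ a (hN x)), map_smul]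
        rfl }
  have hS : ∀ n x, x ∈ F n → S x = (s n).ofConv x := hval
  have hgeom : ∀ n, s n * WithConv.toConv LinearMap.id = 1 - (-j) ^ (n + 1) := by
    intro n
    rw [hj, show (1 : WithConv (A →ₗ[k] A)) + j = 1 - (-j) by abel]
    exact geom_sum_mul_neg _ _
  have hgeom' : ∀ n, WithConv.toConv LinearMap.id * s n = 1 - (-j) ^ (n + 1) := by
    intro n
    rw [hj, show (1 : WithConv (A →ₗ[k] A)) + j = 1 - (-j) by abel]
    exact mul_neg_geom_sum _ _
  have hone : ∀ n x, x ∈ F n → (1 - (-j) ^ (n + 1)).ofConv x =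
      (1 : WithConv (A →ₗ[k] A)).ofConv x := by
    intro n x hx
    have : (-j) ^ (n + 1) = (-1 : k) ^ (n + 1) • j ^ (n + 1) := by
      rcases Nat.even_or_odd (n + 1) with h | h
      · rw [h.neg_pow, h.neg_one_pow, one_smul]
      · rw [h.neg_pow, h.neg_one_pow, neg_smul, one_smul]
    rw [this]
    change (1 : WithConv (A →ₗ[k] A)).ofConv x - (-1 : k) ^ (n + 1) • (j ^ (n + 1)).ofConv x = _
    rw [hnil n x hx (n + 1) (by omega), smul_zero, sub_zero]
  refine ⟨S, fun n x hx => (hS n x hx).trans (hs n x), ?_, ?_⟩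
  · apply WithConv.ofConv_injective
    apply LinearMap.ext
    intro x
    rw [← hone _ _ (hN x), ← hgeom]
    change LinearMap.mul' k A (TensorProduct.map S LinearMap.id (Coalgebra.comul x)) =
      LinearMap.mul' k A (TensorProduct.map (s (N x)).ofConv LinearMap.id (Coalgebra.comul x))
    have h := hcomul _ _ (hN x)
    generalize Coalgebra.comul (R := k) x = t at h
    congr 1
    induction h using Submodule.span_induction with
    | mem t ht =>
      obtain ⟨u, hu, v, hv, rfl⟩ := ht
      rw [TensorProduct.map_tmul, TensorProduct.map_tmul, hS _ _ hu]
    | zero => rw [map_zero, map_zero]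
    | add y z _ _ hy hz => rw [map_add, map_add, hy, hz]
    | smul a y _ hy => rw [map_smul, map_smul, hy]
  · apply WithConv.ofConv_injective
    apply LinearMap.ext
    intro x
    rw [← hone _ _ (hN x), ← hgeom']
    change LinearMap.mul' k A (TensorProduct.map LinearMap.id S (Coalgebra.comul x)) =
      LinearMap.mul' k A (TensorProduct.map LinearMap.id (s (N x)).ofConv (Coalgebra.comul x))
    have h := hcomul _ _ (hN x)
    generalize Coalgebra.comul (R := k) x = t at h
    congr 1
    induction h using Submodule.span_induction with
    | mem t ht =>
      obtain ⟨u, hu, v, hv, rfl⟩ := ht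
      rw [TensorProduct.map_tmul, TensorProduct.map_tmul, hS _ _ hv]
    | zero => rw [map_zero, map_zero]
    | add y z _ _ hy hz => rw [map_add, map_add, hy, hz]
    | smul a y _ hy => rw [map_smul, map_smul, hy]

variable {B : Type w'} {wt : B → ℕ} {Δ : Sym k B →ₐ[k] Sym k B ⊗[k] Sym k B}

/-- A coassociative and counital coproduct on a symmetric algebra which respects a positive weight
on the generators makes it a Hopf algebra. -/
theorem isHopf_symAntipode (hwt : ∀ b, 1 ≤ wt b) (hΔ : ∀ b, Δ (gen b) ∈ symFil₂ k wt (wt b))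
    (coassoc : (Algebra.TensorProduct.assoc k k k (Sym k B) (Sym k B) (Sym k B)).toAlgHom.comp
      ((Algebra.TensorProduct.map Δ (.id k (Sym k B))).comp Δ) =
      (Algebra.TensorProduct.map (.id k (Sym k B)) Δ).comp Δ)
    (counit_left : (Algebra.TensorProduct.map symCounit (.id k (Sym k B))).comp Δ =
      (Algebra.TensorProduct.lid k (Sym k B)).symm.toAlgHom)
    (counit_right : (Algebra.TensorProduct.map (.id k (Sym k B)) symCounit).comp Δ =
      (Algebra.TensorProduct.rid k k (Sym k B)).symm.toAlgHom) :
    IsHopf Δ symCounit (symAntipode Δ).toLinearMap := by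
  let bi : Bialgebra k (Sym k B) := Bialgebra.ofAlgHom Δ symCounit coassoc counit_left counit_right
  let j : WithConv (Sym k B →ₗ[k] Sym k B) := WithConv.toConv augProj
  have hj : WithConv.toConv LinearMap.id = 1 + j := by
    apply WithConv.ofConv_injective
    change LinearMap.id = Algebra.linearMap k (Sym k B) ∘ₗ symCounit.toLinearMap + augProj
    rw [augProj]
    abel
  have hpow : ∀ n x, (j ^ (n + 1)).ofConv x = mulReducedPow Δ n (augProj x) := by
    intro n
    induction n with
    | zero =>
      intro x
      rw [zero_add, pow_one]
      rfl
    | succ n ih =>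
      intro x
      rw [pow_succ, mulReducedPow_augProj_succ, mulReducedPow_succ_apply]
      change LinearMap.mul' k _ (TensorProduct.map (j ^ (n + 1)).ofConv augProj (Δ x)) = _
      congr 3
      exact LinearMap.ext ih
  obtain ⟨S, hS, h1, h2⟩ := exists_convolution_inverse (A := Sym k B) (symFil k wt)
    (fun m n h => symFil_mono h) (exists_mem_symFil wt) (by
      intro n x hx
      refine Submodule.span_mono ?_ (comul_mem_symFil₂ hΔ hx)
      rintro t ⟨a, b, u, v, hab, hu, hv, rfl⟩
      exact ⟨u, symFil_mono (by omega) hu, v, symFil_mono (by omega) hv, rfl⟩) j hj (by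
      intro n x hx m hm
      obtain ⟨m, rfl⟩ : ∃ m', m = m' + 1 := ⟨m - 1, by omega⟩
      rw [hpow, mulReducedPow_augProj_eq_zero hwt hΔ (by omega) hx])
  have h1' : LinearMap.mul' k (Sym k B) ∘ₗ S.rTensor (Sym k B) ∘ₗ Δ.toLinearMap =
      Algebra.linearMap k (Sym k B) ∘ₗ symCounit.toLinearMap := congrArg WithConv.ofConv h1
  have h2' : LinearMap.mul' k (Sym k B) ∘ₗ S.lTensor (Sym k B) ∘ₗ Δ.toLinearMap =
      Algebra.linearMap k (Sym k B) ∘ₗ symCounit.toLinearMap := congrArg WithConv.ofConv h2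
  let ho : HopfAlgebra k (Sym k B) :=
    { bi with
      antipode := S
      mul_antipode_rTensor_comul := h1'
      mul_antipode_lTensor_comul := h2' }
  have hSS : (symAntipode Δ).toLinearMap = S := by
    have : symAntipode Δ = HopfAlgebra.antipodeAlgHom k (Sym k B) := by
      apply sym_algHom_ext
      intro b
      change _ = S (gen b)
      rw [hS _ _ (gen_mem_symFil (wt := wt) b),
        symAntipode_gen (N := wt b) (fun n hn => mulReducedPow_gen_eq_zero hwt hΔ hn)]
      obtain ⟨m, hm⟩ : ∃ m, wt b = m + 1 := ⟨wt b - 1, by have := hwt b; omega⟩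
      rw [hm, Finset.sum_range_succ' _ (m + 1), Finset.sum_range_succ' _ m,
        Finset.sum_range_succ' _ m]
      have h0 : (j ^ 0).ofConv (gen b) = 0 := by
        rw [pow_zero]
        change Algebra.linearMap k (Sym k B) (symCounit (gen b)) = 0
        rw [symCounit_gen, map_zero]
      rw [h0, hpow, augProj_gen]
      simp only [hpow, augProj_gen, mulReducedPow]
      simp [add_comm]
    rw [this]
    rfl
  rw [hSS]
  refine ⟨?_, ?_, ?_, h1', h2'⟩
  · exact congrArg AlgHom.toLinearMap coassoc
  · exact congrArg AlgHom.toLinearMap counit_left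
  · exact congrArg AlgHom.toLinearMap counit_right

end Antipode

section Naturality

variable {k : Type w} [CommRing k] {B : Type*} {C : Type*}
  {Δ : Sym k B →ₐ[k] Sym k B ⊗[k] Sym k B} {Δ' : Sym k C →ₐ[k] Sym k C ⊗[k] Sym k C}
  {f : (B →₀ k) →ₗ[k] (C →₀ k)}

theorem symMap_gen (b : B) :
    symMap f (gen b) = SymmetricAlgebra.ι k (C →₀ k) (f (Finsupp.single b 1)) := by
  simp [symMap, gen, SymmetricAlgebra.lift_ι_apply]

theorem ι_eq_sum_gen (v : C →₀ k) :
    SymmetricAlgebra.ι k (C →₀ k) v = ∑ c ∈ v.support, v c • gen c := by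
  conv_lhs => rw [← v.sum_single]
  rw [Finsupp.sum, map_sum]
  refine Finset.sum_congr rfl fun c _ => ?_
  rw [gen, ← map_smul, Finsupp.smul_single, smul_eq_mul, mul_one]

theorem symCounit_symMap : (symCounit (k := k) (B := C)).comp (symMap f) = symCounit := by
  apply sym_algHom_ext
  intro b
  rw [AlgHom.comp_apply, symMap_gen, ι_eq_sum_gen, map_sum, symCounit_gen]
  refine Finset.sum_eq_zero fun c _ => ?_
  rw [map_smul, symCounit_gen, smul_zero]

theorem augProj_symMap (x : Sym k B) : augProj (symMap f x) = symMap f (augProj x) := by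
  have h := AlgHom.congr_fun (symCounit_symMap (f := f)) x
  rw [AlgHom.comp_apply] at h
  simp only [augProj, LinearMap.sub_apply, LinearMap.id_apply, LinearMap.comp_apply, map_sub,
    AlgHom.toLinearMap_apply, Algebra.linearMap_apply, h, AlgHom.commutes]

theorem mulReducedPow_symMap (h : (Algebra.TensorProduct.map (symMap f) (symMap f)).comp Δ =
    Δ'.comp (symMap f)) (n : ℕ) (x : Sym k B) :
    mulReducedPow Δ' n (symMap f x) = symMap f (mulReducedPow Δ n x) := by
  induction n generalizing x with
  | zero => rfl
  | succ n ih =>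
    have h1 := AlgHom.congr_fun h x
    rw [AlgHom.comp_apply, AlgHom.comp_apply] at h1
    rw [mulReducedPow_succ_apply, mulReducedPow_succ_apply, ← h1]
    generalize Δ x = t
    induction t using TensorProduct.induction_on with
    | zero => simp only [map_zero]
    | add x y hx hy => simp only [map_add, hx, hy]
    | tmul x y =>
      simp only [Algebra.TensorProduct.map_tmul, TensorProduct.map_tmul, LinearMap.comp_apply,
        LinearMap.mul'_apply, augProj_symMap, ih, map_mul]

/-- An extension of a linear map which respects the coproducts is a homomorphism of Hopf
algebras. -/
theorem isHopfHom_symMap (h : (Algebra.TensorProduct.map (symMap f) (symMap f)).comp Δ =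
    Δ'.comp (symMap f)) (hB : ∀ b, ∃ N, ∀ n, N ≤ n → mulReducedPow Δ n (gen b) = 0)
    (hC : ∀ b, ∀ c ∈ (f (Finsupp.single b 1)).support,
      ∃ N, ∀ n, N ≤ n → mulReducedPow Δ' n (gen c) = 0) :
    IsHopfHom Δ symCounit (symAntipode Δ).toLinearMap Δ' symCounit (symAntipode Δ').toLinearMap
      (symMap f) where
  comul := h
  counit := symCounit_symMap
  antipode := by
    have : (symMap f).comp (symAntipode Δ) = (symAntipode Δ').comp (symMap f) := by
      apply sym_algHom_ext
      intro b
      obtain ⟨N, hN⟩ := hB b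
      choose! N' hN' using hC b
      set v := f (Finsupp.single b 1) with hv
      obtain ⟨M, hM⟩ : ∃ M, N ≤ M ∧ ∀ c ∈ v.support, N' c ≤ M :=
        ⟨max N (v.support.sup N'), le_max_left _ _,
          fun c hc => (Finset.le_sup hc).trans (le_max_right _ _)⟩
      rw [AlgHom.comp_apply, AlgHom.comp_apply,
        symAntipode_gen (N := M) (fun n hn => hN n (hM.1.trans hn)), map_add, map_neg, map_sum]
      have h1 : ∀ n, symMap f (if 1 ≤ n then (-1 : k) ^ (n + 1) • mulReducedPow Δ n (gen b) else 0)
          = ∑ c ∈ v.support, v c •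
            (if 1 ≤ n then (-1 : k) ^ (n + 1) • mulReducedPow Δ' n (gen c) else 0) := by
        intro n
        split_ifs
        · rw [map_smul, ← mulReducedPow_symMap h, symMap_gen, ← hv, ι_eq_sum_gen, map_sum,
            Finset.smul_sum]
          refine Finset.sum_congr rfl fun c _ => ?_
          rw [map_smul, smul_comm]
        · simp
      rw [Finset.sum_congr rfl (fun n _ => h1 n), Finset.sum_comm, symMap_gen, ← hv, ι_eq_sum_gen,
        map_sum, ← Finset.sum_neg_distrib, ← Finset.sum_add_distrib]
      refine Finset.sum_congr rfl fun c hc => ?_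
      rw [map_smul, symAntipode_gen (N := M) (fun n hn => hN' c hc n ((hM.2 c hc).trans hn)),
        smul_add, smul_neg, Finset.smul_sum]
    exact congrArg AlgHom.toLinearMap this

end Naturality

section Antichains

variable {α : Type*} (lt : α → α → Prop)

/-- No element of `H` lies below another one. -/
def IsAntichain (H : Finset α) : Prop := ∀ c ∈ H, ∀ d ∈ H, ¬ lt d c

open Classical in
/-- The antichains in `C`. -/
noncomputable def antichains (C : Finset α) : Finset (Finset α) :=
  C.powerset.filter (IsAntichain lt)

open Classical in
/-- The elements of `C` below an element of `K`. -/
noncomputable def dnSet (C K : Finset α) : Finset α := C.filter (fun d => ∃ c ∈ K, lt d c)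

open Classical in
/-- The elements of `C` which are neither in `H` nor below an element of `H`. -/
noncomputable def upSet (C H : Finset α) : Finset α :=
  C.filter (fun d => d ∉ H ∧ ∀ h ∈ H, ¬ lt d h)

variable {lt} {C : Finset α}

theorem mem_antichains {H : Finset α} : H ∈ antichains lt C ↔ H ⊆ C ∧ IsAntichain lt H := by
  simp [antichains]

theorem mem_dnSet {K : Finset α} {d : α} : d ∈ dnSet lt C K ↔ d ∈ C ∧ ∃ c ∈ K, lt d c := by
  simp [dnSet]

theorem mem_upSet {K : Finset α} {d : α} :
    d ∈ upSet lt C K ↔ d ∈ C ∧ d ∉ K ∧ ∀ h ∈ K, ¬ lt d h := by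
  simp [upSet]

theorem dnSet_subset (K : Finset α) : dnSet lt C K ⊆ C := fun _ h => (mem_dnSet.1 h).1

theorem upSet_subset (K : Finset α) : upSet lt C K ⊆ C := fun _ h => (mem_upSet.1 h).1

variable {R : Type*} [CommRing R] [DecidableEq α]

theorem prod_sum_antichains
    (hlam : ∀ d ∈ C, ∀ c ∈ C, ∀ c' ∈ C, lt d c → lt d c' → c = c' ∨ lt c c' ∨ lt c' c)
    (htrans : ∀ b ∈ C, ∀ c ∈ C, ∀ d ∈ C, lt b c → lt c d → lt b d)
    {K : Finset α} (hK : K ⊆ C) (hKa : IsAntichain lt K) (F : α → Finset α → R) :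
    ∏ c ∈ K, ∑ J ∈ antichains lt (dnSet lt C {c}), F c J =
      ∑ H ∈ antichains lt (dnSet lt C K), ∏ c ∈ K, F c (H ∩ dnSet lt C {c}) := by
  induction K using Finset.induction_on with
  | empty =>
    have : antichains lt (dnSet lt C ∅) = {∅} := by
      ext H
      simp only [mem_antichains, Finset.mem_singleton]
      constructor
      · rintro ⟨h, -⟩
        ext d
        have := @h d
        simp only [mem_dnSet] at this
        simp at this
        simpa using this
      · rintro rfl
        exact ⟨by simp, by simp [IsAntichain]⟩
    simp [this]
  | insert a K ha ih =>
    have hK' : K ⊆ C := (Finset.subset_insert _ _).trans hK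
    have haC : a ∈ C := hK (Finset.mem_insert_self _ _)
    have hKa' : IsAntichain lt K := fun c hc d hd =>
      hKa c (Finset.mem_insert_of_mem hc) d (Finset.mem_insert_of_mem hd)
    have hdis : ∀ d ∈ C, lt d a → ∀ c ∈ K, lt d c → False := by
      intro d hd hda c hc hdc
      rcases hlam d hd a haC c (hK' hc) hda hdc with h | h | h
      · exact ha (h ▸ hc)
      · exact hKa c (Finset.mem_insert_of_mem hc) a (Finset.mem_insert_self _ _) h
      · exact hKa a (Finset.mem_insert_self _ _) c (Finset.mem_insert_of_mem hc) h
    rw [Finset.prod_insert ha, ih hK' hKa', Finset.sum_mul_sum, ← Finset.sum_product']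
    refine Finset.sum_bij' (fun p _ => p.1 ∪ p.2)
      (fun H _ => (H ∩ dnSet lt C {a}, H ∩ dnSet lt C K)) ?_ ?_ ?_ ?_ ?_
    · rintro ⟨J, H⟩ hp
      simp only [Finset.mem_product, mem_antichains, Finset.subset_iff, mem_dnSet] at hp ⊢
      obtain ⟨⟨h1, h2⟩, h3, h4⟩ := hp
      refine ⟨?_, ?_⟩
      · intro d hd
        rcases Finset.mem_union.1 hd with hd | hd
        · obtain ⟨hC, c, hc, h⟩ := h1 hd
          rw [Finset.mem_singleton] at hc
          exact ⟨hC, a, Finset.mem_insert_self _ _, hc ▸ h⟩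
        · obtain ⟨hC, c, hc, h⟩ := h3 hd
          exact ⟨hC, c, Finset.mem_insert_of_mem hc, h⟩
      · intro c hc d hd hlt
        rcases Finset.mem_union.1 hc with hc | hc <;> rcases Finset.mem_union.1 hd with hd | hd
        · exact h2 c hc d hd hlt
        · obtain ⟨hcC, x, hx, hcx⟩ := h1 hc
          rw [Finset.mem_singleton] at hx
          subst hx
          obtain ⟨hdC, y, hy, hdy⟩ := h3 hd
          exact hdis d hdC (htrans d hdC c hcC x haC hlt hcx) y hy hdy
        · obtain ⟨hcC, x, hx, hcx⟩ := h3 hc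
          obtain ⟨hdC, y, hy, hdy⟩ := h1 hd
          rw [Finset.mem_singleton] at hy
          subst hy
          exact hdis d hdC hdy x hx (htrans d hdC c hcC x (hK' hx) hlt hcx)
        · exact h4 c hc d hd hlt
    · intro H hH
      simp only [Finset.mem_product, mem_antichains] at hH ⊢
      exact ⟨⟨Finset.inter_subset_right, fun c hc d hd => hH.2 c (Finset.mem_inter.1 hc).1 d
        (Finset.mem_inter.1 hd).1⟩, Finset.inter_subset_right, fun c hc d hd =>
        hH.2 c (Finset.mem_inter.1 hc).1 d (Finset.mem_inter.1 hd).1⟩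
    · rintro ⟨J, H⟩ hp
      simp only [Finset.mem_product, mem_antichains, Finset.subset_iff, mem_dnSet] at hp
      obtain ⟨⟨h1, h2⟩, h3, h4⟩ := hp
      ext d
      · simp only [Finset.mem_inter, Finset.mem_union, mem_dnSet]
        constructor
        · rintro ⟨hd | hd, hC, c, hc, hlt⟩
          · exact hd
          · rw [Finset.mem_singleton] at hc
            subst hc
            obtain ⟨-, y, hy, hdy⟩ := h3 hd
            exact (hdis d hC hlt y hy hdy).elim
        · intro hd
          exact ⟨Or.inl hd, h1 hd⟩
      · simp only [Finset.mem_inter, Finset.mem_union, mem_dnSet]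
        constructor
        · rintro ⟨hd | hd, hC, c, hc, hlt⟩
          · obtain ⟨-, y, hy, hdy⟩ := h1 hd
            rw [Finset.mem_singleton] at hy
            subst hy
            exact (hdis d hC hdy c hc hlt).elim
          · exact hd
        · intro hd
          exact ⟨Or.inr hd, h3 hd⟩
    · intro H hH
      simp only [mem_antichains, Finset.subset_iff, mem_dnSet] at hH
      ext d
      simp only [Finset.mem_inter, Finset.mem_union, mem_dnSet, Finset.mem_singleton]
      constructor
      · rintro (h | h)
        · exact h.1
        · exact h.1
      · intro hd
        obtain ⟨hC, c, hc, hlt⟩ := hH.1 hd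
        rcases Finset.mem_insert.1 hc with rfl | hc
        · exact Or.inl ⟨hd, hC, c, rfl, hlt⟩
        · exact Or.inr ⟨hd, hC, c, hc, hlt⟩
    · rintro ⟨J, H⟩ hp
      simp only [Finset.mem_product, mem_antichains, Finset.subset_iff, mem_dnSet] at hp
      obtain ⟨⟨h1, h2⟩, h3, h4⟩ := hp
      rw [Finset.prod_insert ha]
      congr 1
      · congr 1
        ext d
        simp only [Finset.mem_inter, Finset.mem_union, mem_dnSet]
        constructor
        · intro hd
          exact ⟨Or.inl hd, h1 hd⟩
        · rintro ⟨hd | hd, hC, c, hc, hlt⟩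
          · exact hd
          · rw [Finset.mem_singleton] at hc
            subst hc
            obtain ⟨-, y, hy, hdy⟩ := h3 hd
            exact (hdis d hC hlt y hy hdy).elim
      · refine Finset.prod_congr rfl fun c hc => ?_
        congr 1
        ext d
        simp only [Finset.mem_inter, Finset.mem_union, mem_dnSet, Finset.mem_singleton]
        constructor
        · rintro ⟨hd, h⟩
          exact ⟨Or.inr hd, h⟩
        · rintro ⟨hd | hd, hC, c', rfl, hlt⟩
          · obtain ⟨-, y, hy, hdy⟩ := h1 hd
            rw [Finset.mem_singleton] at hy
            subst hy
            exact (hdis d hC hdy c' hc hlt).elim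
          · exact ⟨hd, hC, c', rfl, hlt⟩

/-- The combinatorial core of coassociativity: nested pairs of admissible cuts can be summed in two
ways. -/
theorem sum_antichains_nested
    (hlam : ∀ d ∈ C, ∀ c ∈ C, ∀ c' ∈ C, lt d c → lt d c' → c = c' ∨ lt c c' ∨ lt c' c)
    (htrans : ∀ b ∈ C, ∀ c ∈ C, ∀ d ∈ C, lt b c → lt c d → lt b d)
    (a : α → R) (q : Finset α → α → R) (z : Finset α → R) :
    ∑ K ∈ antichains lt C, (∏ c ∈ K, (a c + ∑ J ∈ antichains lt (dnSet lt C {c}),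
      (∏ j ∈ J, a j) * q J c)) * z K =
    ∑ H ∈ antichains lt C, ∑ K ∈ antichains lt (upSet lt C H),
      (∏ h ∈ H, a h) * (∏ c ∈ K, q (H ∩ dnSet lt C {c}) c) * z (K ∪ (H \ dnSet lt C K)) := by
  have h1 : ∀ K ∈ antichains lt C, (∏ c ∈ K, (a c + ∑ J ∈ antichains lt (dnSet lt C {c}),
      (∏ j ∈ J, a j) * q J c)) * z K = ∑ K₀ ∈ K.powerset, ∑ H ∈ antichains lt (dnSet lt C K₀),
        (∏ h ∈ H, a h) * (∏ c ∈ K \ K₀, a c) * (∏ c ∈ K₀, q (H ∩ dnSet lt C {c}) c) * z K := by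
    intro K hK
    rw [mem_antichains] at hK
    rw [Finset.prod_congr rfl (fun c _ => add_comm _ _), Finset.prod_add, Finset.sum_mul]
    refine Finset.sum_congr rfl fun K₀ hK₀ => ?_
    rw [Finset.mem_powerset] at hK₀
    rw [prod_sum_antichains hlam htrans (hK₀.trans hK.1)
      (fun c hc d hd => hK.2 c (hK₀ hc) d (hK₀ hd)) (fun c J => (∏ j ∈ J, a j) * q J c),
      Finset.sum_mul, Finset.sum_mul]
    refine Finset.sum_congr rfl fun H hH => ?_
    rw [mem_antichains] at hH
    have h2 : ∏ c ∈ K₀, ∏ j ∈ H ∩ dnSet lt C {c}, a j = ∏ h ∈ H, a h := by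
      rw [← Finset.prod_biUnion]
      · refine Finset.prod_congr ?_ fun _ _ => rfl
        ext d
        simp only [Finset.mem_biUnion, Finset.mem_inter, mem_dnSet, Finset.mem_singleton]
        constructor
        · rintro ⟨c, hc, hd, -⟩
          exact hd
        · intro hd
          obtain ⟨hC, c, hc, hlt⟩ := mem_dnSet.1 (hH.1 hd)
          exact ⟨c, hc, hd, hC, c, rfl, hlt⟩
      · intro c hc c' hc' hne
        rw [Function.onFun, Finset.disjoint_left]
        intro d hd hd'
        simp only [Finset.mem_inter, mem_dnSet, Finset.mem_singleton] at hd hd'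
        obtain ⟨-, hdC, _, rfl, hdc⟩ := hd
        obtain ⟨-, -, _, rfl, hdc'⟩ := hd'
        have hcK := hK₀ hc
        have hcK' := hK₀ hc'
        rcases hlam d hdC _ (hK.1 hcK) _ (hK.1 hcK') hdc hdc' with h | h | h
        · exact hne h
        · exact hK.2 _ hcK' _ hcK h
        · exact hK.2 _ hcK _ hcK' h
    rw [Finset.prod_mul_distrib, h2]
    ring
  rw [Finset.sum_congr rfl h1]
  simp_rw [Finset.sum_sigma']
  refine Finset.sum_bij' (fun p _ => ⟨(p.1 \ p.2.1) ∪ p.2.2, p.2.1⟩)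
    (fun p _ => ⟨p.2 ∪ (p.1 \ dnSet lt C p.2), p.2, p.1 ∩ dnSet lt C p.2⟩) ?_ ?_ ?_ ?_ ?_
  · rintro ⟨K, K₀, H⟩ hp
    simp only [Finset.mem_sigma, mem_antichains, Finset.mem_powerset, Finset.subset_iff, mem_dnSet,
      mem_upSet, Finset.mem_union, Finset.mem_sdiff, IsAntichain] at hp ⊢
    obtain ⟨⟨h1, h2⟩, h3, h4, h5⟩ := hp
    refine ⟨⟨?_, ?_⟩, ?_, ?_⟩
    · rintro x (hx | hx)
      · exact h1 hx.1
      · exact (h4 hx).1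
    · rintro c (hc | hc) d (hd | hd) hlt
      · exact h2 c hc.1 d hd.1 hlt
      · obtain ⟨hdC, x, hx, hdx⟩ := h4 hd
        rcases hlam d hdC c (h1 hc.1) x (h1 (h3 hx)) hlt hdx with h | h | h
        · exact hc.2 (h ▸ hx)
        · exact h2 x (h3 hx) c hc.1 h
        · exact h2 c hc.1 x (h3 hx) h
      · obtain ⟨hcC, x, hx, hcx⟩ := h4 hc
        exact h2 x (h3 hx) d hd.1 (htrans d (h1 hd.1) c hcC x (h1 (h3 hx)) hlt hcx)
      · exact h5 c hc d hd hlt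
    · intro x hx
      refine ⟨h1 (h3 hx), ?_, ?_⟩
      · rintro (h | h)
        · exact h.2 hx
        · obtain ⟨-, y, hy, hxy⟩ := h4 h
          exact h2 y (h3 hy) x (h3 hx) hxy
      · rintro y (hy | hy) hlt
        · exact h2 y hy.1 x (h3 hx) hlt
        · obtain ⟨hyC, t, ht, hyt⟩ := h4 hy
          exact h2 t (h3 ht) x (h3 hx) (htrans x (h1 (h3 hx)) y hyC t (h1 (h3 ht)) hlt hyt)
    · exact fun c hc d hd => h2 c (h3 hc) d (h3 hd)
  · rintro ⟨H, K₀⟩ hp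
    simp only [Finset.mem_sigma, mem_antichains, Finset.mem_powerset, Finset.subset_iff, mem_dnSet,
      mem_upSet, Finset.mem_union, Finset.mem_sdiff, Finset.mem_inter, IsAntichain] at hp ⊢
    obtain ⟨⟨h1, h2⟩, h3, h4⟩ := hp
    refine ⟨⟨?_, ?_⟩, ?_, ?_, ?_⟩
    · rintro x (hx | hx)
      · exact (h3 hx).1
      · exact h1 hx.1
    · rintro c (hc | hc) d (hd | hd) hlt
      · exact h4 c hc d hd hlt
      · exact hd.2 ⟨h1 hd.1, c, hc, hlt⟩
      · exact (h3 hd).2.2 c hc.1 hlt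
      · exact h2 c hc.1 d hd.1 hlt
    · exact fun x hx => Or.inl hx
    · exact fun x hx => hx.2
    · exact fun c hc d hd => h2 c hc.1 d hd.1
  · rintro ⟨K, K₀, H⟩ hp
    simp only [Finset.mem_sigma, mem_antichains, Finset.mem_powerset, Finset.subset_iff, mem_dnSet,
      IsAntichain] at hp
    obtain ⟨⟨h1, h2⟩, h3, h4, h5⟩ := hp
    have e1 : K₀ ∪ ((K \ K₀ ∪ H) \ dnSet lt C K₀) = K := by
      ext x
      simp only [Finset.mem_union, Finset.mem_sdiff, mem_dnSet]
      constructor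
      · rintro (hx | ⟨hx | hx, hn⟩)
        · exact h3 hx
        · exact hx.1
        · exact absurd (h4 hx) hn
      · intro hx
        by_cases hx0 : x ∈ K₀
        · exact Or.inl hx0
        · refine Or.inr ⟨Or.inl ⟨hx, hx0⟩, ?_⟩
          rintro ⟨-, c, hc, hlt⟩
          exact h2 c (h3 hc) x hx hlt
    have e2 : (K \ K₀ ∪ H) ∩ dnSet lt C K₀ = H := by
      ext x
      simp only [Finset.mem_union, Finset.mem_sdiff, Finset.mem_inter, mem_dnSet]
      constructor
      · rintro ⟨hx | hx, hC, c, hc, hlt⟩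
        · exact (h2 c (h3 hc) x hx.1 hlt).elim
        · exact hx
      · intro hx
        exact ⟨Or.inr hx, h4 hx⟩
    simp only [e1, e2]
  · rintro ⟨H, K₀⟩ hp
    simp only [Finset.mem_sigma, mem_antichains, Finset.subset_iff, mem_upSet, IsAntichain] at hp
    obtain ⟨⟨h1, h2⟩, h3, h4⟩ := hp
    have e1 : ((K₀ ∪ (H \ dnSet lt C K₀)) \ K₀) ∪ (H ∩ dnSet lt C K₀) = H := by
      ext x
      simp only [Finset.mem_union, Finset.mem_sdiff, Finset.mem_inter]
      constructor
      · rintro (⟨hx | hx, hn⟩ | hx)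
        · exact absurd hx hn
        · exact hx.1
        · exact hx.1
      · intro hx
        by_cases hd : x ∈ dnSet lt C K₀
        · exact Or.inr ⟨hx, hd⟩
        · exact Or.inl ⟨Or.inr ⟨hx, hd⟩, fun h => (h3 h).2.1 hx⟩
    simp only [e1]
  · rintro ⟨K, K₀, H⟩ hp
    simp only [Finset.mem_sigma, mem_antichains, Finset.mem_powerset, Finset.subset_iff, mem_dnSet,
      IsAntichain] at hp
    obtain ⟨⟨h1, h2⟩, h3, h4, h5⟩ := hp
    have e1 : K₀ ∪ ((K \ K₀ ∪ H) \ dnSet lt C K₀) = K := by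
      ext x
      simp only [Finset.mem_union, Finset.mem_sdiff, mem_dnSet]
      constructor
      · rintro (hx | ⟨hx | hx, hn⟩)
        · exact h3 hx
        · exact hx.1
        · exact absurd (h4 hx) hn
      · intro hx
        by_cases hx0 : x ∈ K₀
        · exact Or.inl hx0
        · refine Or.inr ⟨Or.inl ⟨hx, hx0⟩, ?_⟩
          rintro ⟨-, c, hc, hlt⟩
          exact h2 c (h3 hc) x hx hlt
    have e2 : ∀ c ∈ K₀, (K \ K₀ ∪ H) ∩ dnSet lt C {c} = H ∩ dnSet lt C {c} := by
      intro c hc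
      ext x
      simp only [Finset.mem_union, Finset.mem_sdiff, Finset.mem_inter, mem_dnSet,
        Finset.mem_singleton]
      constructor
      · rintro ⟨hx | hx, hC, c', rfl, hlt⟩
        · exact (h2 c' (h3 hc) x hx.1 hlt).elim
        · exact ⟨hx, hC, c', rfl, hlt⟩
      · rintro ⟨hx, h⟩
        exact ⟨Or.inr hx, h⟩
    have hdisj : Disjoint (K \ K₀) H := by
      rw [Finset.disjoint_left]
      intro x hx hxH
      obtain ⟨-, c, hc, hlt⟩ := h4 hxH
      exact h2 c (h3 hc) x (Finset.mem_sdiff.1 hx).1 hlt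
    simp only [e1]
    have e3 : ∏ c ∈ K₀, q ((K \ K₀ ∪ H) ∩ dnSet lt C {c}) c =
        ∏ c ∈ K₀, q (H ∩ dnSet lt C {c}) c :=
      Finset.prod_congr rfl fun c hc => by rw [e2 c hc]
    rw [Finset.prod_union hdisj, e3]
    ring

end Antichains

section Coproduct

variable {k : Type w} [CommRing k] {I : Type u} [Quiver.{v} I]

/-- The chord `d` is nested inside the chord `c`. -/
def nest (d c : ℕ × ℕ) : Prop := c.1 < d.1 ∧ d.2 < c.2

theorem PathChord.rawCut_subtype {D : PathChord I} {H : Finset (ℕ × ℕ)} (hH : H ⊆ D.cut) :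
    D.rawCut (H.subtype (· ∈ D.cut)) = H :=
  Finset.subtype_map_of_mem hH

theorem PathChord.mem_simpleCuts {D : PathChord I} {H : Finset D.Chord} :
    H ∈ D.simpleCuts ↔ D.rawCut H ∈ antichains nest D.cut := by
  classical
  rw [mem_antichains, PathChord.simpleCuts, Finset.mem_filter]
  constructor
  · rintro ⟨-, h⟩
    refine ⟨D.rawCut_subset H, ?_⟩
    intro c hc d hd
    simp only [PathChord.rawCut, Finset.mem_map, Function.Embedding.subtype_apply] at hc hd
    obtain ⟨c, hc, rfl⟩ := hc
    obtain ⟨d, hd, rfl⟩ := hd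
    exact h c hc d hd
  · rintro ⟨-, h⟩
    refine ⟨Finset.mem_univ _, ?_⟩
    intro c hc d hd
    exact h c.1 (Finset.mem_map_of_mem _ hc) d.1 (Finset.mem_map_of_mem _ hd)

theorem PathChord.sum_simpleCuts {M : Type*} [AddCommMonoid M] (D : PathChord I)
    (F : Finset (ℕ × ℕ) → M) :
    ∑ H ∈ D.simpleCuts, F (D.rawCut H) = ∑ H ∈ antichains nest D.cut, F H := by
  refine Finset.sum_bij (fun H _ => D.rawCut H) (fun H hH => PathChord.mem_simpleCuts.1 hH)
    ?_ ?_ (fun _ _ => rfl)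
  · intro H _ H' _ h
    exact Finset.map_injective _ h
  · intro H hH
    have h := PathChord.rawCut_subtype (mem_antichains.1 hH).1
    exact ⟨_, PathChord.mem_simpleCuts.2 (h.symm ▸ hH), h⟩

variable (k) in
/-- The sign of a set of chords. -/
noncomputable def PathChord.sg (D : PathChord I) (H : Finset (ℕ × ℕ)) : k :=
  ∏ c ∈ H, (D.sgn c : k)

theorem PathChord.eps_cast (D : PathChord I) (H : Finset D.Chord) :
    ((D.eps H : ℤ) : k) = D.sg k (D.rawCut H) := by
  rw [PathChord.eps, PathChord.sg, PathChord.rawCut, Finset.prod_map, Int.cast_prod]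
  rfl

/-- A coproduct which is given on the images `g D` of the chord diagrams by the formula for `Δ`. -/
def IsChordCoprod {A : Type*} [CommRing A] [Algebra k A] (g : PathChord I → A)
    (Δ : A →ₐ[k] A ⊗[k] A) : Prop :=
  ∀ D, Δ (g D) = g D ⊗ₜ[k] 1 + ∑ H ∈ antichains nest D.cut,
    D.sg k H • ((∏ c ∈ H, g (D.piece H (some c))) ⊗ₜ[k] g (D.piece H none))

theorem chordCoprodOn_eq (D : PathChord I) : chordCoprodOn k D = gen D ⊗ₜ[k] 1 +
    ∑ H ∈ antichains nest D.cut, D.sg k H •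
      ((∏ c ∈ H, gen (D.piece H (some c))) ⊗ₜ[k] gen (D.piece H none)) := by
  rw [chordCoprodOn, ← D.sum_simpleCuts]
  congr 1
  refine Finset.sum_congr rfl fun H _ => ?_
  have h1 : ∏ c ∈ H, gen (k := k) (D.face H (some c)) =
      ∏ c ∈ D.rawCut H, gen (D.piece (D.rawCut H) (some c)) := by
    rw [PathChord.rawCut, Finset.prod_map]
    refine Finset.prod_congr rfl fun c _ => ?_
    rw [PathChord.face_eq_piece]
    rfl
  rw [h1, PathChord.face_eq_piece, ← PathChord.eps_cast]
  exact (Int.cast_smul_eq_zsmul k _ _).symm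

theorem chordCoprod_isChordCoprod : IsChordCoprod (k := k) (I := I) gen (chordCoprod k) := by
  intro D
  rw [chordCoprod, symLift_gen, chordCoprodOn_eq]

theorem PathChord.nest_rk {D : PathChord I} {H : Finset (ℕ × ℕ)} {f : Option (ℕ × ℕ)}
    {c d : ℕ × ℕ} (hc : c ∈ D.on H f) (hd : d ∈ D.on H f) :
    nest (D.rk H f d) (D.rk H f c) ↔ nest d c := by
  rw [PathChord.on, mem_onCut] at hc hd
  simp only [nest, PathChord.rk, ChordAlg.rk]
  rw [cnt_lt_iff hc.2.1, cnt_lt_iff hd.2.2]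

theorem PathChord.rk_injOn (D : PathChord I) (H : Finset (ℕ × ℕ)) (f : Option (ℕ × ℕ)) :
    Set.InjOn (D.rk H f) (D.on H f : Set (ℕ × ℕ)) :=
  fun _ hc _ hd h => rk_inj (G := D.cut) (Finset.mem_coe.1 hc) (Finset.mem_coe.1 hd) h

theorem PathChord.sum_antichains_piece {M : Type*} [AddCommMonoid M] {D : PathChord I}
    {H : Finset (ℕ × ℕ)} {f : Option (ℕ × ℕ)} (hH : H ⊆ D.cut) (hf : IsFaceOf D.cut f)
    (F : Finset (ℕ × ℕ) → M) :
    ∑ K ∈ antichains nest (D.piece H f).cut, F K =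
      ∑ K ∈ antichains nest (D.on H f), F (K.image (D.rk H f)) := by
  symm
  rw [PathChord.piece_cut hH hf]
  refine Finset.sum_bij (fun K _ => K.image (D.rk H f)) ?_ ?_ ?_ (fun _ _ => rfl)
  · intro K hK
    rw [mem_antichains] at hK ⊢
    refine ⟨Finset.image_subset_image hK.1, ?_⟩
    intro c hc d hd
    obtain ⟨c', hc', rfl⟩ := Finset.mem_image.1 hc
    obtain ⟨d', hd', rfl⟩ := Finset.mem_image.1 hd
    rw [PathChord.nest_rk (hK.1 hc') (hK.1 hd')]
    exact hK.2 c' hc' d' hd'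
  · intro K hK K' hK' h
    rw [mem_antichains] at hK hK'
    exact Finset.image_injOn_powerset_of_injOn (D.rk_injOn H f)
      (by simpa using hK.1) (by simpa using hK'.1) h
  · intro K hK
    rw [mem_antichains] at hK
    obtain ⟨K', hK', rfl⟩ := Finset.subset_image_iff.1 hK.1
    refine ⟨K', mem_antichains.2 ⟨hK', ?_⟩, rfl⟩
    intro c hc d hd
    rw [← PathChord.nest_rk (hK' hc) (hK' hd)]
    exact hK.2 _ (Finset.mem_image_of_mem _ hc) _ (Finset.mem_image_of_mem _ hd)

variable {A : Type*} [CommRing A] [Algebra k A] {g : PathChord I → A} {Δ : A →ₐ[k] A ⊗[k] A}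

theorem IsChordCoprod.piece (h : IsChordCoprod g Δ) {D : PathChord I} {H : Finset (ℕ × ℕ)}
    {f : Option (ℕ × ℕ)} (hH : H ⊆ D.cut) (hf : IsFaceOf D.cut f) :
    Δ (g (D.piece H f)) = g (D.piece H f) ⊗ₜ[k] 1 + ∑ K ∈ antichains nest (D.on H f),
      D.sg k K • ((∏ c ∈ K, g (D.piece (H ∪ K) (some c))) ⊗ₜ[k] g (D.piece (H ∪ K) f)) := by
  rw [h, PathChord.sum_antichains_piece hH hf]
  congr 1
  refine Finset.sum_congr rfl fun K hK => ?_
  rw [mem_antichains] at hK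
  have hinj : Set.InjOn (D.rk H f) (K : Set (ℕ × ℕ)) :=
    (D.rk_injOn H f).mono (Finset.coe_subset.2 hK.1)
  rw [PathChord.sg, PathChord.sg, Finset.prod_image hinj, Finset.prod_image hinj]
  have h1 := PathChord.piece_piece hH hf hK.1 (g := none) isFaceOf_none
  rw [Option.map_none, Option.none_or] at h1
  rw [h1]
  have h3 : ∏ c ∈ K, (((D.piece H f).sgn (D.rk H f c) : ℤ) : k) = ∏ c ∈ K, (D.sgn c : k) :=
    Finset.prod_congr rfl fun c hc => by rw [PathChord.sgn_rk hH hf (hK.1 hc)]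
  have h4 : ∏ c ∈ K, g ((D.piece H f).piece (K.image (D.rk H f)) (some (D.rk H f c))) =
      ∏ c ∈ K, g (D.piece (H ∪ K) (some c)) := by
    refine Finset.prod_congr rfl fun c hc => ?_
    have h2 := PathChord.piece_piece hH hf hK.1 (g := some c) (isFaceOf_some.2 (hK.1 hc))
    rw [Option.map_some, Option.some_or] at h2
    rw [h2]
  rw [h3, h4]

theorem PathChord.on_singleton {D : PathChord I} {c : ℕ × ℕ} (hc : c ∈ D.cut) :
    D.on {c} (some c) = dnSet nest D.cut {c} := by
  ext d
  rw [PathChord.mem_on (by simpa using hc), mem_dnSet]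
  simp only [Finset.mem_singleton, forall_eq, exists_eq_left, nest, Below, lo, hi]
  constructor
  · rintro ⟨h0, h1, -⟩
    exact ⟨h0, by omega⟩
  · rintro ⟨h0, h1⟩
    exact ⟨h0, by omega, by omega⟩

theorem PathChord.on_none {D : PathChord I} {H : Finset (ℕ × ℕ)} (hH : H ⊆ D.cut) :
    D.on H none = upSet nest D.cut H := by
  ext d
  rw [PathChord.mem_on hH, mem_upSet]
  simp only [nest, Below, lo, hi]
  constructor
  · rintro ⟨h0, h1, h2⟩
    refine ⟨h0, ?_, ?_⟩
    · intro hd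
      have := D.isCut.lt h0
      exact h2 d hd (by omega) (by omega)
    · intro h hh hlt
      have := D.isCut.lt (hH hh)
      exact h2 h hh (by omega) (by omega)
  · rintro ⟨h0, h1, h2⟩
    have hd := D.isCut.lt h0
    refine ⟨h0, by omega, ?_⟩
    intro h hh _ hcon
    by_cases hne : h = d
    · exact h1 (hne ▸ hh)
    · have := D.isCut.tri (hH hh) h0 hne
      exact h2 h hh (by omega)

theorem PathChord.piece_simple {D : PathChord I} {K : Finset (ℕ × ℕ)}
    (hK : K ∈ antichains nest D.cut) {c : ℕ × ℕ} (hc : c ∈ K) :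
    D.piece K (some c) = D.piece {c} (some c) := by
  rw [mem_antichains] at hK
  refine PathChord.piece_congr_cover hK.1 (by simpa using hK.1 hc) ?_ ?_
  · intro d hd hb
    exact (hK.2 c hc d hd ⟨hb.1, hb.2⟩).elim
  · intro d hd hb
    rw [Finset.mem_singleton] at hd
    subst hd
    have := hb.1
    simp [lo] at this

theorem IsChordCoprod.coassoc_apply (h : IsChordCoprod g Δ) (D : PathChord I) :
    Algebra.TensorProduct.assoc k k k A A A
      (Algebra.TensorProduct.map Δ (.id k A) (Δ (g D))) =
      Algebra.TensorProduct.map (.id k A) Δ (Δ (g D)) := by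
  let i1 : A →ₐ[k] A ⊗[k] (A ⊗[k] A) := Algebra.TensorProduct.includeLeft
  let i2 : A →ₐ[k] A ⊗[k] (A ⊗[k] A) := Algebra.TensorProduct.includeRight.comp
    Algebra.TensorProduct.includeLeft
  let i3 : A →ₐ[k] A ⊗[k] (A ⊗[k] A) := Algebra.TensorProduct.includeRight.comp
    Algebra.TensorProduct.includeRight
  let i12 : A ⊗[k] A →ₐ[k] A ⊗[k] (A ⊗[k] A) :=
    (Algebra.TensorProduct.assoc k k k A A A).toAlgHom.comp Algebra.TensorProduct.includeLeft
  let i23 : A ⊗[k] A →ₐ[k] A ⊗[k] (A ⊗[k] A) := Algebra.TensorProduct.includeRight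
  have e12 : ∀ x y, i12 (x ⊗ₜ y) = i1 x * i2 y := by
    intro x y
    simp [i12, i1, i2, Algebra.TensorProduct.one_def]
  have e23 : ∀ x y, i23 (x ⊗ₜ y) = i2 x * i3 y := by
    intro x y
    simp [i23, i2, i3]
  have hl : ∀ x y, Algebra.TensorProduct.assoc k k k A A A
      (Algebra.TensorProduct.map Δ (.id k A) (x ⊗ₜ y)) = i12 (Δ x) * i3 y := by
    intro x y
    rw [Algebra.TensorProduct.map_tmul]
    simp only [AlgHom.coe_id, id]
    generalize Δ x = t
    induction t using TensorProduct.induction_on with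
    | zero => simp
    | add a b ha hb => rw [TensorProduct.add_tmul, map_add, ha, hb, map_add, add_mul]
    | tmul a b => simp [e12, i1, i2, i3]
  have hr : ∀ x y, Algebra.TensorProduct.map (.id k A) Δ (x ⊗ₜ y) = i1 x * i23 (Δ y) := by
    intro x y
    simp [i1, i23]
  have hsmul : ∀ (r : k) (t : A ⊗[k] A), Algebra.TensorProduct.assoc k k k A A A
      (Algebra.TensorProduct.map Δ (.id k A) (r • t)) = r • Algebra.TensorProduct.assoc k k k A A A
      (Algebra.TensorProduct.map Δ (.id k A) t) := by
    intro r t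
    rw [map_smul, map_smul]
  have hL : Algebra.TensorProduct.assoc k k k A A A
      (Algebra.TensorProduct.map Δ (.id k A) (Δ (g D))) = i12 (Δ (g D)) +
        ∑ K ∈ antichains nest D.cut, D.sg k K •
          (i12 (Δ (∏ c ∈ K, g (D.piece K (some c)))) * i3 (g (D.piece K none))) := by
    conv_lhs => rw [h D]
    rw [map_add, map_add, hl, map_one, mul_one, map_sum, map_sum]
    congr 1
    refine Finset.sum_congr rfl fun K _ => ?_
    rw [hsmul, hl]
  have hR : Algebra.TensorProduct.map (.id k A) Δ (Δ (g D)) = i1 (g D) +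
        ∑ H ∈ antichains nest D.cut, D.sg k H •
          (i1 (∏ c ∈ H, g (D.piece H (some c))) * i23 (Δ (g (D.piece H none)))) := by
    conv_lhs => rw [h D]
    rw [map_add, hr, map_one, map_one, mul_one, map_sum]
    congr 1
    refine Finset.sum_congr rfl fun K _ => ?_
    rw [map_smul, hr]
  rw [hL, hR]
  -- the terms which end in `1` agree
  have hstart : i12 (Δ (g D)) = i1 (g D) + ∑ H ∈ antichains nest D.cut, D.sg k H •
      (i1 (∏ c ∈ H, g (D.piece H (some c))) * i2 (g (D.piece H none))) := by
    rw [h D, map_add, e12, map_one, mul_one, map_sum]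
    congr 1
    refine Finset.sum_congr rfl fun K _ => ?_
    rw [map_smul, e12]
  rw [hstart, add_assoc]
  congr 1
  let G : ℕ × ℕ → A := fun c => g (D.piece {c} (some c))
  let a : ℕ × ℕ → A ⊗[k] (A ⊗[k] A) := fun c => (D.sgn c : k) • i1 (G c)
  let q : Finset (ℕ × ℕ) → ℕ × ℕ → A ⊗[k] (A ⊗[k] A) := fun J c =>
    (D.sgn c : k) • i2 (g (D.piece ({c} ∪ J) (some c)))
  let z : Finset (ℕ × ℕ) → A ⊗[k] (A ⊗[k] A) := fun K => i3 (g (D.piece K none))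
  have hprod : ∀ (K : Finset (ℕ × ℕ)) (F : ℕ × ℕ → A ⊗[k] (A ⊗[k] A)),
      D.sg k K • ∏ c ∈ K, F c = ∏ c ∈ K, (D.sgn c : k) • F c := by
    intro K F
    rw [PathChord.sg, Finset.prod_smul]
  have hGa : ∀ H ∈ antichains nest D.cut,
      D.sg k H • i1 (∏ c ∈ H, g (D.piece H (some c))) = ∏ c ∈ H, a c := by
    intro H hH
    rw [map_prod, hprod]
    exact Finset.prod_congr rfl fun c hc => by rw [PathChord.piece_simple hH hc]
  have hlam : ∀ d ∈ D.cut, ∀ c ∈ D.cut, ∀ c' ∈ D.cut, nest d c → nest d c' →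
      c = c' ∨ nest c c' ∨ nest c' c := by
    intro d hd c hc c' hc' h1 h2
    by_cases hne : c = c'
    · exact Or.inl hne
    · have := D.isCut.tri hc hc' hne
      have := D.isCut.lt hd
      unfold nest at *
      omega
  have htrans : ∀ b ∈ D.cut, ∀ c ∈ D.cut, ∀ d ∈ D.cut, nest b c → nest c d → nest b d := by
    intro b _ c _ d _ h1 h2
    unfold nest at *
    omega
  have key := sum_antichains_nested hlam htrans a q z
  have hLHS : ∀ K ∈ antichains nest D.cut, D.sg k K •
      (i12 (Δ (∏ c ∈ K, g (D.piece K (some c)))) * i3 (g (D.piece K none))) =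
      (∏ c ∈ K, (a c + ∑ J ∈ antichains nest (dnSet nest D.cut {c}),
        (∏ j ∈ J, a j) * q J c)) * z K := by
    intro K hK
    rw [← smul_mul_assoc, map_prod, map_prod, hprod]
    congr 1
    refine Finset.prod_congr rfl fun c hc => ?_
    have hcC := (mem_antichains.1 hK).1 hc
    have hcC' : {c} ⊆ D.cut := by simpa using hcC
    rw [PathChord.piece_simple hK hc, h.piece hcC' (isFaceOf_some.2 hcC), map_add, e12, map_one,
      mul_one, smul_add, PathChord.on_singleton hcC, map_sum, Finset.smul_sum]
    congr 1
    refine Finset.sum_congr rfl fun J hJ => ?_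
    have hJC : J ∈ antichains nest D.cut := by
      rw [mem_antichains] at hJ ⊢
      exact ⟨hJ.1.trans (dnSet_subset _), hJ.2⟩
    have h5 : ∏ j ∈ J, g (D.piece ({c} ∪ J) (some j)) = ∏ j ∈ J, g (D.piece J (some j)) := by
      refine Finset.prod_congr rfl fun j hj => congrArg g ?_
      refine PathChord.piece_congr_cover (Finset.union_subset hcC' (mem_antichains.1 hJC).1)
        (mem_antichains.1 hJC).1 ?_ ?_
      · intro d hd hb
        rcases Finset.mem_union.1 hd with hd | hd
        · rw [Finset.mem_singleton] at hd
          subst hd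
          obtain ⟨-, c', hc', hn⟩ := mem_dnSet.1 ((mem_antichains.1 hJ).1 hj)
          rw [Finset.mem_singleton] at hc'
          subst hc'
          have h1 := hb.1
          simp only [lo] at h1
          have := hn.1
          omega
        · exact ⟨d, hd, hb, le_rfl, le_rfl⟩
      · intro d hd hb
        exact ⟨d, Finset.mem_union_right _ hd, hb, le_rfl, le_rfl⟩
    rw [map_smul, e12, h5, ← hGa J hJC]
    simp only [q]
    rw [smul_mul_assoc, mul_smul_comm, smul_comm]
  rw [Finset.sum_congr rfl hLHS, key, ← Finset.sum_add_distrib]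
  refine Finset.sum_congr rfl fun H hH => ?_
  have hHC := (mem_antichains.1 hH).1
  rw [h.piece hHC isFaceOf_none, map_add, e23, map_one, mul_one, mul_add, smul_add, map_sum,
    PathChord.on_none hHC]
  congr 1
  rw [← smul_mul_assoc, hGa H hH, Finset.mul_sum]
  refine Finset.sum_congr rfl fun K hK => ?_
  have hKC : K ∈ antichains nest D.cut := by
    rw [mem_antichains] at hK ⊢
    exact ⟨hK.1.trans (upSet_subset _), hK.2⟩
  have hKC' := (mem_antichains.1 hKC).1
  have hup := (mem_antichains.1 hK).1
  rw [mul_assoc]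
  congr 1
  rw [map_smul, e23, ← smul_mul_assoc, map_prod, hprod]
  congr 1
  · refine Finset.prod_congr rfl fun c hc => ?_
    have hcC := hKC' hc
    simp only [q]
    congr 3
    refine PathChord.piece_congr_cover (Finset.union_subset (by simpa using hcC)
      (Finset.inter_subset_left.trans hHC)) (Finset.union_subset hHC hKC') ?_ ?_
    · intro d hd hb
      rcases Finset.mem_union.1 hd with hd | hd
      · rw [Finset.mem_singleton] at hd
        subst hd
        have := hb.1
        simp [lo] at this
      · exact ⟨d, Finset.mem_union_left _ (Finset.mem_inter.1 hd).1, hb, le_rfl, le_rfl⟩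
    · intro d hd hb
      rcases Finset.mem_union.1 hd with hd | hd
      · refine ⟨d, Finset.mem_union_right _ (Finset.mem_inter.2 ⟨hd, ?_⟩), hb, le_rfl, le_rfl⟩
        exact mem_dnSet.2 ⟨hHC hd, c, Finset.mem_singleton_self _, hb.1, hb.2⟩
      · exact ((mem_antichains.1 hK).2 c hc d hd ⟨hb.1, hb.2⟩).elim
  · simp only [z]
    congr 2
    refine PathChord.piece_congr_cover (Finset.union_subset hKC' (Finset.sdiff_subset.trans hHC))
      (Finset.union_subset hHC hKC') ?_ ?_
    · intro d hd hb
      rcases Finset.mem_union.1 hd with hd | hd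
      · exact ⟨d, Finset.mem_union_right _ hd, hb, le_rfl, le_rfl⟩
      · exact ⟨d, Finset.mem_union_left _ (Finset.mem_sdiff.1 hd).1, hb, le_rfl, le_rfl⟩
    · intro d hd hb
      rcases Finset.mem_union.1 hd with hd | hd
      · by_cases hdn : d ∈ dnSet nest D.cut K
        · obtain ⟨-, c, hc, hn⟩ := mem_dnSet.1 hdn
          have := D.isCut.lt (hKC' hc)
          exact ⟨c, Finset.mem_union_left _ hc, ⟨by simp [lo], this.2⟩, hn.1.le, hn.2.le⟩
        · exact ⟨d, Finset.mem_union_right _ (Finset.mem_sdiff.2 ⟨hd, hdn⟩), hb, le_rfl, le_rfl⟩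
      · exact ⟨d, Finset.mem_union_left _ hd, hb, le_rfl, le_rfl⟩

end Coproduct

section FacePositions

variable {I : Type u} [Quiver.{v} I] {a : List (DArrow I)} {H : Finset (ℕ × ℕ)}

theorem OnFace.unique (hH : IsCut a H) {f g : Option (ℕ × ℕ)} (hf : IsFaceOf H f)
    (hg : IsFaceOf H g) {x : ℕ} (hx : OnFace a.length H f x) (hx' : OnFace a.length H g x) :
    f = g := by
  obtain ⟨h1, h2, h3⟩ := hx
  obtain ⟨h1', h2', h3'⟩ := hx'
  rcases f with _ | c <;> rcases g with _ | d
  · rfl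
  · have hd := isFaceOf_some.1 hg
    have hlt := hH.lt hd
    simp only [lo, hi] at *
    exact (h3 d hd ⟨by simp [lo], by simpa [hi] using hlt.2⟩ (by omega)).elim
  · have hc := isFaceOf_some.1 hf
    have hlt := hH.lt hc
    simp only [lo, hi] at *
    exact (h3' c hc ⟨by simp [lo], by simpa [hi] using hlt.2⟩ (by omega)).elim
  · have hc := isFaceOf_some.1 hf
    have hd := isFaceOf_some.1 hg
    by_contra hne
    have htri := hH.tri hc hd (fun e => hne (congrArg some e))
    have k1 := h3 d hd
    have k2 := h3' c hc
    simp only [Below, lo, hi] at *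
    rcases htri with h | h | h | h
    · omega
    · omega
    · exact k1 (by omega) (by omega)
    · exact k2 (by omega) (by omega)

theorem OnFace.ne (hH : IsCut a H) {f : Option (ℕ × ℕ)} (hf : IsFaceOf H f) {x : ℕ}
    (hx : OnFace a.length H f x) {c : ℕ × ℕ} (hc : c ∈ H) : x ≠ c.1 ∧ x ≠ c.2 := by
  obtain ⟨h1, h2, h3⟩ := hx
  have hlt := hH.lt hc
  have k := h3 c hc
  rcases f with _ | d
  · simp only [Below, lo, hi] at *
    have := k (by omega)
    omega
  · have hd := isFaceOf_some.1 hf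
    by_cases hne : c = d
    · subst hne
      simp only [lo, hi] at *
      omega
    · have htri := hH.tri hc hd hne
      simp only [Below, lo, hi] at *
      by_cases hb : d.1 + 1 ≤ c.1 ∧ c.2 < d.2
      · have := k hb
        omega
      · omega

theorem exists_face {G : Finset (ℕ × ℕ)} (hG : IsCut a G) (hH : H ⊆ G) {d : ℕ × ℕ} (hd : d ∈ G)
    (hdH : d ∉ H) : ∃ f, IsFaceOf H f ∧ d ∈ onCut a.length G H f := by
  classical
  have hdl := hG.lt hd
  have hon : ∀ f : Option (ℕ × ℕ), lo f ≤ d.1 → d.2 < hi a.length f →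
      (∀ h ∈ H, Below a.length f h → ¬ (h.1 < d.1 ∧ d.2 < h.2)) →
      d ∈ onCut a.length G H f := by
    intro f h1 h2 h3
    have key : ∀ h ∈ H, Below a.length f h →
        ¬ (h.1 ≤ d.1 ∧ d.1 ≤ h.2) ∧ ¬ (h.1 ≤ d.2 ∧ d.2 ≤ h.2) := by
      intro h hh hb
      have h4 := h3 h hh hb
      have hne : h ≠ d := fun e => hdH (e ▸ hh)
      have := hG.tri (hH hh) hd hne
      have := hG.lt (hH hh)
      omega
    exact mem_onCut.2 ⟨hd, ⟨h1, by omega, fun h hh hb => (key h hh hb).1⟩,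
      ⟨by omega, h2, fun h hh hb => (key h hh hb).2⟩⟩
  rcases (H.filter (fun h => h.1 < d.1 ∧ d.2 < h.2)).eq_empty_or_nonempty with h0 | h0
  · refine ⟨none, isFaceOf_none, hon none (by simp [lo]) hdl.2 ?_⟩
    intro h hh _ hcon
    have : h ∈ H.filter (fun h => h.1 < d.1 ∧ d.2 < h.2) := Finset.mem_filter.2 ⟨hh, hcon⟩
    rw [h0] at this
    simp at this
  · obtain ⟨c, hc, hmax⟩ := Finset.exists_max_image _ (fun h : ℕ × ℕ => h.1) h0
    rw [Finset.mem_filter] at hc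
    refine ⟨some c, isFaceOf_some.2 hc.1, hon (some c) hc.2.1 hc.2.2 ?_⟩
    intro h hh hb hcon
    have h1 := hmax h (Finset.mem_filter.2 ⟨hh, hcon⟩)
    have h2 := hb.1
    simp only [lo] at h2
    omega

theorem cnt_eq_card (p : ℕ → Prop) [DecidablePred p] (n : ℕ) :
    cnt p n = ((Finset.range n).filter p).card := by
  rw [cnt, Nat.count_eq_card_filter_range]
  congr

/-- Cutting a word along a cut does not increase the weight "length plus one". -/
theorem sum_length_faceWord_le (hH : IsCut a H) :
    ∑ c ∈ H, ((faceWord a H (some c)).length + 1) + ((faceWord a H none).length + 1) ≤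
      a.length + 1 := by
  classical
  let A : Option (ℕ × ℕ) → Finset ℕ := fun f =>
    (Finset.range a.length).filter (OnFace a.length H f)
  have hlen : ∀ f, IsFaceOf H f → (faceWord a H f).length = (A f).card := fun f hf => by
    rw [(isSubword_faceWord hH hf).length, cnt_eq_card]
  let B : Option (ℕ × ℕ) → Finset ℕ := fun f => match f with
    | none => A none
    | some c => insert c.1 (A (some c))
  have hB : ∀ f x, IsFaceOf H f → x ∈ B f → OnFace a.length H f x ∨ ∃ c ∈ H, f = some c ∧ x = c.1 := by
    intro f x hf hx
    rcases f with _ | c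
    · exact Or.inl (Finset.mem_filter.1 hx).2
    · rcases Finset.mem_insert.1 hx with h | h
      · exact Or.inr ⟨c, isFaceOf_some.1 hf, rfl, h⟩
      · exact Or.inl (Finset.mem_filter.1 h).2
  have hface : ∀ f ∈ insert none (H.map Function.Embedding.some), IsFaceOf H f := by
    intro f hf
    rcases Finset.mem_insert.1 hf with rfl | hf
    · exact isFaceOf_none
    · obtain ⟨c, hc, rfl⟩ := Finset.mem_map.1 hf
      exact isFaceOf_some.2 hc
  have hdisj : ∀ f ∈ insert none (H.map Function.Embedding.some),
      ∀ g ∈ insert none (H.map Function.Embedding.some), f ≠ g → Disjoint (B f) (B g) := by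
    intro f hf g hg hne
    rw [Finset.disjoint_left]
    intro x hx hx'
    have hf := hface f hf
    have hg := hface g hg
    rcases hB f x hf hx with h | ⟨c, hc, rfl, rfl⟩ <;> rcases hB g _ hg hx' with h' | ⟨d, hd, rfl, h'⟩
    · exact hne (h.unique hH hf hg h')
    · exact (h.ne hH hf hd).1 h'
    · exact (h'.ne hH hg hc).1 rfl
    · exact hne (congrArg some (hH.eq_of_fst hc hd h'))
  have hcard := Finset.card_biUnion hdisj
  rw [Finset.sum_insert (by simp), Finset.sum_map] at hcard
  have hle : ((insert none (H.map Function.Embedding.some)).biUnion B).card ≤ a.length := by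
    refine (Finset.card_le_card ?_).trans (Finset.card_range a.length).le
    intro x hx
    obtain ⟨f, hf, hx⟩ := Finset.mem_biUnion.1 hx
    rw [Finset.mem_range]
    rcases hB f x (hface f hf) hx with h | ⟨c, hc, -, rfl⟩
    · exact lt_of_lt_of_le h.2.1 (hi_le hH (hface f hf)).2
    · have := hH.lt hc
      omega
  have hsum : ∑ c ∈ H, ((faceWord a H (some c)).length + 1) =
      ∑ c ∈ H, (B (Function.Embedding.some c)).card := by
    refine Finset.sum_congr rfl fun c hc => ?_
    rw [hlen _ (isFaceOf_some.2 hc)]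
    refine (Finset.card_insert_of_notMem ?_).symm
    intro hmem
    exact ((Finset.mem_filter.1 hmem).2.ne hH (isFaceOf_some.2 hc) hc).1 rfl
  rw [hsum, hlen _ isFaceOf_none]
  have : (B none).card = (A none).card := rfl
  omega

end FacePositions

section ChordHopf

variable {k : Type w} [CommRing k] {I : Type u} [Quiver.{v} I]

theorem PathChord.piece_empty (D : PathChord I) : D.piece ∅ none = D := by
  have h0 : (∅ : Finset (ℕ × ℕ)) ⊆ D.cut := Finset.empty_subset _
  have hon : ∀ x, OnFace D.path.arrows.length ∅ none x ↔ x < D.path.arrows.length := by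
    intro x
    simp [OnFace, lo, hi, Visible]
  have hcnt : ∀ x ≤ D.path.arrows.length, cnt (OnFace D.path.arrows.length ∅ none) x = x := by
    intro x
    induction x with
    | zero => intro _; exact cnt_zero
    | succ x ih =>
      intro hx
      rw [cnt_succ_of ((hon x).2 (by omega)), ih (by omega)]
  apply PathChord.ext
  · apply QPath.ext
    · rw [PathChord.piece_path_src h0 isFaceOf_none]
      exact vertexAt_zero _ _
    · rw [PathChord.piece_path_tgt h0 isFaceOf_none]
      exact vertexAt_length D.path.isPath
    · refine (PathChord.piece_isSubword h0 isFaceOf_none).unique ⟨(hcnt _ le_rfl).symm, ?_⟩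
      intro x hx _
      rw [hcnt x hx.le]
  · rw [PathChord.piece_cut h0 isFaceOf_none]
    have h1 : D.on ∅ none = D.cut := by
      ext d
      rw [PathChord.on, mem_onCut, hon, hon, and_iff_left_iff_imp]
      intro hd
      have := D.isCut.lt hd
      omega
    rw [h1]
    ext d
    rw [Finset.mem_image]
    have hrk : ∀ c ∈ D.cut, D.rk ∅ none c = c := by
      intro c hc
      have := D.isCut.lt hc
      exact Prod.ext (hcnt _ (by omega)) (hcnt _ (by omega))
    constructor
    · rintro ⟨c, hc, rfl⟩
      rwa [hrk c hc]
    · exact fun hd => ⟨d, hd, hrk d hd⟩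

/-- The weight of a chord diagram. -/
def PathChord.wt (D : PathChord I) : ℕ := D.path.arrows.length + 1

theorem chordCoprod_gen_mem (D : PathChord I) :
    chordCoprod k (gen D) ∈ symFil₂ k PathChord.wt D.wt := by
  rw [chordCoprod_isChordCoprod]
  refine add_mem (tmul_mem_symFil₂ (gen_mem_symFil D) (one_mem_symFil 0) le_rfl) ?_
  refine Submodule.sum_mem _ fun H hH => Submodule.smul_mem _ _ ?_
  have hHC := (mem_antichains.1 hH).1
  refine tmul_mem_symFil₂ (prod_mem_symFil _ _) (gen_mem_symFil _) ?_
  have h := sum_length_faceWord_le (D.isCut.mono hHC)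
  unfold PathChord.wt
  rw [PathChord.piece_arrows hHC isFaceOf_none]
  have h1 : ∑ c ∈ H, ((D.piece H (some c)).path.arrows.length + 1) =
      ∑ c ∈ H, ((faceWord D.path.arrows H (some c)).length + 1) :=
    Finset.sum_congr rfl fun c hc => by
      rw [PathChord.piece_arrows hHC (isFaceOf_some.2 (hHC hc))]
  rw [h1]
  exact h

theorem mulReducedPow_chordCoprod {D : PathChord I} {n : ℕ} (h : D.wt ≤ n) :
    mulReducedPow (chordCoprod k) n (gen D) = 0 :=
  mulReducedPow_gen_eq_zero (fun _ => Nat.succ_pos _) chordCoprod_gen_mem h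

theorem PathChord.sum_antichains_eq_empty {A : Type*} [AddCommMonoid A]
    (D : PathChord I) (F : Finset (ℕ × ℕ) → A) (h : ∀ H, H.Nonempty → F H = 0) :
    ∑ H ∈ antichains nest D.cut, F H = F ∅ := by
  refine Finset.sum_eq_single_of_mem ∅ (mem_antichains.2 ⟨Finset.empty_subset _, ?_⟩) ?_
  · intro c hc
    simp at hc
  · intro H _ hne
    exact h H (Finset.nonempty_of_ne_empty hne)

theorem chordCoprod_isHopf : IsHopf (chordCoprod k (I := I)) symCounit
    (symAntipode (chordCoprod k (I := I))).toLinearMap := by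
  refine isHopf_symAntipode (wt := PathChord.wt) (fun _ => Nat.succ_pos _) chordCoprod_gen_mem
    ?_ ?_ ?_
  · refine sym_algHom_ext (A := Sym k (PathChord I) ⊗[k] (Sym k (PathChord I) ⊗[k]
      Sym k (PathChord I))) fun D => ?_
    exact (chordCoprod_isChordCoprod (k := k)).coassoc_apply D
  · apply sym_algHom_ext
    intro D
    change Algebra.TensorProduct.map symCounit (.id k _) (chordCoprod k (gen D)) =
      (Algebra.TensorProduct.lid k _).symm (gen D)
    rw [chordCoprod_isChordCoprod, map_add, map_sum, D.sum_antichains_eq_empty]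
    · rw [map_smul]
      simp [PathChord.sg, PathChord.piece_empty, symCounit_gen]
    · rintro H ⟨c, hc⟩
      rw [map_smul, Algebra.TensorProduct.map_tmul, map_prod,
        Finset.prod_eq_zero hc (symCounit_gen _), TensorProduct.zero_tmul, smul_zero]
  · apply sym_algHom_ext
    intro D
    change Algebra.TensorProduct.map (.id k _) symCounit (chordCoprod k (gen D)) =
      (Algebra.TensorProduct.rid k k _).symm (gen D)
    rw [chordCoprod_isChordCoprod, map_add, map_sum, Finset.sum_eq_zero]
    · simp
    · intro H _
      rw [map_smul, Algebra.TensorProduct.map_tmul, symCounit_gen, TensorProduct.tmul_zero,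
        smul_zero]

theorem chordCoprod_finite (D : PathChord I) :
    {n : ℕ | mulReducedPow (chordCoprod k) n (gen D) ≠ 0}.Finite := by
  refine (Set.finite_lt_nat D.wt).subset ?_
  intro n hn
  by_contra hcon
  exact hn (mulReducedPow_chordCoprod (not_lt.1 hcon))

end ChordHopf

section Gluing

variable {I : Type u} [Quiver.{v} I] {a : List (DArrow I)} {H : Finset (ℕ × ℕ)}

theorem subset_of_faceCut_eq {G G' : Finset (ℕ × ℕ)} (hG : IsCut a G) (hHG : H ⊆ G)
    (hHG' : H ⊆ G')
    (h : ∀ f, IsFaceOf H f → faceCut a.length G H f = faceCut a.length G' H f) : G ⊆ G' := by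
  intro d hd
  by_cases hdH : d ∈ H
  · exact hHG' hdH
  · obtain ⟨f, hf, hon⟩ := exists_face hG hHG hd hdH
    have h1 : rk a.length H f d ∈ faceCut a.length G H f := by
      rw [faceCut_eq_image]
      exact Finset.mem_image_of_mem _ hon
    rw [h f hf, faceCut_eq_image, Finset.mem_image] at h1
    obtain ⟨d', hd', he⟩ := h1
    rw [mem_onCut] at hon hd'
    have : d' = d := Prod.ext (cnt_inj hd'.2.1 hon.2.1 (congrArg Prod.fst he))
      (cnt_inj hd'.2.2 hon.2.2 (congrArg Prod.snd he))
    exact this ▸ hd'.1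

open Classical in
/-- The chords of the cut `K` of a face, as chords on the whole word. -/
noncomputable def liftCut (n : ℕ) (H : Finset (ℕ × ℕ)) (f : Option (ℕ × ℕ))
    (K : Finset (ℕ × ℕ)) : Finset (ℕ × ℕ) :=
  (Finset.range n ×ˢ Finset.range n).filter
    (fun d => OnFace n H f d.1 ∧ OnFace n H f d.2 ∧ rk n H f d ∈ K)

theorem mem_liftCut (hH : IsCut a H) {f : Option (ℕ × ℕ)} (hf : IsFaceOf H f)
    {K : Finset (ℕ × ℕ)} {d : ℕ × ℕ} : d ∈ liftCut a.length H f K ↔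
      OnFace a.length H f d.1 ∧ OnFace a.length H f d.2 ∧ rk a.length H f d ∈ K := by
  rw [liftCut, Finset.mem_filter, and_iff_right_iff_imp, Finset.mem_product, Finset.mem_range,
    Finset.mem_range]
  rintro ⟨h1, h2, -⟩
  have := (hi_le hH hf).2
  exact ⟨lt_of_lt_of_le h1.2.1 this, lt_of_lt_of_le h2.2.1 this⟩

theorem IsFaceOf.of_option (f : Option {c // c ∈ H}) : IsFaceOf H (f.map Subtype.val) := by
  intro c hc
  rcases f with _ | d
  · simp at hc
  · simp only [Option.map_some, Option.some.injEq] at hc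
    exact hc ▸ d.2

theorem IsFaceOf.exists_option {f : Option (ℕ × ℕ)} (hf : IsFaceOf H f) :
    ∃ f' : Option {c // c ∈ H}, f'.map Subtype.val = f := by
  rcases f with _ | c
  · exact ⟨none, rfl⟩
  · exact ⟨some ⟨c, hf c rfl⟩, rfl⟩

open Classical in
/-- The cut which is glued together from a cut `H` and cuts of all faces of `H`. -/
noncomputable def glueCut (n : ℕ) (H : Finset (ℕ × ℕ))
    (K : Option {c // c ∈ H} → Finset (ℕ × ℕ)) : Finset (ℕ × ℕ) :=
  H ∪ Finset.univ.biUnion (fun f => liftCut n H (f.map Subtype.val) (K f))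

theorem mem_glueCut {n : ℕ} {K : Option {c // c ∈ H} → Finset (ℕ × ℕ)} {d : ℕ × ℕ} :
    d ∈ glueCut n H K ↔ d ∈ H ∨ ∃ f, d ∈ liftCut n H (f.map Subtype.val) (K f) := by
  simp [glueCut]

theorem OnFace.outside (hH : IsCut a H) {f : Option (ℕ × ℕ)} (hf : IsFaceOf H f) {x y : ℕ}
    (hx : OnFace a.length H f x) (hy : OnFace a.length H f y) {c : ℕ × ℕ} (hc : c ∈ H)
    (h1 : c.1 ≤ x) (h2 : x ≤ c.2) : c.1 < y ∧ y < c.2 := by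
  have hx1 := hx.ne hH hf hc
  obtain ⟨hx2, hx3, hx4⟩ := hx
  obtain ⟨hy2, hy3, hy4⟩ := hy
  have hlt := hH.lt hc
  have k1 := hx4 c hc
  rcases f with _ | d
  · simp only [Below, lo, hi] at *
    exact (k1 (by omega) (by omega)).elim
  · have hd := isFaceOf_some.1 hf
    by_cases hne : c = d
    · subst hne
      simp only [lo, hi] at *
      omega
    · have htri := hH.tri hc hd hne
      simp only [Below, lo, hi] at *
      by_cases hb : d.1 + 1 ≤ c.1 ∧ c.2 < d.2
      · have := k1 hb
        omega
      · omega

theorem isCut_glueCut (hH : IsCut a H) {K : Option {c // c ∈ H} → Finset (ℕ × ℕ)}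
    (hK : ∀ f, IsCut (faceWord a H (f.map Subtype.val)) (K f)) :
    IsCut a (glueCut a.length H K) := by
  have hsub : ∀ f : Option {c // c ∈ H}, IsSubword a (OnFace a.length H (f.map Subtype.val))
      (faceWord a H (f.map Subtype.val)) := fun f => isSubword_faceWord hH (IsFaceOf.of_option f)
  have hlen : ∀ {f : Option {c // c ∈ H}} {x}, OnFace a.length H (f.map Subtype.val) x →
      x < a.length := fun {f x} hx => lt_of_lt_of_le hx.2.1 (hi_le hH (IsFaceOf.of_option f)).2
  have hlift : ∀ {f : Option {c // c ∈ H}} {d},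
      d ∈ liftCut a.length H (f.map Subtype.val) (K f) →
      OnFace a.length H (f.map Subtype.val) d.1 ∧ OnFace a.length H (f.map Subtype.val) d.2 ∧
        rk a.length H (f.map Subtype.val) d ∈ K f := fun {f d} h =>
    (mem_liftCut hH (IsFaceOf.of_option f)).1 h
  have hpair : ∀ d ∈ glueCut a.length H K, IsPair a d := by
    intro d hd
    rcases mem_glueCut.1 hd with hd | ⟨f, hd⟩
    · exact hH.pair d hd
    · obtain ⟨h1, h2, h3⟩ := hlift hd
      obtain ⟨h4, x, h5, h6⟩ := (hK f).pair _ h3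
      refine ⟨(cnt_lt_iff h1).1 h4, x, ?_, ?_⟩
      · rw [← (hsub f).get _ (hlen h1) h1]
        exact h5
      · rw [← (hsub f).get _ (hlen h2) h2]
        exact h6
  -- two chords are either on the same face or on different sides of a chord of `H`
  have hdiff : ∀ {f g : Option {c // c ∈ H}} {x y}, f ≠ g →
      OnFace a.length H (f.map Subtype.val) x → OnFace a.length H (g.map Subtype.val) y →
      (∃ c ∈ H, (∀ x', OnFace a.length H (f.map Subtype.val) x' → c.1 < x' ∧ x' < c.2) ∧
        ∀ y', OnFace a.length H (g.map Subtype.val) y' → y' < c.1 ∨ c.2 < y') ∨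
      (∃ c ∈ H, (∀ y', OnFace a.length H (g.map Subtype.val) y' → c.1 < y' ∧ y' < c.2) ∧
        ∀ x', OnFace a.length H (f.map Subtype.val) x' → x' < c.1 ∨ c.2 < x') := by
    intro f g x y hfg hx hy
    have hin : ∀ (f g : Option {c // c ∈ H}) (c : {c // c ∈ H}), f = some c → f ≠ g →
        (∃ y', OnFace a.length H (g.map Subtype.val) y' ∧ (y' < c.1.1 ∨ c.1.2 < y')) →
        ∃ c ∈ H, (∀ x', OnFace a.length H (f.map Subtype.val) x' → c.1 < x' ∧ x' < c.2) ∧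
        ∀ y', OnFace a.length H (g.map Subtype.val) y' → y' < c.1 ∨ c.2 < y' := by
      rintro f g c rfl hne ⟨z, hz, hz'⟩
      refine ⟨c.1, c.2, fun x' hx' => ⟨hx'.1, hx'.2.1⟩, fun y' hy' => ?_⟩
      by_contra hcon
      have := hy'.outside hH (IsFaceOf.of_option g) hz c.2 (by omega) (by omega)
      omega
    rcases f with _ | c
    · rcases g with _ | d
      · exact (hfg rfl).elim
      · refine Or.inr (hin _ none d rfl (Ne.symm hfg) ⟨x, hx, ?_⟩)
        have := hx.2.2 d.1 d.2 ⟨by simp [lo], (hH.lt d.2).2⟩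
        omega
    · by_cases hy' : y < c.1.1 ∨ c.1.2 < y
      · exact Or.inl (hin _ g c rfl hfg ⟨y, hy, hy'⟩)
      · rcases g with _ | d
        · have := hy.2.2 c.1 c.2 ⟨by simp [lo], (hH.lt c.2).2⟩
          omega
        · refine Or.inr (hin _ _ d rfl (Ne.symm hfg) ⟨x, hx, ?_⟩)
          have hne : c.1 ≠ d.1 := fun e => hfg (congrArg some (Subtype.ext e))
          have htri := hH.tri c.2 d.2 hne
          have k1 := hx.2.2 d.1 d.2
          have hx1 := hx.1
          have hx2 := hx.2.1
          have hy1 := hy.1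
          have hy2 := hy.2.1
          have k2 := hy.2.2 c.1 c.2
          simp only [Below, Option.map_some, lo, hi] at *
          rcases htri with h | h | h | h
          · omega
          · omega
          · have := k1 (by omega)
            omega
          · have := k2 (by omega)
            omega
  refine ⟨hpair, ?_, ?_⟩
  · intro c hc d hd hne
    rcases mem_glueCut.1 hc with hc | ⟨f, hc⟩ <;> rcases mem_glueCut.1 hd with hd | ⟨g, hd⟩
    · exact hH.distinct c hc d hd hne
    · obtain ⟨h1, h2, -⟩ := hlift hd
      have k1 := h1.ne hH (IsFaceOf.of_option g) hc
      have k2 := h2.ne hH (IsFaceOf.of_option g) hc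
      omega
    · obtain ⟨h1, h2, -⟩ := hlift hc
      have k1 := h1.ne hH (IsFaceOf.of_option f) hd
      have k2 := h2.ne hH (IsFaceOf.of_option f) hd
      omega
    · obtain ⟨h1, h2, h3⟩ := hlift hc
      obtain ⟨h1', h2', h3'⟩ := hlift hd
      by_cases hfg : f = g
      · subst hfg
        have hrk : rk a.length H (f.map Subtype.val) c ≠ rk a.length H (f.map Subtype.val) d := by
          intro e
          exact hne (Prod.ext (cnt_inj h1 h1' (congrArg Prod.fst e))
            (cnt_inj h2 h2' (congrArg Prod.snd e)))
        obtain ⟨e1, e2, e3, e4⟩ := (hK f).distinct _ h3 _ h3' hrk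
        refine ⟨?_, ?_, ?_, ?_⟩
        · exact fun e => e1 (congrArg (cnt (OnFace a.length H (f.map Subtype.val))) e)
        · exact fun e => e2 (congrArg (cnt (OnFace a.length H (f.map Subtype.val))) e)
        · exact fun e => e3 (congrArg (cnt (OnFace a.length H (f.map Subtype.val))) e)
        · exact fun e => e4 (congrArg (cnt (OnFace a.length H (f.map Subtype.val))) e)
      · rcases hdiff hfg h1 h1' with ⟨e, -, h5, h6⟩ | ⟨e, -, h5, h6⟩
        · have := h5 _ h1
          have := h5 _ h2
          have := h6 _ h1'
          have := h6 _ h2'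
          omega
        · have := h5 _ h1'
          have := h5 _ h2'
          have := h6 _ h1
          have := h6 _ h2
          omega
  · intro c hc d hd hcross
    have hc2 := (hpair c hc).1
    have hd2 := (hpair d hd).1
    rcases mem_glueCut.1 hc with hc | ⟨f, hc⟩ <;> rcases mem_glueCut.1 hd with hd | ⟨g, hd⟩
    · exact hH.noncrossing c hc d hd hcross
    · obtain ⟨h1, h2, -⟩ := hlift hd
      have := h1.outside hH (IsFaceOf.of_option g) h2 hc (by omega) (by omega)
      omega
    · obtain ⟨h1, h2, -⟩ := hlift hc
      have := h2.outside hH (IsFaceOf.of_option f) h1 hd (by omega) (by omega)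
      omega
    · obtain ⟨h1, h2, h3⟩ := hlift hc
      obtain ⟨h1', h2', h3'⟩ := hlift hd
      by_cases hfg : f = g
      · subst hfg
        exact (hK f).noncrossing _ h3 _ h3'
          ⟨(cnt_lt_iff h1).2 hcross.1, (cnt_lt_iff h1').2 hcross.2.1,
            (cnt_lt_iff h2).2 hcross.2.2⟩
      · rcases hdiff hfg h1 h1' with ⟨e, -, h5, h6⟩ | ⟨e, -, h5, h6⟩
        · have := h5 _ h1
          have := h5 _ h2
          have := h6 _ h1'
          have := h6 _ h2'
          omega
        · have := h5 _ h1'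
          have := h5 _ h2'
          have := h6 _ h1
          have := h6 _ h2
          omega

theorem faceCut_glueCut (hH : IsCut a H) {K : Option {c // c ∈ H} → Finset (ℕ × ℕ)}
    (hK : ∀ f, IsCut (faceWord a H (f.map Subtype.val)) (K f)) (f : Option {c // c ∈ H}) :
    faceCut a.length (glueCut a.length H K) H (f.map Subtype.val) = K f := by
  have hf := IsFaceOf.of_option f
  rw [faceCut_eq_image]
  ext r
  rw [Finset.mem_image]
  constructor
  · rintro ⟨d, hd, rfl⟩
    rw [mem_onCut] at hd
    obtain ⟨hd, h1, h2⟩ := hd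
    rcases mem_glueCut.1 hd with hd | ⟨g, hd⟩
    · exact ((h1.ne hH hf hd).1 rfl).elim
    · rw [mem_liftCut hH (IsFaceOf.of_option g)] at hd
      have he := hd.1.unique hH (IsFaceOf.of_option g) hf h1
      have : g = f := Option.map_injective Subtype.val_injective he
      exact this ▸ hd.2.2
  · intro hr
    obtain ⟨hlt, hlen⟩ := (hK f).lt hr
    rw [(isSubword_faceWord hH hf).length] at hlen
    obtain ⟨x, hx, hxf, hxr⟩ := exists_of_lt_cnt (lt_trans hlt hlen)
    obtain ⟨y, hy, hyf, hyr⟩ := exists_of_lt_cnt hlen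
    have he : rk a.length H (f.map Subtype.val) (x, y) = r := Prod.ext hxr hyr
    refine ⟨(x, y), mem_onCut.2 ⟨mem_glueCut.2 (Or.inr ⟨f, ?_⟩), hxf, hyf⟩, he⟩
    rw [mem_liftCut hH hf]
    exact ⟨hxf, hyf, he.symm ▸ hr⟩

/-- A cut which contains `H` amounts to a family of cuts of the faces of `H`. -/
theorem sum_cuts_superset {M : Type*} [AddCommMonoid M] (hH : IsCut a H)
    (F : (Option {c // c ∈ H} → Finset (ℕ × ℕ)) → M) :
    ∑ G ∈ (cuts a).filter (H ⊆ ·), F (fun f => faceCut a.length G H (f.map Subtype.val)) =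
      ∑ K ∈ Fintype.piFinset (fun f : Option {c // c ∈ H} =>
        cuts (faceWord a H (f.map Subtype.val))), F K := by
  refine Finset.sum_bij (fun G _ f => faceCut a.length G H (f.map Subtype.val)) ?_ ?_ ?_
    (fun _ _ => rfl)
  · intro G hG
    rw [Finset.mem_filter, mem_cuts] at hG
    rw [Fintype.mem_piFinset]
    intro f
    rw [mem_cuts]
    exact isCut_face hG.1 (fun c hc => hG.2 (IsFaceOf.of_option f c hc))
  · intro G hG G' hG' h
    rw [Finset.mem_filter, mem_cuts] at hG hG'
    have hall : ∀ f, IsFaceOf H f → faceCut a.length G H f = faceCut a.length G' H f := by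
      intro f hf
      obtain ⟨f', rfl⟩ := hf.exists_option
      exact congrFun h f'
    exact Finset.Subset.antisymm (subset_of_faceCut_eq hG.1 hG.2 hG'.2 hall)
      (subset_of_faceCut_eq hG'.1 hG'.2 hG.2 fun f hf => (hall f hf).symm)
  · intro K hK
    rw [Fintype.mem_piFinset] at hK
    have hK' := fun f => mem_cuts.1 (hK f)
    refine ⟨glueCut a.length H K, ?_, funext fun f => faceCut_glueCut hH hK' f⟩
    rw [Finset.mem_filter, mem_cuts]
    exact ⟨isCut_glueCut hH hK', fun c hc => mem_glueCut.2 (Or.inl hc)⟩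

/-- A sum over pairs, as a sum over families. -/
theorem sum_piFinset_option_singleton {M β : Type*} [AddCommMonoid M] {c : ℕ × ℕ}
    (t : Option {d // d ∈ ({c} : Finset (ℕ × ℕ))} → Finset β) (F : β → β → M) :
    ∑ K ∈ Fintype.piFinset t, F (K (some ⟨c, Finset.mem_singleton_self c⟩)) (K none) =
      ∑ p ∈ t (some ⟨c, Finset.mem_singleton_self c⟩), ∑ q ∈ t none, F p q := by
  have hall : ∀ d : {d // d ∈ ({c} : Finset (ℕ × ℕ))}, d = ⟨c, Finset.mem_singleton_self c⟩ :=
    fun d => Subtype.ext (Finset.mem_singleton.1 d.2)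
  rw [← Finset.sum_product']
  refine Finset.sum_bij' (fun K _ => (K (some ⟨c, Finset.mem_singleton_self c⟩), K none))
    (fun p _ f => f.elim p.2 (fun _ => p.1)) ?_ ?_ ?_ ?_ (fun _ _ => rfl)
  · intro K hK
    rw [Fintype.mem_piFinset] at hK
    exact Finset.mem_product.2 ⟨hK _, hK _⟩
  · intro p hp
    rw [Finset.mem_product] at hp
    rw [Fintype.mem_piFinset]
    intro f
    rcases f with _ | d
    · exact hp.2
    · rw [hall d]
      exact hp.1
  · intro K hK
    funext f
    rcases f with _ | d
    · rfl
    · rw [hall d]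
      rfl
  · intro p hp
    rfl

end Gluing

section PathToChord

variable {I : Type u} [Quiver.{v} I]

open Classical in
/-- The path `X` with the cut `G`; the cut is dropped if it is not one. -/
noncomputable def QPath.chord (X : QPath I) (G : Finset (ℕ × ℕ)) : PathChord I :=
  if h : IsCut X.arrows G then ⟨X, G, h⟩ else ⟨X, ∅, ⟨by simp, by simp, by simp⟩⟩

/-- The path which remains in the face `f` of `H`. -/
noncomputable def QPath.piece (X : QPath I) (H : Finset (ℕ × ℕ)) (f : Option (ℕ × ℕ)) : QPath I :=
  ((X.chord H).piece H f).path

variable {X : QPath I} {G H : Finset (ℕ × ℕ)} {f : Option (ℕ × ℕ)}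

theorem QPath.chord_path : (X.chord G).path = X := by
  unfold QPath.chord
  split <;> rfl

theorem QPath.chord_cut (hG : IsCut X.arrows G) : (X.chord G).cut = G := by
  rw [QPath.chord, dif_pos hG]

theorem QPath.chord_eq (hG : IsCut X.arrows G) : X.chord G = ⟨X, G, hG⟩ := by
  rw [QPath.chord, dif_pos hG]

theorem PathChord.chord_eq (D : PathChord I) : D.path.chord D.cut = D := by
  rw [QPath.chord_eq D.isCut]

theorem PathChord.piece_path {D : PathChord I} (hH : H ⊆ D.cut) (hf : IsFaceOf H f) :
    (D.piece H f).path = D.path.piece H f := by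
  have hc := D.isCut.mono hH
  have hf' : IsFaceOf D.cut f := fun c h => hH (hf c h)
  have h1 : H ⊆ (D.path.chord H).cut := (QPath.chord_cut hc).symm ▸ Finset.Subset.refl H
  have h2 : IsFaceOf (D.path.chord H).cut f := (QPath.chord_cut hc).symm ▸ hf
  unfold QPath.piece
  apply QPath.ext
  · rw [PathChord.piece_path_src hH hf', PathChord.piece_path_src h1 h2, QPath.chord_path]
  · rw [PathChord.piece_path_tgt hH hf', PathChord.piece_path_tgt h1 h2, QPath.chord_path]
  · rw [PathChord.piece_arrows hH hf', PathChord.piece_arrows h1 h2, QPath.chord_path]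

theorem QPath.piece_arrows (hH : IsCut X.arrows H) (hf : IsFaceOf H f) :
    (X.piece H f).arrows = faceWord X.arrows H f := by
  rw [QPath.piece, PathChord.piece_arrows _ _, QPath.chord_path]
  · rw [QPath.chord_cut hH]
  · rwa [QPath.chord_cut hH]

theorem QPath.chord_piece (hG : IsCut X.arrows G) (hH : H ⊆ G) (hf : IsFaceOf H f) :
    (X.chord G).piece H f = (X.piece H f).chord (faceCut X.arrows.length G H f) := by
  have h1 : H ⊆ (X.chord G).cut := (QPath.chord_cut hG).symm ▸ hH
  have h2 : IsFaceOf (X.chord G).cut f := fun c h => h1 (hf c h)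
  have h3 : ((X.chord G).piece H f).cut = faceCut X.arrows.length G H f := by
    rw [PathChord.piece_cut h1 h2, faceCut_eq_image, PathChord.on, QPath.chord_path,
      QPath.chord_cut hG, PathChord.rk, QPath.chord_path]
  rw [← PathChord.chord_eq ((X.chord G).piece H f), h3, PathChord.piece_path h1 hf,
    QPath.chord_path]

variable {k : Type w} [CommRing k]

variable (k) in
/-- The sign of a set of chords on a path. -/
noncomputable def QPath.sg (X : QPath I) (H : Finset (ℕ × ℕ)) : k :=
  ∏ c ∈ H, ((-omegaAt X.arrows c : ℤ) : k)

theorem QPath.chord_sg : (X.chord G).sg k H = X.sg k H := by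
  simp only [PathChord.sg, QPath.sg, PathChord.sgn, QPath.chord_path]

theorem sRtOn_eq (X : QPath I) : sRtOn k X = ∑ G ∈ cuts X.arrows, bas k (X.chord G) := by
  refine Eq.trans ?_ (Finset.sum_coe_sort (cuts X.arrows) (fun G => bas k (X.chord G)))
  refine Finset.sum_congr rfl fun H _ => ?_
  rw [QPath.chord_eq (mem_cuts.1 H.2)]
  rfl

theorem sRt_bas (X : QPath I) : sRt k (bas k X) = ∑ G ∈ cuts X.arrows, bas k (X.chord G) := by
  rw [← sRtOn_eq]
  simp [sRt]

theorem sum_cuts_faces {M : Type*} [AddCommMonoid M] (hH : IsCut X.arrows H)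
    (F : (Option {c // c ∈ H} → PathChord I) → M) :
    ∑ G ∈ (cuts X.arrows).filter (H ⊆ ·),
        F (fun f => (X.chord G).piece H (f.map Subtype.val)) =
      ∑ K ∈ Fintype.piFinset (fun f : Option {c // c ∈ H} =>
        cuts (X.piece H (f.map Subtype.val)).arrows),
        F (fun f => (X.piece H (f.map Subtype.val)).chord (K f)) := by
  have h1 := sum_cuts_superset hH (fun K => F (fun f => (X.piece H (f.map Subtype.val)).chord (K f)))
  have h2 : (fun f : Option {c // c ∈ H} => cuts (X.piece H (f.map Subtype.val)).arrows) =
      fun f => cuts (faceWord X.arrows H (f.map Subtype.val)) := by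
    funext f
    rw [QPath.piece_arrows hH (IsFaceOf.of_option f)]
  rw [h2, ← h1]
  refine Finset.sum_congr rfl fun G hG => ?_
  rw [Finset.mem_filter, mem_cuts] at hG
  congr 1
  funext f
  rw [QPath.chord_piece hG.1 hG.2 (IsFaceOf.of_option f)]

theorem IsPair.isCut_singleton {a : List (DArrow I)} {c : ℕ × ℕ} (hc : IsPair a c) :
    IsCut a {c} := by
  refine ⟨?_, ?_, ?_⟩
  · intro d hd
    rw [Finset.mem_singleton] at hd
    exact hd ▸ hc
  · intro d hd e he hne
    rw [Finset.mem_singleton] at hd he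
    exact absurd (hd.trans he.symm) hne
  · intro d hd e he h
    rw [Finset.mem_singleton] at hd he
    subst hd
    subst he
    exact lt_irrefl _ h.1

theorem pathComulOn_eq (X : QPath I) :
    pathComulOn k X = ∑ c ∈ pairs X.arrows, ((-omegaAt X.arrows c : ℤ) : k) •
      (bas k (X.piece {c} (some c)) ⊗ₜ[k] bas k (X.piece {c} none)) := by
  refine Eq.trans ?_ (Finset.sum_coe_sort (pairs X.arrows) (fun c =>
    ((-omegaAt X.arrows c : ℤ) : k) •
      (bas k (X.piece {c} (some c)) ⊗ₜ[k] bas k (X.piece {c} none))))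
  refine Finset.sum_congr rfl fun c _ => ?_
  have h1 : X.inner c = X.piece {c.1} (some c.1) := by
    rw [QPath.inner, PathChord.inner_eq_piece]
    exact PathChord.piece_path (D := X.withPair c) (Finset.Subset.refl _)
      (isFaceOf_some.2 (Finset.mem_singleton_self _))
  have h2 : X.outer c = X.piece {c.1} none := by
    rw [QPath.outer, PathChord.outer_eq_piece]
    exact PathChord.piece_path (D := X.withPair c) (Finset.Subset.refl _) isFaceOf_none
  rw [h1, h2]
  exact (Int.cast_smul_eq_zsmul k _ _).symm

theorem IsCut.subset_pairs {a : List (DArrow I)} {H : Finset (ℕ × ℕ)} (h : IsCut a H) :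
    H ⊆ pairs a := fun c hc => mem_pairs.2 (h.pair c hc)

/-- `S_rt` commutes with the comultiplications, for an arbitrary comultiplication given by the
formula for `δ_{p,rt}`. -/
theorem IsChordComul.comul_sum_cuts {M : Type*} [AddCommGroup M] [Module k M] {b : PathChord I → M}
    {δ : M →ₗ[k] M ⊗[k] M} (hδ : IsChordComul b δ) (X : QPath I) :
    δ (∑ G ∈ cuts X.arrows, b (X.chord G)) = ∑ c ∈ pairs X.arrows,
      ((-omegaAt X.arrows c : ℤ) : k) •
        ((∑ G ∈ cuts (X.piece {c} (some c)).arrows, b ((X.piece {c} (some c)).chord G)) ⊗ₜ[k]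
          (∑ G ∈ cuts (X.piece {c} none).arrows, b ((X.piece {c} none).chord G))) := by
  have h1 : ∀ G ∈ cuts X.arrows, δ (b (X.chord G)) = ∑ c ∈ G, ((-omegaAt X.arrows c : ℤ) : k) •
      (b ((X.chord G).piece {c} (some c)) ⊗ₜ[k] b ((X.chord G).piece {c} none)) := by
    intro G hG
    rw [hδ, QPath.chord_cut (mem_cuts.1 hG)]
    simp only [PathChord.sgn, QPath.chord_path]
  rw [map_sum, Finset.sum_congr rfl h1,
    Finset.sum_comm' (t' := pairs X.arrows) (s' := fun c => (cuts X.arrows).filter ({c} ⊆ ·))]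
  · refine Finset.sum_congr rfl fun c hc => ?_
    have hcut := (mem_pairs.1 hc).isCut_singleton
    rw [← Finset.smul_sum]
    congr 1
    have h2 := sum_cuts_faces hcut (fun P => b (P (some ⟨c, Finset.mem_singleton_self c⟩)) ⊗ₜ[k]
      b (P none))
    refine h2.trans ?_
    have h3 := sum_piFinset_option_singleton (c := c)
      (fun f => cuts (X.piece {c} (f.map Subtype.val)).arrows)
      (fun p q => b ((X.piece {c} (some c)).chord p) ⊗ₜ[k] b ((X.piece {c} none).chord q))
    refine h3.trans ?_
    rw [TensorProduct.sum_tmul]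
    refine Finset.sum_congr rfl fun p _ => ?_
    rw [TensorProduct.tmul_sum]
    rfl
  · intro G c
    rw [Finset.mem_filter, Finset.singleton_subset_iff]
    exact ⟨fun h => ⟨⟨h.1, h.2⟩, (mem_cuts.1 h.1).subset_pairs h.2⟩, fun h => h.1⟩

theorem sRt_isComulHom : IsComulHom (pathComul k (I := I)) (chordComul k) (sRt k) := by
  apply Finsupp.lhom_ext'
  intro X
  apply LinearMap.ext_ring
  change TensorProduct.map (sRt k) (sRt k) (pathComul k (bas k X)) =
    chordComul k (sRt k (bas k X))
  have h1 : pathComul k (bas k X) = pathComulOn k X := by simp [pathComul]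
  rw [h1, sRt_bas, chordComul_isChordComul.comul_sum_cuts, pathComulOn_eq, map_sum]
  refine Finset.sum_congr rfl fun c _ => ?_
  rw [map_smul, TensorProduct.map_tmul, sRt_bas, sRt_bas]

theorem etaRt_eq : etaRt k (I := I) = dRt k ∘ₗ sRt k := by
  apply Finsupp.lhom_ext'
  intro X
  apply LinearMap.ext_ring
  change etaRt k (bas k X) = dRt k (sRt k (bas k X))
  have h1 : sRt k (bas k X) = sRtOn k X := by simp [sRt]
  rw [h1, sRtOn, map_sum]
  simp [etaRt, dRt, dRtOn]

/-! ### Injectivity -/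

variable (k) in
open Classical in
/-- The projection to the chord diagrams without chords. -/
noncomputable def forgetRt : (PathChord I →₀ k) →ₗ[k] (QPath I →₀ k) :=
  Finsupp.linearCombination k (fun D => if D.cut = ∅ then bas k D.path else 0)

theorem isCut_empty (a : List (DArrow I)) : IsCut a ∅ := ⟨by simp, by simp, by simp⟩

theorem forgetRt_sRt : forgetRt k ∘ₗ sRt k (I := I) = LinearMap.id := by
  apply Finsupp.lhom_ext'
  intro X
  apply LinearMap.ext_ring
  change forgetRt k (sRt k (bas k X)) = bas k X
  rw [sRt_bas, map_sum, Finset.sum_eq_single_of_mem ∅ (mem_cuts.2 (isCut_empty _))]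
  · simp [forgetRt, QPath.chord_cut (isCut_empty _), QPath.chord_path]
  · intro G hG hne
    simp [forgetRt, QPath.chord_cut (mem_cuts.1 hG), hne]

theorem sRt_injective : Function.Injective (sRt k (I := I)) :=
  Function.LeftInverse.injective (g := forgetRt k) (LinearMap.congr_fun forgetRt_sRt)

theorem symMap_comp {B C E : Type*} (f : (B →₀ k) →ₗ[k] (C →₀ k)) (g : (C →₀ k) →ₗ[k] (E →₀ k)) :
    symMap (g ∘ₗ f) = (symMap g).comp (symMap f) := by
  apply SymmetricAlgebra.algHom_ext
  ext b
  simp [symMap]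

theorem symMap_id {B : Type*} : symMap (LinearMap.id : (B →₀ k) →ₗ[k] (B →₀ k)) = AlgHom.id k _ := by
  apply SymmetricAlgebra.algHom_ext
  ext b
  simp [symMap]

theorem symMap_sRt_injective : Function.Injective (symMap (sRt k (I := I))) := by
  refine Function.LeftInverse.injective (g := symMap (forgetRt k)) fun x => ?_
  have h := symMap_comp (sRt k (I := I)) (forgetRt k)
  rw [forgetRt_sRt, symMap_id] at h
  exact (AlgHom.congr_fun h x).symm

end PathToChord

section PathCoproduct

variable {k : Type w} [CommRing k] {I : Type u} [Quiver.{v} I]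

open Classical in
/-- The simple cuts of a path, as sets of pairs of positions. -/
noncomputable def QPath.simple (X : QPath I) : Finset (Finset (ℕ × ℕ)) :=
  (cuts X.arrows).filter (IsAntichain nest)

theorem QPath.mem_simple {X : QPath I} {H : Finset (ℕ × ℕ)} :
    H ∈ X.simple ↔ IsCut X.arrows H ∧ IsAntichain nest H := by
  simp [QPath.simple, mem_cuts]

theorem QPath.mem_simpleCuts {X : QPath I} {H : X.Cut} : H ∈ X.simpleCuts ↔ H.1 ∈ X.simple := by
  classical
  rw [QPath.mem_simple, QPath.simpleCuts, Finset.mem_filter]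
  constructor
  · rintro ⟨-, h⟩
    refine ⟨mem_cuts.1 H.2, ?_⟩
    intro c hc d hd
    exact h ⟨c, hc⟩ (Finset.mem_univ _) ⟨d, hd⟩ (Finset.mem_univ _)
  · rintro ⟨-, h⟩
    refine ⟨Finset.mem_univ _, ?_⟩
    intro c _ d _
    exact h c.1 c.2 d.1 d.2

theorem PathChord.rawCut_univ (D : PathChord I) : D.rawCut Finset.univ = D.cut := by
  ext c
  simp [PathChord.rawCut]

theorem pathCoprodOn_eq (X : QPath I) : pathCoprodOn k X = gen X ⊗ₜ[k] 1 +
    ∑ H ∈ X.simple, X.sg k H •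
      ((∏ c ∈ H, gen (X.piece H (some c))) ⊗ₜ[k] gen (X.piece H none)) := by
  rw [pathCoprodOn]
  congr 1
  refine Finset.sum_bij (fun H _ => H.1) (fun H hH => QPath.mem_simpleCuts.1 hH)
    (fun H _ H' _ h => Subtype.ext h) ?_ ?_
  · intro H hH
    have hc := mem_cuts.2 (QPath.mem_simple.1 hH).1
    exact ⟨⟨H, hc⟩, QPath.mem_simpleCuts.2 hH, rfl⟩
  · intro H _
    have hcut := mem_cuts.1 H.2
    have hface : ∀ f : Option (X.withCut H).Chord, ((X.withCut H).face Finset.univ f).path =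
        X.piece H.1 ((X.withCut H).rawFace f) := by
      intro f
      rw [PathChord.face_eq_piece, PathChord.rawCut_univ]
      exact PathChord.piece_path (D := X.withCut H) (Finset.Subset.refl _)
        ((X.withCut H).rawFace_isFaceOf f)
    have h1 : ∏ c : (X.withCut H).Chord,
        gen (k := k) ((X.withCut H).face Finset.univ (some c)).path =
        ∏ c ∈ H.1, gen (X.piece H.1 (some c)) := by
      refine Eq.trans ?_ (Finset.prod_coe_sort H.1 (fun c => gen (k := k) (X.piece H.1 (some c))))
      refine Finset.prod_congr rfl fun c _ => ?_
      rw [hface]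
      rfl
    have h2 : X.sg k H.1 = (((X.withCut H).eps Finset.univ : ℤ) : k) := by
      rw [PathChord.eps_cast, PathChord.rawCut_univ]
      rfl
    rw [h1, hface, h2]
    exact (Int.cast_smul_eq_zsmul k _ _).symm

/-- The weight of a path. -/
def QPath.wt (X : QPath I) : ℕ := X.arrows.length + 1

theorem pathCoprod_gen (X : QPath I) : pathCoprod k (gen X) = pathCoprodOn k X := by
  rw [pathCoprod, symLift_gen]

theorem pathCoprod_gen_mem (X : QPath I) :
    pathCoprod k (gen X) ∈ symFil₂ k QPath.wt X.wt := by
  rw [pathCoprod_gen, pathCoprodOn_eq]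
  refine add_mem (tmul_mem_symFil₂ (gen_mem_symFil X) (one_mem_symFil 0) le_rfl) ?_
  refine Submodule.sum_mem _ fun H hH => Submodule.smul_mem _ _ ?_
  have hH := (QPath.mem_simple.1 hH).1
  refine tmul_mem_symFil₂ (prod_mem_symFil _ _) (gen_mem_symFil _) ?_
  have h := sum_length_faceWord_le hH
  unfold QPath.wt
  rw [QPath.piece_arrows hH isFaceOf_none]
  have h1 : ∑ c ∈ H, ((X.piece H (some c)).arrows.length + 1) =
      ∑ c ∈ H, ((faceWord X.arrows H (some c)).length + 1) :=
    Finset.sum_congr rfl fun c hc => by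
      rw [QPath.piece_arrows hH (isFaceOf_some.2 hc)]
  rw [h1]
  exact h

theorem symMap_sRt_gen (X : QPath I) :
    symMap (sRt k) (gen X) = ∑ G ∈ cuts X.arrows, gen (k := k) (X.chord G) := by
  rw [symMap_gen, sRt_bas, map_sum]
  rfl

theorem prod_option_tmul {A ι : Type*} [CommRing A] [Algebra k A] [Fintype ι]
    (x : Option ι → A) : (∏ c : ι, x (some c)) ⊗ₜ[k] x none =
      ∏ f : Option ι, (f.elim (Algebra.TensorProduct.includeRight : A →ₐ[k] A ⊗[k] A)
        (fun _ => Algebra.TensorProduct.includeLeft)) (x f) := by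
  rw [Fintype.prod_option]
  simp only [Option.elim_none, Option.elim_some]
  rw [← map_prod (Algebra.TensorProduct.includeLeft : A →ₐ[k] A ⊗[k] A),
    Algebra.TensorProduct.includeLeft_apply, Algebra.TensorProduct.includeRight_apply,
    Algebra.TensorProduct.tmul_mul_tmul, one_mul, mul_one]

/-- The coproduct of the sum of all chord diagrams on a path. -/
theorem IsChordCoprod.comul_sum_cuts {A : Type*} [CommRing A] [Algebra k A] {g : PathChord I → A}
    {Δ : A →ₐ[k] A ⊗[k] A} (h : IsChordCoprod g Δ) (X : QPath I) :
    Δ (∑ G ∈ cuts X.arrows, g (X.chord G)) =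
      (∑ G ∈ cuts X.arrows, g (X.chord G)) ⊗ₜ[k] 1 + ∑ H ∈ X.simple, X.sg k H •
        ((∏ c ∈ H, ∑ G ∈ cuts (X.piece H (some c)).arrows, g ((X.piece H (some c)).chord G)) ⊗ₜ[k]
          (∑ G ∈ cuts (X.piece H none).arrows, g ((X.piece H none).chord G))) := by
  have h1 : ∀ G ∈ cuts X.arrows, Δ (g (X.chord G)) = g (X.chord G) ⊗ₜ[k] 1 +
      ∑ H ∈ antichains nest G, X.sg k H •
        ((∏ c ∈ H, g ((X.chord G).piece H (some c))) ⊗ₜ[k] g ((X.chord G).piece H none)) := by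
    intro G hG
    rw [h, QPath.chord_cut (mem_cuts.1 hG)]
    simp only [QPath.chord_sg]
  rw [map_sum, Finset.sum_congr rfl h1, Finset.sum_add_distrib, TensorProduct.sum_tmul,
    Finset.sum_comm' (t' := X.simple) (s' := fun H => (cuts X.arrows).filter (H ⊆ ·))]
  · congr 1
    refine Finset.sum_congr rfl fun H hH => ?_
    have hcut := (QPath.mem_simple.1 hH).1
    rw [← Finset.smul_sum]
    congr 1
    have h2 := sum_cuts_faces hcut (fun P => (∏ c : {c // c ∈ H}, g (P (some c))) ⊗ₜ[k] g (P none))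
    have h3 : ∀ G, ∏ c : {c // c ∈ H}, g ((X.chord G).piece H ((some c).map Subtype.val)) =
        ∏ c ∈ H, g ((X.chord G).piece H (some c)) := fun G =>
      Finset.prod_coe_sort H (fun c => g ((X.chord G).piece H (some c)))
    simp only [h3] at h2
    refine h2.trans ?_
    have h4 : ∏ c ∈ H, ∑ G ∈ cuts (X.piece H (some c)).arrows, g ((X.piece H (some c)).chord G) =
        ∏ c : {c // c ∈ H}, ∑ G ∈ cuts (X.piece H ((some c).map Subtype.val)).arrows,
          g ((X.piece H ((some c).map Subtype.val)).chord G) :=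
      (Finset.prod_coe_sort H (fun c => ∑ G ∈ cuts (X.piece H (some c)).arrows,
        g ((X.piece H (some c)).chord G))).symm
    have h5 := prod_option_tmul (k := k) (fun f : Option {c // c ∈ H} =>
      ∑ G ∈ cuts (X.piece H (f.map Subtype.val)).arrows,
          g ((X.piece H (f.map Subtype.val)).chord G))
    rw [h4]
    refine Eq.trans ?_ h5.symm
    simp only [map_sum]
    rw [Finset.prod_univ_sum]
    refine Finset.sum_congr rfl fun K _ => ?_
    exact prod_option_tmul (k := k) (fun f : Option {c // c ∈ H} =>
      g ((X.piece H (f.map Subtype.val)).chord (K f)))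
  · intro G H
    rw [Finset.mem_filter, mem_antichains, QPath.mem_simple]
    exact ⟨fun h => ⟨⟨h.1, h.2.1⟩, (mem_cuts.1 h.1).mono h.2.1, h.2.2⟩,
      fun h => ⟨h.1.1, h.1.2, h.2.2⟩⟩

theorem symMap_sRt_comul :
    (Algebra.TensorProduct.map (symMap (sRt k)) (symMap (sRt k))).comp (pathCoprod k (I := I)) =
      (chordCoprod k).comp (symMap (sRt k)) := by
  refine sym_algHom_ext (A := Sym k (PathChord I) ⊗[k] Sym k (PathChord I)) fun X => ?_
  change Algebra.TensorProduct.map (symMap (sRt k)) (symMap (sRt k)) (pathCoprod k (gen X)) =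
    chordCoprod k (symMap (sRt k) (gen X))
  rw [pathCoprod_gen, pathCoprodOn_eq, symMap_sRt_gen, chordCoprod_isChordCoprod.comul_sum_cuts,
    map_add, map_sum, Algebra.TensorProduct.map_tmul, symMap_sRt_gen, map_one]
  congr 1
  refine Finset.sum_congr rfl fun H _ => ?_
  rw [map_smul, Algebra.TensorProduct.map_tmul, map_prod, symMap_sRt_gen,
    Finset.prod_congr rfl fun c _ => symMap_sRt_gen (X.piece H (some c))]

theorem symMap_sRt_isHopfHom : IsHopfHom
    (pathCoprod k (I := I)) symCounit (symAntipode (pathCoprod k)).toLinearMap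
    (chordCoprod k) symCounit (symAntipode (chordCoprod k)).toLinearMap (symMap (sRt k)) := by
  refine isHopfHom_symMap symMap_sRt_comul (fun X => ⟨X.wt, fun n hn => ?_⟩)
    (fun X D _ => ⟨D.wt, fun n hn => mulReducedPow_chordCoprod hn⟩)
  exact mulReducedPow_gen_eq_zero (fun _ => Nat.succ_pos _) pathCoprod_gen_mem hn

end PathCoproduct

section TreeIso

variable {Λ : Type w'}

theorem RibbonTree.graph_adj_iff {S T : RibbonTree Λ} {i : S.V → T.V} (hi : Function.Injective i)
    (harrow : ∀ a b, S.arrow a b ↔ T.arrow (i a) (i b)) (a b : S.V) :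
    S.graph.Adj a b ↔ T.graph.Adj (i a) (i b) := by
  simp only [RibbonTree.graph, SimpleGraph.fromRel_adj, harrow, ne_eq, hi.eq_iff]

theorem RibbonTree.exists_equiv_comp {S T : RibbonTree Λ} {E : Set (Sym2 T.V)} {x : T.V}
    {i : S.V → T.V} (hi : Function.Injective i)
    (hr : ∀ y, (T.graph.deleteEdges E).Reachable x y ↔ y ∈ Set.range i)
    (harrow : ∀ a b, S.arrow a b ↔ T.arrow (i a) (i b))
    (hcyc : ∀ x a b c, S.cyc x a b c ↔ T.cyc (i x) (i a) (i b) (i c))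
    (hlabel : ∀ a, S.label a = T.label (i a)) :
    ∃ φ : S.V ≃ (T.comp E x).V, S.IsIso (T.comp E x) φ ∧ ∀ a, (φ a).1 = i a := by
  refine ⟨Equiv.ofBijective (fun a => (⟨i a, (hr _).2 ⟨a, rfl⟩⟩ : (T.comp E x).V)) ⟨?_, ?_⟩,
    ⟨?_, ?_, ?_⟩, ?_⟩
  · intro a b h
    exact hi (congrArg Subtype.val h)
  · rintro ⟨y, hy⟩
    obtain ⟨a, rfl⟩ := (hr y).1 hy
    exact ⟨a, rfl⟩
  · intro a b
    exact (harrow a b).symm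
  · intro x a b c
    exact (hcyc x a b c).symm
  · intro a
    exact (hlabel a).symm
  · intro a
    rfl

theorem RibbonTree.iso_comp {S T : RibbonTree Λ} {E : Set (Sym2 T.V)} {x : T.V}
    {i : S.V → T.V} (hi : Function.Injective i)
    (hr : ∀ y, (T.graph.deleteEdges E).Reachable x y ↔ y ∈ Set.range i)
    (harrow : ∀ a b, S.arrow a b ↔ T.arrow (i a) (i b))
    (hcyc : ∀ x a b c, S.cyc x a b c ↔ T.cyc (i x) (i a) (i b) (i c))
    (hlabel : ∀ a, S.label a = T.label (i a)) : S.Iso (T.comp E x) := by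
  obtain ⟨φ, hφ, -⟩ := RibbonTree.exists_equiv_comp hi hr harrow hcyc hlabel
  exact ⟨φ, hφ⟩

theorem RootedTree.iso_trunk {S T : RootedTree Λ} {H : Set T.Edge}
    {i : S.V → T.V} (hi : Function.Injective i)
    (hr : ∀ y, (T.graph.deleteEdges (T.edgeSym H)).Reachable T.root y ↔ y ∈ Set.range i)
    (harrow : ∀ a b, S.arrow a b ↔ T.arrow (i a) (i b))
    (hcyc : ∀ x a b c, S.cyc x a b c ↔ T.cyc (i x) (i a) (i b) (i c))
    (hlabel : ∀ a, S.label a = T.label (i a)) (hroot : i S.root = T.root)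
    (hlt : ∀ a b, S.lt a b ↔ T.lt (i a) (i b)) : S.Iso (T.trunk H) := by
  obtain ⟨φ, hφ, hφi⟩ := RibbonTree.exists_equiv_comp hi hr harrow hcyc hlabel
  refine ⟨φ, hφ, ?_, ?_⟩
  · exact Subtype.ext ((hφi _).trans hroot)
  · intro a b
    change T.lt (φ a).1 (φ b).1 ↔ _
    rw [hφi, hφi, hlt]

theorem RootedTree.iso_branch {S T : RootedTree Λ} {H : Set T.Edge} {e : T.Edge} (he : e ∈ H)
    {i : S.V → T.V} (hi : Function.Injective i)
    (hr : ∀ y, (T.graph.deleteEdges (T.edgeSym H)).Reachable e.1.2 y ↔ y ∈ Set.range i)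
    (harrow : ∀ a b, S.arrow a b ↔ T.arrow (i a) (i b))
    (hcyc : ∀ x a b c, S.cyc x a b c ↔ T.cyc (i x) (i a) (i b) (i c))
    (hlabel : ∀ a, S.label a = T.label (i a)) (hroot : i S.root = e.1.2)
    (hlt : ∀ a b, S.lt a b ↔ T.cyc e.1.2 e.1.1 (i a) (i b)) : S.Iso (T.branch H e he) := by
  obtain ⟨φ, hφ, hφi⟩ := RibbonTree.exists_equiv_comp hi hr harrow hcyc hlabel
  refine ⟨φ, hφ, ?_, ?_⟩
  · exact Subtype.ext ((hφi _).trans hroot)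
  · intro a b
    change T.cyc e.1.2 e.1.1 (φ a).1 (φ b).1 ↔ _
    rw [hφi, hφi, hlt]

theorem dist_le_of_hom {V V' : Type} {G : SimpleGraph V} {G' : SimpleGraph V'} (hG : G.Connected)
    (φ : G →g G') (x y : V) : G'.dist (φ x) (φ y) ≤ G.dist x y := by
  obtain ⟨p, hp⟩ := hG.exists_walk_length_eq_dist x y
  rw [← hp, ← SimpleGraph.Walk.length_map φ p]
  exact SimpleGraph.dist_le _

theorem dist_iso {V V' : Type} {G : SimpleGraph V} {G' : SimpleGraph V'} (hG : G.Connected)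
    (hG' : G'.Connected) (φ : G ≃g G') (x y : V) : G'.dist (φ x) (φ y) = G.dist x y := by
  refine le_antisymm (dist_le_of_hom hG φ.toHom x y) ?_
  have h := dist_le_of_hom hG' φ.symm.toHom (φ x) (φ y)
  simpa using h

theorem reachable_deleteEdges_iff {V V' : Type} {G : SimpleGraph V} {G' : SimpleGraph V'}
    (φ : V ≃ V') (h : ∀ a b, G'.Adj (φ a) (φ b) ↔ G.Adj a b) {E : Set (Sym2 V)}
    {E' : Set (Sym2 V')} (hE : ∀ a b, s(φ a, φ b) ∈ E' ↔ s(a, b) ∈ E) (x y : V) :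
    (G'.deleteEdges E').Reachable (φ x) (φ y) ↔ (G.deleteEdges E).Reachable x y := by
  let ψ : G.deleteEdges E ≃g G'.deleteEdges E' :=
    { toEquiv := φ
      map_rel_iff' := by
        intro a b
        rw [SimpleGraph.deleteEdges_adj, SimpleGraph.deleteEdges_adj, h, hE] }
  exact ψ.reachable_iff

section

variable {T T' : RibbonTree Λ} {φ : T.V ≃ T'.V}

theorem RibbonTree.IsIso.adj_iff (h : T.IsIso T' φ) (a b : T.V) :
    T'.graph.Adj (φ a) (φ b) ↔ T.graph.Adj a b :=
  (RibbonTree.graph_adj_iff φ.injective (fun a b => (h.arrow a b).symm) a b).symm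

/-- The isomorphism of graphs which underlies an isomorphism of trees. -/
def RibbonTree.IsIso.graphIso (h : T.IsIso T' φ) : T.graph ≃g T'.graph :=
  { toEquiv := φ, map_rel_iff' := fun {a b} => h.adj_iff a b }

theorem RibbonTree.IsIso.symm (h : T.IsIso T' φ) : T'.IsIso T φ.symm where
  arrow a b := by rw [← h.arrow, φ.apply_symm_apply, φ.apply_symm_apply]
  cyc x a b c := by rw [← h.cyc]; simp only [φ.apply_symm_apply]
  label x := by rw [← h.label, φ.apply_symm_apply]

theorem RibbonTree.IsIso.comp (h : T.IsIso T' φ) {E : Set (Sym2 T.V)} {E' : Set (Sym2 T'.V)}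
    (hE : ∀ a b, s(φ a, φ b) ∈ E' ↔ s(a, b) ∈ E) (x : T.V) :
    (T.comp E x).Iso (T'.comp E' (φ x)) := by
  refine RibbonTree.iso_comp (i := fun a => φ a.1) (φ.injective.comp Subtype.val_injective) ?_
    (fun a b => (h.arrow _ _).symm) (fun x a b c => (h.cyc _ _ _ _).symm) (fun a => (h.label _).symm)
  intro y
  obtain ⟨y, rfl⟩ := φ.surjective y
  rw [reachable_deleteEdges_iff φ h.adj_iff hE]
  constructor
  · intro hy
    exact ⟨⟨y, hy⟩, rfl⟩
  · rintro ⟨z, hz⟩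
    have : z.1 = y := φ.injective hz
    exact this ▸ z.2

/-- The bijection on edges. -/
def RibbonTree.IsIso.edgeEquiv (h : T.IsIso T' φ) : T.Edge ≃ T'.Edge :=
  (φ.prodCongr φ).subtypeEquiv (fun e => (h.arrow e.1 e.2).symm)

end

theorem OTreeClass.sound {T T' : RibbonTree Λ} (h : T.Iso T') : OTreeClass.mk T = OTreeClass.mk T' :=
  Quot.sound h

theorem RTreeClass.sound {T T' : RootedTree Λ} (h : T.Iso T') : RTreeClass.mk T = RTreeClass.mk T' :=
  Quot.sound h

variable {k : Type w} [CommRing k]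

theorem sym2_equiv_mem {V V' : Type} (φ : V ≃ V') (x y a b : V) :
    s(φ a, φ b) ∈ ({s(φ x, φ y)} : Set (Sym2 V')) ↔ s(a, b) ∈ ({s(x, y)} : Set (Sym2 V)) := by
  simp [φ.injective.eq_iff]

theorem otreeCobracketOn_congr {T T' : RibbonTree Λ} (h : T.Iso T') :
    otreeCobracketOn k T = otreeCobracketOn k T' := by
  obtain ⟨φ, h⟩ := h
  refine Fintype.sum_equiv h.edgeEquiv _ _ fun e => ?_
  have h1 : OTreeClass.mk (T.tail e) = OTreeClass.mk (T'.tail (h.edgeEquiv e)) :=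
    OTreeClass.sound (h.comp (fun a b => sym2_equiv_mem φ _ _ a b) e.1.1)
  have h2 : OTreeClass.mk (T.head e) = OTreeClass.mk (T'.head (h.edgeEquiv e)) :=
    OTreeClass.sound (h.comp (fun a b => sym2_equiv_mem φ _ _ a b) e.1.2)
  rw [h1, h2]

theorem Quot.apply_out_mk {α β : Type*} {r : α → α → Prop} (F : α → β)
    (h : ∀ a b, r a b → F a = F b) (a : α) : F (Quot.out (Quot.mk r a)) = F a :=
  congrArg (Quot.lift F h) (Quot.out_eq (Quot.mk r a))

theorem otreeCobracket_mk (T : RibbonTree Λ) :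
    otreeCobracket k (bas k (OTreeClass.mk T)) = otreeCobracketOn k T := by
  rw [otreeCobracket, Finsupp.linearCombination_single, one_smul]
  exact Quot.apply_out_mk _ (fun _ _ => otreeCobracketOn_congr) T

section

variable {T T' : RootedTree Λ} {φ : T.V ≃ T'.V}

/-- The bijection on edges. -/
def RootedTree.edgeEquiv (h : T.toRibbonTree.IsIso T'.toRibbonTree φ) (hroot : φ T.root = T'.root) :
    T.Edge ≃ T'.Edge :=
  (φ.prodCongr φ).subtypeEquiv (fun e => by
    have hd : ∀ x, T'.graph.dist T'.root (φ x) = T.graph.dist T.root x := by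
      intro x
      rw [← hroot]
      exact dist_iso T.isTree.connected T'.isTree.connected h.graphIso _ _
    simp only [Equiv.prodCongr_apply, Prod.map_fst, Prod.map_snd]
    rw [hd, hd, h.adj_iff])

variable (h : T.toRibbonTree.IsIso T'.toRibbonTree φ) (hroot : φ T.root = T'.root)

theorem RootedTree.mem_edgeSym_image (H : Set T.Edge) (a b : T.V) :
    s(φ a, φ b) ∈ T'.edgeSym (RootedTree.edgeEquiv h hroot '' H) ↔ s(a, b) ∈ T.edgeSym H := by
  have hinj : Function.Injective (Sym2.map φ) := Sym2.map.injective φ.injective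
  simp only [RootedTree.edgeSym, Set.mem_image]
  constructor
  · rintro ⟨_, ⟨e, he, rfl⟩, h1⟩
    exact ⟨e, he, hinj h1⟩
  · rintro ⟨e, he, h1⟩
    exact ⟨_, ⟨e, he, rfl⟩, congrArg (Sym2.map φ) h1⟩

theorem RootedTree.trunk_iso (hlt : ∀ a b, T'.lt (φ a) (φ b) ↔ T.lt a b) (H : Set T.Edge) :
    (T.trunk H).Iso (T'.trunk (RootedTree.edgeEquiv h hroot '' H)) := by
  refine RootedTree.iso_trunk (i := fun a : (T.trunk H).V => φ a.1)
    (φ.injective.comp Subtype.val_injective) ?_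
    (fun a b => (h.arrow _ _).symm) (fun x a b c => (h.cyc _ _ _ _).symm)
    (fun a => (h.label _).symm) hroot (fun a b => (hlt _ _).symm)
  intro y
  obtain ⟨y, rfl⟩ := φ.surjective y
  rw [← hroot]
  refine (reachable_deleteEdges_iff φ h.adj_iff
    (RootedTree.mem_edgeSym_image h hroot H) _ _).trans ?_
  constructor
  · intro hy
    exact ⟨⟨y, hy⟩, rfl⟩
  · rintro ⟨z, hz⟩
    have : z.1 = y := φ.injective hz
    exact this ▸ z.2

theorem RootedTree.branch_iso (H : Set T.Edge) (e : T.Edge) (he : e ∈ H) :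
    (T.branch H e he).Iso (T'.branch (RootedTree.edgeEquiv h hroot '' H)
      (RootedTree.edgeEquiv h hroot e) (Set.mem_image_of_mem _ he)) := by
  refine RootedTree.iso_branch (i := fun a : (T.branch H e he).V => φ a.1) _
    (φ.injective.comp Subtype.val_injective) ?_
    (fun a b => (h.arrow _ _).symm) (fun x a b c => (h.cyc _ _ _ _).symm)
    (fun a => (h.label _).symm) rfl (fun a b => (h.cyc _ _ _ _).symm)
  intro y
  obtain ⟨y, rfl⟩ := φ.surjective y
  refine (reachable_deleteEdges_iff φ h.adj_iff
    (RootedTree.mem_edgeSym_image h hroot H) e.1.2 y).trans ?_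
  constructor
  · intro hy
    exact ⟨⟨y, hy⟩, rfl⟩
  · rintro ⟨z, hz⟩
    have : z.1 = y := φ.injective hz
    exact this ▸ z.2

theorem RootedTree.isSimple_map {H : Finset T.Edge}
    (hH : T'.IsSimple (H.map (RootedTree.edgeEquiv h hroot).toEmbedding)) : T.IsSimple H := by
  intro x p hp e he e' he' h1 h2
  have hroot' : h.graphIso.toHom T.root = T'.root := hroot
  have hmem : ∀ e : T.Edge, s(e.1.1, e.1.2) ∈ p.edges →
      s((RootedTree.edgeEquiv h hroot e).1.1, (RootedTree.edgeEquiv h hroot e).1.2) ∈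
        ((p.map h.graphIso.toHom).copy hroot' rfl).edges := by
    intro e he
    rw [SimpleGraph.Walk.edges_copy, SimpleGraph.Walk.edges_map]
    exact List.mem_map_of_mem (f := Sym2.map φ) he
  apply (RootedTree.edgeEquiv h hroot).injective
  refine hH (h.graphIso.toHom x) ((p.map h.graphIso.toHom).copy hroot' rfl) ?_ _
    (Finset.mem_map_of_mem _ he) _ (Finset.mem_map_of_mem _ he') (hmem e h1) (hmem e' h2)
  rw [SimpleGraph.Walk.isPath_copy]
  exact hp.map φ.injective

end

theorem rtreeComulOn_congr {T T' : RootedTree Λ} (hT : T.Iso T') :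
    rtreeComulOn k T = rtreeComulOn k T' := by
  obtain ⟨φ, h, hroot, hlt⟩ := hT
  refine Fintype.sum_equiv (RootedTree.edgeEquiv h hroot) _ _ fun e => ?_
  have h1 := RTreeClass.sound (RootedTree.branch_iso h hroot {e} e rfl)
  have h2 := RTreeClass.sound (RootedTree.trunk_iso h hroot hlt {e})
  simp only [Set.image_singleton] at h1 h2
  rw [h1, h2]

theorem rtreeComul_mk (T : RootedTree Λ) :
    rtreeComul k (bas k (RTreeClass.mk T)) = rtreeComulOn k T := by
  rw [rtreeComul, Finsupp.linearCombination_single, one_smul]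
  exact Quot.apply_out_mk _ (fun _ _ => rtreeComulOn_congr) T

theorem RootedTree.mem_simpleCuts {T : RootedTree Λ} {H : Finset T.Edge} :
    H ∈ T.simpleCuts ↔ T.IsSimple H := by
  classical
  simp [RootedTree.simpleCuts]

theorem RootedTree.isSimple_map_iff {T T' : RootedTree Λ} {φ : T.V ≃ T'.V}
    (h : T.toRibbonTree.IsIso T'.toRibbonTree φ) (hroot : φ T.root = T'.root) {H : Finset T.Edge} :
    T'.IsSimple (H.map (RootedTree.edgeEquiv h hroot).toEmbedding) ↔ T.IsSimple H := by
  refine ⟨RootedTree.isSimple_map h hroot, fun hH => ?_⟩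
  have hroot' : φ.symm T'.root = T.root := by rw [← hroot, φ.symm_apply_apply]
  refine RootedTree.isSimple_map h.symm hroot' ?_
  have he : (H.map (RootedTree.edgeEquiv h hroot).toEmbedding).map
      (RootedTree.edgeEquiv h.symm hroot').toEmbedding = H := by
    rw [Finset.map_map]
    convert Finset.map_refl
    ext e
    · exact φ.symm_apply_apply e.1.1
    · exact φ.symm_apply_apply e.1.2
  rwa [he]

theorem rtreeCoprodOn_congr {T T' : RootedTree Λ} (hT : T.Iso T') :
    rtreeCoprodOn k T = rtreeCoprodOn k T' := by
  have h0 := RTreeClass.sound hT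
  obtain ⟨φ, h, hroot, hlt⟩ := hT
  unfold rtreeCoprodOn
  rw [h0]
  congr 1
  refine Finset.sum_equiv (RootedTree.edgeEquiv h hroot).finsetCongr ?_ ?_
  · intro H
    rw [RootedTree.mem_simpleCuts, RootedTree.mem_simpleCuts, Equiv.finsetCongr_apply,
      RootedTree.isSimple_map_iff]
  · intro H _
    have hcoe : (((RootedTree.edgeEquiv h hroot).finsetCongr H : Finset T'.Edge) : Set T'.Edge) =
        RootedTree.edgeEquiv h hroot '' (H : Set T.Edge) := by
      rw [Equiv.finsetCongr_apply, Finset.coe_map]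
      rfl
    have h2 := RTreeClass.sound (RootedTree.trunk_iso h hroot hlt (H : Set T.Edge))
    rw [← hcoe] at h2
    rw [h2]
    congr 1
    refine Fintype.prod_equiv ((RootedTree.edgeEquiv h hroot).subtypeEquiv fun e => ?_) _ _ fun e => ?_
    · rw [Equiv.finsetCongr_apply]
      simp
    · refine congrArg gen ((RTreeClass.sound
        (RootedTree.branch_iso h hroot (H : Set T.Edge) e.1 e.2)).trans ?_)
      congr 1
      simp only [← hcoe]
      rfl

theorem rtreeCoprod_mk (T : RootedTree Λ) :
    rtreeCoprod k (gen (RTreeClass.mk T)) = rtreeCoprodOn k T := by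
  rw [rtreeCoprod, symLift_gen]
  exact Quot.apply_out_mk _ (fun _ _ => rtreeCoprodOn_congr) T

end TreeIso

section ParentedTree

variable {V : Type} {G : SimpleGraph V} {r : V} {par : V → V → Prop} {h : V → ℕ}

theorem dist_parent (hG : G.Connected) (hadj : ∀ x y, G.Adj x y ↔ par x y ∨ par y x)
    (huniq : ∀ x x' y, par x y → par x' y → x = x') (hroot : ∀ x, ¬ par x r) {x y : V}
    (hxy : par x y) : G.dist r y = G.dist r x + 1 := by
  have key : ∀ n y z, G.dist r y = n → G.Adj y z → G.dist r z + 1 = n → par z y := by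
    intro n
    induction n using Nat.strong_induction_on with
    | _ n ih =>
      intro y z hy hyz hz
      rcases (hadj y z).1 hyz with h1 | h1
      · have hzr : z ≠ r := by
          rintro rfl
          exact hroot _ h1
        obtain ⟨p, hp⟩ := hG.exists_walk_length_eq_dist z r
        cases p with
        | nil => exact (hzr rfl).elim
        | cons hzw q =>
          rename_i w'
          have h2 : G.dist w' r ≤ q.length := SimpleGraph.dist_le q
          rw [SimpleGraph.Walk.length_cons, SimpleGraph.dist_comm] at hp
          have h3 : G.dist r z ≤ G.dist r w' + 1 := by
            have := hG.dist_triangle (u := r) (v := w') (w := z)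
            rwa [SimpleGraph.dist_eq_one_iff_adj.2 hzw.symm] at this
          rw [SimpleGraph.dist_comm] at h2
          have h4 := ih (G.dist r z) (by omega) z w' rfl hzw (by omega)
          obtain rfl := huniq _ _ _ h1 h4
          omega
      · exact h1
  have hyr : y ≠ r := by
    rintro rfl
    exact hroot _ hxy
  obtain ⟨p, hp⟩ := hG.exists_walk_length_eq_dist y r
  cases p with
  | nil => exact (hyr rfl).elim
  | cons hyw q =>
    rename_i w'
    have h2 : G.dist w' r ≤ q.length := SimpleGraph.dist_le q
    rw [SimpleGraph.Walk.length_cons, SimpleGraph.dist_comm] at hp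
    have h3 : G.dist r y ≤ G.dist r w' + 1 := by
      have := hG.dist_triangle (u := r) (v := w') (w := y)
      rwa [SimpleGraph.dist_eq_one_iff_adj.2 hyw.symm] at this
    rw [SimpleGraph.dist_comm] at h2
    obtain rfl := huniq _ _ _ hxy (key _ y w' rfl hyw (by omega))
    omega

theorem exists_isPath_parent (hadj : ∀ x y, G.Adj x y ↔ par x y ∨ par y x)
    (hlt : ∀ x y, par x y → h x < h y) (hex : ∀ y, y ≠ r → ∃ x, par x y)
    (huniq : ∀ x x' y, par x y → par x' y → x = x') (hroot : ∀ x, ¬ par x r) (y : V) :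
    ∃ p : G.Walk r y, p.IsPath ∧ (∀ v ∈ p.support, h v ≤ h y) ∧
      ∀ x z, par x z → (s(x, z) ∈ p.edges ↔ Relation.ReflTransGen par z y) := by
  have main : ∀ n y, h y = n → ∃ p : G.Walk r y, p.IsPath ∧ (∀ v ∈ p.support, h v ≤ h y) ∧
      ∀ x z, par x z → (s(x, z) ∈ p.edges ↔ Relation.ReflTransGen par z y) := by
    intro n
    induction n using Nat.strong_induction_on with
    | _ n ih =>
      intro y hy
      by_cases hyr : y = r
      · subst hyr
        refine ⟨SimpleGraph.Walk.nil, SimpleGraph.Walk.IsPath.nil, by simp, ?_⟩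
        intro x z hxz
        simp only [SimpleGraph.Walk.edges_nil, List.not_mem_nil, false_iff]
        intro hz
        rcases Relation.ReflTransGen.cases_tail hz with h1 | ⟨c, -, h1⟩
        · exact hroot _ (h1 ▸ hxz)
        · exact hroot _ h1
      · obtain ⟨x, hxy⟩ := hex y hyr
        obtain ⟨p, hp, hps, hpe⟩ := ih (h x) (hy ▸ hlt x y hxy) x rfl
        have hx := hlt x y hxy
        refine ⟨p.concat ((hadj x y).2 (Or.inl hxy)), hp.concat (fun hmem => ?_) _, ?_, ?_⟩
        · have := hps y hmem
          omega
        · intro v hv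
          rw [SimpleGraph.Walk.support_concat, List.mem_append, List.mem_singleton] at hv
          rcases hv with hv | rfl
          · have := hps v hv
            omega
          · exact le_rfl
        · intro x' z hxz
          rw [SimpleGraph.Walk.edges_concat, List.concat_eq_append, List.mem_append,
            List.mem_singleton, hpe x' z hxz]
          constructor
          · rintro (h1 | h1)
            · exact h1.tail hxy
            · rcases Sym2.eq_iff.1 h1 with ⟨-, rfl⟩ | ⟨rfl, rfl⟩
              · exact Relation.ReflTransGen.refl
              · have := hlt _ _ hxz
                omega
          · intro h1
            rcases Relation.ReflTransGen.cases_tail h1 with h2 | ⟨c, h2, h3⟩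
            · subst h2
              obtain rfl := huniq _ _ _ hxy hxz
              exact Or.inr rfl
            · obtain rfl := huniq _ _ _ hxy h3
              exact Or.inl h2
  exact main _ y rfl

end ParentedTree

section DualTree

variable {I : Type u} [Quiver.{v} I] {D : PathChord I}

theorem PathChord.below_some {c d : D.Chord} :
    Below D.path.arrows.length (D.rawFace (some c)) d.1 ↔ nest d.1 c.1 := Iff.rfl

theorem PathChord.below_none (d : D.Chord) :
    Below D.path.arrows.length (D.rawFace none) d.1 :=
  ⟨by simp [PathChord.rawFace, lo], (D.isCut.lt d.2).2⟩

theorem PathChord.parent_iff {f : Option D.Chord} {d : D.Chord} :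
    D.Parent f d ↔ Below D.path.arrows.length (D.rawFace f) d.1 ∧
      ∀ e : D.Chord, nest d.1 e.1 → ¬ Below D.path.arrows.length (D.rawFace f) e.1 := Iff.rfl

theorem PathChord.not_parent_swap {c d : D.Chord} (h : D.Parent (some c) d) :
    ¬ D.Parent (some d) c := by
  intro h'
  have h1 := (PathChord.below_some.1 h.1).1
  have h2 := (PathChord.below_some.1 h'.1).1
  omega

theorem PathChord.above_some {f : Option D.Chord} {d : D.Chord} :
    D.Above f (some d) ↔ D.Parent f d := by
  constructor
  · rintro ⟨d', hd, h⟩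
    obtain rfl := Option.some.inj hd
    exact h
  · exact fun h => ⟨d, rfl, h⟩

theorem PathChord.not_above_none (f : Option D.Chord) : ¬ D.Above f none := by
  rintro ⟨d, hd, -⟩
  simp at hd

theorem PathChord.parent_unique {f f' : Option D.Chord} {d : D.Chord} (h : D.Parent f d)
    (h' : D.Parent f' d) : f = f' :=
  D.above_unique (PathChord.above_some.2 h) (PathChord.above_some.2 h')

/-- The height used for inductions on the faces. -/
def PathChord.height (D : PathChord I) : Option D.Chord → ℕ
  | none => 0
  | some d => d.1.1 + 1

theorem PathChord.height_lt {f g : Option D.Chord} (h : D.Above f g) : D.height f < D.height g := by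
  obtain ⟨d, rfl, h, -⟩ := h
  rcases f with _ | c
  · simp [PathChord.height]
  · have := (PathChord.below_some.1 h).1
    simp only [PathChord.height]
    omega

theorem PathChord.exists_above (g : Option D.Chord) (hg : g ≠ none) : ∃ f, D.Above f g := by
  obtain ⟨d, rfl⟩ := Option.ne_none_iff_exists'.1 hg
  obtain ⟨f, hf⟩ := D.exists_parent d
  exact ⟨f, PathChord.above_some.2 hf⟩

/-- The dual graph. -/
abbrev PathChord.dualGraph (D : PathChord I) : SimpleGraph (Option D.Chord) :=
  SimpleGraph.fromRel D.dualArrow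

theorem PathChord.dual_dist {f : Option D.Chord} {d : D.Chord} (h : D.Parent f d) :
    D.dualGraph.dist none (some d) = D.dualGraph.dist none f + 1 :=
  dist_parent (par := D.Above) D.dual_isTree.connected D.fromRel_adj
    (fun _ _ _ => D.above_unique) PathChord.not_above_none (PathChord.above_some.2 h)

theorem PathChord.reflTransGen_above {c d : D.Chord} :
    Relation.ReflTransGen D.Above (some c) (some d) ↔ c = d ∨ nest d.1 c.1 := by
  constructor
  · intro h
    have key : ∀ g, Relation.ReflTransGen D.Above (some c) g →
        ∃ d, g = some d ∧ (c = d ∨ nest d.1 c.1) := by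
      intro g hg
      induction hg with
      | refl => exact ⟨c, rfl, Or.inl rfl⟩
      | tail _ h1 ih =>
        obtain ⟨d, rfl, h2⟩ := ih
        obtain ⟨e, rfl, h3⟩ := h1
        refine ⟨e, rfl, Or.inr ?_⟩
        have h4 := PathChord.below_some.1 h3.1
        rcases h2 with rfl | h2
        · exact h4
        · unfold nest at *
          omega
    obtain ⟨d', hd, h'⟩ := key _ h
    obtain rfl := Option.some.inj hd
    exact h'
  · have key : ∀ n d, D.height (some d) = n → (c = d ∨ nest d.1 c.1) →
        Relation.ReflTransGen D.Above (some c) (some d) := by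
      intro n
      induction n using Nat.strong_induction_on with
      | _ n ih =>
        rintro d hd (rfl | h)
        · exact Relation.ReflTransGen.refl
        · obtain ⟨f, hf⟩ := D.exists_parent d
          have hlt := PathChord.height_lt (PathChord.above_some.2 hf)
          rcases f with _ | e
          · exact (hf.2 c h (PathChord.below_none c)).elim
          · refine (ih _ (hd ▸ hlt) e rfl ?_).tail (PathChord.above_some.2 hf)
            by_cases hce : c = e
            · exact Or.inl hce
            · refine Or.inr ?_
              have h1 := PathChord.below_some.1 hf.1
              have h2 := hf.2 c h
              rw [PathChord.below_some] at h2
              have htri := D.isCut.tri c.2 e.2 (fun h => hce (Subtype.ext h))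
              have := D.isCut.lt d.2
              unfold nest at *
              omega
    exact key _ d rfl

/-- The edges of the dual tree across the chords in `H`. -/
def PathChord.dualEdges (D : PathChord I) (H : Set (ℕ × ℕ)) : Set (Sym2 (Option D.Chord)) :=
  {s | ∃ g d, d.1 ∈ H ∧ D.Parent g d ∧ s = s(g, some d)}

theorem PathChord.mem_dualEdges {H : Set (ℕ × ℕ)} {g : Option D.Chord} {d : D.Chord}
    (h : D.Parent g d) : s(g, some d) ∈ D.dualEdges H ↔ d.1 ∈ H := by
  constructor
  · rintro ⟨g', d', hd', h', he⟩
    rcases Sym2.eq_iff.1 he with ⟨-, h2⟩ | ⟨rfl, rfl⟩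
    · exact Option.some.inj h2 ▸ hd'
    · exact (PathChord.not_parent_swap h h').elim
  · exact fun hd => ⟨g, d, hd, h, rfl⟩

/-- The edge of the dual tree across the chord `d`. -/
noncomputable def PathChord.dualEdge (D : PathChord I) (d : D.Chord) : D.dualRooted.Edge :=
  ⟨((D.exists_parent d).choose, some d),
    (D.fromRel_adj _ _).2 (Or.inl (PathChord.above_some.2 (D.exists_parent d).choose_spec)),
    PathChord.dual_dist (D.exists_parent d).choose_spec⟩

theorem PathChord.dualEdge_parent (d : D.Chord) : D.Parent (D.dualEdge d).1.1 d :=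
  (D.exists_parent d).choose_spec

theorem PathChord.dualEdge_bijective (D : PathChord I) : Function.Bijective D.dualEdge := by
  constructor
  · intro c d h
    have : (D.dualEdge c).1.2 = (D.dualEdge d).1.2 := by rw [h]
    exact Option.some.inj this
  · rintro ⟨⟨f, g⟩, hadj, hdist⟩
    change (SimpleGraph.fromRel D.dualArrow).Adj f g at hadj
    rcases (D.fromRel_adj f g).1 hadj with ⟨d, rfl, h⟩ | ⟨d, rfl, h⟩
    · refine ⟨d, Subtype.ext (Prod.ext ?_ rfl)⟩
      exact PathChord.parent_unique (D.dualEdge_parent d) h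
    · have h1 := PathChord.dual_dist h
      change D.dualGraph.dist none g = D.dualGraph.dist none (some d) + 1 at hdist
      omega

theorem PathChord.edgeSym_image (H : Set D.Chord) :
    D.dualRooted.edgeSym (D.dualEdge '' H) = D.dualEdges (Subtype.val '' H) := by
  ext s
  constructor
  · rintro ⟨_, ⟨d, hd, rfl⟩, rfl⟩
    exact ⟨_, d, ⟨d, hd, rfl⟩, D.dualEdge_parent d, rfl⟩
  · rintro ⟨g, d, ⟨d', hd', he⟩, hg, rfl⟩
    obtain rfl := Subtype.ext he
    refine ⟨D.dualEdge d', ⟨d', hd', rfl⟩, ?_⟩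
    change s((D.dualEdge d').1.1, some d') = _
    rw [PathChord.parent_unique (D.dualEdge_parent d') hg]
    rfl

theorem PathChord.dualRooted_isSimple_iff (H : Finset D.Chord) :
    D.dualRooted.IsSimple (H.map ⟨D.dualEdge, D.dualEdge_bijective.1⟩) ↔ D.IsSimple H := by
  have hpath := exists_isPath_parent (par := D.Above) (h := D.height) D.fromRel_adj
    (fun _ _ => PathChord.height_lt) PathChord.exists_above (fun _ _ _ => D.above_unique)
    PathChord.not_above_none
  constructor
  · intro h c hc d hd hn
    obtain ⟨p, hp, -, hpe⟩ := hpath (some d)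
    have h1 : s((D.dualEdge c).1.1, some c) ∈ p.edges :=
      (hpe _ _ (PathChord.above_some.2 (D.dualEdge_parent c))).2
        (PathChord.reflTransGen_above.2 (Or.inr hn))
    have h2 : s((D.dualEdge d).1.1, some d) ∈ p.edges :=
      (hpe _ _ (PathChord.above_some.2 (D.dualEdge_parent d))).2 Relation.ReflTransGen.refl
    have h3 := h (some d) p hp _ (Finset.mem_map_of_mem _ hc) _ (Finset.mem_map_of_mem _ hd) h1 h2
    obtain rfl := D.dualEdge_bijective.1 h3
    omega
  · intro h x p hp e he e' he' h1 h2
    obtain ⟨c, hc, rfl⟩ := Finset.mem_map.1 he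
    obtain ⟨d, hd, rfl⟩ := Finset.mem_map.1 he'
    obtain ⟨q, hq, -, hqe⟩ := hpath x
    have hpq : p = q := congrArg Subtype.val
      ((D.dual_isTree.isAcyclic.subsingleton_path _ _).elim ⟨p, hp⟩ ⟨q, hq⟩)
    subst hpq
    have h1 := (hqe _ _ (PathChord.above_some.2 (D.dualEdge_parent c))).1 h1
    have h2 := (hqe _ _ (PathChord.above_some.2 (D.dualEdge_parent d))).1 h2
    rcases x with _ | y
    · rcases Relation.ReflTransGen.cases_tail h1 with h3 | ⟨z, -, h3⟩
      · simp at h3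
      · exact (PathChord.not_above_none _ h3).elim
    · rw [PathChord.reflTransGen_above] at h1 h2
      have hcd : c = d := by
        by_contra hne
        have htri := D.isCut.tri c.2 d.2 (fun h => hne (Subtype.ext h))
        have k1 := h c hc d hd
        have k2 := h d hd c hc
        have hy := D.isCut.lt y.2
        unfold nest at *
        rcases h1 with rfl | h1 <;> rcases h2 with rfl | h2
        · exact hne rfl
        · omega
        · omega
        · omega
      rw [hcd]

end DualTree

section Components

variable {I : Type u} [Quiver.{v} I] {D : PathChord I} {H : Finset (ℕ × ℕ)} {f : Option D.Chord}

/-- The faces of `D` on the piece `f` of the subcut `H`. -/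
def PathChord.InPiece (D : PathChord I) (H : Finset (ℕ × ℕ)) (f g : Option D.Chord) : Prop :=
  g = f ∨ ∃ d, g = some d ∧ d.1 ∈ D.on H (D.rawFace f)

theorem PathChord.not_mem_of_mem_on (hH : H ⊆ D.cut) {d : ℕ × ℕ}
    (hd : d ∈ D.on H (D.rawFace f)) : d ∉ H := by
  intro h
  rw [PathChord.mem_on hH] at hd
  exact hd.2.2 d h hd.2.1 ⟨le_rfl, le_rfl⟩

theorem PathChord.mem_on_of_nest (hH : H ⊆ D.cut) {d e : D.Chord}
    (hd : d.1 ∈ D.on H (D.rawFace f)) (hn : nest d.1 e.1)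
    (hb : Below D.path.arrows.length (D.rawFace f) e.1) : e.1 ∈ D.on H (D.rawFace f) := by
  rw [PathChord.mem_on hH] at hd ⊢
  refine ⟨e.2, hb, fun h hh hhb hcon => hd.2.2 h hh hhb ?_⟩
  unfold nest at hn
  omega

theorem PathChord.below_trans {c d : D.Chord}
    (hb : Below D.path.arrows.length (D.rawFace f) c.1) (hn : nest d.1 c.1) :
    Below D.path.arrows.length (D.rawFace f) d.1 := by
  unfold Below at *
  unfold nest at hn
  omega

theorem PathChord.Parent.inPiece_left (hH : H ⊆ D.cut) {g : Option D.Chord} {d : D.Chord}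
    (hg : D.Parent g d) (hd : d.1 ∈ D.on H (D.rawFace f)) : D.InPiece H f g := by
  have hd' := (PathChord.mem_on hH).1 hd
  rcases g with _ | c
  · rcases f with _ | c'
    · exact Or.inl rfl
    · exact (hg.2 c' (PathChord.below_some.1 hd'.2.1) (PathChord.below_none c')).elim
  · by_cases hcf : some c = f
    · exact Or.inl hcf
    · refine Or.inr ⟨c, rfl, PathChord.mem_on_of_nest hH hd (PathChord.below_some.1 hg.1) ?_⟩
      rcases f with _ | c'
      · exact PathChord.below_none c
      · rw [PathChord.below_some]
        have h1 := PathChord.below_some.1 hd'.2.1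
        have h2 := hg.2 c' h1
        rw [PathChord.below_some] at h2
        have h3 := PathChord.below_some.1 hg.1
        have hne : c ≠ c' := fun e => hcf (congrArg some e)
        have htri := D.isCut.tri c.2 c'.2 (fun h => hne (Subtype.ext h))
        have := D.isCut.lt d.2
        unfold nest at *
        omega

theorem PathChord.Parent.mem_on (hH : H ⊆ D.cut) {g : Option D.Chord} {d : D.Chord}
    (hg : D.Parent g d) (hd : d.1 ∉ H) (hgp : D.InPiece H f g) : d.1 ∈ D.on H (D.rawFace f) := by
  rw [PathChord.mem_on hH]
  have hdl := D.isCut.lt d.2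
  rcases hgp with rfl | ⟨c, rfl, hc⟩
  · refine ⟨d.2, hg.1, fun h hh hb hcon => ?_⟩
    have hne : h ≠ d.1 := fun e => hd (e ▸ hh)
    have htri := D.isCut.tri (hH hh) d.2 hne
    refine hg.2 ⟨h, hH hh⟩ (show nest d.1 h from ?_) hb
    unfold nest
    omega
  · have hc' := (PathChord.mem_on hH).1 hc
    have h1 := PathChord.below_some.1 hg.1
    refine ⟨d.2, PathChord.below_trans hc'.2.1 h1, fun h hh hb hcon => ?_⟩
    have hne : h ≠ d.1 := fun e => hd (e ▸ hh)
    have htri := D.isCut.tri (hH hh) d.2 hne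
    have h2 : nest d.1 h := by
      unfold nest
      omega
    have h3 : ¬ nest h c.1 := hg.2 ⟨h, hH hh⟩ h2
    have h4 := hc'.2.2 h hh hb
    have hne' : h ≠ c.1 := fun e => PathChord.not_mem_of_mem_on hH hc (e ▸ hh)
    have htri' := D.isCut.tri (hH hh) c.2 hne'
    unfold nest at *
    omega

theorem PathChord.InPiece.not_parent (hH : H ⊆ D.cut) {g : Option D.Chord} {c : D.Chord}
    (hg : D.InPiece H (some c) g) : ¬ D.Parent g c := by
  intro h
  rcases hg with rfl | ⟨d, rfl, hd⟩
  · exact PathChord.not_parent_swap h h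
  · have h1 := PathChord.below_some.1 h.1
    have h2 := ((PathChord.mem_on hH).1 hd).2.1
    rw [PathChord.below_some] at h2
    unfold nest at *
    omega

theorem PathChord.reachable_iff (hH : H ⊆ D.cut) (hf : ∀ c, f = some c → c.1 ∈ H)
    (g : Option D.Chord) :
    (D.dualGraph.deleteEdges (D.dualEdges (H : Set (ℕ × ℕ)))).Reachable f g ↔
      D.InPiece H f g := by
  constructor
  · rintro ⟨p⟩
    have key : ∀ x y, (D.dualGraph.deleteEdges (D.dualEdges (H : Set (ℕ × ℕ)))).Walk x y →
        D.InPiece H f x → D.InPiece H f y := by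
      intro x y p
      induction p with
      | nil => exact id
      | cons hadj _ ih =>
        rename_i x y z
        intro hx
        refine ih ?_
        rw [SimpleGraph.deleteEdges_adj, D.fromRel_adj] at hadj
        obtain ⟨⟨d, rfl, h⟩ | ⟨d, rfl, h⟩, hE⟩ := hadj
        · rw [PathChord.mem_dualEdges h] at hE
          exact Or.inr ⟨d, rfl, h.mem_on hH hE hx⟩
        · rw [Sym2.eq_swap, PathChord.mem_dualEdges h] at hE
          rcases hx with hx | ⟨d', hd', hx⟩
          · exact (hE (hf d hx.symm)).elim
          · obtain rfl := Option.some.inj hd'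
            exact h.inPiece_left hH hx
    exact key f g p (Or.inl rfl)
  · have key : ∀ n g, D.height g = n → D.InPiece H f g →
        (D.dualGraph.deleteEdges (D.dualEdges (H : Set (ℕ × ℕ)))).Reachable f g := by
      intro n
      induction n using Nat.strong_induction_on with
      | _ n ih =>
        rintro g hn (rfl | ⟨d, rfl, hd⟩)
        · exact SimpleGraph.Reachable.refl _
        · obtain ⟨x, hx⟩ := D.exists_parent d
          have hab := PathChord.above_some.2 hx
          have h1 := ih _ (hn ▸ PathChord.height_lt hab) x rfl (hx.inPiece_left hH hd)
          refine h1.trans (SimpleGraph.Adj.reachable ?_)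
          rw [SimpleGraph.deleteEdges_adj, D.fromRel_adj, PathChord.mem_dualEdges hx]
          exact ⟨Or.inl hab, PathChord.not_mem_of_mem_on hH hd⟩
    exact key _ g rfl

open Classical in
/-- The inclusion of the faces of a piece into all faces. -/
noncomputable def PathChord.incl (D : PathChord I) (H : Finset (ℕ × ℕ)) (f : Option D.Chord) :
    Option (D.piece H (D.rawFace f)).Chord → Option D.Chord
  | none => f
  | some r => if h : ∃ d : D.Chord, d.1 ∈ D.on H (D.rawFace f) ∧ D.rk H (D.rawFace f) d.1 = r.1
      then some h.choose else none

theorem PathChord.incl_some {r : (D.piece H (D.rawFace f)).Chord} {d : D.Chord}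
    (hd : d.1 ∈ D.on H (D.rawFace f)) (hr : r.1 = D.rk H (D.rawFace f) d.1) :
    D.incl H f (some r) = some d := by
  have h : ∃ d : D.Chord, d.1 ∈ D.on H (D.rawFace f) ∧ D.rk H (D.rawFace f) d.1 = r.1 :=
    ⟨d, hd, hr.symm⟩
  rw [PathChord.incl, dif_pos h]
  congr 1
  apply Subtype.ext
  exact D.rk_injOn H (D.rawFace f) h.choose_spec.1 hd (h.choose_spec.2.trans hr)

theorem PathChord.exists_rk_eq (hH : H ⊆ D.cut) (r : (D.piece H (D.rawFace f)).Chord) :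
    ∃ d : D.Chord, d.1 ∈ D.on H (D.rawFace f) ∧ r.1 = D.rk H (D.rawFace f) d.1 := by
  have h := (PathChord.piece_cut hH (D.rawFace_isFaceOf f)).subset r.2
  rw [Finset.mem_image] at h
  obtain ⟨d, hd, h⟩ := h
  exact ⟨⟨d, PathChord.on_subset hd⟩, hd, h.symm⟩

theorem PathChord.exists_chord_rk (hH : H ⊆ D.cut) {d : ℕ × ℕ} (hd : d ∈ D.on H (D.rawFace f)) :
    ∃ r : (D.piece H (D.rawFace f)).Chord, r.1 = D.rk H (D.rawFace f) d := by
  refine ⟨⟨D.rk H (D.rawFace f) d, ?_⟩, rfl⟩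
  rw [PathChord.piece_cut hH (D.rawFace_isFaceOf f)]
  exact Finset.mem_image_of_mem _ hd

theorem PathChord.incl_injective (hH : H ⊆ D.cut) (hf : ∀ c, f = some c → c.1 ∈ H) :
    Function.Injective (D.incl H f) := by
  have hne : ∀ r, D.incl H f (some r) ≠ f := by
    intro r h
    obtain ⟨d, hd, hr⟩ := PathChord.exists_rk_eq hH r
    rw [PathChord.incl_some hd hr] at h
    exact PathChord.not_mem_of_mem_on hH hd (hf d h.symm)
  intro x y h
  rcases x with _ | r <;> rcases y with _ | s
  · rfl
  · exact (hne s h.symm).elim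
  · exact (hne r h).elim
  · obtain ⟨d, hd, hr⟩ := PathChord.exists_rk_eq hH r
    obtain ⟨d', hd', hs⟩ := PathChord.exists_rk_eq hH s
    rw [PathChord.incl_some hd hr, PathChord.incl_some hd' hs] at h
    obtain rfl := Option.some.inj h
    exact congrArg some (Subtype.ext (hr.trans hs.symm))

theorem PathChord.mem_range_incl (hH : H ⊆ D.cut) {g : Option D.Chord} :
    g ∈ Set.range (D.incl H f) ↔ D.InPiece H f g := by
  constructor
  · rintro ⟨_ | r, rfl⟩
    · exact Or.inl rfl
    · obtain ⟨d, hd, hr⟩ := PathChord.exists_rk_eq hH r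
      exact Or.inr ⟨d, PathChord.incl_some hd hr, hd⟩
  · rintro (rfl | ⟨d, rfl, hd⟩)
    · exact ⟨none, rfl⟩
    · obtain ⟨r, hr⟩ := PathChord.exists_chord_rk hH hd
      exact ⟨some r, PathChord.incl_some hd hr⟩

theorem PathChord.parent_incl (hH : H ⊆ D.cut) (x : Option (D.piece H (D.rawFace f)).Chord)
    {r : (D.piece H (D.rawFace f)).Chord} {d : D.Chord} (hd : d.1 ∈ D.on H (D.rawFace f))
    (hr : r.1 = D.rk H (D.rawFace f) d.1) :
    (D.piece H (D.rawFace f)).Parent x r ↔ D.Parent (D.incl H f x) d := by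
  have hd' := (PathChord.mem_on hH).1 hd
  rw [PathChord.parent_iff, PathChord.parent_iff]
  rcases x with _ | s
  · change _ ↔ Below D.path.arrows.length (D.rawFace f) d.1 ∧ ∀ e : D.Chord, nest d.1 e.1 →
      ¬ Below D.path.arrows.length (D.rawFace f) e.1
    constructor
    · rintro ⟨-, h⟩
      refine ⟨hd'.2.1, fun e hn hb => ?_⟩
      have he := PathChord.mem_on_of_nest hH hd hn hb
      obtain ⟨t, ht⟩ := PathChord.exists_chord_rk hH he
      refine h t ?_ (PathChord.below_none t)
      rw [hr, ht]
      exact (PathChord.nest_rk he hd).2 hn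
    · rintro ⟨-, h⟩
      refine ⟨PathChord.below_none r, fun t hn _ => ?_⟩
      obtain ⟨e, he, ht⟩ := PathChord.exists_rk_eq hH t
      rw [hr, ht] at hn
      exact h e ((PathChord.nest_rk he hd).1 hn) ((PathChord.mem_on hH).1 he).2.1
  · obtain ⟨c, hc, hs⟩ := PathChord.exists_rk_eq hH s
    rw [PathChord.incl_some hc hs, PathChord.below_some, PathChord.below_some, hr, hs,
      PathChord.nest_rk hc hd]
    refine and_congr_right fun hdc => ?_
    constructor
    · intro h e hn hb
      rw [PathChord.below_some] at hb
      have he := PathChord.mem_on_of_nest hH hd hn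
        (PathChord.below_trans ((PathChord.mem_on hH).1 hc).2.1 hb)
      obtain ⟨t, ht⟩ := PathChord.exists_chord_rk hH he
      refine h t ?_ ?_
      · rw [ht]
        exact (PathChord.nest_rk he hd).2 hn
      · rw [PathChord.below_some, ht, hs]
        exact (PathChord.nest_rk hc he).2 hb
    · intro h t hn hb
      obtain ⟨e, he, ht⟩ := PathChord.exists_rk_eq hH t
      rw [ht] at hn
      rw [PathChord.below_some, ht, hs] at hb
      exact h e ((PathChord.nest_rk he hd).1 hn) ((PathChord.nest_rk hc he).1 hb)

theorem PathChord.forward_incl (hH : H ⊆ D.cut)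
    {r : (D.piece H (D.rawFace f)).Chord} {d : D.Chord} (hd : d.1 ∈ D.on H (D.rawFace f))
    (hr : r.1 = D.rk H (D.rawFace f) d.1) :
    (D.piece H (D.rawFace f)).Forward r ↔ D.Forward d := by
  have h := (PathChord.piece_isSubword hH (D.rawFace_isFaceOf f)).get d.1.1
    ((D.isCut.lt d.2).1.trans (D.isCut.lt d.2).2) (mem_onCut.1 hd).2.1
  unfold PathChord.Forward
  rw [← h, hr]
  rfl

theorem PathChord.exists_parent_incl (hH : H ⊆ D.cut) (P : D.Chord → Prop)
    (P' : (D.piece H (D.rawFace f)).Chord → Prop)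
    (hP : ∀ r d, d.1 ∈ D.on H (D.rawFace f) → r.1 = D.rk H (D.rawFace f) d.1 → (P' r ↔ P d))
    (x y : Option (D.piece H (D.rawFace f)).Chord) :
    (∃ r, y = some r ∧ (D.piece H (D.rawFace f)).Parent x r ∧ P' r) ↔
      ∃ d, D.incl H f y = some d ∧ D.Parent (D.incl H f x) d ∧ P d := by
  rcases y with _ | s
  · constructor
    · rintro ⟨r, hr, -⟩
      simp at hr
    · rintro ⟨d, hd, hp, -⟩
      have hx := (PathChord.mem_range_incl (f := f) hH).1 ⟨x, rfl⟩
      change f = some d at hd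
      subst hd
      exact (hx.not_parent hH hp).elim
  · obtain ⟨c, hc, hs⟩ := PathChord.exists_rk_eq hH s
    rw [PathChord.incl_some hc hs]
    constructor
    · rintro ⟨r, hr, h1, h2⟩
      obtain rfl := Option.some.inj hr
      exact ⟨c, rfl, (PathChord.parent_incl hH x hc hs).1 h1, (hP _ _ hc hs).1 h2⟩
    · rintro ⟨d, hd, h1, h2⟩
      obtain rfl := Option.some.inj hd
      exact ⟨s, rfl, (PathChord.parent_incl hH x hc hs).2 h1, (hP _ _ hc hs).2 h2⟩

theorem PathChord.dualArrow_incl (hH : H ⊆ D.cut)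
    (x y : Option (D.piece H (D.rawFace f)).Chord) :
    (D.piece H (D.rawFace f)).dualArrow x y ↔ D.dualArrow (D.incl H f x) (D.incl H f y) :=
  or_congr
    (PathChord.exists_parent_incl hH _ _ (fun _ _ hd hr => PathChord.forward_incl hH hd hr) x y)
    (PathChord.exists_parent_incl hH _ _
      (fun _ _ hd hr => not_congr (PathChord.forward_incl hH hd hr)) y x)

theorem PathChord.above_incl (hH : H ⊆ D.cut)
    (x y : Option (D.piece H (D.rawFace f)).Chord) :
    (D.piece H (D.rawFace f)).Above x y ↔ D.Above (D.incl H f x) (D.incl H f y) := by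
  have h := PathChord.exists_parent_incl hH (fun _ => True) (fun _ => True)
    (fun _ _ _ _ => Iff.rfl) x y
  simpa [PathChord.Above] using h

theorem PathChord.adj_incl (hH : H ⊆ D.cut)
    (x y : Option (D.piece H (D.rawFace f)).Chord) :
    (SimpleGraph.fromRel (D.piece H (D.rawFace f)).dualArrow).Adj x y ↔
      (SimpleGraph.fromRel D.dualArrow).Adj (D.incl H f x) (D.incl H f y) := by
  rw [PathChord.fromRel_adj, PathChord.fromRel_adj, PathChord.above_incl hH,
    PathChord.above_incl hH]

theorem PathChord.dualKey_of_not {f g : Option D.Chord} (h : ∀ d, g = some d → ¬ D.Parent f d) :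
    D.dualKey f g = 0 := by
  rcases g with _ | d
  · rfl
  · simp [PathChord.dualKey, h d rfl]

theorem PathChord.dualKey_of_parent {f : Option D.Chord} {d : D.Chord} (h : D.Parent f d) :
    D.dualKey f (some d) = d.1.1 + 1 := by
  simp [PathChord.dualKey, h]

theorem PathChord.dualKey_lt_incl (hH : H ⊆ D.cut)
    (x a b : Option (D.piece H (D.rawFace f)).Chord) :
    (D.piece H (D.rawFace f)).dualKey x a < (D.piece H (D.rawFace f)).dualKey x b ↔
      D.dualKey (D.incl H f x) (D.incl H f a) < D.dualKey (D.incl H f x) (D.incl H f b) := by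
  have key : ∀ y, ((D.piece H (D.rawFace f)).dualKey x y = 0 ∧
        D.dualKey (D.incl H f x) (D.incl H f y) = 0) ∨
      ∃ d : D.Chord, OnFace D.path.arrows.length H (D.rawFace f) d.1.1 ∧
        (D.piece H (D.rawFace f)).dualKey x y =
          cnt (OnFace D.path.arrows.length H (D.rawFace f)) d.1.1 + 1 ∧
        D.dualKey (D.incl H f x) (D.incl H f y) = d.1.1 + 1 := by
    intro y
    by_cases hy : (D.piece H (D.rawFace f)).Above x y
    · refine Or.inr ?_
      obtain ⟨r, rfl, hp⟩ := hy
      obtain ⟨d, hd, hr⟩ := PathChord.exists_rk_eq hH r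
      have hp' := (PathChord.parent_incl hH x hd hr).1 hp
      refine ⟨d, (mem_onCut.1 hd).2.1, ?_, ?_⟩
      · rw [PathChord.dualKey_of_parent hp, hr]
        rfl
      · rw [PathChord.incl_some hd hr, PathChord.dualKey_of_parent hp']
    · refine Or.inl ⟨PathChord.dualKey_of_not fun d hd hp => hy ⟨d, hd, hp⟩,
        PathChord.dualKey_of_not fun d hd hp => hy ?_⟩
      exact (PathChord.above_incl hH x y).2 ⟨d, hd, hp⟩
  rcases key a with ⟨h1, h2⟩ | ⟨d, hd, h1, h2⟩ <;> rcases key b with ⟨h3, h4⟩ | ⟨e, he, h3, h4⟩ <;>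
    rw [h1, h2, h3, h4]
  · simp
  · simp
  · have := cnt_lt_iff hd (y := e.1.1)
    omega

theorem PathChord.face_incl (hH : H ⊆ D.cut)
    (x : Option (D.piece H (D.rawFace f)).Chord) :
    (D.piece H (D.rawFace f)).face Finset.univ x = D.face Finset.univ (D.incl H f x) := by
  rw [PathChord.face_eq_piece, PathChord.face_eq_piece, PathChord.rawCut_univ,
    PathChord.rawCut_univ, PathChord.piece_cut hH (D.rawFace_isFaceOf f)]
  obtain ⟨g, hg, hgx, hgi⟩ : ∃ g, IsFaceOf (D.on H (D.rawFace f)) g ∧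
      (D.piece H (D.rawFace f)).rawFace x = g.map (D.rk H (D.rawFace f)) ∧
      D.rawFace (D.incl H f x) = g.or (D.rawFace f) := by
    rcases x with _ | r
    · exact ⟨none, isFaceOf_none, rfl, rfl⟩
    · obtain ⟨d, hd, hr⟩ := PathChord.exists_rk_eq hH r
      refine ⟨some d.1, isFaceOf_some.2 hd, ?_, ?_⟩
      · exact congrArg some hr
      · rw [PathChord.incl_some hd hr]
        rfl
  rw [hgx, PathChord.piece_piece hH (D.rawFace_isFaceOf f) (Finset.Subset.refl _) hg, hgi]
  refine PathChord.piece_congr_cover (Finset.union_subset hH PathChord.on_subset)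
    (Finset.Subset.refl _) (fun c hc hb => ⟨c, Finset.union_subset hH PathChord.on_subset hc, hb,
      le_rfl, le_rfl⟩) ?_
  intro c hc hb
  have hbf : Below D.path.arrows.length (D.rawFace f) c := by
    rcases g with _ | d
    · exact hb
    · have hd := isFaceOf_some.1 hg
      exact PathChord.below_trans (c := ⟨d, PathChord.on_subset hd⟩) (d := ⟨c, hc⟩)
        ((PathChord.mem_on hH).1 hd).2.1 hb
  by_cases hcon : c ∈ D.on H (D.rawFace f)
  · exact ⟨c, Finset.mem_union_right _ hcon, hb, le_rfl, le_rfl⟩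
  · rw [PathChord.mem_on hH] at hcon
    push Not at hcon
    obtain ⟨h, hh, hhb, h1, h2⟩ := hcon hc hbf
    refine ⟨h, Finset.mem_union_left _ hh, ?_, h1, h2⟩
    rcases g with _ | d
    · exact hhb
    · have hd := isFaceOf_some.1 hg
      have hne : h ≠ d := fun e => PathChord.not_mem_of_mem_on hH hd (e ▸ hh)
      have htri := D.isCut.tri (hH hh) (PathChord.on_subset hd) hne
      have hcov := ((PathChord.mem_on hH).1 hd).2.2 h hh hhb
      have hb1 := hb.1
      have hb2 := hb.2
      have := D.isCut.lt hc
      simp only [Option.some_or, Below, lo, hi] at *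
      omega

end Components

section DualPieces

variable {I : Type u} [Quiver.{v} I] {D : PathChord I} {H : Finset (ℕ × ℕ)}

theorem PathChord.dualRibbon_cyc_incl {Λ : Type w} {f : Option D.Chord} (hH : H ⊆ D.cut)
    {l : Option D.Chord → Λ} {l' : Option (D.piece H (D.rawFace f)).Chord → Λ}
    (x a b c : Option (D.piece H (D.rawFace f)).Chord) :
    ((D.piece H (D.rawFace f)).dualRibbon l').cyc x a b c ↔
      (D.dualRibbon l).cyc (D.incl H f x) (D.incl H f a) (D.incl H f b) (D.incl H f c) := by
  simp only [PathChord.dualRibbon, PathChord.adj_incl hH, PathChord.dualKey_lt_incl hH]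

theorem PathChord.reachable_incl {f : Option D.Chord} (hH : H ⊆ D.cut)
    (hf : ∀ c, f = some c → c.1 ∈ H) (g : Option D.Chord) :
    (D.dualGraph.deleteEdges (D.dualEdges (H : Set (ℕ × ℕ)))).Reachable f g ↔
      g ∈ Set.range (D.incl H f) := by
  rw [PathChord.reachable_iff hH hf, PathChord.mem_range_incl hH]

theorem PathChord.iso_trunk (hH : H ⊆ D.cut) {E : Set D.dualRooted.Edge}
    (hE : D.dualRooted.edgeSym E = D.dualEdges (H : Set (ℕ × ℕ))) :
    (D.piece H none).dualRooted.Iso (D.dualRooted.trunk E) := by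
  have hf : ∀ c, (none : Option D.Chord) = some c → c.1 ∈ H := by simp
  refine RootedTree.iso_trunk (S := (D.piece H none).dualRooted) (i := D.incl H none)
    (PathChord.incl_injective hH hf) ?_ (PathChord.dualArrow_incl (f := none) hH)
    (PathChord.dualRibbon_cyc_incl (f := none) hH) ?_ rfl ?_
  · intro g
    rw [hE]
    exact PathChord.reachable_incl (f := none) hH hf g
  · intro x
    exact congrArg PathChord.path (PathChord.face_incl (f := none) hH x)
  · intro a b
    exact and_congr (PathChord.adj_incl (f := none) hH none a)
      (and_congr (PathChord.adj_incl (f := none) hH none b)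
        (PathChord.dualKey_lt_incl (f := none) hH none a b))

theorem PathChord.iso_branch (hH : H ⊆ D.cut) {c : D.Chord} (hc : c.1 ∈ H)
    {E : Set D.dualRooted.Edge} (hE : D.dualRooted.edgeSym E = D.dualEdges (H : Set (ℕ × ℕ)))
    (he : D.dualEdge c ∈ E) :
    (D.piece H (some c.1)).dualRooted.Iso (D.dualRooted.branch E (D.dualEdge c) he) := by
  have hf : ∀ d, some c = some d → d.1 ∈ H := by
    intro d hd
    exact Option.some.inj hd ▸ hc
  refine RootedTree.iso_branch (S := (D.piece H (some c.1)).dualRooted) he (i := D.incl H (some c))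
    (PathChord.incl_injective hH hf) ?_ (PathChord.dualArrow_incl (f := some c) hH)
    (PathChord.dualRibbon_cyc_incl (f := some c) hH) ?_ rfl ?_
  · intro g
    rw [hE]
    exact PathChord.reachable_incl (f := some c) hH hf g
  · intro x
    exact congrArg PathChord.path (PathChord.face_incl (f := some c) hH x)
  · intro a b
    have hup : D.Parent (D.dualEdge c).1.1 c := D.dualEdge_parent c
    have hadj : (SimpleGraph.fromRel D.dualArrow).Adj (some c) (D.dualEdge c).1.1 :=
      (D.fromRel_adj _ _).2 (Or.inr (PathChord.above_some.2 hup))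
    have hkey0 : D.dualKey (some c) (D.dualEdge c).1.1 = 0 := by
      refine PathChord.dualKey_of_not fun d hd hp => ?_
      have h1 : D.Parent (some d) c := by
        have h2 := hup
        rwa [hd] at h2
      exact PathChord.not_parent_swap h1 hp
    have hpos : ∀ x, (SimpleGraph.fromRel D.dualArrow).Adj (some c) (D.incl H (some c) x) →
        0 < D.dualKey (some c) (D.incl H (some c) x) := by
      intro x hx
      rcases (D.fromRel_adj _ _).1 hx with ⟨d, hd, hp⟩ | h
      · rw [hd, PathChord.dualKey_of_parent hp]
        omega
      · have h1 := (PathChord.mem_range_incl (f := some c) hH).1 ⟨x, rfl⟩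
        exact (h1.not_parent hH (PathChord.above_some.1 h)).elim
    have h1 := PathChord.adj_incl (f := some c) hH none a
    have h2 := PathChord.adj_incl (f := some c) hH none b
    have h3 := PathChord.dualKey_lt_incl (f := some c) hH none a b
    have h4 := hpos a
    have h5 := hpos b
    change (_ ∧ _ ∧ _) ↔ ((SimpleGraph.fromRel D.dualArrow).Adj (some c) (D.dualEdge c).1.1 ∧
        (SimpleGraph.fromRel D.dualArrow).Adj (some c) (D.incl H (some c) a) ∧
        (SimpleGraph.fromRel D.dualArrow).Adj (some c) (D.incl H (some c) b)) ∧
      ((D.dualKey (some c) (D.dualEdge c).1.1 < D.dualKey (some c) (D.incl H (some c) a) ∧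
        D.dualKey (some c) (D.incl H (some c) a) < D.dualKey (some c) (D.incl H (some c) b)) ∨
      (D.dualKey (some c) (D.incl H (some c) a) < D.dualKey (some c) (D.incl H (some c) b) ∧
        D.dualKey (some c) (D.incl H (some c) b) < D.dualKey (some c) (D.dualEdge c).1.1) ∨
      (D.dualKey (some c) (D.incl H (some c) b) < D.dualKey (some c) (D.dualEdge c).1.1 ∧
        D.dualKey (some c) (D.dualEdge c).1.1 < D.dualKey (some c) (D.incl H (some c) a)))
    rw [hkey0]
    refine Iff.trans (and_congr h1 (and_congr h2 h3)) ?_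
    change (_ ∧ _ ∧ D.dualKey (some c) _ < D.dualKey (some c) _) ↔ _
    constructor
    · rintro ⟨k1, k2, k3⟩
      exact ⟨⟨hadj, k1, k2⟩, Or.inl ⟨h4 k1, k3⟩⟩
    · rintro ⟨⟨-, k1, k2⟩, k3⟩
      refine ⟨k1, k2, ?_⟩
      omega

theorem ClosedChord.iso_comp {D : ClosedChord I} {H : Finset (ℕ × ℕ)} {f : Option D.1.Chord}
    (hH : H ⊆ D.1.cut) (hf : ∀ c, f = some c → c.1 ∈ H)
    (hcl : (D.1.piece H (D.1.rawFace f)).path.src = (D.1.piece H (D.1.rawFace f)).path.tgt) :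
    (ClosedChord.dualOriented ⟨D.1.piece H (D.1.rawFace f), hcl⟩).Iso
      (D.dualOriented.comp (D.1.dualEdges (H : Set (ℕ × ℕ))) f) := by
  refine RibbonTree.iso_comp (S := ClosedChord.dualOriented ⟨D.1.piece H (D.1.rawFace f), hcl⟩)
    (i := D.1.incl H f)
    (PathChord.incl_injective hH hf) (PathChord.reachable_incl hH hf)
    (PathChord.dualArrow_incl hH) (PathChord.dualRibbon_cyc_incl hH) ?_
  intro x
  refine congrArg Necklace.mk (Subtype.ext ?_)
  exact congrArg PathChord.path (PathChord.face_incl hH x)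

end DualPieces

section DualCoalgebra

variable {k : Type w} [CommRing k] {I : Type u} [Quiver.{v} I] {D : PathChord I}

theorem PathChord.edgeSym_dualEdge (H : Finset D.Chord) :
    D.dualRooted.edgeSym (D.dualEdge '' (H : Set D.Chord)) =
      D.dualEdges (D.rawCut H : Set (ℕ × ℕ)) := by
  rw [PathChord.edgeSym_image]
  congr 1
  simp [PathChord.rawCut]

/-- The class of the dual tree. -/
noncomputable def PathChord.dualClass (D : PathChord I) : RTreeClass (QPath I) :=
  RTreeClass.mk D.dualRooted

theorem rtreeComulOn_dualRooted (D : PathChord I) : rtreeComulOn k D.dualRooted =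
    ∑ c ∈ D.cut, bas k (D.piece {c} (some c)).dualClass ⊗ₜ[k] bas k (D.piece {c} none).dualClass := by
  refine Eq.trans ?_ (Finset.sum_coe_sort D.cut (fun c =>
    bas k (D.piece {c} (some c)).dualClass ⊗ₜ[k] bas k (D.piece {c} none).dualClass))
  symm
  refine Fintype.sum_bijective D.dualEdge D.dualEdge_bijective _ _ fun c => ?_
  have hE : D.dualRooted.edgeSym {D.dualEdge c} = D.dualEdges (({c.1} : Finset (ℕ × ℕ)) : Set _) := by
    have := PathChord.edgeSym_dualEdge {c}
    rwa [Finset.coe_singleton, Set.image_singleton, PathChord.rawCut_singleton] at this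
  have hc : ({c.1} : Finset (ℕ × ℕ)) ⊆ D.cut := by simp
  have h1 := RTreeClass.sound (PathChord.iso_branch hc (Finset.mem_singleton_self _) hE rfl)
  have h2 := RTreeClass.sound (PathChord.iso_trunk hc hE)
  rw [← h1, ← h2]
  rfl

theorem rtreeCoprodOn_dualRooted (D : PathChord I) : rtreeCoprodOn k D.dualRooted =
    gen D.dualClass ⊗ₜ[k] 1 + ∑ H ∈ antichains nest D.cut,
      ((∏ c ∈ H, gen (D.piece H (some c)).dualClass) ⊗ₜ[k] gen (D.piece H none).dualClass) := by
  rw [rtreeCoprodOn, ← D.sum_simpleCuts]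
  congr 1
  symm
  refine Finset.sum_equiv (Equiv.ofBijective D.dualEdge D.dualEdge_bijective).finsetCongr ?_ ?_
  · intro H
    rw [RootedTree.mem_simpleCuts, Equiv.finsetCongr_apply]
    have h1 := PathChord.dualRooted_isSimple_iff H
    refine Iff.trans ?_ h1.symm
    classical
    simp [PathChord.simpleCuts]
  · intro H _
    have hcoe : (((Equiv.ofBijective D.dualEdge D.dualEdge_bijective).finsetCongr H :
        Finset D.dualRooted.Edge) : Set D.dualRooted.Edge) = D.dualEdge '' (H : Set D.Chord) := by
      rw [Equiv.finsetCongr_apply, Finset.coe_map]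
      rfl
    have hE := PathChord.edgeSym_dualEdge H
    rw [← hcoe] at hE
    have h2 := RTreeClass.sound (PathChord.iso_trunk (D.rawCut_subset H) hE)
    rw [← h2]
    congr 1
    rw [PathChord.rawCut, Finset.prod_map]
    refine Eq.trans (Finset.prod_coe_sort H (fun c => gen (k := k)
      (D.piece (D.rawCut H) (some c.1)).dualClass)).symm ?_
    refine Fintype.prod_equiv ((Equiv.ofBijective D.dualEdge D.dualEdge_bijective).subtypeEquiv
      fun e => ?_) _ _ fun e => ?_
    · rw [Equiv.finsetCongr_apply]
      simp
    · refine congrArg gen (RTreeClass.sound (PathChord.iso_branch (D.rawCut_subset H) ?_ hE _))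
      exact Finset.mem_map_of_mem _ e.2

/-- Multiplicative functions on chords, evaluated along a subcut. -/
theorem PathChord.prod_cut {M : Type*} [CommMonoid M] (D : PathChord I) {H : Finset (ℕ × ℕ)}
    (hH : H ⊆ D.cut) (F : ℕ × ℕ → M) : ∏ c ∈ D.cut, F c =
      (∏ c ∈ H, F c) * ((∏ c ∈ H, ∏ d ∈ D.on H (some c), F d) * ∏ d ∈ D.on H none, F d) := by
  classical
  have hcut := D.isCut.mono hH
  have hface : ∀ f ∈ insert none (H.map Function.Embedding.some), IsFaceOf H f := by
    intro f hf
    rcases Finset.mem_insert.1 hf with rfl | hf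
    · exact isFaceOf_none
    · obtain ⟨c, hc, rfl⟩ := Finset.mem_map.1 hf
      exact isFaceOf_some.2 hc
  have h1 : D.cut \ H = (insert none (H.map Function.Embedding.some)).biUnion (D.on H) := by
    ext d
    rw [Finset.mem_sdiff, Finset.mem_biUnion]
    constructor
    · rintro ⟨hd, hdH⟩
      obtain ⟨f, hf, hon⟩ := exists_face D.isCut hH hd hdH
      refine ⟨f, ?_, hon⟩
      rcases f with _ | c
      · simp
      · simpa using isFaceOf_some.1 hf
    · rintro ⟨f, hf, hd⟩
      refine ⟨PathChord.on_subset hd, fun hdH => ?_⟩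
      exact ((mem_onCut.1 hd).2.1.ne hcut (hface f hf) hdH).1 rfl
  rw [← Finset.prod_sdiff hH, mul_comm, h1, Finset.prod_biUnion, Finset.prod_insert (by simp),
    Finset.prod_map, mul_comm (∏ d ∈ D.on H none, F d)]
  · rfl
  · intro f hf g hg hne
    rw [Function.onFun, Finset.disjoint_left]
    intro d hd hd'
    exact hne ((mem_onCut.1 hd).2.1.unique hcut (hface f hf) (hface g hg) (mem_onCut.1 hd').2.1)

theorem PathChord.sg_piece {H : Finset (ℕ × ℕ)} {f : Option (ℕ × ℕ)} (hH : H ⊆ D.cut)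
    (hf : IsFaceOf D.cut f) :
    (D.piece H f).sg k (D.piece H f).cut = D.sg k (D.on H f) := by
  rw [PathChord.sg, PathChord.piece_cut hH hf, Finset.prod_image (D.rk_injOn H f), PathChord.sg]
  exact Finset.prod_congr rfl fun c hc => by rw [PathChord.sgn_rk hH hf hc]

/-- The sign of the whole cut is multiplicative along subcuts. -/
theorem PathChord.sg_cut (D : PathChord I) {H : Finset (ℕ × ℕ)} (hH : H ⊆ D.cut) :
    D.sg k D.cut = D.sg k H * ((∏ c ∈ H, (D.piece H (some c)).sg k (D.piece H (some c)).cut) *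
      (D.piece H none).sg k (D.piece H none).cut) := by
  rw [PathChord.sg_piece hH isFaceOf_none,
    Finset.prod_congr rfl fun c hc => PathChord.sg_piece hH (isFaceOf_some.2 (hH hc))]
  exact D.prod_cut hH _

theorem dRt_bas (D : PathChord I) : dRt k (bas k D) = D.sg k D.cut • bas k D.dualClass := by
  have h : D.sg k D.cut = ((D.eps Finset.univ : ℤ) : k) := by
    rw [PathChord.eps_cast, PathChord.rawCut_univ]
  rw [dRt, Finsupp.linearCombination_single, one_smul, dRtOn, h]
  exact (Int.cast_smul_eq_zsmul k _ _).symm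

theorem rtreeComul_dualClass (D : PathChord I) :
    rtreeComul k (bas k D.dualClass) = rtreeComulOn k D.dualRooted := rtreeComul_mk _

/-- `D_rt` commutes with the comultiplications. -/
theorem dRt_isComulHom : IsComulHom (chordComul k (I := I)) (rtreeComul k) (dRt k) := by
  apply Finsupp.lhom_ext'
  intro D
  apply LinearMap.ext_ring
  change TensorProduct.map (dRt k) (dRt k) (chordComul k (bas k D)) =
    rtreeComul k (dRt k (bas k D))
  rw [chordComul_isChordComul, dRt_bas, map_smul, rtreeComul_dualClass, rtreeComulOn_dualRooted,
    map_sum, Finset.smul_sum]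
  refine Finset.sum_congr rfl fun c hc => ?_
  have h := D.sg_cut (k := k) (H := {c}) (by simpa using hc)
  rw [Finset.prod_singleton] at h
  rw [map_smul, TensorProduct.map_tmul, dRt_bas, dRt_bas, h, TensorProduct.smul_tmul_smul, smul_smul]
  congr 2
  simp [PathChord.sg]

theorem symMap_dRt_gen (D : PathChord I) :
    symMap (dRt k) (gen D) = D.sg k D.cut • gen D.dualClass := by
  rw [symMap_gen, dRt_bas, map_smul]
  rfl

theorem symMap_dRt_comul :
    (Algebra.TensorProduct.map (symMap (dRt k)) (symMap (dRt k))).comp (chordCoprod k (I := I)) =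
      (rtreeCoprod k).comp (symMap (dRt k)) := by
  refine sym_algHom_ext (A := Sym k (RTreeClass (QPath I)) ⊗[k] Sym k (RTreeClass (QPath I)))
    fun D => ?_
  change Algebra.TensorProduct.map (symMap (dRt k)) (symMap (dRt k)) (chordCoprod k (gen D)) =
    rtreeCoprod k (symMap (dRt k) (gen D))
  have h0 : rtreeCoprod k (gen D.dualClass) = rtreeCoprodOn k D.dualRooted := rtreeCoprod_mk _
  rw [symMap_dRt_gen, map_smul, h0, rtreeCoprodOn_dualRooted, chordCoprod_isChordCoprod, map_add,
    map_sum, Algebra.TensorProduct.map_tmul, symMap_dRt_gen, map_one, smul_add,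
    TensorProduct.smul_tmul', Finset.smul_sum]
  congr 1
  refine Finset.sum_congr rfl fun H hH => ?_
  have hHC := (mem_antichains.1 hH).1
  rw [map_smul, Algebra.TensorProduct.map_tmul, map_prod, symMap_dRt_gen,
    Finset.prod_congr rfl fun c _ => symMap_dRt_gen (D.piece H (some c)), Finset.prod_smul,
    TensorProduct.smul_tmul_smul, smul_smul, D.sg_cut hHC]

theorem PathChord.sg_sq (D : PathChord I) {H : Finset (ℕ × ℕ)} (hH : H ⊆ D.cut) :
    D.sg k H * D.sg k H = 1 := by
  rw [PathChord.sg, ← Finset.prod_mul_distrib]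
  refine Finset.prod_eq_one fun c hc => ?_
  obtain ⟨-, x, h1, h2⟩ := D.isCut.pair c (hH hc)
  have : D.sgn c = 1 ∨ D.sgn c = -1 := by
    rw [PathChord.sgn, omegaAt, h1, h2]
    cases x <;> simp [DArrow.rev, omega]
  rcases this with h | h <;> simp [h]

theorem symMap_dRt_isHopfHom : IsHopfHom
    (chordCoprod k (I := I)) symCounit (symAntipode (chordCoprod k)).toLinearMap
    (rtreeCoprod k) symCounit (symAntipode (rtreeCoprod k)).toLinearMap (symMap (dRt k)) := by
  refine isHopfHom_symMap symMap_dRt_comul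
    (fun D => ⟨D.wt, fun n hn => mulReducedPow_chordCoprod hn⟩)
    (fun D t ht => ⟨D.wt, fun n hn => ?_⟩)
  have ht' : t = D.dualClass := by
    have h1 : dRt k (Finsupp.single D 1) = D.sg k D.cut • bas k D.dualClass := dRt_bas D
    rw [h1] at ht
    have h2 := Finsupp.support_smul ht
    exact Finset.mem_singleton.1 (Finsupp.support_single_subset h2)
  subst ht'
  have h := mulReducedPow_symMap (symMap_dRt_comul (k := k) (I := I)) n (gen D)
  rw [mulReducedPow_chordCoprod hn, map_zero, symMap_dRt_gen, map_smul] at h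
  have h3 : (D.sg k D.cut * D.sg k D.cut) • mulReducedPow (rtreeCoprod k) n (gen D.dualClass) = 0 := by
    rw [mul_smul]
    rw [h, smul_zero]
  rwa [D.sg_sq (Finset.Subset.refl _), one_smul] at h3

end DualCoalgebra

section Rotation

variable {I : Type u} [Quiver.{v} I]

theorem DArrow.rev_rev (b : DArrow I) : b.rev.rev = b := by cases b <;> rfl

theorem rotChord_of_eq {m : ℕ} {c : ℕ × ℕ} (h : c.1 = 0) : rotChord m c = (c.2 - 1, m) := if_pos h

theorem rotChord_of_ne {m : ℕ} {c : ℕ × ℕ} (h : c.1 ≠ 0) :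
    rotChord m c = (c.1 - 1, c.2 - 1) := if_neg h

open Classical in
/-- The face of the rotated cut which corresponds to the face `f` of `H`. -/
noncomputable def rotFace (m : ℕ) (H : Finset (ℕ × ℕ)) : Option (ℕ × ℕ) → Option (ℕ × ℕ)
  | none => if h : ∃ c ∈ H, c.1 = 0 then some (rotChord m h.choose) else none
  | some c => if c.1 = 0 then none else some (rotChord m c)

variable {a : List (DArrow I)} {H : Finset (ℕ × ℕ)} {m : ℕ}

theorem rotFace_none_of_mem (hH : IsCut a H) {c : ℕ × ℕ} (hc : c ∈ H) (h0 : c.1 = 0) :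
    rotFace m H none = some (rotChord m c) := by
  have h : ∃ c ∈ H, c.1 = 0 := ⟨c, hc, h0⟩
  rw [rotFace, dif_pos h, hH.eq_of_fst h.choose_spec.1 hc (h.choose_spec.2.trans h0.symm)]

theorem rotFace_none_of_not (h : ∀ c ∈ H, c.1 ≠ 0) : rotFace m H none = none := by
  rw [rotFace, dif_neg]
  rintro ⟨c, hc, h0⟩
  exact h c hc h0

theorem rotFace_some_of_eq {c : ℕ × ℕ} (h : c.1 = 0) : rotFace m H (some c) = none := by
  rw [rotFace, if_pos h]

theorem rotFace_some_of_ne {c : ℕ × ℕ} (h : c.1 ≠ 0) :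
    rotFace m H (some c) = some (rotChord m c) := by
  rw [rotFace, if_neg h]

theorem isFaceOf_rotFace (hH : IsCut a H) {f : Option (ℕ × ℕ)} (hf : IsFaceOf H f) :
    IsFaceOf (H.image (rotChord m)) (rotFace m H f) := by
  rcases f with _ | c
  · by_cases h : ∃ c ∈ H, c.1 = 0
    · obtain ⟨c, hc, h0⟩ := h
      rw [rotFace_none_of_mem hH hc h0, isFaceOf_some]
      exact Finset.mem_image_of_mem _ hc
    · push Not at h
      rw [rotFace_none_of_not h]
      exact isFaceOf_none
  · by_cases h : c.1 = 0
    · rw [rotFace_some_of_eq h]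
      exact isFaceOf_none
    · rw [rotFace_some_of_ne h, isFaceOf_some]
      exact Finset.mem_image_of_mem _ (isFaceOf_some.1 hf)

theorem visible_image_rotChord {n : ℕ} {g : Option (ℕ × ℕ)} {y : ℕ} :
    Visible n (H.image (rotChord m)) g y ↔ ∀ d ∈ H, Below n g (rotChord m d) →
      ¬ ((rotChord m d).1 ≤ y ∧ y ≤ (rotChord m d).2) := by
  unfold Visible
  exact Finset.forall_mem_image

theorem onFace_rot_succ (hH : IsCut a H) (hm : a.length = m + 1) {f : Option (ℕ × ℕ)}
    (hf : IsFaceOf H f) {y : ℕ} (hy : y < m) :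
    OnFace (m + 1) H f (y + 1) ↔ OnFace (m + 1) (H.image (rotChord m)) (rotFace m H f) y := by
  unfold OnFace
  rw [visible_image_rotChord]
  have hlt : ∀ d ∈ H, d.1 < d.2 ∧ d.2 < m + 1 := fun d hd => hm ▸ hH.lt hd
  by_cases h : ∃ c ∈ H, c.1 = 0
  · obtain ⟨c, hc, h0⟩ := h
    have hcl := hlt c hc
    have hd0 : ∀ d ∈ H, d ≠ c → d.1 ≠ 0 := fun d hd hne h => hne (hH.eq_of_fst hd hc (h.trans h0.symm))
    rcases f with _ | e
    · rw [rotFace_none_of_mem hH hc h0, rotChord_of_eq h0]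
      simp only [Visible, Below, lo, hi]
      constructor
      · rintro ⟨-, -, hv⟩
        have hvc := hv c hc (by omega)
        refine ⟨by omega, by omega, fun d hd hb => ?_⟩
        by_cases hdc : d = c
        · subst hdc
          rw [rotChord_of_eq h0] at *
          simp only at *
          omega
        · have := hlt d hd
          have := hd0 d hd hdc
          have := hv d hd (by omega)
          rw [rotChord_of_ne (hd0 d hd hdc)] at *
          simp only at *
          omega
      · rintro ⟨h1, h2, hv⟩
        refine ⟨by omega, by omega, fun d hd hb => ?_⟩
        by_cases hdc : d = c
        · subst hdc
          omega
        · have := hlt d hd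
          have := hd0 d hd hdc
          have htri := hH.tri hd hc hdc
          have hvd := hv d hd
          rw [rotChord_of_ne (hd0 d hd hdc)] at hvd
          simp only at hvd
          rcases htri with h | h | h | h
          · omega
          · have := hvd (by omega)
            omega
          · omega
          · omega
    · have he := isFaceOf_some.1 hf
      by_cases hec : e = c
      · subst hec
        rw [rotFace_some_of_eq h0]
        simp only [Visible, Below, lo, hi]
        constructor
        · rintro ⟨h1, h2, hv⟩
          refine ⟨by omega, by omega, fun d hd hb => ?_⟩
          by_cases hdc : d = e
          · subst hdc
            rw [rotChord_of_eq h0] at *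
            simp only at *
            omega
          · have := hlt d hd
            have := hd0 d hd hdc
            have htri := hH.tri hd hc hdc
            have hvd := hv d hd
            rw [rotChord_of_ne (hd0 d hd hdc)] at *
            simp only at *
            rcases htri with h | h | h | h
            · omega
            · omega
            · omega
            · have := hvd (by omega)
              omega
        · rintro ⟨-, -, hv⟩
          have hvc := hv e hc
          rw [rotChord_of_eq h0] at hvc
          simp only at hvc
          have := hvc (by omega)
          refine ⟨by omega, by omega, fun d hd hb => ?_⟩
          have hdc : d ≠ e := by
            rintro rfl
            omega
          have := hlt d hd
          have := hd0 d hd hdc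
          have hvd := hv d hd
          rw [rotChord_of_ne (hd0 d hd hdc)] at hvd
          simp only at hvd
          have := hvd (by omega)
          omega
      · have he0 := hd0 e he hec
        rw [rotFace_some_of_ne he0, rotChord_of_ne he0]
        have hel := hlt e he
        simp only [Visible, Below, lo, hi]
        constructor
        · rintro ⟨h1, h2, hv⟩
          refine ⟨by omega, by omega, fun d hd hb => ?_⟩
          by_cases hdc : d = c
          · subst hdc
            rw [rotChord_of_eq h0] at *
            simp only at *
            omega
          · have := hlt d hd
            have := hd0 d hd hdc
            have hvd := hv d hd
            rw [rotChord_of_ne (hd0 d hd hdc)] at *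
            simp only at *
            have := hvd (by omega)
            omega
        · rintro ⟨h1, h2, hv⟩
          refine ⟨by omega, by omega, fun d hd hb => ?_⟩
          have hdc : d ≠ c := by
            rintro rfl
            omega
          have := hlt d hd
          have := hd0 d hd hdc
          have hvd := hv d hd
          rw [rotChord_of_ne (hd0 d hd hdc)] at hvd
          simp only at hvd
          have := hvd (by omega)
          omega
  · push Not at h
    rcases f with _ | e
    · rw [rotFace_none_of_not h]
      simp only [Visible, Below, lo, hi]
      constructor
      · rintro ⟨-, -, hv⟩
        refine ⟨by omega, by omega, fun d hd hb => ?_⟩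
        have := hlt d hd
        have hd0 := h d hd
        have := hv d hd (by omega)
        rw [rotChord_of_ne hd0] at *
        simp only at *
        omega
      · rintro ⟨-, -, hv⟩
        refine ⟨by omega, by omega, fun d hd hb => ?_⟩
        have := hlt d hd
        have hd0 := h d hd
        have hvd := hv d hd
        rw [rotChord_of_ne hd0] at hvd
        simp only at hvd
        have := hvd (by omega)
        omega
    · have he := isFaceOf_some.1 hf
      have he0 := h e he
      rw [rotFace_some_of_ne he0, rotChord_of_ne he0]
      have hel := hlt e he
      simp only [Visible, Below, lo, hi]
      constructor
      · rintro ⟨h1, h2, hv⟩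
        refine ⟨by omega, by omega, fun d hd hb => ?_⟩
        have := hlt d hd
        have hd0 := h d hd
        have hvd := hv d hd
        rw [rotChord_of_ne hd0] at *
        simp only at *
        have := hvd (by omega)
        omega
      · rintro ⟨h1, h2, hv⟩
        refine ⟨by omega, by omega, fun d hd hb => ?_⟩
        have := hlt d hd
        have hd0 := h d hd
        have hvd := hv d hd
        rw [rotChord_of_ne hd0] at hvd
        simp only at hvd
        have := hvd (by omega)
        omega

theorem onFace_rot_zero (hH : IsCut a H) (hm : a.length = m + 1) {f : Option (ℕ × ℕ)}
    (hf : IsFaceOf H f) :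
    OnFace (m + 1) H f 0 ↔ OnFace (m + 1) (H.image (rotChord m)) (rotFace m H f) m := by
  have hlt : ∀ d ∈ H, d.1 < d.2 ∧ d.2 < m + 1 := fun d hd => hm ▸ hH.lt hd
  by_cases h : ∃ c ∈ H, c.1 = 0
  · obtain ⟨c, hc, h0⟩ := h
    have h1 : ¬ OnFace (m + 1) H f 0 := by
      intro hon
      rw [← hm] at hon
      exact (hon.ne hH hf hc).1 h0.symm
    have hcl := hlt c hc
    refine iff_of_false h1 ?_
    rintro ⟨h2, h3, h4⟩
    rw [visible_image_rotChord] at h4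
    have h5 := h4 c hc
    rw [rotChord_of_eq h0] at h5
    rcases f with _ | e
    · rw [rotFace_none_of_mem hH hc h0, rotChord_of_eq h0] at h3
      simp only [hi] at h3
      omega
    · have he := isFaceOf_some.1 hf
      have hel := hlt e he
      by_cases he0 : e.1 = 0
      · rw [rotFace_some_of_eq he0] at h5
        simp only [Below, lo, hi] at h5
        exact h5 (by omega) (by omega)
      · rw [rotFace_some_of_ne he0, rotChord_of_ne he0] at h3
        simp only [hi] at h3
        omega
  · push Not at h
    rcases f with _ | e
    · rw [rotFace_none_of_not h]
      refine iff_of_true ⟨by simp [lo], by simp [hi], fun d hd _ => ?_⟩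
        ⟨by simp [lo], by simp [hi], ?_⟩
      · have := h d hd
        omega
      · rw [visible_image_rotChord]
        intro d hd _
        have := hlt d hd
        rw [rotChord_of_ne (h d hd)]
        simp only
        omega
    · have he := isFaceOf_some.1 hf
      have he0 := h e he
      have hel := hlt e he
      rw [rotFace_some_of_ne he0, rotChord_of_ne he0]
      refine iff_of_false ?_ ?_
      · rintro ⟨h1, -⟩
        simp [lo] at h1
      · rintro ⟨-, h1, -⟩
        simp only [hi] at h1
        omega

theorem IsCut.rot {b : DArrow I} {l : List (DArrow I)} (hH : IsCut (b :: l) H) :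
    IsCut (l ++ [b]) (H.image (rotChord l.length)) := by
  have hlt : ∀ d ∈ H, d.1 < d.2 ∧ d.2 < l.length + 1 := fun d hd => hH.lt hd
  refine ⟨?_, ?_, ?_⟩
  · intro c hc
    obtain ⟨d, hd, rfl⟩ := Finset.mem_image.1 hc
    obtain ⟨h1, x, h2, h3⟩ := hH.pair d hd
    have := hlt d hd
    by_cases h0 : d.1 = 0
    · rw [rotChord_of_eq h0]
      obtain ⟨j, hj⟩ : ∃ j, d.2 = j + 1 := ⟨d.2 - 1, by omega⟩
      rw [h0, List.getElem?_cons_zero] at h2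
      rw [hj, List.getElem?_cons_succ] at h3
      refine ⟨by simp only; omega, x.rev, ?_, ?_⟩
      · simp only [hj, Nat.add_sub_cancel]
        rw [List.getElem?_append_left (by omega)]
        exact h3
      · rw [DArrow.rev_rev]
        simpa using h2
    · rw [rotChord_of_ne h0]
      obtain ⟨i, hi⟩ : ∃ i, d.1 = i + 1 := ⟨d.1 - 1, by omega⟩
      obtain ⟨j, hj⟩ : ∃ j, d.2 = j + 1 := ⟨d.2 - 1, by omega⟩
      rw [hi, List.getElem?_cons_succ] at h2
      rw [hj, List.getElem?_cons_succ] at h3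
      refine ⟨by simp only; omega, x, ?_, ?_⟩
      · simp only [hi, Nat.add_sub_cancel]
        rw [List.getElem?_append_left (by omega)]
        exact h2
      · simp only [hj, Nat.add_sub_cancel]
        rw [List.getElem?_append_left (by omega)]
        exact h3
  · intro c hc c' hc' hne
    obtain ⟨d, hd, rfl⟩ := Finset.mem_image.1 hc
    obtain ⟨d', hd', rfl⟩ := Finset.mem_image.1 hc'
    have hne' : d ≠ d' := fun e => hne (congrArg _ e)
    have := hH.distinct d hd d' hd' hne'
    have := hlt d hd
    have := hlt d' hd'
    unfold rotChord
    split_ifs <;> simp only <;> omega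
  · intro c hc c' hc'
    obtain ⟨d, hd, rfl⟩ := Finset.mem_image.1 hc
    obtain ⟨d', hd', rfl⟩ := Finset.mem_image.1 hc'
    by_cases hne : d = d'
    · subst hne
      omega
    · have := hH.tri hd hd' hne
      have := hlt d hd
      have := hlt d' hd'
      unfold rotChord
      split_ifs <;> simp only <;> omega

/-- The inverse of `rotChord`. -/
def unrotChord (m : ℕ) (c : ℕ × ℕ) : ℕ × ℕ :=
  if c.2 = m then (0, c.1 + 1) else (c.1 + 1, c.2 + 1)

theorem IsCut.unrot {b : DArrow I} {l : List (DArrow I)} (hH : IsCut (l ++ [b]) H) :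
    IsCut (b :: l) (H.image (unrotChord l.length)) := by
  have hlt : ∀ d ∈ H, d.1 < d.2 ∧ d.2 < l.length + 1 := fun d hd => by simpa using hH.lt hd
  refine ⟨?_, ?_, ?_⟩
  · intro c hc
    obtain ⟨d, hd, rfl⟩ := Finset.mem_image.1 hc
    obtain ⟨h1, x, h2, h3⟩ := hH.pair d hd
    have := hlt d hd
    rw [List.getElem?_append_left (by omega)] at h2
    unfold unrotChord
    split_ifs with h0
    · rw [h0] at h3
      simp only [List.getElem?_concat_length, Option.some.injEq] at h3
      refine ⟨by simp, x.rev, ?_, ?_⟩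
      · simp [h3]
      · rw [DArrow.rev_rev]
        simpa using h2
    · rw [List.getElem?_append_left (by omega)] at h3
      refine ⟨by simp only; omega, x, ?_, ?_⟩
      · simpa using h2
      · simpa using h3
  · intro c hc c' hc' hne
    obtain ⟨d, hd, rfl⟩ := Finset.mem_image.1 hc
    obtain ⟨d', hd', rfl⟩ := Finset.mem_image.1 hc'
    have hne' : d ≠ d' := fun e => hne (congrArg _ e)
    have := hH.distinct d hd d' hd' hne'
    have := hlt d hd
    have := hlt d' hd'
    unfold unrotChord
    split_ifs <;> simp only <;> omega
  · intro c hc c' hc'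
    obtain ⟨d, hd, rfl⟩ := Finset.mem_image.1 hc
    obtain ⟨d', hd', rfl⟩ := Finset.mem_image.1 hc'
    by_cases hne : d = d'
    · subst hne
      omega
    · have := hH.tri hd hd' hne
      have := hlt d hd
      have := hlt d' hd'
      unfold unrotChord
      split_ifs <;> simp only <;> omega

theorem unrotChord_rotChord {c : ℕ × ℕ} (h : c.1 < c.2) (h' : c.2 ≤ m) :
    unrotChord m (rotChord m c) = c := by
  unfold rotChord
  split_ifs with h0
  · simp only [unrotChord, if_true]
    exact Prod.ext h0.symm (by simp only; omega)
  · rw [unrotChord, if_neg (by simp only; omega)]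
    exact Prod.ext (by simp only; omega) (by simp only; omega)

theorem rotChord_unrotChord {c : ℕ × ℕ} : rotChord m (unrotChord m c) = c := by
  unfold unrotChord
  split_ifs with h0
  · rw [rotChord, if_pos rfl]
    exact Prod.ext (by simp) h0.symm
  · rw [rotChord, if_neg (by simp)]
    exact Prod.ext (by simp) (by simp)

end Rotation

section RotatedPieces

variable {I : Type u} [Quiver.{v} I]

/-- The closed chord diagram `D'` arises from `D` by moving the first arrow `b` to the end. -/
structure PathChord.IsRot (D D' : PathChord I) (b : DArrow I) (l : List (DArrow I)) : Prop where
  arrows : D.path.arrows = b :: l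
  arrows' : D'.path.arrows = l ++ [b]
  cut : D'.cut = D.cut.image (rotChord l.length)
  closed : D.path.src = D.path.tgt
  closed' : D'.path.src = D'.path.tgt

theorem PathChord.piece_closed {D : PathChord I} (h : D.path.src = D.path.tgt)
    (H : Finset (ℕ × ℕ)) (f : Option (ℕ × ℕ)) :
    (D.piece H f).path.src = (D.piece H f).path.tgt := by
  by_cases hHf : H ⊆ D.cut ∧ IsFaceOf D.cut f
  · rw [PathChord.piece_path_src hHf.1 hHf.2, PathChord.piece_path_tgt hHf.1 hHf.2]
    cases f with
    | none =>
      simp only [lo, hi]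
      rw [vertexAt_length D.path.isPath, vertexAt_zero, h]
    | some c => exact (vertexAt_pair D.path.isPath (D.isCut.pair _ (hHf.2 c rfl))).2
  · rw [PathChord.piece, dif_neg hHf, h]

/-- Pieces of chord diagrams on closed paths. -/
noncomputable def ClosedChord.piece (D : ClosedChord I) (H : Finset (ℕ × ℕ))
    (f : Option (ℕ × ℕ)) : ClosedChord I :=
  ⟨D.1.piece H f, PathChord.piece_closed D.2 H f⟩

namespace PathChord.IsRot

variable {D D' : PathChord I} {b : DArrow I} {l : List (DArrow I)} {H : Finset (ℕ × ℕ)}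
  {f : Option (ℕ × ℕ)}

theorem length (h : D.IsRot D' b l) : D.path.arrows.length = l.length + 1 := by simp [h.arrows]

theorem length' (h : D.IsRot D' b l) : D'.path.arrows.length = l.length + 1 := by
  simp [h.arrows']

theorem vertexAt_eq (h : D.IsRot D' b l) {x : ℕ} (hx : x ≤ l.length) :
    vertexAt D'.path.src D'.path.arrows x = vertexAt D.path.src D.path.arrows (x + 1) := by
  rcases Nat.lt_or_ge x l.length with hx | hx'
  · have h1 : D'.path.arrows[x]? = some l[x] := by
      rw [h.arrows', List.getElem?_append_left hx, List.getElem?_eq_getElem hx]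
    have h2 : D.path.arrows[x + 1]? = some l[x] := by
      rw [h.arrows, List.getElem?_cons_succ, List.getElem?_eq_getElem hx]
    rw [(vertexAt_arrow D'.path.isPath h1).1, (vertexAt_arrow D.path.isPath h2).1]
  · obtain rfl : x = l.length := le_antisymm hx hx'
    have h1 : D'.path.arrows[l.length]? = some b := by simp [h.arrows']
    have h2 : D.path.arrows[0]? = some b := by simp [h.arrows]
    rw [(vertexAt_arrow D'.path.isPath h1).1, ← (vertexAt_arrow D.path.isPath h2).1, ← h.length,
      vertexAt_length D.path.isPath, vertexAt_zero, h.closed]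

theorem isCut (h : D.IsRot D' b l) (hH : H ⊆ D.cut) : IsCut (b :: l) H := by
  have := D.isCut.mono hH
  rwa [h.arrows] at this

theorem image_subset (h : D.IsRot D' b l) (hH : H ⊆ D.cut) :
    H.image (rotChord l.length) ⊆ D'.cut := by
  rw [h.cut]
  exact Finset.image_subset_image hH

theorem succ (h : D.IsRot D' b l) (hH : H ⊆ D.cut) (hf : IsFaceOf H f) {y : ℕ}
    (hy : y < l.length) :
    OnFace D.path.arrows.length H f (y + 1) ↔ OnFace D'.path.arrows.length
      (H.image (rotChord l.length)) (rotFace l.length H f) y := by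
  rw [h.length, h.length']
  exact onFace_rot_succ (h.isCut hH) (by simp) hf hy

theorem zero (h : D.IsRot D' b l) (hH : H ⊆ D.cut) (hf : IsFaceOf H f) :
    OnFace D.path.arrows.length H f 0 ↔ OnFace D'.path.arrows.length
      (H.image (rotChord l.length)) (rotFace l.length H f) l.length := by
  rw [h.length, h.length']
  exact onFace_rot_zero (h.isCut hH) (by simp) hf

theorem lt (h : D.IsRot D' b l) {c : ℕ × ℕ} (hc : c ∈ D.cut) : c.1 < c.2 ∧ c.2 < l.length + 1 :=
  h.length ▸ D.isCut.lt hc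

theorem on_eq (h : D.IsRot D' b l) (hH : H ⊆ D.cut) (hf : IsFaceOf H f) :
    D'.on (H.image (rotChord l.length)) (rotFace l.length H f) =
      (D.on H f).image (rotChord l.length) := by
  have key : ∀ c ∈ D.cut, (OnFace D'.path.arrows.length (H.image (rotChord l.length))
      (rotFace l.length H f) (rotChord l.length c).1 ∧ OnFace D'.path.arrows.length
      (H.image (rotChord l.length)) (rotFace l.length H f) (rotChord l.length c).2) ↔
      OnFace D.path.arrows.length H f c.1 ∧ OnFace D.path.arrows.length H f c.2 := by
    intro c hc
    have hlt := h.lt hc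
    by_cases h0 : c.1 = 0
    · rw [rotChord_of_eq h0]
      simp only
      rw [← h.zero hH hf, ← h.succ hH hf (by omega), h0, and_comm,
        show c.2 - 1 + 1 = c.2 by omega]
    · rw [rotChord_of_ne h0]
      simp only
      rw [← h.succ hH hf (by omega), ← h.succ hH hf (by omega),
        show c.2 - 1 + 1 = c.2 by omega, show c.1 - 1 + 1 = c.1 by omega]
  ext e
  simp only [PathChord.on, Finset.mem_image, mem_onCut, h.cut]
  constructor
  · rintro ⟨⟨c, hc, rfl⟩, he⟩
    exact ⟨c, ⟨hc, (key c hc).1 he⟩, rfl⟩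
  · rintro ⟨c, ⟨hc, he⟩, rfl⟩
    exact ⟨⟨c, hc, rfl⟩, (key c hc).2 he⟩

theorem isFaceOf (h : D.IsRot D' b l) (hH : H ⊆ D.cut) (hf : IsFaceOf H f) :
    IsFaceOf D'.cut (rotFace l.length H f) := fun c hc =>
  h.image_subset hH (isFaceOf_rotFace (h.isCut hH) hf c hc)

theorem piece_eq (h : D.IsRot D' b l) (hH : H ⊆ D.cut) (hf : IsFaceOf H f)
    (h0 : ¬ OnFace D.path.arrows.length H f 0) :
    D'.piece (H.image (rotChord l.length)) (rotFace l.length H f) = D.piece H f := by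
  have hf0 : IsFaceOf D.cut f := fun c hc => hH (hf c hc)
  have hH' := h.image_subset hH
  have hf' := h.isFaceOf hH hf
  have h0' := fun hm => h0 ((h.zero hH hf).2 hm)
  have hcnt : ∀ x ≤ l.length, cnt (OnFace D.path.arrows.length H f) (x + 1) =
      cnt (OnFace D'.path.arrows.length (H.image (rotChord l.length)) (rotFace l.length H f)) x :=
    fun x hx => cnt_shift h0 fun z hz => h.succ hH hf (by omega)
  have hsub := PathChord.piece_isSubword hH hf0
  have hsrc : (D'.piece (H.image (rotChord l.length)) (rotFace l.length H f)).path.src =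
      (D.piece H f).path.src := by
    rw [PathChord.piece_path_src hH' hf', PathChord.piece_path_src hH hf0]
    rcases f with _ | c
    · by_cases hex : ∃ c ∈ H, c.1 = 0
      · obtain ⟨c, hc, hc0⟩ := hex
        have hlt := h.lt (hH hc)
        rw [rotFace_none_of_mem (h.isCut hH) hc hc0, rotChord_of_eq hc0]
        simp only [lo]
        rw [show c.2 - 1 + 1 = c.2 by omega, h.vertexAt_eq (by omega),
          ← (vertexAt_pair D.path.isPath (D.isCut.pair c (hH hc))).1, hc0]
      · push Not at hex
        refine absurd ⟨by simp [lo], ?_, ?_⟩ h0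
        · simp [hi, h.length]
        · intro d hd _
          have := hex d hd
          omega
    · have hc := isFaceOf_some.1 hf
      have hlt := h.lt (hH hc)
      by_cases hc0 : c.1 = 0
      · rw [rotFace_some_of_eq hc0]
        simp only [lo, hc0]
        exact h.vertexAt_eq (by omega)
      · rw [rotFace_some_of_ne hc0, rotChord_of_ne hc0]
        simp only [lo]
        rw [show c.1 - 1 + 1 = c.1 by omega]
        exact h.vertexAt_eq (by omega)
  apply PathChord.ext
  · apply QPath.ext
    · exact hsrc
    · rw [← PathChord.piece_closed h.closed, ← PathChord.piece_closed h.closed', hsrc]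
    · refine (PathChord.piece_isSubword hH' hf').unique ⟨?_, ?_⟩
      · have e1 := hcnt _ le_rfl
        have e2 := cnt_succ_of_not (p := OnFace D'.path.arrows.length
          (H.image (rotChord l.length)) (rotFace l.length H f)) h0'
        rw [← h.length] at e1
        rw [← h.length'] at e2
        rw [hsub.length, e1, e2]
      · intro x hx hon
        rw [h.length'] at hx
        have hxl : x < l.length := by
          by_contra hcon
          obtain rfl : x = l.length := by omega
          exact h0' hon
        rw [← hcnt x hxl.le, hsub.get _ (by rw [h.length]; omega) ((h.succ hH hf hxl).2 hon),
          h.arrows, h.arrows', List.getElem?_cons_succ, List.getElem?_append_left hxl]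
  · rw [PathChord.piece_cut hH hf0, PathChord.piece_cut hH' hf', h.on_eq hH hf,
      Finset.image_image]
    refine Finset.image_congr fun c hc => ?_
    obtain ⟨hc0, hc1, hc2⟩ := mem_onCut.1 (Finset.mem_coe.1 hc)
    have hne : c.1 ≠ 0 := fun e => h0 (e ▸ hc1)
    have hlt := h.lt hc0
    simp only [Function.comp, PathChord.rk, ChordAlg.rk, rotChord_of_ne hne]
    rw [← hcnt _ (by omega), ← hcnt _ (by omega), show c.2 - 1 + 1 = c.2 by omega,
      show c.1 - 1 + 1 = c.1 by omega]

theorem piece_isRot (h : D.IsRot D' b l) (hH : H ⊆ D.cut) (hf : IsFaceOf H f)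
    (h0 : OnFace D.path.arrows.length H f 0) :
    ∃ w, (D.piece H f).IsRot
      (D'.piece (H.image (rotChord l.length)) (rotFace l.length H f)) b w := by
  have hf0 : IsFaceOf D.cut f := fun c hc => hH (hf c hc)
  have hH' := h.image_subset hH
  have hf' := h.isFaceOf hH hf
  have h0' := (h.zero hH hf).1 h0
  have hcnt : ∀ x ≤ l.length, cnt (OnFace D.path.arrows.length H f) (x + 1) =
      cnt (OnFace D'.path.arrows.length (H.image (rotChord l.length))
        (rotFace l.length H f)) x + 1 :=
    fun x hx => cnt_shift_of h0 fun z hz => h.succ hH hf (by omega)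
  have hsub := PathChord.piece_isSubword hH hf0
  have hlen := hcnt _ le_rfl
  rw [← h.length, ← hsub.length] at hlen
  have hget0 := hsub.get 0 (by rw [h.length]; omega) h0
  rw [cnt_zero, h.arrows, List.getElem?_cons_zero] at hget0
  obtain ⟨w, hw⟩ : ∃ w, (D.piece H f).path.arrows = b :: w := by
    cases hp : (D.piece H f).path.arrows with
    | nil => simp [hp] at hget0
    | cons b' w =>
      rw [hp, List.getElem?_cons_zero, Option.some.injEq] at hget0
      exact ⟨w, by rw [hget0]⟩
  have hwl : w.length = cnt (OnFace D'.path.arrows.length (H.image (rotChord l.length))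
      (rotFace l.length H f)) l.length := by
    rw [hw, List.length_cons] at hlen
    omega
  refine ⟨w, hw, ?_, ?_, PathChord.piece_closed h.closed _ _, PathChord.piece_closed h.closed' _ _⟩
  · refine (PathChord.piece_isSubword hH' hf').unique ⟨?_, ?_⟩
    · have e2 := cnt_succ_of (p := OnFace D'.path.arrows.length
        (H.image (rotChord l.length)) (rotFace l.length H f)) h0'
      rw [← h.length'] at e2
      rw [e2, List.length_append, hwl, List.length_singleton]
    · intro x hx hon
      rw [h.length'] at hx
      rcases Nat.lt_or_ge x l.length with hxl | hxl
      · have hlt := cnt_lt_cnt hon hxl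
        have := hsub.get (x + 1) (by rw [h.length]; omega) ((h.succ hH hf hxl).2 hon)
        rw [hcnt x hxl.le, hw, h.arrows, List.getElem?_cons_succ, List.getElem?_cons_succ] at this
        have ha : D'.path.arrows[x]? = l[x]? := by
          rw [h.arrows', List.getElem?_append_left hxl]
        rw [List.getElem?_append_left (by omega), this, ha]
      · obtain rfl : x = l.length := by omega
        have ha : D'.path.arrows[l.length]? = some b := by simp [h.arrows']
        rw [← hwl, ha]
        simp
  · rw [PathChord.piece_cut hH hf0, PathChord.piece_cut hH' hf', h.on_eq hH hf,
      Finset.image_image, Finset.image_image]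
    refine Finset.image_congr fun c hc => ?_
    obtain ⟨hc0, hc1, hc2⟩ := mem_onCut.1 (Finset.mem_coe.1 hc)
    have hlt := h.lt hc0
    have e2 := hcnt (c.2 - 1) (by omega)
    rw [show c.2 - 1 + 1 = c.2 by omega] at e2
    by_cases hz : c.1 = 0
    · simp only [Function.comp, PathChord.rk, ChordAlg.rk, rotChord_of_eq hz]
      rw [rotChord_of_eq (by simp only [hz, cnt_zero]), e2, hwl, Nat.add_sub_cancel]
    · have e1 := hcnt (c.1 - 1) (by omega)
      rw [show c.1 - 1 + 1 = c.1 by omega] at e1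
      simp only [Function.comp, PathChord.rk, ChordAlg.rk, rotChord_of_ne hz]
      rw [rotChord_of_ne (by simp only [e1]; omega), e1, e2, Nat.add_sub_cancel,
        Nat.add_sub_cancel]

end PathChord.IsRot

/-- The cut is forgotten. -/
def NecklaceChord.forget : NecklaceChord I → Necklace I :=
  Quot.lift (fun D => Necklace.mk ⟨D.1.path, D.2⟩) fun _ _ ⟨a, l, h1, h2, _⟩ =>
    Quot.sound ⟨a, l, h1, h2⟩

theorem NecklaceChord.mk_eq {D D' : ClosedChord I} {b : DArrow I} {l : List (DArrow I)}
    (h : D.1.IsRot D'.1 b l) : NecklaceChord.mk D = NecklaceChord.mk D' :=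
  Quot.sound ⟨b, l, h.arrows, h.arrows', h.cut⟩

theorem ClosedChord.mk_piece_rot {D D' : ClosedChord I} {b : DArrow I} {l : List (DArrow I)}
    (h : D.1.IsRot D'.1 b l) {H : Finset (ℕ × ℕ)} {f : Option (ℕ × ℕ)} (hH : H ⊆ D.1.cut)
    (hf : IsFaceOf H f) :
    NecklaceChord.mk (D'.piece (H.image (rotChord l.length)) (rotFace l.length H f)) =
      NecklaceChord.mk (D.piece H f) := by
  by_cases h0 : OnFace D.1.path.arrows.length H f 0
  · obtain ⟨w, hw⟩ := h.piece_isRot hH hf h0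
    exact (NecklaceChord.mk_eq (D := D.piece H f) (D' := D'.piece _ _) hw).symm
  · exact congrArg _ (Subtype.ext (h.piece_eq hH hf h0))

end RotatedPieces

section RotationInvariance

variable {I : Type u} [Quiver.{v} I] {k : Type w} [CommRing k]

theorem RotChord.isRot {D D' : ClosedChord I} (h : RotChord D D') :
    ∃ b l, D.1.IsRot D'.1 b l := by
  obtain ⟨b, l, h1, h2, h3⟩ := h
  exact ⟨b, l, h1, h2, h3, D.2, D'.2⟩

/-! ### The sum of all cuts -/

/-- The closed path `X` with the cut `G`. -/
noncomputable def ClosedPath.chord (X : ClosedPath I) (G : Finset (ℕ × ℕ)) : ClosedChord I :=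
  ⟨X.1.chord G, by rw [QPath.chord_path]; exact X.2⟩

theorem sOrOn_eq (X : ClosedPath I) :
    sOrOn k X = ∑ G ∈ cuts X.1.arrows, bas k (NecklaceChord.mk (ClosedPath.chord X G)) := by
  refine Eq.trans ?_ (Finset.sum_coe_sort (cuts X.1.arrows)
    (fun G => bas k (NecklaceChord.mk (ClosedPath.chord X G))))
  refine Finset.sum_congr rfl fun G _ => ?_
  have h : ClosedPath.withCut X G = ClosedPath.chord X G.1 :=
    Subtype.ext (QPath.chord_eq (mem_cuts.1 G.2)).symm
  rw [h]

theorem sOrOn_congr {X Y : ClosedPath I} (h : RotPath X Y) : sOrOn k X = sOrOn k Y := by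
  obtain ⟨b, l, hX, hY⟩ := h
  have hun : ∀ {G}, IsCut (b :: l) G →
      (G.image (rotChord l.length)).image (unrotChord l.length) = G := by
    intro G hG
    rw [Finset.image_image]
    refine (Finset.image_congr fun c hc => ?_).trans Finset.image_id
    have := hG.lt (Finset.mem_coe.1 hc)
    rw [List.length_cons] at this
    exact unrotChord_rotChord this.1 (by omega)
  rw [sOrOn_eq, sOrOn_eq]
  refine Finset.sum_bij' (fun G _ => G.image (rotChord l.length))
    (fun G _ => G.image (unrotChord l.length)) ?_ ?_ ?_ ?_ ?_
  · intro G hG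
    rw [mem_cuts, hX] at hG
    rw [mem_cuts, hY]
    exact hG.rot
  · intro G hG
    rw [mem_cuts, hY] at hG
    rw [mem_cuts, hX]
    exact hG.unrot
  · intro G hG
    rw [mem_cuts, hX] at hG
    exact hun hG
  · intro G hG
    simp only [Finset.image_image]
    refine (Finset.image_congr fun c hc => ?_).trans Finset.image_id
    exact rotChord_unrotChord
  · intro G hG
    rw [mem_cuts] at hG
    have hG' : IsCut Y.1.arrows (G.image (rotChord l.length)) := by
      rw [hY]
      exact (hX ▸ hG).rot
    congr 1
    refine Quot.sound ⟨b, l, ?_, ?_, ?_⟩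
    · exact (congrArg _ QPath.chord_path).trans hX
    · exact (congrArg _ QPath.chord_path).trans hY
    · exact (QPath.chord_cut hG').trans (congrArg _ (QPath.chord_cut hG).symm)

theorem sOr_mk (X : ClosedPath I) : sOr k (bas k (Necklace.mk X)) = sOrOn k X := by
  rw [sOr, Finsupp.linearCombination_single, one_smul]
  exact Quot.apply_out_mk _ (fun _ _ => sOrOn_congr) X

/-! ### The cobracket -/

theorem chordCobracketOn_eq (D : ClosedChord I) :
    chordCobracketOn k D = ∑ c ∈ D.1.cut, (D.1.sgn c : k) •
      (bas k (NecklaceChord.mk (D.piece {c} (some c))) ⊗ₜ[k]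
          bas k (NecklaceChord.mk (D.piece {c} none)) -
        bas k (NecklaceChord.mk (D.piece {c} none)) ⊗ₜ[k]
          bas k (NecklaceChord.mk (D.piece {c} (some c)))) := by
  refine Eq.trans ?_ (Finset.sum_coe_sort D.1.cut (fun c => (D.1.sgn c : k) •
      (bas k (NecklaceChord.mk (D.piece {c} (some c))) ⊗ₜ[k]
          bas k (NecklaceChord.mk (D.piece {c} none)) -
        bas k (NecklaceChord.mk (D.piece {c} none)) ⊗ₜ[k]
          bas k (NecklaceChord.mk (D.piece {c} (some c))))))
  refine Finset.sum_congr rfl fun c _ => ?_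
  have h1 : D.inner c = D.piece {c.1} (some c.1) := Subtype.ext (D.1.inner_eq_piece c)
  have h2 : D.outer c = D.piece {c.1} none := Subtype.ext (D.1.outer_eq_piece c)
  rw [h1, h2]
  exact (Int.cast_smul_eq_zsmul k _ _).symm

theorem omega_swap (x y : DArrow I) : omega y x = -omega x y := by
  cases x <;> cases y <;> simp only [omega, neg_zero] <;> split_ifs <;> simp_all

theorem omegaAt_of_get {a : List (DArrow I)} {c : ℕ × ℕ} {x y : DArrow I} (h1 : a[c.1]? = some x)
    (h2 : a[c.2]? = some y) : omegaAt a c = omega x y := by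
  rw [omegaAt, h1, h2]

namespace PathChord.IsRot

variable {D D' : PathChord I} {b : DArrow I} {l : List (DArrow I)}

theorem rotChord_injOn (h : D.IsRot D' b l) : Set.InjOn (rotChord l.length) (D.cut : Set (ℕ × ℕ)) := by
  intro c hc d hd hcd
  have h1 := h.lt hc
  have h2 := h.lt hd
  rw [← unrotChord_rotChord h1.1 (Nat.lt_succ_iff.1 h1.2), hcd,
    unrotChord_rotChord h2.1 (Nat.lt_succ_iff.1 h2.2)]

theorem getElem?_succ (h : D.IsRot D' b l) {x : ℕ} (hx : x ≠ 0) (hx' : x < l.length + 1) :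
    D'.path.arrows[x - 1]? = D.path.arrows[x]? := by
  obtain ⟨y, rfl⟩ := Nat.exists_eq_succ_of_ne_zero hx
  rw [h.arrows, h.arrows', Nat.succ_eq_add_one, Nat.add_sub_cancel, List.getElem?_cons_succ,
    List.getElem?_append_left (by omega)]

theorem getElem?_zero (h : D.IsRot D' b l) :
    D'.path.arrows[l.length]? = D.path.arrows[0]? := by
  rw [h.arrows, h.arrows']
  simp

theorem sgn_of_ne (h : D.IsRot D' b l) {c : ℕ × ℕ} (hc : c ∈ D.cut) (h0 : c.1 ≠ 0) :
    D'.sgn (rotChord l.length c) = D.sgn c := by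
  have hlt := h.lt hc
  rw [rotChord_of_ne h0]
  unfold PathChord.sgn omegaAt
  simp only
  rw [h.getElem?_succ h0 (by omega), h.getElem?_succ (by omega) hlt.2]

theorem sgn_of_eq (h : D.IsRot D' b l) {c : ℕ × ℕ} (hc : c ∈ D.cut) (h0 : c.1 = 0) :
    D'.sgn (rotChord l.length c) = -D.sgn c := by
  have hlt := h.lt hc
  obtain ⟨-, x, h1, h2⟩ := D.isCut.pair c hc
  rw [rotChord_of_eq h0]
  unfold PathChord.sgn
  rw [omegaAt_of_get h1 h2, omegaAt_of_get (x := x.rev) (y := x), omega_swap]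
  · exact (h.getElem?_succ (by omega) hlt.2).trans h2
  · rw [h0] at h1
    exact h.getElem?_zero.trans h1

end PathChord.IsRot

theorem neg_smul_sub {M : Type*} [AddCommGroup M] [Module k M] (r : k) (x y : M) :
    (-r) • (x - y) = r • (y - x) := by
  rw [neg_smul, ← smul_neg, neg_sub]

theorem chordCobracketOn_congr {D D' : ClosedChord I} (hr : RotChord D D') :
    chordCobracketOn k D = chordCobracketOn k D' := by
  obtain ⟨b, l, h⟩ := hr.isRot
  rw [chordCobracketOn_eq, chordCobracketOn_eq, h.cut, Finset.sum_image h.rotChord_injOn]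
  refine Finset.sum_congr rfl fun c hc => ?_
  have hs : {c} ⊆ D.1.cut := by simpa using hc
  have h1 := ClosedChord.mk_piece_rot h hs (f := some c) (by simp [isFaceOf_some])
  have h2 := ClosedChord.mk_piece_rot h hs (f := none) isFaceOf_none
  rw [Finset.image_singleton] at h1 h2
  by_cases h0 : c.1 = 0
  · rw [rotFace_some_of_eq h0] at h1
    rw [rotFace_none_of_mem (h.isCut hs) (Finset.mem_singleton_self c) h0] at h2
    rw [h.sgn_of_eq hc h0, h1, h2, Int.cast_neg]
    exact (neg_smul_sub _ _ _).symm
  · rw [rotFace_some_of_ne h0] at h1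
    rw [rotFace_none_of_not (by simpa using h0)] at h2
    rw [h.sgn_of_ne hc h0, h1, h2]

theorem chordCobracket_mk (D : ClosedChord I) :
    chordCobracket k (bas k (NecklaceChord.mk D)) = chordCobracketOn k D := by
  rw [chordCobracket, Finsupp.linearCombination_single, one_smul]
  exact Quot.apply_out_mk _ (fun _ _ => chordCobracketOn_congr) D

/-! ### The dual tree -/

theorem PathChord.parent_iff_onFace {D : PathChord I} {g : Option D.Chord} {d : D.Chord} :
    D.Parent g d ↔ g ≠ some d ∧
      OnFace D.path.arrows.length (D.cut.erase d.1) (D.rawFace g) d.1.1 := by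
  have hd := D.isCut.lt d.2
  constructor
  · intro h
    refine ⟨?_, h.1.1, lt_trans hd.1 h.1.2, ?_⟩
    · rintro rfl
      have := h.1.1
      simp only [PathChord.rawFace, Option.map_some, lo] at this
      omega
    · intro e he hb hcon
      have hec := Finset.mem_of_mem_erase he
      have := D.isCut.tri hec d.2 (Finset.ne_of_mem_erase he)
      have := D.isCut.lt hec
      exact h.2 ⟨e, hec⟩ ⟨by simp only [lo]; omega, by simp only [hi]; omega⟩ hb
  · rintro ⟨hne, h1, h2, h3⟩
    refine ⟨⟨h1, ?_⟩, ?_⟩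
    · rcases g with _ | c
      · exact hd.2
      · have hcd : c.1 ≠ d.1 := fun e => hne (congrArg some (Subtype.ext e))
        have := D.isCut.tri c.2 d.2 hcd
        have := D.isCut.lt c.2
        simp only [PathChord.rawFace, Option.map_some, lo, hi] at *
        omega
    · intro e he hb
      simp only [Below, lo, hi] at he
      refine h3 e.1 (Finset.mem_erase.2 ⟨?_, e.2⟩) hb (by omega)
      intro hed
      rw [hed] at he
      omega

namespace PathChord.IsRot

variable {D D' : PathChord I} {b : DArrow I} {l : List (DArrow I)}

/-- The bijection between the chords. -/
noncomputable def chordEquiv (h : D.IsRot D' b l) : D.Chord ≃ D'.Chord :=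
  Equiv.ofBijective
    (fun c => ⟨rotChord l.length c.1, by rw [h.cut]; exact Finset.mem_image_of_mem _ c.2⟩) <| by
    constructor
    · intro c d hcd
      exact Subtype.ext (h.rotChord_injOn c.2 d.2 (congrArg Subtype.val hcd))
    · rintro ⟨e, he⟩
      rw [h.cut] at he
      obtain ⟨c, hc, rfl⟩ := Finset.mem_image.1 he
      exact ⟨⟨c, hc⟩, rfl⟩

theorem chordEquiv_val (h : D.IsRot D' b l) (c : D.Chord) :
    (h.chordEquiv c).1 = rotChord l.length c.1 := rfl

theorem exists_faceEquiv (h : D.IsRot D' b l) : ∃ φ : Option D.Chord ≃ Option D'.Chord,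
    ∀ g, D'.rawFace (φ g) = rotFace l.length D.cut (D.rawFace g) := by
  have hcut := h.isCut (Finset.Subset.refl D.cut)
  by_cases hex : ∃ c : D.Chord, c.1.1 = 0
  · obtain ⟨c, hc⟩ := hex
    refine ⟨(Equiv.optionCongr h.chordEquiv).trans (Equiv.swap none (some (h.chordEquiv c))), ?_⟩
    rintro (_ | d)
    · simp only [Equiv.trans_apply, Equiv.optionCongr_apply, Option.map_none, Equiv.swap_apply_left,
        PathChord.rawFace, Option.map_some]
      rw [rotFace_none_of_mem hcut c.2 hc, chordEquiv_val]
    · by_cases hdc : d = c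
      · subst hdc
        simp only [Equiv.trans_apply, Equiv.optionCongr_apply, Option.map_none,
          Equiv.swap_apply_right, PathChord.rawFace, Option.map_some]
        rw [rotFace_some_of_eq hc]
      · have hd0 : d.1.1 ≠ 0 := fun h0 =>
          hdc (Subtype.ext (hcut.eq_of_fst d.2 c.2 (h0.trans hc.symm)))
        have hne : some (h.chordEquiv d) ≠ some (h.chordEquiv c) := fun he =>
          hdc (h.chordEquiv.injective (Option.some.inj he))
        simp only [Equiv.trans_apply, Equiv.optionCongr_apply, PathChord.rawFace, Option.map_some]
        rw [Equiv.swap_apply_of_ne_of_ne (by simp) hne, rotFace_some_of_ne hd0]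
        rfl
  · push Not at hex
    refine ⟨Equiv.optionCongr h.chordEquiv, ?_⟩
    rintro (_ | d)
    · exact (rotFace_none_of_not (fun c hc => hex ⟨c, hc⟩)).symm
    · exact (rotFace_some_of_ne (hex d)).symm

theorem erase_image (h : D.IsRot D' b l) (d : D.Chord) :
    (D.cut.erase d.1).image (rotChord l.length) = D'.cut.erase (h.chordEquiv d).1 := by
  ext e
  have hmem : e ∈ D'.cut ↔ ∃ c ∈ D.cut, rotChord l.length c = e := by
    rw [h.cut, Finset.mem_image]
  rw [Finset.mem_erase, hmem, Finset.mem_image, chordEquiv_val]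
  constructor
  · rintro ⟨c, hc, rfl⟩
    rw [Finset.mem_erase] at hc
    exact ⟨fun he => hc.1 (h.rotChord_injOn hc.2 d.2 he), c, hc.2, rfl⟩
  · rintro ⟨hne, c, hc, rfl⟩
    exact ⟨c, Finset.mem_erase.2 ⟨fun he => hne (he ▸ rfl), hc⟩, rfl⟩

theorem parent_none (h : D.IsRot D' b l) {d : D.Chord} (hd : d.1.1 = 0) :
    D.Parent none d ∧ D'.Parent none (h.chordEquiv d) := by
  have hlt := h.lt d.2
  constructor
  · refine ⟨⟨by simp [PathChord.rawFace, lo], by rw [h.length]; exact hlt.2⟩, ?_⟩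
    rintro e ⟨he, -⟩ -
    simp only [lo] at he
    omega
  · have hv : (h.chordEquiv d).1 = (d.1.2 - 1, l.length) := by
      rw [chordEquiv_val, rotChord_of_eq hd]
    refine ⟨⟨by simp [PathChord.rawFace, lo], ?_⟩, ?_⟩
    · simp [hv, PathChord.rawFace, hi, h.length']
    · rintro e ⟨-, he⟩ -
      have hle := D'.isCut.lt e.2
      rw [h.length'] at hle
      simp only [hi, hv] at he
      omega

variable {φ : Option D.Chord ≃ Option D'.Chord}

theorem face_some (h : D.IsRot D' b l)
    (hφ : ∀ g, D'.rawFace (φ g) = rotFace l.length D.cut (D.rawFace g)) (d : D.Chord) (hd : d.1.1 ≠ 0) : φ (some d) = some (h.chordEquiv d) := by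
  have h1 := hφ (some d)
  rw [PathChord.rawFace, PathChord.rawFace, Option.map_some, rotFace_some_of_ne hd] at h1
  exact Option.map_injective Subtype.val_injective h1

theorem face_zero (h : D.IsRot D' b l)
    (hφ : ∀ g, D'.rawFace (φ g) = rotFace l.length D.cut (D.rawFace g)) (d : D.Chord) (hd : d.1.1 = 0) :
    φ (some d) = none ∧ φ none = some (h.chordEquiv d) := by
  have h1 := hφ (some d)
  have h2 := hφ none
  rw [PathChord.rawFace, PathChord.rawFace, Option.map_some, rotFace_some_of_eq hd] at h1
  rw [PathChord.rawFace, PathChord.rawFace, Option.map_none,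
    rotFace_none_of_mem (h.isCut (Finset.Subset.refl D.cut)) d.2 hd] at h2
  exact ⟨Option.map_injective Subtype.val_injective h1,
    Option.map_injective Subtype.val_injective h2⟩

theorem parent_iff (h : D.IsRot D' b l)
    (hφ : ∀ g, D'.rawFace (φ g) = rotFace l.length D.cut (D.rawFace g)) {g : Option D.Chord} {d : D.Chord} (hd : d.1.1 ≠ 0) :
    D'.Parent (φ g) (h.chordEquiv d) ↔ D.Parent g d := by
  have hlt := h.lt d.2
  have hv : (h.chordEquiv d).1.1 + 1 = d.1.1 := by
    rw [chordEquiv_val, rotChord_of_ne hd]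
    simp only
    omega
  rw [PathChord.parent_iff_onFace, PathChord.parent_iff_onFace, ← h.face_some hφ d hd,
    φ.injective.ne_iff, ← h.erase_image, hφ]
  refine and_congr_right fun hne => ?_
  have hf : IsFaceOf (D.cut.erase d.1) (D.rawFace g) := by
    rcases g with _ | c
    · exact isFaceOf_none
    · refine isFaceOf_some.2 (Finset.mem_erase.2 ⟨fun e => hne (congrArg some (Subtype.ext e)), c.2⟩)
  have hrot : rotFace l.length D.cut (D.rawFace g) =
      rotFace l.length (D.cut.erase d.1) (D.rawFace g) := by
    rcases g with _ | c
    · have hcut := h.isCut (Finset.Subset.refl D.cut)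
      change rotFace _ _ none = rotFace _ _ none
      by_cases hex : ∃ c ∈ D.cut, c.1 = 0
      · obtain ⟨c, hc, h0⟩ := hex
        have hc' : c ∈ D.cut.erase d.1 := Finset.mem_erase.2 ⟨fun e => hd (e ▸ h0), hc⟩
        rw [rotFace_none_of_mem hcut hc h0,
          rotFace_none_of_mem (h.isCut (Finset.erase_subset _ _)) hc' h0]
      · push Not at hex
        rw [rotFace_none_of_not hex,
          rotFace_none_of_not fun c hc => hex c (Finset.mem_of_mem_erase hc)]
    · rfl
  rw [hrot, ← h.succ (Finset.erase_subset _ _) hf (by omega), hv]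

theorem forward_of_ne (h : D.IsRot D' b l) {d : D.Chord} (hd : d.1.1 ≠ 0) :
    D'.Forward (h.chordEquiv d) ↔ D.Forward d := by
  have hlt := h.lt d.2
  have h1 := h.getElem?_succ hd (by omega)
  unfold PathChord.Forward
  rw [chordEquiv_val, rotChord_of_ne hd]
  simp only [h1]

theorem forward_of_eq (h : D.IsRot D' b l) {d : D.Chord} (hd : d.1.1 = 0) :
    D'.Forward (h.chordEquiv d) ↔ ¬ D.Forward d := by
  have hlt := h.lt d.2
  obtain ⟨-, x, h1, h2⟩ := D.isCut.pair d.1 d.2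
  have h3 := (h.getElem?_succ (by omega) hlt.2).trans h2
  unfold PathChord.Forward
  rw [chordEquiv_val, rotChord_of_eq hd, h1]
  simp only [h3]
  cases x <;> simp [DArrow.rev]

end PathChord.IsRot

end RotationInvariance

section RotatedDual

variable {I : Type u} [Quiver.{v} I] {k : Type w} [CommRing k]

namespace PathChord.IsRot

variable {D D' : PathChord I} {b : DArrow I} {l : List (DArrow I)}
  {φ : Option D.Chord ≃ Option D'.Chord}

theorem dualArrow_iff (h : D.IsRot D' b l)
    (hφ : ∀ g, D'.rawFace (φ g) = rotFace l.length D.cut (D.rawFace g)) (f g : Option D.Chord) :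
    D'.dualArrow (φ f) (φ g) ↔ D.dualArrow f g := by
  have down : ∀ {f g : Option D.Chord} {d : D.Chord}, φ g = some (h.chordEquiv d) →
      D'.Parent (φ f) (h.chordEquiv d) →
      (d.1.1 ≠ 0 ∧ g = some d ∧ D.Parent f d) ∨ (d.1.1 = 0 ∧ f = some d ∧ D.Parent g d) := by
    intro f g d hg hp
    by_cases h0 : d.1.1 = 0
    · obtain ⟨h1, h2⟩ := h.face_zero hφ d h0
      obtain ⟨h3, h4⟩ := h.parent_none h0
      have hg' : g = none := φ.injective (hg.trans h2.symm)
      have hf' : f = some d := φ.injective ((PathChord.parent_unique hp h4).trans h1.symm)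
      exact Or.inr ⟨h0, hf', hg' ▸ h3⟩
    · have hg' : g = some d := φ.injective (hg.trans (h.face_some hφ d h0).symm)
      exact Or.inl ⟨h0, hg', (h.parent_iff hφ h0).1 hp⟩
  have up : ∀ {f : Option D.Chord} {d : D.Chord}, D.Parent f d →
      (d.1.1 ≠ 0 ∧ φ (some d) = some (h.chordEquiv d) ∧ D'.Parent (φ f) (h.chordEquiv d)) ∨
      (d.1.1 = 0 ∧ φ f = some (h.chordEquiv d) ∧ D'.Parent (φ (some d)) (h.chordEquiv d)) := by
    intro f d hp
    by_cases h0 : d.1.1 = 0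
    · obtain ⟨h1, h2⟩ := h.face_zero hφ d h0
      obtain ⟨h3, h4⟩ := h.parent_none h0
      obtain rfl := PathChord.parent_unique hp h3
      exact Or.inr ⟨h0, h2, h1 ▸ h4⟩
    · exact Or.inl ⟨h0, h.face_some hφ d h0, (h.parent_iff hφ h0).2 hp⟩
  constructor
  · rintro (⟨d', hd, hp, hF⟩ | ⟨d', hd, hp, hF⟩)
    · obtain ⟨d, rfl⟩ := h.chordEquiv.surjective d'
      rcases down hd hp with ⟨h0, h1, h2⟩ | ⟨h0, h1, h2⟩
      · exact Or.inl ⟨d, h1, h2, (h.forward_of_ne h0).1 hF⟩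
      · exact Or.inr ⟨d, h1, h2, (h.forward_of_eq h0).1 hF⟩
    · obtain ⟨d, rfl⟩ := h.chordEquiv.surjective d'
      rcases down hd hp with ⟨h0, h1, h2⟩ | ⟨h0, h1, h2⟩
      · exact Or.inr ⟨d, h1, h2, fun hD => hF ((h.forward_of_ne h0).2 hD)⟩
      · exact Or.inl ⟨d, h1, h2, not_not.1 fun hD => hF ((h.forward_of_eq h0).2 hD)⟩
  · rintro (⟨d, rfl, hp, hF⟩ | ⟨d, rfl, hp, hF⟩)
    · rcases up hp with ⟨h0, h1, h2⟩ | ⟨h0, h1, h2⟩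
      · exact Or.inl ⟨_, h1, h2, (h.forward_of_ne h0).2 hF⟩
      · exact Or.inr ⟨_, h1, h2, fun hD => (h.forward_of_eq h0).1 hD hF⟩
    · rcases up hp with ⟨h0, h1, h2⟩ | ⟨h0, h1, h2⟩
      · exact Or.inr ⟨_, h1, h2, fun hD => hF ((h.forward_of_ne h0).1 hD)⟩
      · exact Or.inl ⟨_, h1, h2, (h.forward_of_eq h0).2 hF⟩

theorem dualKey_of_ne (h : D.IsRot D' b l)
    (hφ : ∀ g, D'.rawFace (φ g) = rotFace l.length D.cut (D.rawFace g)) {f : Option D.Chord}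
    (hf : ∀ d, f = some d → d.1.1 ≠ 0) {a : Option D.Chord}
    (ha : D.Above f a ∨ D.Above a f) :
    D'.dualKey (φ f) (φ a) = D.dualKey f a - 1 ∧ (f = none → 1 ≤ D.dualKey f a) ∧
      (f ≠ none → D.dualKey f a ≠ 1) := by
  rcases ha with ⟨d, rfl, hp⟩ | ⟨d, rfl, hp⟩
  · rw [PathChord.dualKey_of_parent hp, Nat.add_sub_cancel]
    by_cases h0 : d.1.1 = 0
    · obtain ⟨h1, h2⟩ := h.face_zero hφ d h0
      obtain rfl := PathChord.parent_unique hp (h.parent_none h0).1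
      refine ⟨?_, fun _ => by omega, fun hne => absurd rfl hne⟩
      rw [h1, h0]
      rfl
    · have hlt := h.lt d.2
      refine ⟨?_, fun _ => by omega, fun _ => by omega⟩
      rw [h.face_some hφ d h0, PathChord.dualKey_of_parent ((h.parent_iff hφ h0).2 hp),
        chordEquiv_val, rotChord_of_ne h0]
      simp only
      omega
  · have h0 := hf d rfl
    have hnot : ∀ {E : PathChord I} {x : Option E.Chord} {e : E.Chord}, E.Parent x e →
        E.dualKey (some e) x = 0 := by
      intro E x e hp
      refine PathChord.dualKey_of_not ?_
      rintro c rfl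
      exact PathChord.not_parent_swap hp
    refine ⟨?_, fun he => by simp at he, fun _ => by rw [hnot hp]; omega⟩
    rw [hnot hp, h.face_some hφ d h0, hnot ((h.parent_iff hφ h0).2 hp)]

theorem dualKey_of_eq (h : D.IsRot D' b l)
    (hφ : ∀ g, D'.rawFace (φ g) = rotFace l.length D.cut (D.rawFace g)) {d : D.Chord}
    (hd : d.1.1 = 0) {a : Option D.Chord}
    (ha : D.Above (some d) a ∨ D.Above a (some d)) :
    (D.dualKey (some d) a = 0 ∧ D'.dualKey (φ (some d)) (φ a) = d.1.2) ∨
      (2 ≤ D.dualKey (some d) a ∧ D.dualKey (some d) a ≤ d.1.2 ∧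
        D'.dualKey (φ (some d)) (φ a) = D.dualKey (some d) a - 1) := by
  obtain ⟨h1, h2⟩ := h.face_zero hφ d hd
  obtain ⟨h3, h4⟩ := h.parent_none hd
  rcases ha with ⟨e, rfl, hp⟩ | ⟨e, he, hp⟩
  · have hb1 : 1 ≤ e.1.1 := by
      have := hp.1.1
      simp only [PathChord.rawFace, Option.map_some, lo] at this
      omega
    have hb2 : e.1.2 < d.1.2 := hp.1.2
    have hlt := h.lt e.2
    have h0 : e.1.1 ≠ 0 := by omega
    right
    rw [PathChord.dualKey_of_parent hp, h.face_some hφ e h0,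
      PathChord.dualKey_of_parent ((h.parent_iff hφ h0).2 hp), chordEquiv_val, rotChord_of_ne h0]
    simp only
    omega
  · obtain rfl := Option.some.inj he
    obtain rfl := PathChord.parent_unique hp h3
    have hlt := h.lt d.2
    left
    refine ⟨rfl, ?_⟩
    rw [h2, h1, PathChord.dualKey_of_parent h4, chordEquiv_val, rotChord_of_eq hd]
    simp only
    omega

end PathChord.IsRot

theorem ClosedChord.dualOriented_label (D : ClosedChord I) (f : Option D.1.Chord) :
    D.dualOriented.label f =
      (NecklaceChord.mk (D.piece D.1.cut (D.1.rawFace f))).forget := by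
  refine congrArg Necklace.mk (Subtype.ext ?_)
  change (D.1.face Finset.univ f).path = (D.1.piece D.1.cut (D.1.rawFace f)).path
  rw [PathChord.face_eq_piece, PathChord.rawCut_univ]

theorem dualOriented_iso {D D' : ClosedChord I} (hr : RotChord D D') :
    D.dualOriented.Iso D'.dualOriented := by
  obtain ⟨b, l, h⟩ := hr.isRot
  obtain ⟨φ, hφ⟩ := h.exists_faceEquiv
  have hadj : ∀ f g, (SimpleGraph.fromRel D'.1.dualArrow).Adj (φ f) (φ g) ↔
      (SimpleGraph.fromRel D.1.dualArrow).Adj f g := by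
    intro f g
    rw [SimpleGraph.fromRel_adj, SimpleGraph.fromRel_adj, h.dualArrow_iff hφ, h.dualArrow_iff hφ,
      φ.injective.ne_iff]
  have hkey : ∀ f x y z : Option D.1.Chord, (SimpleGraph.fromRel D.1.dualArrow).Adj f x →
      (SimpleGraph.fromRel D.1.dualArrow).Adj f y → (SimpleGraph.fromRel D.1.dualArrow).Adj f z →
      ((D'.1.dualKey (φ f) (φ x) < D'.1.dualKey (φ f) (φ y) ∧
          D'.1.dualKey (φ f) (φ y) < D'.1.dualKey (φ f) (φ z) ∨
        D'.1.dualKey (φ f) (φ y) < D'.1.dualKey (φ f) (φ z) ∧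
          D'.1.dualKey (φ f) (φ z) < D'.1.dualKey (φ f) (φ x) ∨
        D'.1.dualKey (φ f) (φ z) < D'.1.dualKey (φ f) (φ x) ∧
          D'.1.dualKey (φ f) (φ x) < D'.1.dualKey (φ f) (φ y)) ↔
      (D.1.dualKey f x < D.1.dualKey f y ∧ D.1.dualKey f y < D.1.dualKey f z ∨
        D.1.dualKey f y < D.1.dualKey f z ∧ D.1.dualKey f z < D.1.dualKey f x ∨
        D.1.dualKey f z < D.1.dualKey f x ∧ D.1.dualKey f x < D.1.dualKey f y)) := by
    intro f x y z hx hy hz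
    rw [PathChord.fromRel_adj] at hx hy hz
    by_cases hf : ∃ d : D.1.Chord, f = some d ∧ d.1.1 = 0
    · obtain ⟨d, rfl, hd⟩ := hf
      have h1 := h.dualKey_of_eq hφ hd hx
      have h2 := h.dualKey_of_eq hφ hd hy
      have h3 := h.dualKey_of_eq hφ hd hz
      omega
    · push Not at hf
      have h1 := h.dualKey_of_ne hφ hf hx
      have h2 := h.dualKey_of_ne hφ hf hy
      have h3 := h.dualKey_of_ne hφ hf hz
      by_cases hn : f = none
      · have := h1.2.1 hn
        have := h2.2.1 hn
        have := h3.2.1 hn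
        omega
      · have := h1.2.2 hn
        have := h2.2.2 hn
        have := h3.2.2 hn
        omega
  have hlabel : ∀ f : Option D.1.Chord,
      (NecklaceChord.mk (D'.piece D'.1.cut (D'.1.rawFace (φ f)))).forget =
        (NecklaceChord.mk (D.piece D.1.cut (D.1.rawFace f))).forget := by
    intro f
    rw [hφ, h.cut]
    exact congrArg _
      (ClosedChord.mk_piece_rot h (Finset.Subset.refl _) (D.1.rawFace_isFaceOf f))
  refine ⟨φ, h.dualArrow_iff hφ, fun f x y z => ⟨?_, ?_⟩, fun f => ?_⟩
  · rintro ⟨⟨hx, hy, hz⟩, hc⟩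
    have hx' := (hadj f x).1 hx
    have hy' := (hadj f y).1 hy
    have hz' := (hadj f z).1 hz
    exact ⟨⟨hx', hy', hz'⟩, (hkey f x y z hx' hy' hz').1 hc⟩
  · rintro ⟨⟨hx, hy, hz⟩, hc⟩
    exact ⟨⟨(hadj f x).2 hx, (hadj f y).2 hy, (hadj f z).2 hz⟩, (hkey f x y z hx hy hz).2 hc⟩
  · exact (ClosedChord.dualOriented_label D' (φ f)).trans
      ((hlabel f).trans (ClosedChord.dualOriented_label D f).symm)

theorem dOr_mk (D : ClosedChord I) : dOr k (bas k (NecklaceChord.mk D)) = dOrOn k D := by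
  rw [dOr, Finsupp.linearCombination_single, one_smul]
  exact Quot.apply_out_mk _ (fun _ _ h => congrArg _ (OTreeClass.sound (dualOriented_iso h))) D

end RotatedDual

section Lie

variable {I : Type u} [Quiver.{v} I] {k : Type w} [CommRing k]

/-- The antisymmetrization followed by the tensor square of a linear map. -/
noncomputable def antisymMap {M N : Type*} [AddCommGroup M] [Module k M] [AddCommGroup N]
    [Module k N] (f : M →ₗ[k] N) : M ⊗[k] M →ₗ[k] N ⊗[k] N :=
  TensorProduct.map f f ∘ₗ (LinearMap.id - (TensorProduct.comm k M M).toLinearMap)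

theorem antisymMap_tmul {M N : Type*} [AddCommGroup M] [Module k M] [AddCommGroup N]
    [Module k N] (f : M →ₗ[k] N) (x y : M) :
    antisymMap f (x ⊗ₜ[k] y) = f x ⊗ₜ[k] f y - f y ⊗ₜ[k] f x := by
  simp [antisymMap]

theorem antisymMap_comp {M N K : Type*} [AddCommGroup M] [Module k M] [AddCommGroup N]
    [Module k N] [AddCommGroup K] [Module k K] (f : M →ₗ[k] N) (g : N →ₗ[k] K) :
    antisymMap (g ∘ₗ f) = TensorProduct.map g g ∘ₗ antisymMap f := by
  apply TensorProduct.ext'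
  intro x y
  simp [antisymMap_tmul]

theorem antisymMap_comp' {M N K : Type*} [AddCommGroup M] [Module k M] [AddCommGroup N]
    [Module k N] [AddCommGroup K] [Module k K] (f : M →ₗ[k] N) (g : N →ₗ[k] K) :
    antisymMap (g ∘ₗ f) = antisymMap g ∘ₗ TensorProduct.map f f := by
  apply TensorProduct.ext'
  intro x y
  simp [antisymMap_tmul]

variable (k) in
open Classical in
/-- The projection from chord diagrams on paths to chord diagrams on necklaces, which vanishes on
paths which are not closed. -/
noncomputable def closeChord : (PathChord I →₀ k) →ₗ[k] (NecklaceChord I →₀ k) :=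
  Finsupp.linearCombination k fun D =>
    if h : D.path.src = D.path.tgt then bas k (NecklaceChord.mk ⟨D, h⟩) else 0

variable (k) in
open Classical in
/-- The projection from paths to necklaces, which vanishes on paths which are not closed. -/
noncomputable def closePath : (QPath I →₀ k) →ₗ[k] (Necklace I →₀ k) :=
  Finsupp.linearCombination k fun X =>
    if h : X.src = X.tgt then bas k (Necklace.mk ⟨X, h⟩) else 0

theorem closeChord_of_eq (D : ClosedChord I) :
    closeChord k (bas k D.1) = bas k (NecklaceChord.mk D) := by
  rw [closeChord, Finsupp.linearCombination_single, one_smul, dif_pos D.2]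

theorem closeChord_of_ne {D : PathChord I} (h : D.path.src ≠ D.path.tgt) :
    closeChord k (bas k D) = 0 := by
  rw [closeChord, Finsupp.linearCombination_single, one_smul, dif_neg h]

theorem closePath_of_eq (X : ClosedPath I) : closePath k (bas k X.1) = bas k (Necklace.mk X) := by
  rw [closePath, Finsupp.linearCombination_single, one_smul, dif_pos X.2]

theorem closePath_of_ne {X : QPath I} (h : X.src ≠ X.tgt) : closePath k (bas k X) = 0 := by
  rw [closePath, Finsupp.linearCombination_single, one_smul, dif_neg h]

theorem closeChord_surjective : Function.Surjective (closeChord k (I := I)) := by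
  intro x
  induction x using Finsupp.induction_linear with
  | zero => exact ⟨0, map_zero _⟩
  | add x y hx hy =>
    obtain ⟨x, rfl⟩ := hx
    obtain ⟨y, rfl⟩ := hy
    exact ⟨x + y, map_add _ _ _⟩
  | single N r =>
    induction N using Quot.ind with
    | mk D =>
      refine ⟨r • bas k D.1, ?_⟩
      rw [map_smul, closeChord_of_eq]
      exact Finsupp.smul_single_one _ _

theorem smul_zero_sub_zero {M : Type*} [AddCommGroup M] [Module k M] (r : k) :
    r • ((0 : M) - 0) = 0 := by
  rw [sub_zero, smul_zero]

theorem neg_zsmul_sub {M : Type*} [AddCommGroup M] (n : ℤ) (x y : M) :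
    (-n) • (x - y) = n • (y - x) := by
  rw [neg_smul, ← smul_neg, neg_sub]

theorem chordCobracket_comp_closeChord :
    chordCobracket k (I := I) ∘ₗ closeChord k = antisymMap (closeChord k) ∘ₗ chordComul k := by
  apply Finsupp.lhom_ext'
  intro D
  apply LinearMap.ext_ring
  change chordCobracket k (closeChord k (bas k D)) =
    antisymMap (closeChord k) (chordComul k (bas k D))
  rw [chordComul_isChordComul, map_sum]
  by_cases h : D.path.src = D.path.tgt
  · rw [closeChord_of_eq ⟨D, h⟩, chordCobracket_mk, chordCobracketOn_eq]
    refine Finset.sum_congr rfl fun c _ => ?_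
    rw [map_smul, antisymMap_tmul]
    rw [← closeChord_of_eq, ← closeChord_of_eq]
    rfl
  · rw [closeChord_of_ne h, map_zero]
    symm
    refine Finset.sum_eq_zero fun c hc => ?_
    have hne : (D.piece {c} none).path.src ≠ (D.piece {c} none).path.tgt := by
      have hs : {c} ⊆ D.cut := by simpa using hc
      rw [PathChord.piece_path_src hs isFaceOf_none, PathChord.piece_path_tgt hs isFaceOf_none]
      simp only [lo, hi]
      rwa [vertexAt_zero, vertexAt_length D.path.isPath]
    rw [map_smul, antisymMap_tmul, closeChord_of_ne hne, TensorProduct.tmul_zero,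
      TensorProduct.zero_tmul]
    exact smul_zero_sub_zero (M := (NecklaceChord I →₀ k) ⊗[k] (NecklaceChord I →₀ k)) _

theorem chordCobracket_isLieCobracket : IsLieCobracket (chordCobracket k (I := I)) :=
  chordComul_isPreLie.isLieCobracket closeChord_surjective chordCobracket_comp_closeChord

/-! ### Necklaces -/

theorem sOr_comp_closePath : sOr k (I := I) ∘ₗ closePath k = closeChord k ∘ₗ sRt k := by
  apply Finsupp.lhom_ext'
  intro X
  apply LinearMap.ext_ring
  change sOr k (closePath k (bas k X)) = closeChord k (sRt k (bas k X))
  rw [sRt_bas, map_sum]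
  by_cases h : X.src = X.tgt
  · rw [closePath_of_eq ⟨X, h⟩, sOr_mk, sOrOn_eq]
    refine Finset.sum_congr rfl fun G _ => ?_
    exact (closeChord_of_eq (ClosedPath.chord ⟨X, h⟩ G)).symm
  · rw [closePath_of_ne h, map_zero]
    symm
    refine Finset.sum_eq_zero fun G _ => closeChord_of_ne ?_
    rwa [QPath.chord_path]

theorem necklaceCobracketOn_eq (X : ClosedPath I) :
    necklaceCobracketOn k X = antisymMap (closePath k) (pathComul k (bas k X.1)) := by
  have h1 : pathComul k (bas k X.1) = pathComulOn k X.1 := by simp [pathComul]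
  rw [h1, pathComulOn, map_sum]
  refine Finset.sum_congr rfl fun c _ => ?_
  rw [map_zsmul, antisymMap_tmul]
  have h2 := closePath_of_eq (k := k) (ClosedPath.inner X c)
  have h3 := closePath_of_eq (k := k) (ClosedPath.outer X c)
  change closePath k (bas k (X.1.inner c)) = _ at h2
  change closePath k (bas k (X.1.outer c)) = _ at h3
  rw [h2, h3, wedge]
  exact (neg_zsmul_sub _ _ _).symm

variable (k) in
open Classical in
/-- A necklace chord diagram without chords, as a necklace. -/
noncomputable def forgetOrOn : NecklaceChord I → (Necklace I →₀ k) :=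
  Quot.lift
    (fun D => if D.1.cut = ∅ then bas k (NecklaceChord.mk D).forget else 0) fun D D' h => by
      have h1 : NecklaceChord.mk D = NecklaceChord.mk D' := Quot.sound h
      obtain ⟨b, l, -, -, h2⟩ := h
      simp only [h2, Finset.image_eq_empty, h1]

variable (k) in
/-- The projection to the necklace chord diagrams without chords. -/
noncomputable def forgetOr : (NecklaceChord I →₀ k) →ₗ[k] (Necklace I →₀ k) :=
  Finsupp.linearCombination k (forgetOrOn k)

open Classical in
theorem forgetOr_mk (D : ClosedChord I) : forgetOr k (bas k (NecklaceChord.mk D)) =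
    if D.1.cut = ∅ then bas k (NecklaceChord.mk D).forget else 0 := by
  rw [forgetOr, Finsupp.linearCombination_single, one_smul]
  rfl

theorem forgetOr_sOr : forgetOr k ∘ₗ sOr k (I := I) = LinearMap.id := by
  apply Finsupp.lhom_ext'
  intro N
  apply LinearMap.ext_ring
  induction N using Quot.ind with
  | mk X =>
    change forgetOr k (sOr k (bas k (Necklace.mk X))) = bas k (Necklace.mk X)
    rw [sOr_mk, sOrOn_eq, map_sum, Finset.sum_eq_single_of_mem ∅ (mem_cuts.2 (isCut_empty _))]
    · have h1 : (NecklaceChord.mk (ClosedPath.chord X ∅)).forget = Necklace.mk X :=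
        congrArg Necklace.mk (Subtype.ext QPath.chord_path)
      have h2 : (ClosedPath.chord X ∅).1.cut = ∅ := QPath.chord_cut (isCut_empty _)
      rw [forgetOr_mk, if_pos h2, h1]
    · intro G hG hne
      have h2 : (ClosedPath.chord X G).1.cut = G := QPath.chord_cut (mem_cuts.1 hG)
      rw [forgetOr_mk, if_neg]
      rwa [h2]

theorem sOr_injective : Function.Injective (sOr k (I := I)) :=
  Function.LeftInverse.injective (g := forgetOr k) (LinearMap.congr_fun forgetOr_sOr)

theorem map_sOr_injective : Function.Injective (TensorProduct.map (sOr k (I := I)) (sOr k (I := I))) := by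
  have h : TensorProduct.map (forgetOr k (I := I)) (forgetOr k) ∘ₗ TensorProduct.map (sOr k (I := I)) (sOr k (I := I)) =
      LinearMap.id := by
    rw [← TensorProduct.map_comp, forgetOr_sOr, TensorProduct.map_id]
  exact Function.LeftInverse.injective (g := TensorProduct.map (forgetOr k) (forgetOr k))
    (LinearMap.congr_fun h)

theorem map_sOr_necklaceCobracketOn (X : ClosedPath I) :
    TensorProduct.map (sOr k) (sOr k) (necklaceCobracketOn k X) =
      chordCobracket k (sOr k (bas k (Necklace.mk X))) := by
  have h1 := LinearMap.congr_fun (sRt_isComulHom (k := k) (I := I)) (bas k X.1)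
  have h2 : TensorProduct.map (sOr k (I := I)) (sOr k) ∘ₗ antisymMap (closePath k) =
      antisymMap (closeChord k) ∘ₗ TensorProduct.map (sRt k) (sRt k) := by
    rw [← antisymMap_comp', ← sOr_comp_closePath, antisymMap_comp]
  have h3 := LinearMap.congr_fun (sOr_comp_closePath (k := k) (I := I)) (bas k X.1)
  have h4 := LinearMap.congr_fun (chordCobracket_comp_closeChord (k := k) (I := I))
    (sRt k (bas k X.1))
  rw [LinearMap.comp_apply, LinearMap.comp_apply] at h1 h3 h4
  rw [necklaceCobracketOn_eq, ← closePath_of_eq, h3, h4, ← h1]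
  exact LinearMap.congr_fun h2 _

theorem necklaceCobracket_mk (X : ClosedPath I) :
    necklaceCobracket k (bas k (Necklace.mk X)) = necklaceCobracketOn k X := by
  rw [necklaceCobracket, Finsupp.linearCombination_single, one_smul]
  refine Quot.apply_out_mk _ (fun X Y h => map_sOr_injective ?_) X
  rw [map_sOr_necklaceCobracketOn, map_sOr_necklaceCobracketOn]
  exact congrArg (fun N => chordCobracket k (sOr k (bas k N)))
    (Quot.sound h : Necklace.mk X = Necklace.mk Y)

theorem sOr_isComulHom :
    IsComulHom (necklaceCobracket k (I := I)) (chordCobracket k) (sOr k) := by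
  apply Finsupp.lhom_ext'
  intro N
  apply LinearMap.ext_ring
  induction N using Quot.ind with
  | mk X =>
    change TensorProduct.map (sOr k) (sOr k) (necklaceCobracket k (bas k (Necklace.mk X))) =
      chordCobracket k (sOr k (bas k (Necklace.mk X)))
    rw [necklaceCobracket_mk, map_sOr_necklaceCobracketOn]

theorem etaOrOn_eq (X : ClosedPath I) : etaOrOn k X = dOr k (sOr k (bas k (Necklace.mk X))) := by
  rw [sOr_mk, sOrOn, map_sum]
  exact Finset.sum_congr rfl fun H _ => (dOr_mk _).symm

theorem etaOr_mk (X : ClosedPath I) : etaOr k (bas k (Necklace.mk X)) = etaOrOn k X := by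
  rw [etaOr, Finsupp.linearCombination_single, one_smul]
  refine Quot.apply_out_mk _ (fun X Y h => ?_) X
  rw [etaOrOn_eq, etaOrOn_eq]
  exact congrArg (fun N => dOr k (sOr k (bas k N)))
    (Quot.sound h : Necklace.mk X = Necklace.mk Y)

theorem etaOr_eq : etaOr k (I := I) = dOr k ∘ₗ sOr k := by
  apply Finsupp.lhom_ext'
  intro N
  apply LinearMap.ext_ring
  induction N using Quot.ind with
  | mk X => exact (etaOr_mk X).trans (etaOrOn_eq X)

end Lie

section DualLie

variable {I : Type u} [Quiver.{v} I] {k : Type w} [CommRing k]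

theorem RibbonTree.comp_iso {Λ : Type w'} (T : RibbonTree Λ) (E : Set (Sym2 T.V)) {x y : T.V}
    (h : (T.graph.deleteEdges E).Reachable x y) : (T.comp E x).Iso (T.comp E y) :=
  RibbonTree.iso_comp (S := T.comp E x) (i := Subtype.val) Subtype.val_injective
    (fun z => by
      constructor
      · exact fun hz => ⟨⟨z, h.trans hz⟩, rfl⟩
      · rintro ⟨a, rfl⟩
        exact h.symm.trans a.2)
    (fun _ _ => Iff.rfl) (fun _ _ _ _ => Iff.rfl) (fun _ => rfl)

variable {D : ClosedChord I}

/-- The face above a chord. -/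
noncomputable def PathChord.above (D : PathChord I) (c : D.Chord) : Option D.Chord :=
  (D.exists_parent c).choose

theorem PathChord.above_parent (D : PathChord I) (c : D.Chord) : D.Parent (D.above c) c :=
  (D.exists_parent c).choose_spec

theorem PathChord.dualEdges_singleton (D : PathChord I) (c : D.Chord) :
    D.dualEdges (({c.1} : Finset (ℕ × ℕ)) : Set (ℕ × ℕ)) = {s(D.above c, some c)} := by
  ext e
  constructor
  · rintro ⟨g, d, hd, hp, rfl⟩
    obtain rfl : d = c := Subtype.ext (by simpa using hd)
    rw [PathChord.parent_unique hp (D.above_parent d)]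
    rfl
  · rintro rfl
    exact ⟨_, c, by simp, D.above_parent c, rfl⟩

theorem ClosedChord.comp_some (c : D.1.Chord) :
    OTreeClass.mk (D.dualOriented.comp {s(D.1.above c, some c)} (some c)) =
      OTreeClass.mk (ClosedChord.dualOriented (D.piece {c.1} (some c.1))) := by
  have h := ClosedChord.iso_comp (D := D) (H := {c.1}) (f := some c) (by simp)
    (by rintro d hd; simp [← Option.some.inj hd])
    (PathChord.piece_closed D.2 _ _)
  rw [D.1.dualEdges_singleton] at h
  exact (OTreeClass.sound h).symm

theorem ClosedChord.comp_above (c : D.1.Chord) :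
    OTreeClass.mk (D.dualOriented.comp {s(D.1.above c, some c)} (D.1.above c)) =
      OTreeClass.mk (ClosedChord.dualOriented (D.piece {c.1} none)) := by
  have hc : ({c.1} : Finset (ℕ × ℕ)) ⊆ D.1.cut := by simp
  have h := ClosedChord.iso_comp (D := D) (f := none) hc (by simp)
    (PathChord.piece_closed D.2 _ _)
  have hr : D.1.InPiece {c.1} none (D.1.above c) := by
    have hp := D.1.above_parent c
    generalize D.1.above c = f at hp ⊢
    rcases f with _ | d
    · exact Or.inl rfl
    · refine Or.inr ⟨d, rfl, (PathChord.mem_on hc).2 ⟨d.2, PathChord.below_none d, ?_⟩⟩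
      have hlt := hp.1.1
      simp only [PathChord.rawFace, Option.map_some, lo] at hlt
      simp only [Finset.mem_singleton, forall_eq]
      omega
  have hr' := (PathChord.reachable_iff hc (f := none) (by simp) _).2 hr
  have h2 := RibbonTree.comp_iso D.dualOriented _ hr'
  rw [D.1.dualEdges_singleton] at h h2
  exact (OTreeClass.sound h2).symm.trans (OTreeClass.sound h).symm

open Classical in
/-- The edge of the dual oriented tree across a chord. -/
noncomputable def ClosedChord.dualEdge (D : ClosedChord I) (c : D.1.Chord) : D.dualOriented.Edge :=
  if h : D.1.Forward c then ⟨(D.1.above c, some c), Or.inl ⟨c, rfl, D.1.above_parent c, h⟩⟩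
  else ⟨(some c, D.1.above c), Or.inr ⟨c, rfl, D.1.above_parent c, h⟩⟩

theorem ClosedChord.dualEdge_sym (c : D.1.Chord) :
    s((D.dualEdge c).1.1, (D.dualEdge c).1.2) = s(D.1.above c, some c) := by
  unfold ClosedChord.dualEdge
  split
  · rfl
  · exact Sym2.eq_swap

theorem ClosedChord.dualEdge_bijective (D : ClosedChord I) : Function.Bijective D.dualEdge := by
  constructor
  · intro c d h
    have h1 := D.dualEdge_sym c
    rw [h, ClosedChord.dualEdge_sym] at h1
    rcases Sym2.eq_iff.1 h1 with ⟨-, h2⟩ | ⟨h2, h3⟩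
    · exact (Option.some.inj h2).symm
    · have hc := D.1.above_parent c
      have hd := D.1.above_parent d
      rw [h2] at hd
      rw [← h3] at hc
      exact (PathChord.not_parent_swap hd hc).elim
  · rintro ⟨⟨f, g⟩, he⟩
    obtain ⟨d, hd, hp, hF⟩ | ⟨d, hd, hp, hF⟩ := id he
    · obtain rfl : g = some d := hd
      obtain rfl := PathChord.parent_unique hp (D.1.above_parent d)
      exact ⟨d, dif_pos hF⟩
    · obtain rfl : f = some d := hd
      obtain rfl := PathChord.parent_unique hp (D.1.above_parent d)
      exact ⟨d, dif_neg hF⟩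

theorem PathChord.sgn_of_forward {D : PathChord I} {c : D.Chord} (h : D.Forward c) :
    D.sgn c.1 = -1 := by
  obtain ⟨e, he⟩ := h
  obtain ⟨-, x, h1, h2⟩ := D.isCut.pair _ c.2
  rw [he, Option.some.injEq] at h1
  subst h1
  rw [PathChord.sgn, omegaAt_of_get he h2]
  simp [DArrow.rev, omega]

theorem PathChord.sgn_of_not_forward {D : PathChord I} {c : D.Chord} (h : ¬ D.Forward c) :
    D.sgn c.1 = 1 := by
  obtain ⟨-, x, h1, h2⟩ := D.isCut.pair _ c.2
  rw [PathChord.sgn, omegaAt_of_get h1 h2]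
  cases x with
  | arr e => exact absurd ⟨e, h1⟩ h
  | star e => simp [DArrow.rev, omega]

theorem neg_one_cast_smul_sub {M : Type*} [AddCommGroup M] [Module k M] (x y : M) :
    ((-1 : ℤ) : k) • (x - y) = y - x := by
  simp

theorem one_cast_smul {M : Type*} [AddCommGroup M] [Module k M] (x : M) :
    ((1 : ℤ) : k) • x = x := by
  simp

theorem otreeCobracketOn_dualOriented (D : ClosedChord I) : otreeCobracketOn k D.dualOriented =
    ∑ c ∈ D.1.cut, (D.1.sgn c : k) • antisymMap LinearMap.id
      (bas k (OTreeClass.mk (D.piece {c} (some c)).dualOriented) ⊗ₜ[k]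
        bas k (OTreeClass.mk (D.piece {c} none).dualOriented)) := by
  refine Eq.trans ?_ (Finset.sum_coe_sort D.1.cut (fun c =>
    (D.1.sgn c : k) • antisymMap LinearMap.id
      (bas k (OTreeClass.mk (D.piece {c} (some c)).dualOriented) ⊗ₜ[k]
        bas k (OTreeClass.mk (D.piece {c} none).dualOriented))))
  symm
  refine Fintype.sum_bijective D.dualEdge D.dualEdge_bijective _ _ fun c => ?_
  have hE := D.dualEdge_sym c
  rw [← ClosedChord.comp_some c, ← ClosedChord.comp_above c, antisymMap_tmul]
  unfold RibbonTree.tail RibbonTree.head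
  rw [hE]
  by_cases h : D.1.Forward c
  · rw [PathChord.sgn_of_forward h, ClosedChord.dualEdge, dif_pos h]
    exact neg_one_cast_smul_sub _ _
  · rw [PathChord.sgn_of_not_forward h, ClosedChord.dualEdge, dif_neg h]
    exact one_cast_smul (M := (OTreeClass (Necklace I) →₀ k) ⊗[k] (OTreeClass (Necklace I) →₀ k)) _

theorem dOr_isComulHom :
    IsComulHom (chordCobracket k (I := I)) (otreeCobracket k) (dOr k) := by
  apply Finsupp.lhom_ext'
  intro N
  apply LinearMap.ext_ring
  induction N using Quot.ind with
  | mk D =>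
    change TensorProduct.map (dOr k) (dOr k) (chordCobracket k (bas k (NecklaceChord.mk D))) =
      otreeCobracket k (dOr k (bas k (NecklaceChord.mk D)))
    rw [chordCobracket_mk, chordCobracketOn_eq, dOr_mk, dOrOn, otreeCobracket_mk,
      otreeCobracketOn_dualOriented, map_sum]
    refine Finset.sum_congr rfl fun c _ => ?_
    rw [map_smul, map_sub, TensorProduct.map_tmul, TensorProduct.map_tmul, dOr_mk, dOr_mk,
      antisymMap_tmul]
    rfl

end DualLie

end ChordAlg

theorem theorem3p2 (k : Type*) [CommRing k] (I : Type*) [Quiver I] :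
    -- the operations on necklaces, on necklace chord diagrams and on isomorphism classes of trees
    -- are well defined: they are given by their formulas on every representative
    ((∀ X : ChordAlg.ClosedPath I,
        ChordAlg.necklaceCobracket k (Finsupp.single (ChordAlg.Necklace.mk X) 1) =
          ChordAlg.necklaceCobracketOn k X) ∧
      (∀ D : ChordAlg.ClosedChord I,
        ChordAlg.chordCobracket k (Finsupp.single (ChordAlg.NecklaceChord.mk D) 1) =
          ChordAlg.chordCobracketOn k D) ∧
      (∀ T : ChordAlg.RootedTree (ChordAlg.QPath I),
        ChordAlg.rtreeComul k (Finsupp.single (ChordAlg.RTreeClass.mk T) 1) =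
          ChordAlg.rtreeComulOn k T) ∧
      (∀ T : ChordAlg.RootedTree (ChordAlg.QPath I),
        ChordAlg.rtreeCoprod k (ChordAlg.gen (ChordAlg.RTreeClass.mk T)) =
          ChordAlg.rtreeCoprodOn k T) ∧
      (∀ T : ChordAlg.RibbonTree (ChordAlg.Necklace I),
        ChordAlg.otreeCobracket k (Finsupp.single (ChordAlg.OTreeClass.mk T) 1) =
          ChordAlg.otreeCobracketOn k T) ∧
      (∀ X : ChordAlg.ClosedPath I,
        ChordAlg.sOr k (Finsupp.single (ChordAlg.Necklace.mk X) 1) = ChordAlg.sOrOn k X) ∧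
      (∀ D : ChordAlg.ClosedChord I,
        ChordAlg.dOr k (Finsupp.single (ChordAlg.NecklaceChord.mk D) 1) = ChordAlg.dOrOn k D) ∧
      (∀ X : ChordAlg.ClosedPath I,
        ChordAlg.etaOr k (Finsupp.single (ChordAlg.Necklace.mk X) 1) = ChordAlg.etaOrOn k X)) ∧
    -- `Ch_rt` is a pre-Lie coalgebra, `Ch_or` is a Lie coalgebra
    ChordAlg.IsPreLieComul (ChordAlg.chordComul k (I := I)) ∧
    ChordAlg.IsLieCobracket (ChordAlg.chordCobracket k (I := I)) ∧
    -- `Sym Ch_rt` is a Hopf algebra with the given coproduct, counit and antipode (and the sum in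
    -- the formula for the antipode is finite)
    (ChordAlg.IsHopf (ChordAlg.chordCoprod k (I := I)) ChordAlg.symCounit
        (ChordAlg.symAntipode (ChordAlg.chordCoprod k (I := I))).toLinearMap ∧
      ∀ D : ChordAlg.PathChord I,
        {n : ℕ | ChordAlg.mulReducedPow (ChordAlg.chordCoprod k) n (ChordAlg.gen D) ≠ 0}.Finite) ∧
    -- the factorizations of `η`
    (ChordAlg.etaRt k (I := I) = ChordAlg.dRt k ∘ₗ ChordAlg.sRt k ∧
      ChordAlg.etaOr k (I := I) = ChordAlg.dOr k ∘ₗ ChordAlg.sOr k ∧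
      ChordAlg.symMap (ChordAlg.etaRt k (I := I)) =
        (ChordAlg.symMap (ChordAlg.dRt k)).comp (ChordAlg.symMap (ChordAlg.sRt k))) ∧
    -- `S_rt` and `D_rt` are homomorphisms of pre-Lie coalgebras
    (ChordAlg.IsComulHom (ChordAlg.pathComul k (I := I)) (ChordAlg.chordComul k)
        (ChordAlg.sRt k) ∧
      ChordAlg.IsComulHom (ChordAlg.chordComul k (I := I)) (ChordAlg.rtreeComul k)
        (ChordAlg.dRt k)) ∧
    -- `S_or` and `D_or` are homomorphisms of Lie coalgebras
    (ChordAlg.IsComulHom (ChordAlg.necklaceCobracket k (I := I)) (ChordAlg.chordCobracket k)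
        (ChordAlg.sOr k) ∧
      ChordAlg.IsComulHom (ChordAlg.chordCobracket k (I := I)) (ChordAlg.otreeCobracket k)
        (ChordAlg.dOr k)) ∧
    -- the multiplicative extensions of `S_rt` and `D_rt` are homomorphisms of Hopf algebras
    (ChordAlg.IsHopfHom
        (ChordAlg.pathCoprod k (I := I)) ChordAlg.symCounit
        (ChordAlg.symAntipode (ChordAlg.pathCoprod k)).toLinearMap
        (ChordAlg.chordCoprod k) ChordAlg.symCounit
        (ChordAlg.symAntipode (ChordAlg.chordCoprod k)).toLinearMap
        (ChordAlg.symMap (ChordAlg.sRt k)) ∧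
      ChordAlg.IsHopfHom
        (ChordAlg.chordCoprod k (I := I)) ChordAlg.symCounit
        (ChordAlg.symAntipode (ChordAlg.chordCoprod k)).toLinearMap
        (ChordAlg.rtreeCoprod k) ChordAlg.symCounit
        (ChordAlg.symAntipode (ChordAlg.rtreeCoprod k)).toLinearMap
        (ChordAlg.symMap (ChordAlg.dRt k))) ∧
    -- the maps `S_*` are injective
    (Function.Injective (ChordAlg.sRt k (I := I)) ∧
      Function.Injective (ChordAlg.sOr k (I := I)) ∧
      Function.Injective (ChordAlg.symMap (ChordAlg.sRt k (I := I)))) := by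
  refine ⟨⟨ChordAlg.necklaceCobracket_mk, ChordAlg.chordCobracket_mk, ChordAlg.rtreeComul_mk,
    ChordAlg.rtreeCoprod_mk, ChordAlg.otreeCobracket_mk, ChordAlg.sOr_mk, ChordAlg.dOr_mk,
    ChordAlg.etaOr_mk⟩, ChordAlg.chordComul_isPreLie, ChordAlg.chordCobracket_isLieCobracket,
    ⟨ChordAlg.chordCoprod_isHopf, ChordAlg.chordCoprod_finite⟩,
    ⟨ChordAlg.etaRt_eq, ChordAlg.etaOr_eq, ?_⟩,
    ⟨ChordAlg.sRt_isComulHom, ChordAlg.dRt_isComulHom⟩,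
    ⟨ChordAlg.sOr_isComulHom, ChordAlg.dOr_isComulHom⟩,
    ⟨ChordAlg.symMap_sRt_isHopfHom, ChordAlg.symMap_dRt_isHopfHom⟩,
    ChordAlg.sRt_injective, ChordAlg.sOr_injective, ChordAlg.symMap_sRt_injective⟩
  rw [ChordAlg.etaRt_eq]
  exact ChordAlg.symMap_comp _ _
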